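/- Let $\mathbb K$ be a field of characteristic zero. All categories are $\mathbb K$-linear and $\mathbb Z$-graded: morphism spaces are $\mathbb Z$-graded vector spaces and composition adds degrees. For graded vector spaces put $(q^kV)_d=V_{d-k}$ and $\operatorname{HOM}^i(V,W)=\prod_j\operatorname{Hom}(V_j,W_{i+j})$; let $\mathrm{Vect}^{\mathbb Z}$ be the category of graded vector spaces with morphism spaces $\operatorname{HOM}$. The dotted Temperley--Lieb category $\mathrm{dTL}$ is the strict monoidal graded category with objects $c^{n}$ $(n\ge 0)$, $c^m\otimes c^n=c^{m+n}$, with morphisms generated by the cup $\cup\colon c^0\to c^2$ and the cap $\cap\colon c^2\to c^0$ of degree $0$ and the dot $\bullet\colon c\to c$ of degree $2$, modulo planar isotopy (zigzag relations, dots slide along cups and caps) and the relations $\cap\circ\cup=2$, $\bullet^2=0$ and $$\bullet\otimes 1+1\otimes\bullet=\cup\circ\cap_\bullet+\cup_\bullet\circ\cap,$$ where $\cup_\bullet=(\bullet\otimes 1)\circ\cup$ and $\cap_\bullet=\cap\circ(\bullet\otimes 1)$. Let $\overline{\mathrm{dTL}}=\mathrm{Ind}(\mathrm{Mat}(\mathrm{Kar}(\mathrm{dTL})))$: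 first the completion by images of degree zero idempotents; then by formal finite sums $\bigoplus_i q^{k_i}X_i$, where a degree $d$ morphism $q^kX\to q^lY$ is a morphism $X\to Y$ of degree $d+k-l$; then by directed systems of degree zero morphisms indexed by small filtered categories, with $\operatorname{Hom}^d((X_i),(Y_j))=\lim_i\operatorname{colim}_j\operatorname{Hom}^d(X_i,Y_j)$. The tensor product is extended to $\overline{\mathrm{dTL}}$ bilinearly and termwise on directed systems. The polynomial representation is the functor $\mathrm{Pol}\colon\mathrm{dTL}\to\mathrm{Vect}^{\mathbb Z}$ with $$\mathrm{Pol}(c^n)=q^{-n}\,\mathbb K[x_1,\dots,x_n]/(x_1^2,\dots,x_n^2),\qquad \deg x_i=2,$$ which takes $\otimes$ to the tensor product, the dot to multiplication by $x$, the cup to $1\mapsto x_1+x_2$ and the cap to $x_1\mapsto1$, $x_2\mapsto1$, $1\mapsto0$, $x_1x_2\mapsto0$. It is extended to $\mathrm{Pol}\colon\overline{\mathrm{dTL}}\to\mathrm{Vect}^{\mathbb Z}$ by taking images of idempotents, finite sums of shifts, and filtered colimits. The symmetric group $\mathfrak S_n$ acts on $c^n$ with adjacent transpositions acting by the crossing $\mathrm{id}_{c^2}-\cup\circ\cap$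 of neighbouring strands; let $P_n=(c^n,\frac1{n!}\sum_{w\in\mathfrak S_n}w)\in\mathrm{Kar}(\mathrm{dTL})$, and let $U_n\colon P_n\to P_{n+2}$ be the morphism of degree $2$ obtained from $\mathrm{id}_{c^n}\otimes\cup_\bullet$ by composing with the two idempotents. The Kirby color is $\omega=\omega_0\oplus\omega_1\in\overline{\mathrm{dTL}}$, where $\omega_k$ is the directed system $$q^{-k}P_k\xrightarrow{U_k}q^{-k-2}P_{k+2}\xrightarrow{U_{k+2}}q^{-k-4}P_{k+4}\to\cdots.$$ For a graded vector space $V$ and $W\in\overline{\mathrm{dTL}}$ let $V\otimes W$ denote the copower, the object with natural isomorphisms $\operatorname{Hom}(V\otimes W,Y)\cong\operatorname{HOM}(V,\operatorname{Hom}(W,Y))$. Then: 1. $\omega$ represents the graded dual of the polynomial representation: there is an isomorphism of functors $\overline{\mathrm{dTL}}^{\mathrm{op}}\to\mathrm{Vect}^{\mathbb Z}$ $$\operatorname{Hom}_{\overline{\mathrm{dTL}}}(-,\omega)\cong\mathrm{Pol}^*,$$ where $\mathrm{Pol}^*$ is $\mathrm{Pol}$ followed by $\operatorname{HOM}(-,\mathbb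 K)$. 2. The copowers $\mathrm{Pol}(X)\otimes\omega$ exist for all $X\in\overline{\mathrm{dTL}}$ and there is an isomorphism of functors $\overline{\mathrm{dTL}}\to\overline{\mathrm{dTL}}$ $$\omega\otimes-\;\cong\;\mathrm{Pol}(-)\otimes\omega .$$ Both isomorphisms have components of degree zero and are natural with respect to morphisms of all degrees. -/

import Mathlib

universe u v w

open CategoryTheory CategoryTheory.Limits

namespace GradedLinear

noncomputable section

/-- A `ℤ`-graded `K`-linear category (a category enriched in `ℤ`-graded vector spaces).
`Hom X Y d` is the space of morphisms of degree `d`; composition is written in diagrammatic order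
and `comp h f g` is the composite of `f` of degree `i` and `g` of degree `j`, regarded in
degree `k`, where `h : i + j = k`. -/
class GCat (K : Type u) [Field K] (C : Type v) where
  Hom : C → C → ℤ → Type u
  [acg : ∀ X Y d, AddCommGroup (Hom X Y d)]
  [mod : ∀ X Y d, Module K (Hom X Y d)]
  id : ∀ X, Hom X X 0
  comp : ∀ {X Y Z : C} {i j k : ℤ}, i + j = k → Hom X Y i →ₗ[K] Hom Y Z j →ₗ[K] Hom X Z k
  id_comp : ∀ {X Y : C} {d : ℤ} (h : 0 + d = d) (f : Hom X Y d), comp h (id X) f = f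
  comp_id : ∀ {X Y : C} {d : ℤ} (h : d + 0 = d) (f : Hom X Y d), comp h f (id Y) = f
  assoc : ∀ {W X Y Z : C} {i j k ij jk ijk : ℤ} (h₁ : i + j = ij) (h₂ : ij + k = ijk)
    (h₃ : j + k = jk) (h₄ : i + jk = ijk) (f : Hom W X i) (g : Hom X Y j) (e : Hom Y Z k),
    comp h₂ (comp h₁ f g) e = comp h₄ f (comp h₃ g e)

attribute [reducible, instance] GCat.acg GCat.mod

/-- Morphisms of degree `d` in a graded linear category. -/
abbrev GHom (K : Type u) [Field K] {C : Type v} [GCat K C] (X Y : C) (d : ℤ) : Type u :=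
  GCat.Hom K X Y d

section Basics

variable {K : Type u} [Field K] {C : Type v} [GCat K C]

/-- Identification of morphism spaces in equal degrees. -/
def degCast {X Y : C} {d e : ℤ} (h : d = e) : GHom K X Y d →ₗ[K] GHom K X Y e :=
  h ▸ LinearMap.id

@[simp] lemma degCast_self {X Y : C} {d : ℤ} (h : d = d) (f : GHom K X Y d) :
    degCast h f = f := rfl

lemma degCast_id_comp {X Y : C} {a d e : ℤ} (h₀ : 0 = a) (h : a + d = e) (f : GHom K X Y d) :
    GCat.comp h (degCast h₀ (GCat.id X)) f = degCast (by omega) f := by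
  subst h₀
  obtain rfl : d = e := by omega
  simp [GCat.id_comp]

lemma comp_degCast_id {X Y : C} {a d e : ℤ} (h₀ : 0 = a) (h : d + a = e) (f : GHom K X Y d) :
    GCat.comp h f (degCast h₀ (GCat.id Y)) = degCast (by omega) f := by
  subst h₀
  obtain rfl : d = e := by omega
  simp [GCat.comp_id]

end Basics

/-! ### The degree zero subcategory -/

/-- The degree zero subcategory of a graded linear category. -/
structure DegZero (K : Type u) [Field K] (C : Type v) where
  of : C

instance (K : Type u) [Field K] (C : Type v) [GCat K C] : Category.{u} (DegZero K C) where
  Hom X Y := GHom K X.of Y.of 0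
  id X := GCat.id X.of
  comp f g := GCat.comp (add_zero 0) f g
  id_comp f := GCat.id_comp _ f
  comp_id f := GCat.comp_id _ f
  assoc f g h := GCat.assoc _ _ _ _ f g h

instance (K : Type u) [Field K] (C : Type v) [GCat K C] : Preadditive (DegZero K C) where
  homGroup X Y := inferInstanceAs (AddCommGroup (GHom K X.of Y.of 0))
  add_comp X Y Z f f' g := LinearMap.map_add₂
    (GCat.comp (K := K) (X := X.of) (Y := Y.of) (Z := Z.of) (add_zero 0)) f f' g
  comp_add X Y Z f g g' := LinearMap.map_add
    (GCat.comp (K := K) (X := X.of) (Y := Y.of) (Z := Z.of) (add_zero 0) f) g g'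

/-! ### Graded functors and graded natural isomorphisms -/

/-- A functor of `ℤ`-graded `K`-linear categories. -/
structure GFunctor (K : Type u) [Field K] (C : Type v) (D : Type w) [GCat K C] [GCat K D] where
  obj : C → D
  map : ∀ {X Y : C} {d : ℤ}, GHom K X Y d →ₗ[K] GHom K (obj X) (obj Y) d
  map_id : ∀ X : C, map (GCat.id (K := K) X) = GCat.id (obj X)
  map_comp : ∀ {X Y Z : C} {i j k : ℤ} (h : i + j = k) (f : GHom K X Y i) (g : GHom K Y Z j),
    map (GCat.comp h f g) = GCat.comp h (map f) (map g)

/-- A natural transformation of graded functors (with components of degree zero), natural with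
respect to morphisms of all degrees. -/
structure GNatTrans {K : Type u} [Field K] {C : Type v} {D : Type w} [GCat K C] [GCat K D]
    (F G : GFunctor K C D) where
  app : ∀ X : C, GHom K (F.obj X) (G.obj X) 0
  naturality : ∀ {X Y : C} {d : ℤ} (f : GHom K X Y d),
    GCat.comp (add_zero d) (F.map f) (app Y) = GCat.comp (zero_add d) (app X) (G.map f)

/-- A natural isomorphism of graded functors. -/
structure GNatIso {K : Type u} [Field K] {C : Type v} {D : Type w} [GCat K C] [GCat K D]
    (F G : GFunctor K C D) where
  hom : GNatTrans F G
  inv : GNatTrans G F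
  hom_inv_id : ∀ X, GCat.comp (add_zero 0) (hom.app X) (inv.app X) = GCat.id (F.obj X)
  inv_hom_id : ∀ X, GCat.comp (add_zero 0) (inv.app X) (hom.app X) = GCat.id (G.obj X)

/-- Composition of graded functors. -/
def GFunctor.comp {K : Type u} [Field K] {C D E : Type*} [GCat K C] [GCat K D] [GCat K E]
    (F : GFunctor K C D) (G : GFunctor K D E) : GFunctor K C E where
  obj X := G.obj (F.obj X)
  map := G.map ∘ₗ F.map
  map_id X := by simp [F.map_id, G.map_id]
  map_comp h f g := by simp [F.map_comp, G.map_comp]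

/-- The opposite of a graded linear category. -/
structure GOp (C : Type v) where
  op ::
  unop : C

instance (K : Type u) [Field K] (C : Type v) [GCat K C] : GCat K (GOp C) where
  Hom X Y d := GHom K Y.unop X.unop d
  id X := GCat.id X.unop
  comp h := (GCat.comp ((add_comm _ _).trans h)).flip
  id_comp _ f := GCat.comp_id _ f
  comp_id _ f := GCat.id_comp _ f
  assoc _ _ _ _ f g e := (GCat.assoc _ _ _ _ e g f).symm

/-- The opposite of a graded functor. -/
def GFunctor.op {K : Type u} [Field K] {C D : Type*} [GCat K C] [GCat K D]
    (F : GFunctor K C D) : GFunctor K (GOp C) (GOp D) where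
  obj X := GOp.op (F.obj X.unop)
  map {X Y d} := F.map (X := Y.unop) (Y := X.unop) (d := d)
  map_id X := F.map_id X.unop
  map_comp _ f g := F.map_comp _ g f

/-! ### Graded vector spaces -/

/-- A `ℤ`-graded vector space: a family of vector spaces indexed by `ℤ`. -/
structure GVect (K : Type u) [Field K] where
  V : ℤ → Type u
  [acg : ∀ d, AddCommGroup (V d)]
  [mod : ∀ d, Module K (V d)]

attribute [instance] GVect.acg GVect.mod

/-- `HOM^d(V, W)`: families of linear maps `V_j → W_k`, one for each pair with `j + d = k`, that is,
one map `V_j → W_{j+d}` for each `j`. -/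
abbrev HOM {K : Type u} [Field K] (V W : GVect K) (d : ℤ) : Type u :=
  ∀ p : {p : ℤ × ℤ // p.1 + d = p.2}, V.V p.1.1 →ₗ[K] W.V p.1.2

/-- The component `V_j → W_k` of a homogeneous map of degree `d = k - j`. -/
def HOM.at {K : Type u} [Field K] {V W : GVect K} {d : ℤ} (f : HOM V W d) (j k : ℤ)
    (h : j + d = k) : V.V j →ₗ[K] W.V k := f ⟨(j, k), h⟩

lemma HOM.ext {K : Type u} [Field K] {V W : GVect K} {d : ℤ} {f g : HOM V W d}
    (H : ∀ j k h x, f.at j k h x = g.at j k h x) : f = g := by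
  funext ⟨⟨j, k⟩, h⟩
  exact LinearMap.ext fun x => H j k h x

/-- Identification of the components of a graded vector space in equal degrees. -/
def GVect.tr {K : Type u} [Field K] (V : GVect K) {j k : ℤ} (h : j = k) : V.V j →ₗ[K] V.V k :=
  h ▸ LinearMap.id

@[simp] lemma GVect.tr_self {K : Type u} [Field K] (V : GVect K) {j : ℤ} (h : j = j)
    (x : V.V j) : V.tr h x = x := rfl

/-- The graded linear category of graded vector spaces, with morphism spaces `HOM`. -/
instance (K : Type u) [Field K] : GCat K (GVect K) where
  Hom V W d := HOM V W d
  id V p := V.tr (by have := p.2; omega)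
  comp {X Y Z i j k} h := LinearMap.mk₂ K
    (fun f g p => HOM.at g (p.1.1 + i) p.1.2 (by have := p.2; omega) ∘ₗ HOM.at f p.1.1 (p.1.1 + i) rfl)
    (fun _ _ _ => funext fun _ => LinearMap.comp_add _ _ _)
    (fun _ _ _ => funext fun _ => LinearMap.comp_smul _ _ _)
    (fun _ _ _ => funext fun _ => LinearMap.add_comp _ _ _)
    (fun _ _ _ => funext fun _ => LinearMap.smul_comp _ _ _)
  id_comp {V W d} h f := HOM.ext fun j k hk x => by
    obtain rfl : j + d = k := hk
    have key : ∀ (a : ℤ) (h₁ : j = a) (h₂ : a + d = j + d),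
        HOM.at f a (j + d) h₂ (V.tr h₁ x) = HOM.at f j (j + d) rfl x := by
      intro a h₁ h₂; subst h₁; rfl
    exact key _ _ _
  comp_id {V W d} h f := HOM.ext fun j k hk x => by
    obtain rfl : j + d = k := hk
    rfl
  assoc {V W X Y i j k ij jk ijk} h₁ h₂ h₃ h₄ f g e := HOM.ext fun a b hb x => by
    subst h₁ h₃
    have key : ∀ (c : ℤ) (p₁ : a + i + j = c) (p₂ : c + k = b) (q : (a + i) + j = a + i + j)
        (q' : a + i + j + k = b),
        HOM.at e c b p₂ (HOM.at g (a + i) c p₁ (HOM.at f a (a + i) rfl x)) =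
        HOM.at e (a + i + j) b q' (HOM.at g (a + i) (a + i + j) q (HOM.at f a (a + i) rfl x)) := by
      intro c p₁ p₂ q q'; subst p₁; rfl
    exact key _ _ _ _ _

lemma HOM.comp_at {K : Type u} [Field K] {U V W : GVect K} {i j k : ℤ} (h : i + j = k)
    (f : GHom K U V i) (g : GHom K V W j) (a b c : ℤ) (hab : a + i = b) (hbc : b + j = c)
    (hac : a + k = c) (x : U.V a) :
    HOM.at (GCat.comp h f g : HOM U W k) a c hac x = HOM.at g b c hbc (HOM.at f a b hab x) := by
  subst hab; rfl

lemma HOM.id_at {K : Type u} [Field K] {V : GVect K} (a b : ℤ) (h : a + 0 = b) (x : V.V a) :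
    HOM.at (GCat.id (K := K) V : HOM V V 0) a b h x = V.tr (by omega) x := rfl

lemma HOM.add_at {K : Type u} [Field K] {V W : GVect K} {d : ℤ} (f g : HOM V W d) (a b : ℤ)
    (h : a + d = b) : HOM.at (f + g) a b h = HOM.at f a b h + HOM.at g a b h := rfl

lemma HOM.smul_at {K : Type u} [Field K] {V W : GVect K} {d : ℤ} (c : K) (f : HOM V W d)
    (a b : ℤ) (h : a + d = b) : HOM.at (c • f) a b h = c • HOM.at f a b h := rfl

/-! ### Representable functors, graded duals, copowers -/

/-- The contravariant functor `Hom(-, Y)` with values in graded vector spaces. -/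
def homInto (K : Type u) [Field K] {C : Type v} [GCat K C] (Y : C) :
    GFunctor K (GOp C) (GVect K) where
  obj X := ⟨fun d => GHom K X.unop Y d⟩
  map {X X' d} :=
    { toFun := fun f p => GCat.comp (X := X'.unop) (Y := X.unop) (Z := Y)
        ((add_comm _ _).trans p.2) f
      map_add' := fun f g => funext fun p => map_add (GCat.comp (K := K)
        (X := X'.unop) (Y := X.unop) (Z := Y) ((add_comm _ _).trans p.2)) f g
      map_smul' := fun c f => funext fun p => map_smul (GCat.comp (K := K)
        (X := X'.unop) (Y := X.unop) (Z := Y) ((add_comm _ _).trans p.2)) c f }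
  map_id X := HOM.ext fun j k h x => by
    obtain rfl : j = k := by omega
    exact GCat.id_comp _ _
  map_comp {X X' X'' i j k} h f g := HOM.ext fun a b hb x =>
    GCat.assoc (K := K) (W := X''.unop) (X := X'.unop) (Y := X.unop) (Z := Y) _ _ _ _ g f x

/-- The covariant functor `Hom(W, -)` with values in graded vector spaces. -/
def homFrom (K : Type u) [Field K] {C : Type v} [GCat K C] (W : C) :
    GFunctor K C (GVect K) where
  obj X := ⟨fun d => GHom K W X d⟩
  map {X X' d} :=
    { toFun := fun f p => (GCat.comp (K := K) p.2).flip f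
      map_add' := fun f g => funext fun p => map_add (GCat.comp (K := K) _).flip f g
      map_smul' := fun c f => funext fun p => map_smul (GCat.comp (K := K) _).flip c f }
  map_id X := HOM.ext fun j k h x => by
    obtain rfl : j = k := by omega
    exact GCat.comp_id _ _
  map_comp h f g := HOM.ext fun a b hb x => (GCat.assoc (K := K) _ _ _ _ x f g).symm

/-- The ground field, concentrated in degree zero. -/
def GVect.unit (K : Type u) [Field K] : GVect K :=
  ⟨fun d => (if d = 0 then ⊤ else ⊥ : Submodule K K)⟩

/-- The contravariant graded dual functor `HOM(-, K)`. -/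
def gradedDual (K : Type u) [Field K] : GFunctor K (GOp (GVect K)) (GVect K) :=
  homInto K (GVect.unit K)

/-- `T` with the degree zero map `unit : V → Hom(W, T)` is a copower `V ⊗ W`: composition with
`unit` is an isomorphism `Hom(T, Y) ≅ HOM(V, Hom(W, Y))` for every `Y`. -/
def IsCopower {K : Type u} [Field K] {C : Type v} [GCat K C] (V : GVect K) (W T : C)
    (unit : GHom K V ((homFrom K W).obj T) 0) : Prop :=
  ∀ (Y : C) (d : ℤ), Function.Bijective
    (fun g : GHom K T Y d => GCat.comp (zero_add d) unit ((homFrom K W).map g))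

/-- The functor `X ↦ P(X) ⊗ W` given by copowers: a functor `T` together with natural maps
`P(X) → Hom(W, T(X))` that make each `T(X)` the copower `P(X) ⊗ W`. -/
structure CopowerFunctor {K : Type u} [Field K] {C : Type v} [GCat K C]
    (P : GFunctor K C (GVect K)) (W : C) where
  functor : GFunctor K C C
  unit : GNatTrans P (functor.comp (homFrom K W))
  isCopower : ∀ X, IsCopower (P.obj X) W (functor.obj X) (unit.app X)

/-! ### Monoidal products -/

/-- The tensor product of a graded linear monoidal category, as a bilinear bifunctor. -/
class GTensor (K : Type u) [Field K] (C : Type v) [GCat K C] where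
  obj : C → C → C
  hom : ∀ {X X' Y Y' : C} {i j k : ℤ}, i + j = k →
    GHom K X X' i →ₗ[K] GHom K Y Y' j →ₗ[K] GHom K (obj X Y) (obj X' Y') k
  id_hom_id : ∀ (X Y : C) (h : (0 : ℤ) + 0 = 0),
    hom h (GCat.id (K := K) X) (GCat.id (K := K) Y) = GCat.id (obj X Y)
  interchange : ∀ {X X' X'' Y Y' Y'' : C} {i i' j j' p q r s k : ℤ}
    (h₁ : i + i' = p) (h₂ : j + j' = q) (h₃ : p + q = k)
    (h₄ : i + j = r) (h₅ : i' + j' = s) (h₆ : r + s = k)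
    (f : GHom K X X' i) (f' : GHom K X' X'' i') (g : GHom K Y Y' j) (g' : GHom K Y' Y'' j'),
    hom h₃ (GCat.comp h₁ f f') (GCat.comp h₂ g g') =
      GCat.comp h₆ (hom h₄ f g) (hom h₅ f' g')

/-! ### The Karoubi envelope -/

/-- Objects of the graded Karoubi envelope: objects with a degree zero idempotent. -/
structure Kar (K : Type u) [Field K] (C : Type v) [GCat K C] where
  X : C
  e : GHom K X X 0
  idem : GCat.comp (add_zero 0) e e = e

section Kar

variable {K : Type u} [Field K] {C : Type v} [GCat K C]

/-- Morphisms `(X, e) → (X', e')` of degree `d`: those `f : X → X'` with `f = e' ∘ f ∘ e`. -/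
def Kar.homSub (A B : Kar K C) (d : ℤ) : Submodule K (GHom K A.X B.X d) :=
  LinearMap.eqLocus
    ((GCat.comp (add_zero d)).flip B.e ∘ₗ GCat.comp (zero_add d) A.e) LinearMap.id

lemma Kar.mem_homSub {A B : Kar K C} {d : ℤ} {f : GHom K A.X B.X d} :
    f ∈ Kar.homSub A B d ↔
      GCat.comp (add_zero d) (GCat.comp (zero_add d) A.e f) B.e = f := Iff.rfl

lemma Kar.id_comp' {A B : Kar K C} {d : ℤ} (h : 0 + d = d) {f : GHom K A.X B.X d}
    (hf : f ∈ Kar.homSub A B d) : GCat.comp h A.e f = f := by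
  rw [Kar.mem_homSub] at hf
  rw [← hf, GCat.assoc (zero_add d) (add_zero d) (add_zero d) (zero_add d),
    ← GCat.assoc (add_zero 0) (zero_add d) h (zero_add d), A.idem]

lemma Kar.comp_id' {A B : Kar K C} {d : ℤ} (h : d + 0 = d) {f : GHom K A.X B.X d}
    (hf : f ∈ Kar.homSub A B d) : GCat.comp h f B.e = f := by
  rw [Kar.mem_homSub] at hf
  rw [← hf, GCat.assoc (add_zero d) h (add_zero 0) (add_zero d), B.idem]

lemma Kar.mem_of {A B : Kar K C} {d : ℤ} {f : GHom K A.X B.X d}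
    (h₁ : GCat.comp (zero_add d) A.e f = f) (h₂ : GCat.comp (add_zero d) f B.e = f) :
    f ∈ Kar.homSub A B d := by
  rw [Kar.mem_homSub, h₁, h₂]

instance : GCat K (Kar K C) where
  Hom A B d := Kar.homSub A B d
  id A := ⟨A.e, Kar.mem_of A.idem A.idem⟩
  comp {A B D i j k} h := LinearMap.mk₂ K
    (fun f g => ⟨GCat.comp h f.1 g.1, Kar.mem_of
      (by rw [← GCat.assoc (zero_add i) h h (zero_add k), Kar.id_comp' _ f.2])
      (by rw [GCat.assoc h (add_zero k) (add_zero j) h, Kar.comp_id' _ g.2])⟩)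
    (fun f f' g => Subtype.ext (LinearMap.map_add₂ (GCat.comp (K := K) h) f.1 f'.1 g.1))
    (fun c f g => Subtype.ext (LinearMap.map_smul₂ (GCat.comp (K := K) h) c f.1 g.1))
    (fun f g g' => Subtype.ext (map_add (GCat.comp (K := K) h f.1) g.1 g'.1))
    (fun c f g => Subtype.ext (map_smul (GCat.comp (K := K) h f.1) c g.1))
  id_comp h f := Subtype.ext (Kar.id_comp' h f.2)
  comp_id h f := Subtype.ext (Kar.comp_id' h f.2)
  assoc h₁ h₂ h₃ h₄ f g e := Subtype.ext (GCat.assoc h₁ h₂ h₃ h₄ f.1 g.1 e.1)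

instance [GTensor K C] : GTensor K (Kar K C) where
  obj A B := ⟨GTensor.obj K A.X B.X, GTensor.hom (add_zero 0) A.e B.e, by
    rw [← GTensor.interchange (add_zero 0) (add_zero 0) (add_zero 0), A.idem, B.idem]⟩
  hom {A A' B B' i j k} h := LinearMap.mk₂ K
    (fun f g => ⟨GTensor.hom h f.1 g.1, Kar.mem_of
      (by rw [← GTensor.interchange (zero_add i) (zero_add j) h (add_zero 0) h (zero_add k),
        Kar.id_comp' _ f.2, Kar.id_comp' _ g.2])
      (by rw [← GTensor.interchange (add_zero i) (add_zero j) h h (add_zero 0) (add_zero k),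
        Kar.comp_id' _ f.2, Kar.comp_id' _ g.2])⟩)
    (fun f f' g => Subtype.ext (LinearMap.map_add₂ (GTensor.hom (K := K) h) f.1 f'.1 g.1))
    (fun c f g => Subtype.ext (LinearMap.map_smul₂ (GTensor.hom (K := K) h) c f.1 g.1))
    (fun f g g' => Subtype.ext (map_add (GTensor.hom (K := K) h f.1) g.1 g'.1))
    (fun c f g => Subtype.ext (map_smul (GTensor.hom (K := K) h f.1) c g.1))
  id_hom_id _ _ _ := rfl
  interchange h₁ h₂ h₃ h₄ h₅ h₆ f f' g g' :=
    Subtype.ext (GTensor.interchange h₁ h₂ h₃ h₄ h₅ h₆ f.1 f'.1 g.1 g'.1)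

/-- Extension of a functor with values in graded vector spaces to the Karoubi envelope: `(X, e)` is
sent to the image of the idempotent `F(e)`. -/
def GFunctor.extKar (F : GFunctor K C (GVect K)) : GFunctor K (Kar K C) (GVect K) where
  obj A := ⟨fun d => LinearMap.range (HOM.at (F.map A.e) d d (add_zero d))⟩
  map {A B d} :=
    { toFun := fun f p => (HOM.at (F.map f.1) p.1.1 p.1.2 p.2).restrict (by
        rintro _ ⟨x, rfl⟩
        refine ⟨HOM.at (F.map f.1) p.1.1 p.1.2 p.2 x, ?_⟩
        rw [← HOM.comp_at (add_zero d) _ _ _ _ _ _ _ p.2,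
          ← HOM.comp_at (zero_add d) _ _ _ _ _ _ _ p.2, ← F.map_comp, ← F.map_comp,
          Kar.comp_id' _ f.2, Kar.id_comp' _ f.2])
      map_add' := fun f g => funext fun p => LinearMap.ext fun x => Subtype.ext
        (LinearMap.congr_fun (congrFun (map_add F.map f.1 g.1) p) x.1)
      map_smul' := fun c f => funext fun p => LinearMap.ext fun x => Subtype.ext
        (LinearMap.congr_fun (congrFun (map_smul F.map c f.1) p) x.1) }
  map_id A := HOM.ext fun j k h x => by
    obtain rfl : j = k := by omega
    obtain ⟨_, x, rfl⟩ := x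
    refine Subtype.ext ?_
    change HOM.at (F.map A.e) j j _ (HOM.at (F.map A.e) j j _ x) = HOM.at (F.map A.e) j j _ x
    rw [← HOM.comp_at (add_zero 0) _ _ _ _ _ _ _ (add_zero j), ← F.map_comp, A.idem]
  map_comp {A B D i j k} h f g := HOM.ext fun a b hb x => Subtype.ext (by
    rw [HOM.comp_at h _ _ a (a + i) b rfl (by omega)]
    change HOM.at (F.map (GCat.comp h f.1 g.1)) a b hb x.1 =
      HOM.at (F.map g.1) (a + i) b _ (HOM.at (F.map f.1) a (a + i) _ x.1)
    rw [F.map_comp, HOM.comp_at h _ _ a (a + i) b rfl (by omega)])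

end Kar

/-! ### The additive completion -/

/-- Objects of the `ℤ`-additive completion: formal finite sums `⨁ i, q ^ (s i) X i`. -/
structure Mat (K : Type u) [Field K] (C : Type v) where
  ι : Type
  [fin : Fintype ι]
  s : ι → ℤ
  X : ι → C

attribute [instance] Mat.fin

section Mat

variable {K : Type u} [Field K] {C : Type v} [GCat K C]

/-- Matrices of morphisms; the entry `q ^ a X → q ^ b Y` of a morphism of degree `d` is a morphism
`X → Y` of degree `d + a - b`. -/
abbrev Mat.HomM (A B : Mat K C) (d : ℤ) : Type u :=
  ∀ (i : A.ι) (j : B.ι), GHom K (A.X i) (B.X j) (d + A.s i - B.s j)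

open Classical in
/-- The identity matrix. -/
def Mat.idM (A : Mat K C) : Mat.HomM A A 0 := fun i j =>
  if h : i = j then h ▸ degCast (by omega) (GCat.id (K := K) (A.X i)) else 0

lemma Mat.idM_self (A : Mat K C) (i : A.ι) :
    A.idM i i = degCast (by omega) (GCat.id (K := K) (A.X i)) := by
  simp [Mat.idM]

lemma Mat.idM_ne (A : Mat K C) {i j : A.ι} (h : i ≠ j) : A.idM i j = 0 := by
  simp [Mat.idM, h]

/-- Matrix multiplication. -/
def Mat.compM {A B D : Mat K C} {i j k : ℤ} (h : i + j = k) :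
    Mat.HomM A B i →ₗ[K] Mat.HomM B D j →ₗ[K] Mat.HomM A D k :=
  LinearMap.mk₂ K
    (fun f g a c => ∑ b, GCat.comp (by omega) (f a b) (g b c))
    (fun f f' g => by funext a c; simp [Finset.sum_add_distrib])
    (fun r f g => by funext a c; simp [Finset.smul_sum])
    (fun f g g' => by funext a c; simp [Finset.sum_add_distrib])
    (fun r f g => by funext a c; simp [Finset.smul_sum])

lemma Mat.compM_apply {A B D : Mat K C} {i j k : ℤ} (h : i + j = k) (f : Mat.HomM A B i)
    (g : Mat.HomM B D j) (a : A.ι) (c : D.ι) :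
    Mat.compM h f g a c = ∑ b, GCat.comp (by omega) (f a b) (g b c) := rfl

instance : GCat K (Mat K C) where
  Hom A B d := Mat.HomM A B d
  id A := A.idM
  comp h := Mat.compM h
  id_comp {A B d} h f := by
    funext a c
    rw [Mat.compM_apply, Finset.sum_eq_single a]
    · rw [Mat.idM_self, degCast_id_comp, degCast_self]
    · intro b _ hb
      rw [Mat.idM_ne _ hb.symm, map_zero, LinearMap.zero_apply]
    · simp
  comp_id {A B d} h f := by
    funext a c
    rw [Mat.compM_apply, Finset.sum_eq_single c]
    · rw [Mat.idM_self, comp_degCast_id, degCast_self]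
    · intro b _ hb
      rw [Mat.idM_ne _ hb, map_zero]
    · simp
  assoc {A B D E i j k ij jk ijk} h₁ h₂ h₃ h₄ f g e := by
    funext a c
    simp only [Mat.compM_apply, map_sum, LinearMap.sum_apply]
    rw [Finset.sum_comm]
    refine Finset.sum_congr rfl fun b _ => Finset.sum_congr rfl fun b' _ => ?_
    exact GCat.assoc _ _ _ _ _ _ _

/-- The tensor product `(⨁ i, q ^ a_i X_i) ⊗ (⨁ j, q ^ b_j Y_j) = ⨁ (i, j), q ^ (a_i + b_j) X_i ⊗ Y_j`. -/
abbrev Mat.tensorObj [GTensor K C] (A B : Mat K C) : Mat K C :=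
  ⟨A.ι × B.ι, fun p => A.s p.1 + B.s p.2, fun p => GTensor.obj K (A.X p.1) (B.X p.2)⟩

/-- The tensor product of matrices of morphisms. -/
def Mat.tensorM [GTensor K C] {A A' B B' : Mat K C} {i j k : ℤ} (h : i + j = k) :
    Mat.HomM A A' i →ₗ[K] Mat.HomM B B' j →ₗ[K]
      Mat.HomM (Mat.tensorObj A B) (Mat.tensorObj A' B') k :=
  LinearMap.mk₂ K
    (fun f g a b => GTensor.hom (by dsimp only [Mat.tensorObj]; omega) (f a.1 b.1) (g a.2 b.2))
    (fun f f' g => by funext a c; exact LinearMap.map_add₂ _ _ _ _)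
    (fun r f g => by funext a c; exact LinearMap.map_smul₂ _ _ _ _)
    (fun f g g' => by funext a c; exact map_add _ _ _)
    (fun r f g => by funext a c; exact map_smul _ _ _)

lemma Mat.tensorM_apply [GTensor K C] {A A' B B' : Mat K C} {i j k : ℤ} (h : i + j = k)
    (f : Mat.HomM A A' i) (g : Mat.HomM B B' j) (a : A.ι × B.ι) (b : A'.ι × B'.ι) :
    Mat.tensorM h f g a b = GTensor.hom (by dsimp only [Mat.tensorObj]; omega) (f a.1 b.1) (g a.2 b.2) := rfl

lemma GTensor.hom_degCast_id [GTensor K C] (X Y : C) {a b c : ℤ} (ha : 0 = a) (hb : 0 = b)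
    (h : a + b = c) :
    GTensor.hom h (degCast ha (GCat.id (K := K) X)) (degCast hb (GCat.id (K := K) Y)) =
      degCast (by omega) (GCat.id (K := K) (GTensor.obj K X Y)) := by
  subst ha hb
  obtain rfl : c = 0 := by omega
  simp [GTensor.id_hom_id]

/-- `q ^ a X ⊗ q ^ b Y = q ^ (a + b) (X ⊗ Y)`, extended bilinearly. -/
instance [GTensor K C] : GTensor K (Mat K C) where
  obj A B := Mat.tensorObj A B
  hom h := Mat.tensorM h
  id_hom_id A B h := by
    funext ⟨a, b⟩ ⟨a', b'⟩
    change Mat.tensorM h A.idM B.idM (a, b) (a', b') = (Mat.tensorObj A B).idM (a, b) (a', b')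
    rw [Mat.tensorM_apply]
    by_cases ha : a = a'
    · by_cases hb : b = b'
      · subst ha hb
        rw [Mat.idM_self, Mat.idM_self, Mat.idM_self, GTensor.hom_degCast_id]
      · rw [Mat.idM_ne B hb, map_zero, Mat.idM_ne]
        simp [hb]
    · rw [Mat.idM_ne A ha, map_zero, LinearMap.zero_apply, Mat.idM_ne]
      simp [ha]
  interchange h₁ h₂ h₃ h₄ h₅ h₆ f f' g g' := by
    funext ⟨a, b⟩ ⟨a', b'⟩
    change Mat.tensorM h₃ (Mat.compM h₁ f f') (Mat.compM h₂ g g') (a, b) (a', b') =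
      Mat.compM h₆ (Mat.tensorM h₄ f g) (Mat.tensorM h₅ f' g') (a, b) (a', b')
    rw [Mat.compM_apply, Mat.tensorM_apply, Mat.compM_apply, Mat.compM_apply,
      Fintype.sum_prod_type]
    simp only [map_sum, LinearMap.sum_apply]
    rw [Finset.sum_comm]
    refine Finset.sum_congr rfl fun c _ => Finset.sum_congr rfl fun c' _ => ?_
    exact GTensor.interchange _ _ _ _ _ _ _ _ _ _

/-- The value on `⨁ i, q ^ (s i) X i` of the extension of `F`: the graded vector space
`⨁ i, q ^ (s i) F(X i)`. -/
def GFunctor.matObj (F : GFunctor K C (GVect K)) (A : Mat K C) : GVect K :=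
  ⟨fun d => ∀ i, (F.obj (A.X i)).V (d - A.s i)⟩

/-- The action of a matrix of morphisms. -/
def GFunctor.matMap (F : GFunctor K C (GVect K)) {A B : Mat K C} {d : ℤ} :
    Mat.HomM A B d →ₗ[K] HOM (F.matObj A) (F.matObj B) d where
  toFun f p :=
    { toFun := fun x j => ∑ i,
        HOM.at (F.map (f i j)) (p.1.1 - A.s i) (p.1.2 - B.s j) (by have := p.2; omega) (x i)
      map_add' := fun x y => funext fun j =>
        (Finset.sum_congr rfl fun i _ => map_add _ (x i) (y i)).trans Finset.sum_add_distrib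
      map_smul' := fun c x => funext fun j =>
        (Finset.sum_congr rfl fun i _ => map_smul _ c (x i)).trans Finset.smul_sum.symm }
  map_add' f g := funext fun p => LinearMap.ext fun x => funext fun j =>
    (Finset.sum_congr rfl fun i _ => by
      rw [show (f + g) i j = f i j + g i j from rfl, map_add]; rfl).trans Finset.sum_add_distrib
  map_smul' c f := funext fun p => LinearMap.ext fun x => funext fun j =>
    (Finset.sum_congr rfl fun i _ => by
      rw [show (c • f) i j = c • f i j from rfl, map_smul]).trans Finset.smul_sum.symm

lemma GFunctor.matMap_at (F : GFunctor K C (GVect K)) {A B : Mat K C} {d : ℤ}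
    (f : Mat.HomM A B d) (p q : ℤ) (h : p + d = q) (x : (F.matObj A).V p) (j : B.ι) :
    HOM.at (F.matMap f) p q h x j =
      ∑ i, HOM.at (F.map (f i j)) (p - A.s i) (q - B.s j) (by omega) (x i) := rfl

lemma HOM.sum_at {V W : GVect K} {d : ℤ} {ι : Type} (s : Finset ι) (f : ι → HOM V W d) (a b : ℤ)
    (h : a + d = b) (x : V.V a) :
    HOM.at (∑ i ∈ s, f i) a b h x = ∑ i ∈ s, HOM.at (f i) a b h x := by
  classical
  induction s using Finset.induction_on with
  | empty => rfl
  | insert i s hi ih => rw [Finset.sum_insert hi, Finset.sum_insert hi, HOM.add_at, ← ih]; rfl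

lemma GFunctor.map_degCast_id (F : GFunctor K C (GVect K)) (X : C) {d : ℤ} (h₀ : 0 = d)
    (p : ℤ) (h : p + d = p) (x : (F.obj X).V p) :
    HOM.at (F.map (degCast h₀ (GCat.id (K := K) X))) p p h x = x := by
  subst h₀
  rw [degCast_self, F.map_id]
  rfl

/-- Extension of a functor with values in graded vector spaces to the additive completion. -/
def GFunctor.extMat (F : GFunctor K C (GVect K)) : GFunctor K (Mat K C) (GVect K) where
  obj A := F.matObj A
  map := F.matMap
  map_id A := HOM.ext fun p q h x => by
    obtain rfl : p = q := by omega
    funext j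
    change HOM.at (F.matMap A.idM) p p h x j = x j
    rw [GFunctor.matMap_at, Finset.sum_eq_single j]
    · rw [Mat.idM_self, GFunctor.map_degCast_id]
    · intro i _ hi
      rw [Mat.idM_ne _ hi, map_zero]
      rfl
    · simp
  map_comp {A B D i j k} h f g := HOM.ext fun p q hq x => by
    funext c
    change HOM.at (F.matMap (Mat.compM h f g)) p q hq x c = _
    rw [HOM.comp_at h _ _ p (p + i) q rfl (by omega), GFunctor.matMap_at]
    change _ = HOM.at (F.matMap g) (p + i) q _ (HOM.at (F.matMap f) p (p + i) _ x) c
    rw [GFunctor.matMap_at]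
    have h1 : ∀ a, HOM.at (F.map (Mat.compM h f g a c)) (p - A.s a) (q - D.s c) (by omega) (x a) =
        ∑ b, HOM.at (F.map (g b c)) (p + i - B.s b) (q - D.s c) (by omega)
          (HOM.at (F.map (f a b)) (p - A.s a) (p + i - B.s b) (by omega) (x a)) := by
      intro a
      rw [Mat.compM_apply, map_sum]
      refine (HOM.sum_at _ _ _ _ _ _).trans (Finset.sum_congr rfl fun b _ => ?_)
      rw [F.map_comp, HOM.comp_at]
    rw [Finset.sum_congr rfl fun a _ => h1 a, Finset.sum_comm]
    refine Finset.sum_congr rfl fun b _ => ?_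
    rw [GFunctor.matMap_at, map_sum]

end Mat

/-! ### The ind-completion -/

/-- Objects of the ind-completion: directed systems in the degree zero subcategory, indexed by
small filtered categories. -/
structure IndObj (K : Type u) [Field K] (C : Type v) [GCat K C] where
  I : Type u
  [cat : SmallCategory I]
  [filt : IsFiltered I]
  F : I ⥤ DegZero K C

attribute [instance] IndObj.cat IndObj.filt

section Ind

variable {K : Type u} [Field K] {C : Type v} [GCat K C]

/-- The object at a given index of a directed system. -/
abbrev IndObj.at (A : IndObj K C) (i : A.I) : C := (A.F.obj i).of

/-- The transition morphism (of degree zero) of a directed system. -/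
abbrev IndObj.tr (A : IndObj K C) {i j : A.I} (u : i ⟶ j) : GHom K (A.at i) (A.at j) 0 :=
  A.F.map u

lemma IndObj.tr_id (A : IndObj K C) (i : A.I) : A.tr (𝟙 i) = GCat.id (A.at i) := A.F.map_id i

lemma IndObj.tr_comp (A : IndObj K C) {i j k : A.I} (u : i ⟶ j) (v : j ⟶ k) :
    A.tr (u ≫ v) = GCat.comp (add_zero 0) (A.tr u) (A.tr v) := A.F.map_comp u v

/-- The directed system `j ↦ Hom^d(X, B j)`. -/
def IndObj.homSys (X : C) (B : IndObj K C) (d : ℤ) : B.I ⥤ ModuleCat.{u} K where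
  obj j := ModuleCat.of K (GHom K X (B.at j) d)
  map v := ModuleCat.ofHom ((GCat.comp (add_zero d)).flip (B.tr v))
  map_id j := by
    ext f
    change GCat.comp (add_zero d) f (B.tr (𝟙 j)) = f
    rw [B.tr_id, GCat.comp_id]
  map_comp u v := by
    ext f
    change GCat.comp (add_zero d) f (B.tr (u ≫ v)) =
      GCat.comp (add_zero d) (GCat.comp (add_zero d) f (B.tr u)) (B.tr v)
    rw [B.tr_comp, GCat.assoc (add_zero d) (add_zero d) (add_zero 0) (add_zero d)]

/-- `colim_j Hom^d(X, B j)`. -/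
abbrev CHom (X : C) (B : IndObj K C) (d : ℤ) : Type u := (colimit (B.homSys X d) : ModuleCat.{u} K)

/-- The canonical map `Hom^d(X, B j) → colim_j Hom^d(X, B j)`. -/
def CHom.ι (X : C) (B : IndObj K C) (d : ℤ) (j : B.I) : GHom K X (B.at j) d →ₗ[K] CHom X B d :=
  (colimit.ι (B.homSys X d) j).hom

lemma CHom.w {X : C} {B : IndObj K C} {d : ℤ} {j j' : B.I} (v : j ⟶ j')
    (f : GHom K X (B.at j) d) :
    CHom.ι X B d j' (GCat.comp (add_zero d) f (B.tr v)) = CHom.ι X B d j f :=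
  ConcreteCategory.congr_hom (colimit.w (B.homSys X d) v) f

lemma CHom.ext {X : C} {B : IndObj K C} {d : ℤ} {M : Type u} [AddCommGroup M] [Module K M]
    {φ ψ : CHom X B d →ₗ[K] M} (H : ∀ j f, φ (CHom.ι X B d j f) = ψ (CHom.ι X B d j f)) :
    φ = ψ := by
  have : ModuleCat.ofHom φ = ModuleCat.ofHom ψ := by
    refine colimit.hom_ext fun j => ?_
    ext f
    exact H j f
  exact congrArg ModuleCat.Hom.hom this

/-- Maps out of `colim_j Hom^d(X, B j)`. -/
def CHom.desc {X : C} {B : IndObj K C} {d : ℤ} {M : Type u} [AddCommGroup M] [Module K M]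
    (φ : ∀ j, GHom K X (B.at j) d →ₗ[K] M)
    (w : ∀ (j j' : B.I) (v : j ⟶ j') (f : GHom K X (B.at j) d),
      φ j' (GCat.comp (add_zero d) f (B.tr v)) = φ j f) : CHom X B d →ₗ[K] M :=
  (colimit.desc (B.homSys X d)
    { pt := ModuleCat.of K M
      ι :=
        { app := fun j => ModuleCat.ofHom (φ j)
          naturality := fun j j' v => by
            ext f
            exact w j j' v f } }).hom

@[simp] lemma CHom.desc_ι {X : C} {B : IndObj K C} {d : ℤ} {M : Type u} [AddCommGroup M]
    [Module K M] (φ : ∀ j, GHom K X (B.at j) d →ₗ[K] M)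
    (w : ∀ (j j' : B.I) (v : j ⟶ j') (f : GHom K X (B.at j) d),
      φ j' (GCat.comp (add_zero d) f (B.tr v)) = φ j f) (j : B.I) (f : GHom K X (B.at j) d) :
    CHom.desc φ w (CHom.ι X B d j f) = φ j f :=
  ConcreteCategory.congr_hom (colimit.ι_desc (F := B.homSys X d) _ j) f

/-- Precomposition `Hom^i(X, Y) × colim_j Hom^k(Y, B j) → colim_j Hom^l(X, B j)`. -/
def CHom.pre {X Y : C} {B : IndObj K C} {i k l : ℤ} (h : i + k = l) :
    GHom K X Y i →ₗ[K] CHom Y B k →ₗ[K] CHom X B l :=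
  (CHom.desc (fun j => ((GCat.comp h).compr₂ (CHom.ι X B l j)).flip) (fun _ _ v f => by
    refine LinearMap.ext fun g => ?_
    change CHom.ι X B l _ (GCat.comp h g (GCat.comp (add_zero k) f (B.tr v))) =
      CHom.ι X B l _ (GCat.comp h g f)
    rw [← GCat.assoc h (add_zero l) (add_zero k) h, CHom.w])).flip

@[simp] lemma CHom.pre_ι {X Y : C} {B : IndObj K C} {i k l : ℤ} (h : i + k = l)
    (g : GHom K X Y i) (j : B.I) (f : GHom K Y (B.at j) k) :
    CHom.pre h g (CHom.ι Y B k j f) = CHom.ι X B l j (GCat.comp h g f) := by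
  exact LinearMap.congr_fun (CHom.desc_ι _ _ j f) g

lemma CHom.pre_pre {X Y Z : C} {B : IndObj K C} {i j k ij jk l : ℤ} (h₁ : i + j = ij)
    (h₂ : ij + k = l) (h₃ : j + k = jk) (h₄ : i + jk = l) (f : GHom K X Y i) (g : GHom K Y Z j)
    (x : CHom Z B k) :
    CHom.pre h₂ (GCat.comp h₁ f g) x = CHom.pre h₄ f (CHom.pre h₃ g x) := by
  have : CHom.pre h₂ (GCat.comp h₁ f g) =
      CHom.pre (B := B) h₄ f ∘ₗ CHom.pre h₃ g := CHom.ext fun b e => by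
    simp [GCat.assoc h₁ h₂ h₃ h₄]
  exact LinearMap.congr_fun this x

lemma CHom.pre_id {X : C} {B : IndObj K C} {k : ℤ} (h : 0 + k = k) (x : CHom X B k) :
    CHom.pre h (GCat.id (K := K) X) x = x := by
  have : CHom.pre h (GCat.id (K := K) X) = (LinearMap.id : CHom X B k →ₗ[K] CHom X B k) :=
    CHom.ext fun b e => by simp [GCat.id_comp]
  exact LinearMap.congr_fun this x

/-- Morphisms of degree `d` in the ind-completion: `lim_i colim_j Hom^d(A i, B j)`. -/
def IndObj.homSub (A B : IndObj K C) (d : ℤ) : Submodule K (∀ i, CHom (A.at i) B d) where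
  carrier := {f | ∀ {i i' : A.I} (v : i ⟶ i'), CHom.pre (zero_add d) (A.tr v) (f i') = f i}
  add_mem' hf hg i i' v := by
    rw [Pi.add_apply, Pi.add_apply, map_add, hf v, hg v]
  zero_mem' v := by
    rw [Pi.zero_apply, Pi.zero_apply, map_zero]
  smul_mem' c f hf i i' v := by
    rw [Pi.smul_apply, Pi.smul_apply, map_smul, hf v]

/-- The action of morphisms of ind-objects,
`colim_j Hom^i(X, A j) × Hom^k(A, B) → colim_j Hom^l(X, B j)`. -/
def CHom.act {X : C} {A B : IndObj K C} {i k l : ℤ} (h : i + k = l) :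
    CHom X A i →ₗ[K] IndObj.homSub A B k →ₗ[K] CHom X B l :=
  CHom.desc
    (fun j => LinearMap.lcomp K (CHom X B l)
      (LinearMap.proj j ∘ₗ (IndObj.homSub A B k).subtype) ∘ₗ CHom.pre h)
    (fun _ _ v f => by
      refine LinearMap.ext fun g => ?_
      change CHom.pre h (GCat.comp (add_zero i) f (A.tr v)) (g.1 _) = CHom.pre h f (g.1 _)
      rw [CHom.pre_pre (add_zero i) h (zero_add k) h, g.2 v])

@[simp] lemma CHom.act_ι {X : C} {A B : IndObj K C} {i k l : ℤ} (h : i + k = l) (j : A.I)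
    (f : GHom K X (A.at j) i) (g : IndObj.homSub A B k) :
    CHom.act h (CHom.ι X A i j f) g = CHom.pre h f (g.1 j) := by
  exact LinearMap.congr_fun (CHom.desc_ι _ _ j f) g

lemma CHom.act_pre {X Y : C} {A B : IndObj K C} {i j k ij jk l : ℤ} (h₁ : i + j = ij)
    (h₂ : ij + k = l) (h₃ : j + k = jk) (h₄ : i + jk = l) (f : GHom K X Y i) (x : CHom Y A j)
    (g : IndObj.homSub A B k) :
    CHom.act h₂ (CHom.pre h₁ f x) g = CHom.pre h₄ f (CHom.act h₃ x g) := by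
  have : (CHom.act h₂).flip g ∘ₗ CHom.pre h₁ f =
      CHom.pre h₄ f ∘ₗ (CHom.act (X := Y) h₃).flip g := CHom.ext fun b e => by
    simp [CHom.pre_pre h₁ h₂ h₃ h₄]
  exact LinearMap.congr_fun this x

/-- The identity of an ind-object. -/
def IndObj.idI (A : IndObj K C) : IndObj.homSub A A 0 :=
  ⟨fun i => CHom.ι _ _ _ i (GCat.id (A.at i)), fun {i i'} v => by
    rw [CHom.pre_ι, GCat.comp_id]
    exact (congrArg _ (GCat.id_comp _ _).symm).trans (CHom.w v (GCat.id (A.at i)))⟩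

/-- Composition in the ind-completion. -/
def IndObj.compI {A B D : IndObj K C} {i j k : ℤ} (h : i + j = k) :
    IndObj.homSub A B i →ₗ[K] IndObj.homSub B D j →ₗ[K] IndObj.homSub A D k :=
  LinearMap.mk₂ K
    (fun f g => ⟨fun a => CHom.act h (f.1 a) g, fun {a a'} v => by
      rw [← CHom.act_pre (zero_add i) h h (zero_add k), f.2 v]⟩)
    (fun f f' g => Subtype.ext (funext fun a => LinearMap.map_add₂ (CHom.act h) (f.1 a) (f'.1 a) g))
    (fun c f g => Subtype.ext (funext fun a => LinearMap.map_smul₂ (CHom.act h) c (f.1 a) g))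
    (fun f g g' => Subtype.ext (funext fun a => map_add (CHom.act h (f.1 a)) g g'))
    (fun c f g => Subtype.ext (funext fun a => map_smul (CHom.act h (f.1 a)) c g))

lemma IndObj.compI_val {A B D : IndObj K C} {i j k : ℤ} (h : i + j = k)
    (f : IndObj.homSub A B i) (g : IndObj.homSub B D j) (a : A.I) :
    (IndObj.compI h f g).1 a = CHom.act h (f.1 a) g := rfl

lemma CHom.act_idI {X : C} {A : IndObj K C} {d : ℤ} (h : d + 0 = d) (x : CHom X A d) :
    CHom.act h x A.idI = x := by
  have : (CHom.act h).flip A.idI = (LinearMap.id : CHom X A d →ₗ[K] CHom X A d) :=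
    CHom.ext fun b e => by simp [IndObj.idI, GCat.comp_id]
  exact LinearMap.congr_fun this x

lemma CHom.act_act {X : C} {A B D : IndObj K C} {i j k ij jk l : ℤ} (h₁ : i + j = ij)
    (h₂ : ij + k = l) (h₃ : j + k = jk) (h₄ : i + jk = l) (x : CHom X A i)
    (f : IndObj.homSub A B j) (g : IndObj.homSub B D k) :
    CHom.act h₂ (CHom.act h₁ x f) g = CHom.act h₄ x (IndObj.compI h₃ f g) := by
  have : (CHom.act h₂).flip g ∘ₗ (CHom.act (X := X) h₁).flip f =
      (CHom.act h₄).flip (IndObj.compI h₃ f g) := CHom.ext fun b e => by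
    simp [CHom.act_pre h₁ h₂ h₃ h₄, IndObj.compI_val]
  exact LinearMap.congr_fun this x

/-- The ind-completion. -/
instance : GCat K (IndObj K C) where
  Hom A B d := IndObj.homSub A B d
  id A := A.idI
  comp h := IndObj.compI h
  id_comp {A B d} h f := Subtype.ext (funext fun a => by
    rw [IndObj.compI_val]
    exact (CHom.act_ι h a _ f).trans (CHom.pre_id h _))
  comp_id h f := Subtype.ext (funext fun a => CHom.act_idI h (f.1 a))
  assoc h₁ h₂ h₃ h₄ f g e := Subtype.ext (funext fun a =>
    CHom.act_act h₁ h₂ h₃ h₄ (f.1 a) g e)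

/-- The tensor product of ind-objects, `(colim_i A i) ⊗ (colim_j B j) = colim_{(i, j)} A i ⊗ B j`. -/
@[reducible] def IndObj.tensorObj [GTensor K C] (A B : IndObj K C) : IndObj K C where
  I := A.I × B.I
  F :=
    { obj := fun p => ⟨GTensor.obj K (A.at p.1) (B.at p.2)⟩
      map := fun v => (GTensor.hom (add_zero 0) (A.tr v.1) (B.tr v.2) : GHom K _ _ 0)
      map_id := fun p => by
        change GTensor.hom (add_zero 0) (A.tr (𝟙 p.1)) (B.tr (𝟙 p.2)) = GCat.id _
        rw [A.tr_id, B.tr_id, GTensor.id_hom_id]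
      map_comp := fun u v => by
        change GTensor.hom (add_zero 0) (A.tr (u.1 ≫ v.1)) (B.tr (u.2 ≫ v.2)) =
          GCat.comp (add_zero 0) (GTensor.hom (add_zero 0) (A.tr u.1) (B.tr u.2))
            (GTensor.hom (add_zero 0) (A.tr v.1) (B.tr v.2))
        rw [A.tr_comp, B.tr_comp, GTensor.interchange (add_zero 0) (add_zero 0) (add_zero 0)
          (add_zero 0) (add_zero 0) (add_zero 0)] }

/-- The map `colim_j Hom^d(X, B j) → colim_{(a', j)} Hom^d(A a ⊗ X, A a' ⊗ B j)` sending `f` to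
`id ⊗ f`. -/
def CHom.whisker [GTensor K C] (A : IndObj K C) (a : A.I) {X : C} {B : IndObj K C} {d : ℤ} :
    CHom X B d →ₗ[K] CHom (GTensor.obj K (A.at a) X) (A.tensorObj B) d :=
  CHom.desc
    (fun j => CHom.ι (GTensor.obj K (A.at a) X) (A.tensorObj B) d (a, j) ∘ₗ
      GTensor.hom (zero_add d) (GCat.id (A.at a)))
    (fun j j' v f => by
      have h := CHom.w (X := GTensor.obj K (A.at a) X) (B := A.tensorObj B) (d := d)
        (j := (a, j)) (j' := (a, j')) (𝟙 a, v)
        (GTensor.hom (zero_add d) (GCat.id (A.at a)) f)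
      refine Eq.trans ?_ h
      change CHom.ι _ (A.tensorObj B) d (a, j') _ = CHom.ι _ (A.tensorObj B) d (a, j')
        (GCat.comp (add_zero d) _ (GTensor.hom (add_zero 0) (A.tr (𝟙 a)) (B.tr v)))
      rw [← GTensor.interchange (add_zero 0) (add_zero d) (zero_add d), A.tr_id, GCat.comp_id])

lemma CHom.whisker_ι [GTensor K C] (A : IndObj K C) (a : A.I) {X : C} {B : IndObj K C} {d : ℤ}
    (j : B.I) (f : GHom K X (B.at j) d) :
    CHom.whisker A a (CHom.ι X B d j f) = CHom.ι (GTensor.obj K (A.at a) X) (A.tensorObj B) d (a, j)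
      (GTensor.hom (zero_add d) (GCat.id (A.at a)) f) :=
  CHom.desc_ι _ _ j f

lemma CHom.pre_whisker [GTensor K C] (A : IndObj K C) {a a' : A.I} (u : a ⟶ a') {X Y : C}
    {B : IndObj K C} {i d l : ℤ} (h : i + d = l) (h₀ : 0 + i = i) (v : GHom K X Y i)
    (x : CHom Y B d) :
    CHom.pre h (GTensor.hom h₀ (A.tr u) v) (CHom.whisker A a' x) =
      CHom.whisker A a (CHom.pre h v x) := by
  have : CHom.pre h (GTensor.hom h₀ (A.tr u) v) ∘ₗ CHom.whisker A a' (X := Y) (B := B) =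
      CHom.whisker A a ∘ₗ CHom.pre h v := CHom.ext fun j f => by
    rw [LinearMap.comp_apply, LinearMap.comp_apply, CHom.whisker_ι, CHom.pre_ι, CHom.pre_ι,
      CHom.whisker_ι, ← GTensor.interchange (add_zero 0) h (zero_add l), GCat.comp_id]
    have h := CHom.w (X := GTensor.obj K (A.at a) X) (B := A.tensorObj B) (d := l)
        (j := (a, j)) (j' := (a', j)) (u, 𝟙 j)
        (GTensor.hom (zero_add l) (GCat.id (A.at a)) (GCat.comp h v f))
    refine Eq.trans ?_ h
    change _ = CHom.ι _ (A.tensorObj B) l (a', j)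
        (GCat.comp (add_zero l) _ (GTensor.hom (add_zero 0) (A.tr u) (B.tr (𝟙 j))))
    rw [← GTensor.interchange (add_zero 0) (add_zero l) (zero_add l), B.tr_id, GCat.comp_id,
      GCat.id_comp]
  exact LinearMap.congr_fun this x

lemma CHom.act_whisker [GTensor K C] (A : IndObj K C) (a : A.I) {X : C} {B D : IndObj K C}
    {i d l : ℤ} (h : i + d = l) (x : CHom X B i) (g : IndObj.homSub B D d)
    (g' : IndObj.homSub (A.tensorObj B) (A.tensorObj D) d)
    (hg : ∀ p, g'.1 p = CHom.whisker A p.1 (g.1 p.2)) :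
    CHom.act h (CHom.whisker A a x) g' = CHom.whisker A a (CHom.act h x g) := by
  have : (CHom.act h).flip g' ∘ₗ CHom.whisker A a (X := X) =
      CHom.whisker A a ∘ₗ (CHom.act h).flip g := CHom.ext fun j f => by
    simp only [LinearMap.comp_apply, LinearMap.flip_apply, CHom.whisker_ι, CHom.act_ι]
    refine (CHom.act_ι h (A := A.tensorObj B) (a, j) _ g').trans ?_
    rw [hg]
    have := CHom.pre_whisker A (𝟙 a) h (zero_add i) f (g.1 j)
    rw [A.tr_id] at this
    exact this
  exact LinearMap.congr_fun this x

/-- The functor `A ⊗ -` on the ind-completion; `A ⊗ f` has as component at `(a, i)` the class of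
`id ⊗ f_i`. -/
def tensorLeft [GTensor K C] (A : IndObj K C) : GFunctor K (IndObj K C) (IndObj K C) where
  obj X := A.tensorObj X
  map {X Y d} :=
    { toFun := fun f => (⟨fun p => CHom.whisker A p.1 (f.1 p.2), fun {_ p'} v =>
        (CHom.pre_whisker A v.1 (zero_add d) (zero_add 0) (X.tr v.2) (f.1 p'.2)).trans
          (congrArg _ (f.2 v.2))⟩ : IndObj.homSub (A.tensorObj X) (A.tensorObj Y) d)
      map_add' := fun f g => Subtype.ext (funext fun p =>
        map_add (CHom.whisker A p.1) (f.1 p.2) (g.1 p.2))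
      map_smul' := fun c f => Subtype.ext (funext fun p =>
        map_smul (CHom.whisker A p.1) c (f.1 p.2)) }
  map_id X := Subtype.ext (funext fun p =>
    (CHom.whisker_ι A p.1 p.2 (GCat.id (X.at p.2))).trans
      (congrArg (CHom.ι _ (A.tensorObj X) 0 p) (GTensor.id_hom_id _ _ _)))
  map_comp h f g := Subtype.ext (funext fun p =>
    (CHom.act_whisker A p.1 h (f.1 p.2) g _ (fun _ => rfl)).symm)

/-! #### Extension of functors to the ind-completion by filtered colimits -/

/-- The directed system `i ↦ F(A i)_d`. -/
def GFunctor.indSys (F : GFunctor K C (GVect K)) (A : IndObj K C) (d : ℤ) :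
    A.I ⥤ ModuleCat.{u} K where
  obj i := ModuleCat.of K ((F.obj (A.at i)).V d)
  map v := ModuleCat.ofHom (HOM.at (F.map (A.tr v)) d d (add_zero d))
  map_id i := by
    ext x
    change HOM.at (F.map (A.tr (𝟙 i))) d d (add_zero d) x = x
    rw [A.tr_id, F.map_id]
    rfl
  map_comp u v := by
    ext x
    change HOM.at (F.map (A.tr (u ≫ v))) d d (add_zero d) x =
      HOM.at (F.map (A.tr v)) d d (add_zero d) (HOM.at (F.map (A.tr u)) d d (add_zero d) x)
    rw [A.tr_comp, F.map_comp, HOM.comp_at]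

/-- The value of the extension on a directed system: `colim_i F(A i)`, computed in each degree. -/
def GFunctor.indObj (F : GFunctor K C (GVect K)) (A : IndObj K C) : GVect K :=
  ⟨fun d => (colimit (F.indSys A d) : ModuleCat.{u} K)⟩

/-- The canonical map `F(A i)_d → colim_i F(A i)_d`. -/
def GFunctor.indι (F : GFunctor K C (GVect K)) (A : IndObj K C) (d : ℤ) (i : A.I) :
    (F.obj (A.at i)).V d →ₗ[K] (F.indObj A).V d :=
  (colimit.ι (F.indSys A d) i).hom

lemma GFunctor.ind_w (F : GFunctor K C (GVect K)) {A : IndObj K C} {d : ℤ} {i j : A.I} (v : i ⟶ j)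
    (x : (F.obj (A.at i)).V d) :
    F.indι A d j (HOM.at (F.map (A.tr v)) d d (add_zero d) x) = F.indι A d i x :=
  ConcreteCategory.congr_hom (colimit.w (F.indSys A d) v) x

lemma GFunctor.ind_ext (F : GFunctor K C (GVect K)) {A : IndObj K C} {d : ℤ} {M : Type u}
    [AddCommGroup M] [Module K M] {φ ψ : (F.indObj A).V d →ₗ[K] M}
    (H : ∀ i x, φ (F.indι A d i x) = ψ (F.indι A d i x)) : φ = ψ := by
  have : (ModuleCat.ofHom φ : colimit (F.indSys A d) ⟶ ModuleCat.of K M) = ModuleCat.ofHom ψ := by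
    refine colimit.hom_ext fun j => ?_
    ext f
    exact H j f
  exact congrArg ModuleCat.Hom.hom this

/-- Maps out of `colim_i F(A i)_d`. -/
def GFunctor.indDesc (F : GFunctor K C (GVect K)) {A : IndObj K C} {d : ℤ} {M : Type u}
    [AddCommGroup M] [Module K M] (φ : ∀ i, (F.obj (A.at i)).V d →ₗ[K] M)
    (w : ∀ (i j : A.I) (v : i ⟶ j) (x : (F.obj (A.at i)).V d),
      φ j (HOM.at (F.map (A.tr v)) d d (add_zero d) x) = φ i x) : (F.indObj A).V d →ₗ[K] M :=
  (colimit.desc (F.indSys A d)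
    { pt := ModuleCat.of K M
      ι :=
        { app := fun i => ModuleCat.ofHom (φ i)
          naturality := fun i j v => by
            ext x
            exact w i j v x } }).hom

lemma GFunctor.indDesc_ι (F : GFunctor K C (GVect K)) {A : IndObj K C} {d : ℤ} {M : Type u}
    [AddCommGroup M] [Module K M] (φ : ∀ i, (F.obj (A.at i)).V d →ₗ[K] M)
    (w : ∀ (i j : A.I) (v : i ⟶ j) (x : (F.obj (A.at i)).V d),
      φ j (HOM.at (F.map (A.tr v)) d d (add_zero d) x) = φ i x) (i : A.I)
    (x : (F.obj (A.at i)).V d) : F.indDesc φ w (F.indι A d i x) = φ i x :=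
  ConcreteCategory.congr_hom (colimit.ι_desc (F := F.indSys A d) _ i) x

/-- The map `colim_j Hom^d(X, B j) → Hom(F(X)_p, colim_j F(B j)_q)` for `p + d = q`. -/
def GFunctor.evalC (F : GFunctor K C (GVect K)) {X : C} {B : IndObj K C} {d p q : ℤ}
    (h : p + d = q) : CHom X B d →ₗ[K] (F.obj X).V p →ₗ[K] (F.indObj B).V q :=
  CHom.desc
    (fun j =>
      { toFun := fun f => F.indι B q j ∘ₗ HOM.at (F.map f) p q h
        map_add' := fun f g => by rw [map_add, ← LinearMap.comp_add]; rfl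
        map_smul' := fun c f => by
          rw [map_smul, RingHom.id_apply, ← LinearMap.comp_smul]; rfl })
    (fun _ _ v f => LinearMap.ext fun x => by
      change F.indι B q _ (HOM.at (F.map (GCat.comp (add_zero d) f (B.tr v))) p q h x) =
        F.indι B q _ (HOM.at (F.map f) p q h x)
      rw [F.map_comp, HOM.comp_at (add_zero d) _ _ p q q h (add_zero q), F.ind_w])

lemma GFunctor.evalC_ι (F : GFunctor K C (GVect K)) {X : C} {B : IndObj K C} {d p q : ℤ}
    (h : p + d = q) (j : B.I) (f : GHom K X (B.at j) d) (x : (F.obj X).V p) :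
    F.evalC h (CHom.ι X B d j f) x = F.indι B q j (HOM.at (F.map f) p q h x) := by
  rw [GFunctor.evalC, CHom.desc_ι]
  rfl

lemma GFunctor.evalC_pre (F : GFunctor K C (GVect K)) {X Y : C} {B : IndObj K C}
    {i d l p q r : ℤ} (h : i + d = l) (h₁ : p + i = q) (h₂ : q + d = r) (h₃ : p + l = r)
    (f : GHom K X Y i) (y : CHom Y B d) (x : (F.obj X).V p) :
    F.evalC h₃ (CHom.pre h f y) x = F.evalC h₂ y (HOM.at (F.map f) p q h₁ x) := by
  have : (F.evalC h₃).flip x ∘ₗ CHom.pre h f =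
      (F.evalC (B := B) h₂).flip (HOM.at (F.map f) p q h₁ x) := CHom.ext fun j g => by
    simp only [LinearMap.comp_apply, LinearMap.flip_apply, CHom.pre_ι, GFunctor.evalC_ι]
    rw [F.map_comp, HOM.comp_at h _ _ p q r h₁ h₂]
  exact LinearMap.congr_fun this y

/-- The action of a morphism of ind-objects on `colim_i F(A i)`. -/
def GFunctor.indMap (F : GFunctor K C (GVect K)) {A B : IndObj K C} {d : ℤ} :
    IndObj.homSub A B d →ₗ[K] HOM (F.indObj A) (F.indObj B) d where
  toFun f p := F.indDesc (fun i => F.evalC p.2 (f.1 i)) (fun i j v x => by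
    rw [← F.evalC_pre (zero_add d) (add_zero _) p.2 p.2, f.2 v])
  map_add' f g := funext fun p => F.ind_ext fun i x => by
    rw [Pi.add_apply, LinearMap.add_apply, GFunctor.indDesc_ι, GFunctor.indDesc_ι,
      GFunctor.indDesc_ι]
    exact LinearMap.map_add₂ (F.evalC p.2) (f.1 i) (g.1 i) x
  map_smul' c f := funext fun p => F.ind_ext fun i x => by
    rw [Pi.smul_apply, LinearMap.smul_apply, GFunctor.indDesc_ι, GFunctor.indDesc_ι]
    exact LinearMap.map_smul₂ (F.evalC p.2) c (f.1 i) x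

lemma GFunctor.indMap_ι (F : GFunctor K C (GVect K)) {A B : IndObj K C} {d p q : ℤ}
    (h : p + d = q) (f : IndObj.homSub A B d) (i : A.I) (x : (F.obj (A.at i)).V p) :
    HOM.at (F.indMap f) p q h (F.indι A p i x) = F.evalC h (f.1 i) x :=
  F.indDesc_ι (fun i => F.evalC h (f.1 i)) (fun i j v x => by
    rw [← F.evalC_pre (zero_add d) (add_zero _) h h, f.2 v]) i x

lemma GFunctor.evalC_act (F : GFunctor K C (GVect K)) {X : C} {A B : IndObj K C}
    {i d l p q r : ℤ} (h : i + d = l) (h₁ : p + i = q) (h₂ : q + d = r) (h₃ : p + l = r)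
    (y : CHom X A i) (g : IndObj.homSub A B d) (x : (F.obj X).V p) :
    F.evalC h₃ (CHom.act h y g) x = HOM.at (F.indMap g) q r h₂ (F.evalC h₁ y x) := by
  have : (F.evalC h₃).flip x ∘ₗ (CHom.act h).flip g =
      HOM.at (F.indMap g) q r h₂ ∘ₗ (F.evalC h₁).flip x := CHom.ext fun j f => by
    simp only [LinearMap.comp_apply, LinearMap.flip_apply, CHom.act_ι, GFunctor.evalC_ι]
    rw [F.evalC_pre h h₁ h₂ h₃, GFunctor.indMap_ι]
  exact LinearMap.congr_fun this y

/-- Extension of a functor with values in graded vector spaces to the ind-completion, commuting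
with filtered colimits. -/
def GFunctor.extInd (F : GFunctor K C (GVect K)) : GFunctor K (IndObj K C) (GVect K) where
  obj A := F.indObj A
  map := F.indMap
  map_id A := HOM.ext fun p q h y => by
    obtain rfl : p = q := by omega
    have : HOM.at (F.indMap A.idI) p p h = LinearMap.id := F.ind_ext fun i x => by
      rw [GFunctor.indMap_ι, IndObj.idI, GFunctor.evalC_ι, F.map_id]
      rfl
    exact LinearMap.congr_fun this y
  map_comp {A B D i j k} h f g := HOM.ext fun p q hq y => by
    rw [HOM.comp_at h _ _ p (p + i) q rfl (by omega)]
    have : HOM.at (F.indMap (IndObj.compI h f g)) p q hq =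
        HOM.at (F.indMap g) (p + i) q (by omega) ∘ₗ HOM.at (F.indMap f) p (p + i) rfl :=
      F.ind_ext fun a x => by
        rw [LinearMap.comp_apply, GFunctor.indMap_ι, GFunctor.indMap_ι, IndObj.compI_val,
          F.evalC_act h rfl]
    exact LinearMap.congr_fun this y

end Ind

/-! ### The dotted Temperley-Lieb category -/

/-- Formal morphisms `c ^ a → c ^ b` of degree `d`, generated from the cup, the cap and the dot by
composition (diagrammatic order), tensor product and linear combinations. -/
inductive Pre (K : Type u) : ℕ → ℕ → ℤ → Type u
  | id (a : ℕ) : Pre K a a 0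
  | cup : Pre K 0 2 0
  | cap : Pre K 2 0 0
  | dot : Pre K 1 1 2
  | comp {a b c : ℕ} {i j k : ℤ} (h : i + j = k) (f : Pre K a b i) (g : Pre K b c j) : Pre K a c k
  | tensor {a b a' b' m n : ℕ} {i j k : ℤ} (hm : a + a' = m) (hn : b + b' = n) (h : i + j = k)
      (f : Pre K a b i) (g : Pre K a' b' j) : Pre K m n k
  | zero (a b : ℕ) (d : ℤ) : Pre K a b d
  | add {a b : ℕ} {d : ℤ} (f g : Pre K a b d) : Pre K a b d
  | smul {a b : ℕ} {d : ℤ} (r : K) (f : Pre K a b d) : Pre K a b d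

/-- The congruence on formal morphisms generated by the axioms of a strict monoidal linear category
and the defining relations of the dotted Temperley-Lieb category. -/
inductive Rel (K : Type u) [Field K] : ∀ {a b : ℕ} {d : ℤ}, Pre K a b d → Pre K a b d → Prop
  | refl {a b d} (f : Pre K a b d) : Rel K f f
  | symm {a b d} {f g : Pre K a b d} : Rel K f g → Rel K g f
  | trans {a b d} {f g e : Pre K a b d} : Rel K f g → Rel K g e → Rel K f e
  -- compatibility with the operations
  | comp_congr {a b c i j k} (h : i + j = k) {f f' : Pre K a b i} {g g' : Pre K b c j} :
      Rel K f f' → Rel K g g' → Rel K (.comp h f g) (.comp h f' g')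
  | tensor_congr {a b a' b' m n i j k} (hm : a + a' = m) (hn : b + b' = n) (h : i + j = k)
      {f f' : Pre K a b i} {g g' : Pre K a' b' j} :
      Rel K f f' → Rel K g g' → Rel K (.tensor hm hn h f g) (.tensor hm hn h f' g')
  | add_congr {a b d} {f f' g g' : Pre K a b d} :
      Rel K f f' → Rel K g g' → Rel K (.add f g) (.add f' g')
  | smul_congr {a b d} (r : K) {f f' : Pre K a b d} : Rel K f f' → Rel K (.smul r f) (.smul r f')
  -- vector space axioms
  | add_assoc {a b d} (f g e : Pre K a b d) : Rel K (.add (.add f g) e) (.add f (.add g e))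
  | add_comm {a b d} (f g : Pre K a b d) : Rel K (.add f g) (.add g f)
  | zero_add {a b d} (f : Pre K a b d) : Rel K (.add (.zero a b d) f) f
  | neg_add {a b d} (f : Pre K a b d) : Rel K (.add (.smul (-1) f) f) (.zero a b d)
  | one_smul {a b d} (f : Pre K a b d) : Rel K (.smul 1 f) f
  | mul_smul {a b d} (r s : K) (f : Pre K a b d) : Rel K (.smul (r * s) f) (.smul r (.smul s f))
  | smul_add {a b d} (r : K) (f g : Pre K a b d) :
      Rel K (.smul r (.add f g)) (.add (.smul r f) (.smul r g))
  | add_smul {a b d} (r s : K) (f : Pre K a b d) :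
      Rel K (.smul (r + s) f) (.add (.smul r f) (.smul s f))
  -- bilinearity of composition and tensor product
  | add_comp {a b c i j k} (h : i + j = k) (f f' : Pre K a b i) (g : Pre K b c j) :
      Rel K (.comp h (.add f f') g) (.add (.comp h f g) (.comp h f' g))
  | smul_comp {a b c i j k} (h : i + j = k) (r : K) (f : Pre K a b i) (g : Pre K b c j) :
      Rel K (.comp h (.smul r f) g) (.smul r (.comp h f g))
  | comp_add {a b c i j k} (h : i + j = k) (f : Pre K a b i) (g g' : Pre K b c j) :
      Rel K (.comp h f (.add g g')) (.add (.comp h f g) (.comp h f g'))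
  | comp_smul {a b c i j k} (h : i + j = k) (r : K) (f : Pre K a b i) (g : Pre K b c j) :
      Rel K (.comp h f (.smul r g)) (.smul r (.comp h f g))
  | add_tensor {a b a' b' m n i j k} (hm : a + a' = m) (hn : b + b' = n) (h : i + j = k)
      (f f' : Pre K a b i) (g : Pre K a' b' j) :
      Rel K (.tensor hm hn h (.add f f') g) (.add (.tensor hm hn h f g) (.tensor hm hn h f' g))
  | smul_tensor {a b a' b' m n i j k} (hm : a + a' = m) (hn : b + b' = n) (h : i + j = k)
      (r : K) (f : Pre K a b i) (g : Pre K a' b' j) :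
      Rel K (.tensor hm hn h (.smul r f) g) (.smul r (.tensor hm hn h f g))
  | tensor_add {a b a' b' m n i j k} (hm : a + a' = m) (hn : b + b' = n) (h : i + j = k)
      (f : Pre K a b i) (g g' : Pre K a' b' j) :
      Rel K (.tensor hm hn h f (.add g g')) (.add (.tensor hm hn h f g) (.tensor hm hn h f g'))
  | tensor_smul {a b a' b' m n i j k} (hm : a + a' = m) (hn : b + b' = n) (h : i + j = k)
      (r : K) (f : Pre K a b i) (g : Pre K a' b' j) :
      Rel K (.tensor hm hn h f (.smul r g)) (.smul r (.tensor hm hn h f g))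
  -- category axioms
  | id_comp {a b d} (h : 0 + d = d) (f : Pre K a b d) : Rel K (.comp h (.id a) f) f
  | comp_id {a b d} (h : d + 0 = d) (f : Pre K a b d) : Rel K (.comp h f (.id b)) f
  | assoc {a b c e i j k ij jk l} (h₁ : i + j = ij) (h₂ : ij + k = l) (h₃ : j + k = jk)
      (h₄ : i + jk = l) (f : Pre K a b i) (g : Pre K b c j) (p : Pre K c e k) :
      Rel K (.comp h₂ (.comp h₁ f g) p) (.comp h₄ f (.comp h₃ g p))
  -- strict monoidal category axioms
  | tensor_id {a b m} (hm : a + b = m) (h : (0 : ℤ) + 0 = 0) :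
      Rel K (.tensor hm hm h (.id a) (.id b)) (.id m)
  | interchange {a₁ a₂ a₃ b₁ b₂ b₃ m₁ m₂ m₃ i i' j j' p q r s k}
      (hm₁ : a₁ + b₁ = m₁) (hm₂ : a₂ + b₂ = m₂) (hm₃ : a₃ + b₃ = m₃)
      (h₁ : i + i' = p) (h₂ : j + j' = q) (h₃ : p + q = k)
      (h₄ : i + j = r) (h₅ : i' + j' = s) (h₆ : r + s = k)
      (f : Pre K a₁ a₂ i) (f' : Pre K a₂ a₃ i') (g : Pre K b₁ b₂ j) (g' : Pre K b₂ b₃ j') :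
      Rel K (.tensor hm₁ hm₃ h₃ (.comp h₁ f f') (.comp h₂ g g'))
        (.comp h₆ (.tensor hm₁ hm₂ h₄ f g) (.tensor hm₂ hm₃ h₅ f' g'))
  | tensor_assoc {a b c a' b' c' ab ab' bc bc' m n i j k ij jk l}
      (h₁ : a + b = ab) (h₁' : a' + b' = ab') (h₂ : ab + c = m) (h₂' : ab' + c' = n)
      (h₃ : b + c = bc) (h₃' : b' + c' = bc') (h₄ : a + bc = m) (h₄' : a' + bc' = n)
      (d₁ : i + j = ij) (d₂ : ij + k = l) (d₃ : j + k = jk) (d₄ : i + jk = l)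
      (f : Pre K a a' i) (g : Pre K b b' j) (e : Pre K c c' k) :
      Rel K (.tensor h₂ h₂' d₂ (.tensor h₁ h₁' d₁ f g) e)
        (.tensor h₄ h₄' d₄ f (.tensor h₃ h₃' d₃ g e))
  | id_tensor {a b d} (ha : 0 + a = a) (hb : 0 + b = b) (h : 0 + d = d) (f : Pre K a b d) :
      Rel K (.tensor ha hb h (.id 0) f) f
  | tensor_unit {a b d} (ha : a + 0 = a) (hb : b + 0 = b) (h : d + 0 = d) (f : Pre K a b d) :
      Rel K (.tensor ha hb h f (.id 0)) f
  -- planar isotopy: `c` is self-dual through cup and cap, and dots slide along cups and caps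
  | zigzag_left : Rel K
      (.comp (add_zero 0) (.tensor rfl rfl (add_zero 0) (.id 1) .cup : Pre K 1 3 0)
        (.tensor rfl rfl (add_zero 0) .cap (.id 1) : Pre K 3 1 0)) (.id 1)
  | zigzag_right : Rel K
      (.comp (add_zero 0) (.tensor rfl rfl (add_zero 0) .cup (.id 1) : Pre K 1 3 0)
        (.tensor rfl rfl (add_zero 0) (.id 1) .cap : Pre K 3 1 0)) (.id 1)
  | dot_cup : Rel K
      (.comp (zero_add 2) .cup (.tensor rfl rfl (add_zero 2) .dot (.id 1) : Pre K 2 2 2))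
      (.comp (zero_add 2) .cup (.tensor rfl rfl (zero_add 2) (.id 1) .dot : Pre K 2 2 2))
  | dot_cap : Rel K
      (.comp (add_zero 2) (.tensor rfl rfl (add_zero 2) .dot (.id 1) : Pre K 2 2 2) .cap)
      (.comp (add_zero 2) (.tensor rfl rfl (zero_add 2) (.id 1) .dot : Pre K 2 2 2) .cap)
  -- the circle equals two
  | circle : Rel K (.comp (add_zero 0) .cup .cap) (.smul 2 (.id 0))
  -- two dots on a strand are zero
  | dot_dot : Rel K (.comp (two_add_two_eq_four) .dot .dot) (.zero 1 1 4)
  -- neck cutting: the sum of the two ways of placing a dot on two parallel strands equals the sum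
  -- of the two ways of placing a dot on `cup ∘ cap`
  | neck : Rel K
      (.add (.tensor rfl rfl (add_zero 2) .dot (.id 1) : Pre K 2 2 2)
        (.tensor rfl rfl (zero_add 2) (.id 1) .dot : Pre K 2 2 2))
      (.add
        (.comp (add_zero 2) (.comp (add_zero 2)
          (.tensor rfl rfl (add_zero 2) .dot (.id 1) : Pre K 2 2 2) .cap) .cup)
        (.comp (zero_add 2) .cap (.comp (zero_add 2) .cup
          (.tensor rfl rfl (add_zero 2) .dot (.id 1) : Pre K 2 2 2))))

/-- Morphisms `c ^ a → c ^ b` of degree `d` in the dotted Temperley-Lieb category. -/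
def DHom (K : Type u) [Field K] (a b : ℕ) (d : ℤ) : Type u := Quot (Rel K (a := a) (b := b) (d := d))

namespace DHom

variable {K : Type u} [Field K]

/-- The class of a formal morphism. -/
def mk {a b : ℕ} {d : ℤ} (f : Pre K a b d) : DHom K a b d := Quot.mk _ f

/-- Composition, in diagrammatic order. -/
def comp {a b c : ℕ} {i j k : ℤ} (h : i + j = k) : DHom K a b i → DHom K b c j → DHom K a c k :=
  Quot.map₂ (.comp h) (fun f _ _ hg => .comp_congr h (.refl f) hg)
    (fun _ _ g hf => .comp_congr h hf (.refl g))

/-- Tensor product (horizontal juxtaposition). -/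
def tensor {a b a' b' m n : ℕ} {i j k : ℤ} (hm : a + a' = m) (hn : b + b' = n) (h : i + j = k) :
    DHom K a b i → DHom K a' b' j → DHom K m n k :=
  Quot.map₂ (.tensor hm hn h) (fun f _ _ hg => .tensor_congr hm hn h (.refl f) hg)
    (fun _ _ g hf => .tensor_congr hm hn h hf (.refl g))

instance {a b : ℕ} {d : ℤ} : Add (DHom K a b d) :=
  ⟨Quot.map₂ .add (fun f _ _ hg => .add_congr (.refl f) hg)
    (fun _ _ g hf => .add_congr hf (.refl g))⟩

instance {a b : ℕ} {d : ℤ} : Zero (DHom K a b d) := ⟨mk (.zero a b d)⟩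

instance {a b : ℕ} {d : ℤ} : SMul K (DHom K a b d) :=
  ⟨fun r => Quot.map (.smul r) (fun _ _ h => .smul_congr r h)⟩

instance {a b : ℕ} {d : ℤ} : Neg (DHom K a b d) := ⟨fun f => (-1 : K) • f⟩

lemma zero_add' {a b : ℕ} {d : ℤ} (x : DHom K a b d) : 0 + x = x := by
  induction x using Quot.ind with | _ f
  exact Quot.sound (.zero_add f)

lemma add_comm' {a b : ℕ} {d : ℤ} (x y : DHom K a b d) : x + y = y + x := by
  induction x using Quot.ind with | _ f
  induction y using Quot.ind with | _ g
  exact Quot.sound (.add_comm f g)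

instance {a b : ℕ} {d : ℤ} : AddCommGroup (DHom K a b d) where
  add_assoc x y z := by
    induction x using Quot.ind with | _ f
    induction y using Quot.ind with | _ g
    induction z using Quot.ind with | _ e
    exact Quot.sound (.add_assoc f g e)
  zero_add := zero_add'
  add_zero x := (add_comm' x 0).trans (zero_add' x)
  nsmul := nsmulRec
  zsmul := zsmulRec
  neg_add_cancel x := by
    induction x using Quot.ind with | _ f
    exact Quot.sound (.neg_add f)
  add_comm := add_comm'

lemma smul_add' {a b : ℕ} {d : ℤ} (r : K) (x y : DHom K a b d) : r • (x + y) = r • x + r • y := by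
  induction x using Quot.ind with | _ f
  induction y using Quot.ind with | _ g
  exact Quot.sound (.smul_add r f g)

lemma add_smul' {a b : ℕ} {d : ℤ} (r s : K) (x : DHom K a b d) : (r + s) • x = r • x + s • x := by
  induction x using Quot.ind with | _ f
  exact Quot.sound (.add_smul r s f)

instance {a b : ℕ} {d : ℤ} : Module K (DHom K a b d) where
  one_smul x := by
    induction x using Quot.ind with | _ f
    exact Quot.sound (.one_smul f)
  mul_smul r s x := by
    induction x using Quot.ind with | _ f
    exact Quot.sound (.mul_smul r s f)
  smul_zero r := add_eq_right.1
    ((smul_add' r (0 : DHom K a b d) 0).symm.trans (congrArg (r • ·) (zero_add 0)))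
  smul_add := smul_add'
  add_smul := add_smul'
  zero_smul x := add_eq_right.1
    ((add_smul' (0 : K) 0 x).symm.trans (congrArg (· • x) (zero_add 0)))

/-- Composition as a bilinear map. -/
def compL {a b c : ℕ} {i j k : ℤ} (h : i + j = k) :
    DHom K a b i →ₗ[K] DHom K b c j →ₗ[K] DHom K a c k :=
  LinearMap.mk₂ K (comp h)
    (fun x x' y => by
      induction x using Quot.ind with | _ f
      induction x' using Quot.ind with | _ f'
      induction y using Quot.ind with | _ g
      exact Quot.sound (.add_comp h f f' g))
    (fun r x y => by
      induction x using Quot.ind with | _ f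
      induction y using Quot.ind with | _ g
      exact Quot.sound (.smul_comp h r f g))
    (fun x y y' => by
      induction x using Quot.ind with | _ f
      induction y using Quot.ind with | _ g
      induction y' using Quot.ind with | _ g'
      exact Quot.sound (.comp_add h f g g'))
    (fun r x y => by
      induction x using Quot.ind with | _ f
      induction y using Quot.ind with | _ g
      exact Quot.sound (.comp_smul h r f g))

/-- Tensor product as a bilinear map. -/
def tensorL {a b a' b' m n : ℕ} {i j k : ℤ} (hm : a + a' = m) (hn : b + b' = n) (h : i + j = k) :
    DHom K a b i →ₗ[K] DHom K a' b' j →ₗ[K] DHom K m n k :=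
  LinearMap.mk₂ K (tensor hm hn h)
    (fun x x' y => by
      induction x using Quot.ind with | _ f
      induction x' using Quot.ind with | _ f'
      induction y using Quot.ind with | _ g
      exact Quot.sound (.add_tensor hm hn h f f' g))
    (fun r x y => by
      induction x using Quot.ind with | _ f
      induction y using Quot.ind with | _ g
      exact Quot.sound (.smul_tensor hm hn h r f g))
    (fun x y y' => by
      induction x using Quot.ind with | _ f
      induction y using Quot.ind with | _ g
      induction y' using Quot.ind with | _ g'
      exact Quot.sound (.tensor_add hm hn h f g g'))
    (fun r x y => by
      induction x using Quot.ind with | _ f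
      induction y using Quot.ind with | _ g
      exact Quot.sound (.tensor_smul hm hn h r f g))

end DHom

/-- Objects of the dotted Temperley-Lieb category: the tensor powers `c ^ n`. -/
structure DTL (K : Type u) where
  n : ℕ

/-- The dotted Temperley-Lieb category. -/
instance (K : Type u) [Field K] : GCat K (DTL K) where
  Hom X Y d := DHom K X.n Y.n d
  id X := DHom.mk (.id X.n)
  comp h := DHom.compL h
  id_comp h x := by
    induction x using Quot.ind with | _ f
    exact Quot.sound (.id_comp h f)
  comp_id h x := by
    induction x using Quot.ind with | _ f
    exact Quot.sound (.comp_id h f)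
  assoc h₁ h₂ h₃ h₄ x y z := by
    induction x using Quot.ind with | _ f
    induction y using Quot.ind with | _ g
    induction z using Quot.ind with | _ e
    exact Quot.sound (.assoc h₁ h₂ h₃ h₄ f g e)

/-- The tensor product `c ^ m ⊗ c ^ n = c ^ (m + n)`. -/
instance (K : Type u) [Field K] : GTensor K (DTL K) where
  obj X Y := ⟨X.n + Y.n⟩
  hom h := DHom.tensorL rfl rfl h
  id_hom_id X Y h := Quot.sound (.tensor_id rfl h)
  interchange h₁ h₂ h₃ h₄ h₅ h₆ x x' y y' := by
    induction x using Quot.ind with | _ f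
    induction x' using Quot.ind with | _ f'
    induction y using Quot.ind with | _ g
    induction y' using Quot.ind with | _ g'
    exact Quot.sound (.interchange rfl rfl rfl h₁ h₂ h₃ h₄ h₅ h₆ f f' g g')

/-! ### The polynomial representation -/

section Pol

variable {K : Type u} [Field K]

/-- The squarefree monomials `x_1 ^ s_1 ⋯ x_n ^ s_n`, `s_i ∈ {0, 1}`, which form a basis of
`K[x_1, …, x_n] / (x_i ^ 2)`. -/
abbrev Mon (n : ℕ) : Type := Fin n → Fin 2

/-- The degree of a monomial in `q ^ (-n) K[x_1, …, x_n] / (x_i ^ 2)`, where each `x_i` has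
degree two. -/
def Mon.deg {n : ℕ} (s : Mon n) : ℤ := 2 * ∑ i, ((s i : ℕ) : ℤ) - n

/-- A monomial in `x_1, …, x_{a+b}` as the product of a monomial in the first `a` variables and a
monomial in the last `b` variables. -/
def Mon.split {a b m : ℕ} (h : a + b = m) : Mon m ≃ Mon a × Mon b where
  toFun s := (fun i => s (Fin.cast h (Fin.castAdd b i)), fun j => s (Fin.cast h (Fin.natAdd a j)))
  invFun p := fun k => Fin.append p.1 p.2 (Fin.cast h.symm k)
  left_inv s := by
    subst h
    funext k
    refine Fin.addCases (fun i => ?_) (fun j => ?_) k <;> simp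
  right_inv p := by
    subst h
    refine Prod.ext ?_ ?_ <;> funext i <;> simp

lemma Mon.deg_split {a b m : ℕ} (h : a + b = m) (s : Mon m) :
    s.deg = (Mon.split h s).1.deg + (Mon.split h s).2.deg := by
  subst h
  simp only [Mon.deg, Mon.split, Equiv.coe_fn_mk, Fin.sum_univ_add, Fin.cast_eq_self]
  push_cast
  ring

lemma Mon.split_assoc₁ {a b c ab bc m : ℕ} (h₁ : a + b = ab) (h₂ : ab + c = m) (_h₃ : b + c = bc)
    (h₄ : a + bc = m) (s : Mon m) :
    (Mon.split h₁ (Mon.split h₂ s).1).1 = (Mon.split h₄ s).1 := rfl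

lemma Mon.split_assoc₂ {a b c ab bc m : ℕ} (h₁ : a + b = ab) (h₂ : ab + c = m) (h₃ : b + c = bc)
    (h₄ : a + bc = m) (s : Mon m) :
    (Mon.split h₁ (Mon.split h₂ s).1).2 = (Mon.split h₃ (Mon.split h₄ s).2).1 := rfl

lemma Mon.split_assoc₃ {a b c ab bc m : ℕ} (h₁ : a + b = ab) (h₂ : ab + c = m) (h₃ : b + c = bc)
    (h₄ : a + bc = m) (s : Mon m) :
    (Mon.split h₂ s).2 = (Mon.split h₃ (Mon.split h₄ s).2).2 := by
  funext i
  refine congrArg s (Fin.ext ?_)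
  simp only [Fin.val_cast, Fin.val_natAdd]
  omega

lemma Mon.split_zero_left {a : ℕ} (h : 0 + a = a) (s : Mon a) : (Mon.split h s).2 = s :=
  funext fun i => congrArg s (Fin.ext (by simp))

lemma Mon.split_zero_right {a : ℕ} (h : a + 0 = a) (s : Mon a) : (Mon.split h s).1 = s := rfl

open scoped Kronecker

/-- The matrix of the cup `1 ↦ x_1 + x_2` (rows are indexed by the monomials of the target). -/
def cupM (R : Type w) [Zero R] [One R] : Matrix (Mon 2) (Mon 0) R :=
  fun t _ => if t = ![1, 0] ∨ t = ![0, 1] then 1 else 0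

/-- The matrix of the cap `x_1 ↦ 1, x_2 ↦ 1, 1 ↦ 0, x_1 x_2 ↦ 0`. -/
def capM (R : Type w) [Zero R] [One R] : Matrix (Mon 0) (Mon 2) R :=
  fun _ s => if s = ![1, 0] ∨ s = ![0, 1] then 1 else 0

/-- The matrix of the dot, which is multiplication by `x` on `K[x] / (x ^ 2)`. -/
def dotM (R : Type w) [Zero R] [One R] : Matrix (Mon 1) (Mon 1) R :=
  fun t s => if s = ![0] ∧ t = ![1] then 1 else 0

/-- The matrix of the tensor product of two linear maps. -/
def tenM {R : Type w} [Mul R] {a b m a' b' m' : ℕ} (h : a + b = m) (h' : a' + b' = m')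
    (A : Matrix (Mon a) (Mon a') R) (B : Matrix (Mon b) (Mon b') R) : Matrix (Mon m) (Mon m') R :=
  (A ⊗ₖ B).submatrix (Mon.split h) (Mon.split h')

/-- The matrix, in the bases of squarefree monomials, of the linear map assigned by the polynomial
representation to a formal morphism. -/
def polMat : ∀ {a b : ℕ} {d : ℤ}, Pre K a b d → Matrix (Mon b) (Mon a) K
  | _, _, _, .id _ => 1
  | _, _, _, .cup => cupM K
  | _, _, _, .cap => capM K
  | _, _, _, .dot => dotM K
  | _, _, _, .comp _ f g => polMat g * polMat f
  | _, _, _, .tensor hm hn _ f g => tenM hn hm (polMat f) (polMat g)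
  | _, _, _, .zero _ _ _ => 0
  | _, _, _, .add f g => polMat f + polMat g
  | _, _, _, .smul r f => r • polMat f

lemma tenM_apply {R : Type w} [Mul R] {a b m a' b' m' : ℕ} (h : a + b = m) (h' : a' + b' = m')
    (A : Matrix (Mon a) (Mon a') R) (B : Matrix (Mon b) (Mon b') R) (t : Mon m) (s : Mon m') :
    tenM h h' A B t s = A (Mon.split h t).1 (Mon.split h' s).1 *
      B (Mon.split h t).2 (Mon.split h' s).2 := rfl

lemma tenM_mul {a b m a' b' m' a'' b'' m'' : ℕ} (h : a + b = m) (h' : a' + b' = m')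
    (h'' : a'' + b'' = m'') (A : Matrix (Mon a) (Mon a') K) (A' : Matrix (Mon a') (Mon a'') K)
    (B : Matrix (Mon b) (Mon b') K) (B' : Matrix (Mon b') (Mon b'') K) :
    tenM h h'' (A * A') (B * B') = tenM h h' A B * tenM h' h'' A' B' := by
  rw [tenM, tenM, tenM, Matrix.submatrix_mul_equiv, Matrix.mul_kronecker_mul]

lemma map_cupM : (cupM ℤ).map (Int.castRingHom K) = cupM K := by
  ext t s; simp [cupM]

lemma map_capM : (capM ℤ).map (Int.castRingHom K) = capM K := by
  ext t s; simp [capM]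

lemma map_dotM : (dotM ℤ).map (Int.castRingHom K) = dotM K := by
  ext t s; simp [dotM]

lemma map_tenM {a b m a' b' m' : ℕ} (h : a + b = m) (h' : a' + b' = m')
    (A : Matrix (Mon a) (Mon a') ℤ) (B : Matrix (Mon b) (Mon b') ℤ) :
    (tenM h h' A B).map (Int.castRingHom K) =
      tenM h h' (A.map (Int.castRingHom K)) (B.map (Int.castRingHom K)) := by
  ext t s; simp [tenM_apply]

lemma map_oneM {n : ℕ} : (1 : Matrix (Mon n) (Mon n) ℤ).map (Int.castRingHom K) = 1 :=
  Matrix.map_one _ (map_zero _) (map_one _)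

/-- The assignment on formal morphisms respects all relations. -/
lemma polMat_rel {a b : ℕ} {d : ℤ} {f g : Pre K a b d} (h : Rel K f g) : polMat f = polMat g := by
  induction h with
  | refl => rfl
  | symm _ ih => exact ih.symm
  | trans _ _ ih ih' => exact ih.trans ih'
  | comp_congr _ _ _ ih ih' => simp only [polMat, ih, ih']
  | tensor_congr _ _ _ _ _ ih ih' => simp only [polMat, ih, ih']
  | add_congr _ _ ih ih' => simp only [polMat, ih, ih']
  | smul_congr _ _ ih => simp only [polMat, ih]
  | add_assoc => simp only [polMat, _root_.add_assoc]
  | add_comm => simp only [polMat]; exact _root_.add_comm _ _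
  | zero_add => simp only [polMat, _root_.zero_add]
  | neg_add => simp only [polMat, neg_smul, _root_.one_smul, neg_add_cancel]
  | one_smul => simp only [polMat, _root_.one_smul]
  | mul_smul => simp only [polMat, SemigroupAction.mul_smul]
  | smul_add => simp only [polMat, _root_.smul_add]
  | add_smul => simp only [polMat, _root_.add_smul]
  | add_comp => simp only [polMat, Matrix.mul_add]
  | smul_comp => simp only [polMat, Matrix.mul_smul]
  | comp_add => simp only [polMat, Matrix.add_mul]
  | comp_smul => simp only [polMat, Matrix.smul_mul]
  | add_tensor => ext; simp only [polMat, tenM_apply, Matrix.add_apply, add_mul]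
  | smul_tensor => ext; simp only [polMat, tenM_apply, Matrix.smul_apply, smul_mul_assoc]
  | tensor_add => ext; simp only [polMat, tenM_apply, Matrix.add_apply, mul_add]
  | tensor_smul => ext; simp only [polMat, tenM_apply, Matrix.smul_apply, mul_smul_comm]
  | id_comp => simp only [polMat, Matrix.mul_one]
  | comp_id => simp only [polMat, Matrix.one_mul]
  | assoc => simp only [polMat, Matrix.mul_assoc]
  | tensor_id =>
    simp only [polMat]
    rw [tenM, Matrix.one_kronecker_one, Matrix.submatrix_one_equiv]
  | interchange => simp only [polMat]; exact tenM_mul _ _ _ _ _ _ _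
  | tensor_assoc h₁ h₁' h₂ h₂' h₃ h₃' h₄ h₄' _ _ _ _ f g e =>
    ext t s
    simp only [polMat, tenM_apply, mul_assoc, ← Mon.split_assoc₁ h₁ h₂ h₃ h₄,
      ← Mon.split_assoc₂ h₁ h₂ h₃ h₄, ← Mon.split_assoc₃ h₁ h₂ h₃ h₄,
      ← Mon.split_assoc₁ h₁' h₂' h₃' h₄', ← Mon.split_assoc₂ h₁' h₂' h₃' h₄',
      ← Mon.split_assoc₃ h₁' h₂' h₃' h₄']
  | id_tensor ha hb _ f =>
    ext t s
    simp only [polMat, tenM_apply, Mon.split_zero_left]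
    rw [Subsingleton.elim (Mon.split hb t).1 (Mon.split ha s).1, Matrix.one_apply_eq, one_mul]
  | tensor_unit ha hb _ f =>
    ext t s
    simp only [polMat, tenM_apply, Mon.split_zero_right]
    rw [Subsingleton.elim (Mon.split hb t).2 (Mon.split ha s).2, Matrix.one_apply_eq, mul_one]
  | zigzag_left =>
    have h : tenM (a := 0) (b := 1) (a' := 2) (b' := 1) rfl rfl (capM ℤ) 1 *
        tenM (a := 1) (b := 2) (a' := 1) (b' := 0) rfl rfl 1 (cupM ℤ) = 1 := by decide +kernel
    simpa only [polMat, Matrix.map_mul, map_tenM, map_cupM, map_capM, map_oneM] using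
      congrArg (fun M => M.map (Int.castRingHom K)) h
  | zigzag_right =>
    have h : tenM (a := 1) (b := 0) (a' := 1) (b' := 2) rfl rfl 1 (capM ℤ) *
        tenM (a := 2) (b := 1) (a' := 0) (b' := 1) rfl rfl (cupM ℤ) 1 = 1 := by decide +kernel
    simpa only [polMat, Matrix.map_mul, map_tenM, map_cupM, map_capM, map_oneM] using
      congrArg (fun M => M.map (Int.castRingHom K)) h
  | dot_cup =>
    have h : tenM (a := 1) (b := 1) (m := 2) (a' := 1) (b' := 1) (m' := 2) rfl rfl (dotM ℤ) 1 * cupM ℤ =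
        tenM (a := 1) (b := 1) (m := 2) (a' := 1) (b' := 1) (m' := 2) rfl rfl 1 (dotM ℤ) * cupM ℤ := by decide +kernel
    simpa only [polMat, Matrix.map_mul, map_tenM, map_cupM, map_dotM, map_oneM] using
      congrArg (fun M => M.map (Int.castRingHom K)) h
  | dot_cap =>
    have h : capM ℤ * tenM (a := 1) (b := 1) (m := 2) (a' := 1) (b' := 1) (m' := 2) rfl rfl (dotM ℤ) 1 =
        capM ℤ * tenM (a := 1) (b := 1) (m := 2) (a' := 1) (b' := 1) (m' := 2) rfl rfl 1 (dotM ℤ) := by decide +kernel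
    simpa only [polMat, Matrix.map_mul, map_tenM, map_capM, map_dotM, map_oneM] using
      congrArg (fun M => M.map (Int.castRingHom K)) h
  | circle =>
    have h : capM ℤ * cupM ℤ = (1 : Matrix (Mon 0) (Mon 0) ℤ) + 1 := by decide +kernel
    simpa only [polMat, Matrix.map_mul, map_capM, map_cupM, map_oneM, two_smul,
      Matrix.map_add _ (map_add (Int.castRingHom K))] using
      congrArg (fun M => M.map (Int.castRingHom K)) h
  | dot_dot =>
    have h : dotM ℤ * dotM ℤ = 0 := by decide +kernel
    simpa only [polMat, Matrix.map_mul, map_dotM, Matrix.map_zero _ (map_zero (Int.castRingHom K))]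
      using congrArg (fun M => M.map (Int.castRingHom K)) h
  | neck =>
    have h : tenM (a := 1) (b := 1) (m := 2) (a' := 1) (b' := 1) (m' := 2) rfl rfl (dotM ℤ) 1 +
        tenM (a := 1) (b := 1) (m := 2) (a' := 1) (b' := 1) (m' := 2) rfl rfl 1 (dotM ℤ) =
        cupM ℤ * (capM ℤ * tenM (a := 1) (b := 1) (m := 2) (a' := 1) (b' := 1) (m' := 2) rfl rfl (dotM ℤ) 1) +
        tenM (a := 1) (b := 1) (m := 2) (a' := 1) (b' := 1) (m' := 2) rfl rfl (dotM ℤ) 1 * cupM ℤ * capM ℤ := by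
      decide +kernel
    simpa only [polMat, Matrix.map_mul, map_tenM, map_capM, map_cupM, map_dotM, map_oneM,
      Matrix.map_add _ (map_add (Int.castRingHom K))] using
      congrArg (fun M => M.map (Int.castRingHom K)) h

/-- The matrix of a formal morphism of degree `d` is homogeneous of degree `d`. -/
lemma polMat_deg {a b : ℕ} {d : ℤ} (f : Pre K a b d) :
    ∀ {t : Mon b} {s : Mon a}, polMat f t s ≠ 0 → t.deg = s.deg + d := by
  induction f with
  | id a =>
    intro t s h
    by_cases hts : t = s
    · rw [hts, add_zero]
    · exact absurd (Matrix.one_apply_ne hts) h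
  | cup =>
    intro t s h
    have ht : t = ![1, 0] ∨ t = ![0, 1] := by
      by_contra hn
      exact h (if_neg hn)
    rcases ht with rfl | rfl <;> simp [Mon.deg]
  | cap =>
    intro t s h
    have hs : s = ![1, 0] ∨ s = ![0, 1] := by
      by_contra hn
      exact h (if_neg hn)
    rcases hs with rfl | rfl <;> simp [Mon.deg]
  | dot =>
    intro t s h
    have hs : s = ![0] ∧ t = ![1] := by
      by_contra hn
      exact h (if_neg hn)
    rcases hs with ⟨rfl, rfl⟩
    simp [Mon.deg]
  | comp h f g ihf ihg =>
    intro t s hts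
    obtain ⟨r, -, hr⟩ := Finset.exists_ne_zero_of_sum_ne_zero hts
    have h₁ := ihg (left_ne_zero_of_mul hr)
    have h₂ := ihf (right_ne_zero_of_mul hr)
    omega
  | tensor hm hn h f g ihf ihg =>
    intro t s hts
    have h₁ := ihf (left_ne_zero_of_mul hts)
    have h₂ := ihg (right_ne_zero_of_mul hts)
    rw [Mon.deg_split hn t, Mon.deg_split hm s]
    omega
  | zero => exact fun h => absurd rfl h
  | add f g ihf ihg =>
    intro t s hts
    by_cases h : polMat f t s = 0
    · refine ihg fun h' => hts ?_
      rw [polMat, Matrix.add_apply, h, h', add_zero]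
    · exact ihf h
  | smul r f ih => exact fun hts => ih (right_ne_zero_of_mul hts)

/-- The matrix of a morphism of the dotted Temperley-Lieb category. -/
def polM {a b : ℕ} {d : ℤ} : DHom K a b d →ₗ[K] Matrix (Mon b) (Mon a) K where
  toFun := Quot.lift polMat fun _ _ h => polMat_rel h
  map_add' x y := by
    induction x using Quot.ind with | _ f
    induction y using Quot.ind with | _ g
    rfl
  map_smul' r x := by
    induction x using Quot.ind with | _ f
    rfl

lemma polM_deg {a b : ℕ} {d : ℤ} (f : DHom K a b d) {t : Mon b} {s : Mon a}
    (h : polM f t s ≠ 0) : t.deg = s.deg + d := by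
  induction f using Quot.ind with | _ f
  exact polMat_deg f h

lemma polM_comp {a b c : ℕ} {i j k : ℤ} (h : i + j = k) (f : DHom K a b i) (g : DHom K b c j) :
    polM (DHom.compL h f g) = polM g * polM f := by
  induction f using Quot.ind with | _ f
  induction g using Quot.ind with | _ g
  rfl

variable (K) in
/-- The graded vector space `q ^ (-n) K[x_1, …, x_n] / (x_i ^ 2)`: in degree `d`, the vectors of
coefficients of the squarefree monomials of degree `d`. -/
def polObj (n : ℕ) : GVect K := ⟨fun d => {s : Mon n // s.deg = d} → K⟩

/-- A homogeneous matrix acts on coefficient vectors. -/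
def polAct {a b : ℕ} {d : ℤ} : DHom K a b d →ₗ[K] HOM (polObj K a) (polObj K b) d where
  toFun f p :=
    { toFun := fun x t => ∑ s : {s : Mon a // s.deg = p.1.1}, polM f t.1 s.1 * x s
      map_add' := fun x y => funext fun t => (Finset.sum_congr rfl fun s _ =>
        mul_add (polM f t.1 s.1) (x s) (y s)).trans Finset.sum_add_distrib
      map_smul' := fun c x => funext fun t => (Finset.sum_congr rfl fun s _ =>
        mul_smul_comm c (polM f t.1 s.1) (x s)).trans Finset.smul_sum.symm }
  map_add' f g := funext fun p => LinearMap.ext fun x => funext fun t =>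
    (Finset.sum_congr rfl fun s _ => by
      rw [map_add, Matrix.add_apply, add_mul]).trans Finset.sum_add_distrib
  map_smul' c f := funext fun p => LinearMap.ext fun x => funext fun t =>
    (Finset.sum_congr rfl fun s _ => by
      rw [map_smul, Matrix.smul_apply, smul_mul_assoc]).trans Finset.smul_sum.symm

lemma polAct_at {a b : ℕ} {d p q : ℤ} (h : p + d = q) (f : DHom K a b d) (x : (polObj K a).V p)
    (t : {t : Mon b // t.deg = q}) :
    HOM.at (polAct f) p q h x t = ∑ s : {s : Mon a // s.deg = p}, polM f t.1 s.1 * x s := rfl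

lemma polM_comp_apply {a b c : ℕ} {i j k p r : ℤ} (h : i + j = k) (f : DHom K a b i)
    (g : DHom K b c j) (hr : p + i = r) (t : Mon c) (s : Mon a) (hs : s.deg = p) :
    polM (DHom.compL h f g) t s =
      ∑ u : {u : Mon b // u.deg = r}, polM g t u.1 * polM f u.1 s := by
  rw [polM_comp, Matrix.mul_apply,
    ← Finset.sum_subtype (Finset.univ.filter fun u : Mon b => u.deg = r) (by simp)
      (fun u => polM g t u * polM f u s)]
  refine (Finset.sum_subset (Finset.filter_subset _ _) fun u _ hu => ?_).symm
  by_cases hf : polM f u s = 0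
  · rw [hf, mul_zero]
  · refine absurd ?_ hu
    rw [Finset.mem_filter]
    exact ⟨Finset.mem_univ _, (polM_deg f hf).trans (by rw [hs, hr])⟩

variable (K) in
/-- The polynomial representation of the dotted Temperley-Lieb category. -/
def polDTL : GFunctor K (DTL K) (GVect K) where
  obj X := polObj K X.n
  map := polAct
  map_id X := HOM.ext fun p q h x => by
    obtain rfl : p = q := by omega
    funext t
    refine (polAct_at h _ x t).trans ((Finset.sum_eq_single t ?_ ?_).trans ?_)
    · intro s _ hs
      change (1 : Matrix (Mon X.n) (Mon X.n) K) t.1 s.1 * x s = 0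
      rw [Matrix.one_apply_ne fun h => hs (Subtype.ext h.symm), zero_mul]
    · simp
    · change (1 : Matrix (Mon X.n) (Mon X.n) K) t.1 t.1 * x t = x t
      rw [Matrix.one_apply_eq, one_mul]
  map_comp {X Y Z i j k} h f g := HOM.ext fun p q hq x => by
    funext t
    have hq' : p + i + j = q := by omega
    have e : ∀ s : {s : Mon X.n // s.deg = p}, polM (DHom.compL h f g) t.1 s.1 * x s =
        ∑ u : {u : Mon Y.n // u.deg = p + i}, polM g t.1 u.1 * (polM f u.1 s.1 * x s) := by
      intro s
      rw [polM_comp_apply h f g rfl t.1 s.1 s.2, Finset.sum_mul]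
      exact Finset.sum_congr rfl fun _ _ => mul_assoc _ _ _
    refine (Finset.sum_congr rfl fun s _ => e s).trans (Finset.sum_comm.trans ?_)
    refine (Finset.sum_congr rfl fun u _ => Finset.mul_sum _ _ _).symm.trans ?_
    exact ((polAct_at hq' g (HOM.at (polAct f) p (p + i) rfl x) t).symm).trans
      (congrFun (HOM.comp_at (U := polObj K X.n) (V := polObj K Y.n) (W := polObj K Z.n) h
        (polAct f) (polAct g) p (p + i) q rfl hq' hq x) t).symm

end Pol

/-! ### Symmetrizers -/

/-- A permutation of `n + 1` letters is determined by the image `p` of the first letter and by a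
permutation `e` of the remaining letters: it is the composite of `id ⊕ e` and of the inverse of
the cycle `0 → 1 → ⋯ → p → 0`. -/
def permEquiv (n : ℕ) : Equiv.Perm (Fin (n + 1)) ≃ Fin (n + 1) × Equiv.Perm (Fin n) where
  toFun w := (w 0, (Equiv.Perm.decomposeFin (Fin.cycleRange (w 0) * w)).2)
  invFun x := (Fin.cycleRange x.1)⁻¹ * Equiv.Perm.decomposeFin.symm (0, x.2)
  left_inv w := by
    have h : Equiv.Perm.decomposeFin (Fin.cycleRange (w 0) * w) =
        (0, (Equiv.Perm.decomposeFin (Fin.cycleRange (w 0) * w)).2) := by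
      refine Prod.ext ?_ rfl
      have := Equiv.Perm.decomposeFin_symm_apply_zero
        (Equiv.Perm.decomposeFin (Fin.cycleRange (w 0) * w)).1
        (Equiv.Perm.decomposeFin (Fin.cycleRange (w 0) * w)).2
      rw [Prod.mk.eta, Equiv.symm_apply_apply, Equiv.Perm.mul_apply, Fin.cycleRange_self] at this
      exact this.symm
    simp only
    rw [← h, Equiv.symm_apply_apply, inv_mul_cancel_left]
  right_inv x := by
    have h : ((Fin.cycleRange x.1)⁻¹ * Equiv.Perm.decomposeFin.symm (0, x.2)) 0 = x.1 := by
      rw [Equiv.Perm.mul_apply, Equiv.Perm.decomposeFin_symm_apply_zero]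
      exact Fin.cycleRange_symm_zero x.1
    simp only [h, mul_inv_cancel_left, Equiv.apply_symm_apply]

/-- A word in the adjacent transpositions `(i, i + 1)` (a letter `i` stands for `(i, i + 1)`)
whose product is a given permutation. -/
def permWord : ∀ n : ℕ, Equiv.Perm (Fin n) → List ℕ
  | 0, _ => []
  | n + 1, w => (List.range (permEquiv n w).1).reverse ++
      (permWord n (permEquiv n w).2).map (· + 1)

/-- The adjacent transposition `(i, i + 1)` of `n` letters. -/
def adjSwap (n i : ℕ) : Equiv.Perm (Fin n) :=
  if h : i + 1 < n then Equiv.swap ⟨i, by omega⟩ ⟨i + 1, h⟩ else 1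

lemma adjSwap_val (n i : ℕ) (h : i + 1 < n) (x : Fin n) :
    (adjSwap n i x : ℕ) = if (x : ℕ) = i then i + 1 else if (x : ℕ) = i + 1 then i else x := by
  rw [adjSwap, dif_pos h, Equiv.swap_apply_def]
  simp only [Fin.ext_iff]
  split_ifs <;> rfl

lemma cycleRange_val {n : ℕ} (p x : Fin (n + 1)) : (Fin.cycleRange p x : ℕ) =
    if (x : ℕ) < p then (x : ℕ) + 1 else if (x : ℕ) = p then 0 else x := by
  rcases lt_trichotomy x p with h | h | h
  · rw [Fin.coe_cycleRange_of_lt h, if_pos (Fin.lt_def.1 h)]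
  · rw [h, Fin.cycleRange_self, if_neg (lt_irrefl _), if_pos rfl, Fin.val_zero]
  · have := Fin.lt_def.1 h
    rw [Fin.cycleRange_of_gt h, if_neg (by omega), if_neg (by omega)]

lemma prod_reverse_range (n p : ℕ) (h : p < n + 1) :
    (((List.range p).reverse.map (adjSwap (n + 1))).prod) = (Fin.cycleRange ⟨p, h⟩)⁻¹ := by
  induction p with
  | zero =>
    refine eq_inv_of_mul_eq_one_left ?_
    ext x
    simp
  | succ p ih =>
    have key : Fin.cycleRange ⟨p + 1, h⟩ * adjSwap (n + 1) p =
        Fin.cycleRange ⟨p, by omega⟩ := by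
      ext x
      rw [Equiv.Perm.mul_apply, cycleRange_val, cycleRange_val, adjSwap_val _ _ h]
      dsimp only
      split_ifs <;> omega
    rw [List.range_succ, List.reverse_append, List.map_append, List.prod_append, ih (by omega),
      ← key, mul_inv_rev]
    simp only [List.reverse_singleton, List.map_singleton, List.prod_singleton]
    rw [mul_inv_cancel_left]

lemma decomposeFin_adjSwap (n i : ℕ) :
    Equiv.Perm.decomposeFin.symm (0, adjSwap n i) = adjSwap (n + 1) (i + 1) := by
  ext x
  by_cases h : i + 1 < n
  · refine Fin.cases ?_ (fun y => ?_) x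
    · rw [adjSwap_val _ _ (by omega)]
      simp
    · rw [adjSwap_val _ _ (by omega), Equiv.Perm.decomposeFin_symm_apply_succ]
      simp only [Equiv.swap_self, Equiv.refl_apply, Fin.val_succ, adjSwap_val _ _ h]
      split_ifs <;> omega
  · rw [adjSwap, adjSwap, dif_neg h, dif_neg (by omega)]
    refine Fin.cases ?_ (fun y => ?_) x <;> simp

lemma decomposeFin_one (n : ℕ) :
    Equiv.Perm.decomposeFin.symm ((0 : Fin (n + 1)), (1 : Equiv.Perm (Fin n))) = 1 := by
  ext x
  refine Fin.cases ?_ (fun y => ?_) x <;> simp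

lemma decomposeFin_mul (n : ℕ) (e e' : Equiv.Perm (Fin n)) :
    Equiv.Perm.decomposeFin.symm ((0 : Fin (n + 1)), e * e') =
      Equiv.Perm.decomposeFin.symm (0, e) * Equiv.Perm.decomposeFin.symm (0, e') := by
  ext x
  refine Fin.cases ?_ (fun y => ?_) x <;> simp

/-- The word of a permutation `w` is a factorization of `w` into adjacent transpositions. -/
lemma permWord_prod (n : ℕ) (w : Equiv.Perm (Fin n)) :
    ((permWord n w).map (adjSwap n)).prod = w := by
  induction n with
  | zero => exact Subsingleton.elim _ _
  | succ n ih =>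
    have h : ∀ l : List ℕ, ((l.map (· + 1)).map (adjSwap (n + 1))).prod =
        Equiv.Perm.decomposeFin.symm (0, (l.map (adjSwap n)).prod) := by
      intro l
      induction l with
      | nil => exact (decomposeFin_one n).symm
      | cons a l ihl =>
        rw [List.map_cons, List.map_cons, List.map_cons, List.prod_cons, List.prod_cons, ihl,
          decomposeFin_mul, decomposeFin_adjSwap]
    rw [permWord, List.map_append, List.prod_append, prod_reverse_range _ _ (Fin.is_lt _), h, ih]
    exact (permEquiv n).symm_apply_apply w

/-- The sum over all permutations of `n` letters of the products of the elements `s (o + i)`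
along the word of the permutation. -/
def wordSum {A : Type u} [Ring A] (s : ℕ → A) (o n : ℕ) : A :=
  ∑ w : Equiv.Perm (Fin n), ((permWord n w).map fun i => s (o + i)).prod

section WordSum

variable {A : Type u} [Ring A] (s : ℕ → A)

/-- The product `s (o + p - 1) ⋯ s (o + 1) s o`. -/
def descProd (o p : ℕ) : A := ((List.range p).reverse.map fun i => s (o + i)).prod

lemma descProd_succ (o p : ℕ) : descProd s o (p + 1) = s (o + p) * descProd s o p := by
  simp [descProd, List.range_succ]

lemma wordSum_succ (o n : ℕ) :
    wordSum s o (n + 1) = (∑ p : Fin (n + 1), descProd s o p) * wordSum s (o + 1) n := by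
  rw [wordSum, ← (permEquiv n).symm.sum_comp, Fintype.sum_prod_type, Finset.sum_mul]
  refine Finset.sum_congr rfl fun p _ => ?_
  rw [wordSum, Finset.mul_sum]
  refine Finset.sum_congr rfl fun e _ => ?_
  rw [permWord, Equiv.apply_symm_apply, List.map_append, List.prod_append, List.map_map, descProd]
  congr 3
  funext i
  exact congrArg s (by simp only; omega)

/-- The relations of the adjacent transpositions of `N` letters. -/
structure CoxeterRel (N : ℕ) : Prop where
  sq : ∀ i, i + 2 ≤ N → s i * s i = 1
  far : ∀ i j, i + 2 ≤ j → j + 2 ≤ N → s i * s j = s j * s i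
  braid : ∀ i, i + 3 ≤ N → s i * s (i + 1) * s i = s (i + 1) * s i * s (i + 1)

variable {s}

lemma CoxeterRel.desc_far {N : ℕ} (H : CoxeterRel s N) (o p t : ℕ) (h : o + p + 1 ≤ t)
    (ht : t + 2 ≤ N) : s t * descProd s o p = descProd s o p * s t := by
  induction p with
  | zero => simp [descProd]
  | succ p ih =>
    rw [descProd_succ, ← mul_assoc, ← H.far _ _ (by omega) ht, mul_assoc, ih (by omega), mul_assoc]

lemma CoxeterRel.desc_near {N : ℕ} (H : CoxeterRel s N) (o p r : ℕ) (h : r + 2 ≤ p)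
    (hp : o + p + 1 ≤ N) :
    s (o + r) * descProd s o p = descProd s o p * s (o + r + 1) := by
  induction p with
  | zero => omega
  | succ p ih =>
    rcases Nat.lt_or_ge p (r + 2) with h' | h'
    · obtain rfl : p = r + 1 := by omega
      rw [descProd_succ, descProd_succ, ← mul_assoc, ← mul_assoc, ← add_assoc,
        H.braid _ (by omega), mul_assoc, H.desc_far o r (o + r + 1) (by omega) (by omega)]
      simp only [mul_assoc]
    · rw [descProd_succ, ← mul_assoc, H.far _ _ (by omega) (by omega), mul_assoc,
        ih h' (by omega), mul_assoc]

lemma CoxeterRel.absorb {N : ℕ} (H : CoxeterRel s N) (n o t : ℕ) (ho : o ≤ t) (ht : t + 2 ≤ o + n)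
    (hN : o + n ≤ N) : s t * wordSum s o n = wordSum s o n := by
  induction n generalizing o t with
  | zero => omega
  | succ n ih =>
    obtain ⟨r, rfl⟩ := Nat.exists_eq_add_of_le ho
    have hr : r + 1 < n + 1 := by omega
    rw [wordSum_succ, ← mul_assoc, Finset.mul_sum, Finset.sum_mul, Finset.sum_mul,
      ← Equiv.sum_comp (Equiv.swap (⟨r, by omega⟩ : Fin (n + 1)) ⟨r + 1, hr⟩)
        (fun p : Fin (n + 1) => descProd s o p * wordSum s (o + 1) n)]
    refine Finset.sum_congr rfl fun p _ => ?_
    rcases lt_trichotomy (p : ℕ) r with h | h | h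
    · rw [Equiv.swap_apply_of_ne_of_ne (by simp [Fin.ext_iff]; omega)
        (by simp [Fin.ext_iff]; omega), H.desc_far o p (o + r) (by omega) (by omega), mul_assoc,
        ih _ _ (by omega) (by omega) (by omega)]
    · obtain rfl : p = ⟨r, Nat.lt_of_succ_lt hr⟩ := Fin.ext h
      rw [Equiv.swap_apply_left, ← descProd_succ]
    · rcases Nat.lt_or_ge (r + 1) p with h' | h'
      · rw [Equiv.swap_apply_of_ne_of_ne (by simp [Fin.ext_iff]; omega)
          (by simp [Fin.ext_iff]; omega), H.desc_near o p r (by omega) (by omega), mul_assoc,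
          ih _ _ (by omega) (by omega) (by omega)]
      · obtain rfl : p = ⟨r + 1, hr⟩ := Fin.ext (by simp only; omega)
        rw [Equiv.swap_apply_right]
        simp only
        rw [descProd_succ, ← mul_assoc, H.sq _ (by omega), one_mul]

lemma permWord_mem (n : ℕ) (w : Equiv.Perm (Fin n)) : ∀ i ∈ permWord n w, i + 2 ≤ n := by
  induction n with
  | zero => simp [permWord]
  | succ n ih =>
    intro i hi
    rw [permWord, List.mem_append, List.mem_reverse, List.mem_range, List.mem_map] at hi
    rcases hi with hi | ⟨j, hj, rfl⟩
    · have := (permEquiv n w).1.is_lt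
      omega
    · have := ih _ j hj
      omega

lemma CoxeterRel.wordSum_mul {N : ℕ} (H : CoxeterRel s N) :
    wordSum s 0 N * wordSum s 0 N = N.factorial • wordSum s 0 N := by
  have h : ∀ l : List ℕ, (∀ i ∈ l, i + 2 ≤ N) →
      (l.map fun i => s (0 + i)).prod * wordSum s 0 N = wordSum s 0 N := by
    intro l hl
    induction l with
    | nil => simp
    | cons i l ih =>
      rw [List.map_cons, List.prod_cons, mul_assoc, ih fun j hj => hl j (List.mem_cons_of_mem _ hj)]
      have := hl i List.mem_cons_self
      exact H.absorb N 0 (0 + i) (by omega) (by omega) (by omega)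
  refine (Finset.sum_mul _ _ _).trans ?_
  rw [Finset.sum_congr rfl fun w _ => h _ (permWord_mem N w), Finset.sum_const, Finset.card_univ,
    Fintype.card_perm, Fintype.card_fin]

end WordSum

/-! ### Symmetrizers in the dotted Temperley-Lieb category -/

namespace DHom

variable {K : Type u} [Field K]

/-- The endomorphism ring of `c ^ n` in degree zero; the product `f * g` is `f` after `g`. -/
instance (n : ℕ) : Ring (DHom K n n 0) where
  __ := (inferInstance : AddCommGroup (DHom K n n 0))
  one := mk (.id n)
  mul f g := compL (add_zero 0) g f
  left_distrib f g g' := LinearMap.map_add₂ (compL (add_zero 0)) g g' f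
  right_distrib f f' g := map_add (compL (add_zero 0) g) f f'
  zero_mul f := map_zero (compL (add_zero 0) f)
  mul_zero f := LinearMap.map_zero₂ (compL (add_zero 0)) f
  mul_assoc f g h := (GCat.assoc (K := K) (W := (⟨n⟩ : DTL K)) (X := ⟨n⟩) (Y := ⟨n⟩) (Z := ⟨n⟩)
    (add_zero 0) (add_zero 0) (add_zero 0) (add_zero 0) h g f).symm
  one_mul f := GCat.comp_id (K := K) (X := (⟨n⟩ : DTL K)) (Y := ⟨n⟩) (add_zero 0) f
  mul_one f := GCat.id_comp (K := K) (X := (⟨n⟩ : DTL K)) (Y := ⟨n⟩) (add_zero 0) f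

lemma mul_def {n : ℕ} (f g : DHom K n n 0) : f * g = comp (add_zero 0) g f := rfl

lemma smul_mul' {n : ℕ} (r : K) (f g : DHom K n n 0) : (r • f) * g = r • (f * g) :=
  map_smul (compL (add_zero 0) g) r f

lemma mul_smul' {n : ℕ} (r : K) (f g : DHom K n n 0) : f * (r • g) = r • (f * g) :=
  LinearMap.map_smul₂ (compL (add_zero 0)) r g f

variable (K) in
/-- The morphism `cup ∘ cap`. -/
def cupcap : DHom K 2 2 0 := comp (add_zero 0) (mk .cap) (mk .cup)

variable (K) in
/-- The crossing of two strands, `id - cup ∘ cap`. -/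
def crossing : DHom K 2 2 0 := 1 - cupcap K

lemma tensor_id_id {a b m : ℕ} (h : a + b = m) :
    tensor h h (add_zero 0) (1 : DHom K a a 0) (1 : DHom K b b 0) = 1 :=
  Quot.sound (.tensor_id h (add_zero 0))

lemma comp_one {a b : ℕ} (f : DHom K a b 0) : comp (add_zero 0) f (1 : DHom K b b 0) = f := by
  induction f using Quot.ind with | _ f
  exact Quot.sound (.comp_id _ f)

lemma one_comp {a b : ℕ} (f : DHom K a b 0) : comp (add_zero 0) (1 : DHom K a a 0) f = f := by
  induction f using Quot.ind with | _ f
  exact Quot.sound (.id_comp _ f)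

lemma comp_assoc {a b c e : ℕ} (f : DHom K a b 0) (g : DHom K b c 0) (p : DHom K c e 0) :
    comp (add_zero 0) (comp (add_zero 0) f g) p = comp (add_zero 0) f (comp (add_zero 0) g p) := by
  induction f using Quot.ind with | _ f
  induction g using Quot.ind with | _ g
  induction p using Quot.ind with | _ p
  exact Quot.sound (.assoc _ _ _ _ f g p)

lemma tensor_comp {a₁ a₂ a₃ b₁ b₂ b₃ m₁ m₂ m₃ : ℕ} (hm₁ : a₁ + b₁ = m₁) (hm₂ : a₂ + b₂ = m₂)
    (hm₃ : a₃ + b₃ = m₃) (f : DHom K a₁ a₂ 0) (f' : DHom K a₂ a₃ 0) (g : DHom K b₁ b₂ 0)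
    (g' : DHom K b₂ b₃ 0) :
    tensor hm₁ hm₃ (add_zero 0) (comp (add_zero 0) f f') (comp (add_zero 0) g g') =
      comp (add_zero 0) (tensor hm₁ hm₂ (add_zero 0) f g) (tensor hm₂ hm₃ (add_zero 0) f' g') := by
  induction f using Quot.ind with | _ f
  induction f' using Quot.ind with | _ f'
  induction g using Quot.ind with | _ g
  induction g' using Quot.ind with | _ g'
  exact Quot.sound (.interchange hm₁ hm₂ hm₃ _ _ _ _ _ _ f f' g g')

lemma tensor_assoc {a b c a' b' c' ab ab' bc bc' m n : ℕ}
    (h₁ : a + b = ab) (h₁' : a' + b' = ab') (h₂ : ab + c = m) (h₂' : ab' + c' = n)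
    (h₃ : b + c = bc) (h₃' : b' + c' = bc') (h₄ : a + bc = m) (h₄' : a' + bc' = n)
    (f : DHom K a a' 0) (g : DHom K b b' 0) (e : DHom K c c' 0) :
    tensor h₂ h₂' (add_zero 0) (tensor h₁ h₁' (add_zero 0) f g) e =
      tensor h₄ h₄' (add_zero 0) f (tensor h₃ h₃' (add_zero 0) g e) := by
  induction f using Quot.ind with | _ f
  induction g using Quot.ind with | _ g
  induction e using Quot.ind with | _ e
  exact Quot.sound (.tensor_assoc h₁ h₁' h₂ h₂' h₃ h₃' h₄ h₄' _ _ _ _ f g e)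

lemma tensor_mul {a b m : ℕ} (h : a + b = m) (f f' : DHom K a a 0) (g g' : DHom K b b 0) :
    tensor h h (add_zero 0) (f * f') (g * g') =
      tensor h h (add_zero 0) f g * tensor h h (add_zero 0) f' g' :=
  tensor_comp h h h f' f g' g

/-- The morphism `id_i ⊗ f`, as a homomorphism of rings. -/
def idTensor {a N : ℕ} (i : ℕ) (h : i + a = N) : DHom K a a 0 →+* DHom K N N 0 where
  toFun f := tensor h h (add_zero 0) (mk (.id i)) f
  map_one' := tensor_id_id h
  map_mul' f g := (congrArg (fun x => tensor h h (add_zero 0) x (f * g))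
    (mul_one (1 : DHom K i i 0)).symm).trans (tensor_mul h 1 1 f g)
  map_zero' := map_zero (tensorL h h (add_zero 0) (mk (.id i)))
  map_add' f g := map_add (tensorL h h (add_zero 0) (mk (.id i))) f g

/-- The morphism `f ⊗ id_r`, as a homomorphism of rings. -/
def tensorId {a N : ℕ} (r : ℕ) (h : a + r = N) : DHom K a a 0 →+* DHom K N N 0 where
  toFun f := tensor h h (add_zero 0) f (mk (.id r))
  map_one' := tensor_id_id h
  map_mul' f g := (congrArg (fun x => tensor h h (add_zero 0) (f * g) x)
    (mul_one (1 : DHom K r r 0)).symm).trans (tensor_mul h f g 1 1)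
  map_zero' := LinearMap.map_zero₂ (tensorL h h (add_zero 0)) (mk (.id r))
  map_add' f g := LinearMap.map_add₂ (tensorL h h (add_zero 0)) f g (mk (.id r))

/-- The morphism `id_i ⊗ f ⊗ id_r`, as a homomorphism of rings. -/
def ctx {a N : ℕ} (i r : ℕ) (h : i + a + r = N) : DHom K a a 0 →+* DHom K N N 0 :=
  (tensorId r h).comp (idTensor i rfl)

lemma ctx_eq {a b N : ℕ} (i r : ℕ) (h : i + a + r = N) (hb : i + a = b) (h' : b + r = N)
    (f : DHom K a a 0) : ctx i r h f = tensorId r h' (idTensor i hb f) := by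
  subst hb
  rfl

lemma idTensor_idTensor {a b N : ℕ} (i j k : ℕ) (h : j + a = b) (h' : i + b = N) (hk : i + j = k)
    (h'' : k + a = N) (f : DHom K a a 0) : idTensor i h' (idTensor j h f) = idTensor k h'' f := by
  change tensor _ _ _ (1 : DHom K i i 0) (tensor _ _ _ (1 : DHom K j j 0) f) =
    tensor _ _ _ (1 : DHom K k k 0) f
  rw [← tensor_assoc hk hk h'' h'' h h h' h', tensor_id_id]

lemma tensorId_tensorId {a b N : ℕ} (i j k : ℕ) (h : a + j = b) (h' : b + i = N) (hk : j + i = k)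
    (h'' : a + k = N) (f : DHom K a a 0) : tensorId i h' (tensorId j h f) = tensorId k h'' f := by
  change tensor _ _ _ (tensor _ _ _ f (1 : DHom K j j 0)) (1 : DHom K i i 0) =
    tensor _ _ _ f (1 : DHom K k k 0)
  rw [tensor_assoc h h h' h' hk hk h'' h'', tensor_id_id]

lemma tensorId_idTensor {a b b' N : ℕ} (i r : ℕ) (h : i + a = b) (h' : b + r = N) (h₁ : a + r = b')
    (h₁' : i + b' = N) (f : DHom K a a 0) :
    tensorId r h' (idTensor i h f) = idTensor i h₁' (tensorId r h₁ f) :=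
  tensor_assoc h h h' h' h₁ h₁ h₁' h₁' (1 : DHom K i i 0) f (1 : DHom K r r 0)

lemma tensorId_idTensor_comm {a b N : ℕ} (h : a + b = N) (f : DHom K a a 0) (g : DHom K b b 0) :
    tensorId b h f * idTensor a h g = idTensor a h g * tensorId b h f := by
  refine (tensor_mul h f 1 1 g).symm.trans (Eq.trans ?_ (tensor_mul h 1 f g 1))
  rw [mul_one, one_mul, mul_one, one_mul]

lemma ctx_far {a b N : ℕ} (i r j t : ℕ) (h : i + a + r = N) (h' : j + b + t = N)
    (hij : i + a ≤ j) (f : DHom K a a 0) (g : DHom K b b 0) :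
    ctx i r h f * ctx j t h' g = ctx j t h' g * ctx i r h f := by
  obtain ⟨l, rfl⟩ := Nat.exists_eq_add_of_le hij
  have hr : l + b + t = r := by omega
  have e : ctx (i + a + l) t h' g =
      idTensor (i + a) h (tensorId t hr (idTensor l (rfl : l + b = l + b) g)) := by
    rw [tensorId_idTensor l t rfl hr (rfl : b + t = b + t) (by omega),
      idTensor_idTensor (i + a) l (i + a + l) _ h rfl (by omega)]
    exact tensorId_idTensor _ _ _ _ _ _ _
  rw [e]
  exact tensorId_idTensor_comm h _ _

variable (K) in
lemma cupcap_sq : cupcap K * cupcap K = cupcap K + cupcap K := by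
  have h : comp (add_zero 0) (mk .cup) (mk .cap) = (1 : DHom K 0 0 0) + 1 :=
    (show _ = (2 : K) • (1 : DHom K 0 0 0) from Quot.sound .circle).trans (two_smul K _)
  have h' : cupcap K * cupcap K = comp (add_zero 0) (mk .cap)
      (comp (add_zero 0) (comp (add_zero 0) (mk .cup) (mk .cap)) (mk .cup)) := by
    rw [mul_def, cupcap]
    simp only [comp_assoc]
  have h₂ : comp (add_zero 0) ((1 : DHom K 0 0 0) + 1) (mk .cup : DHom K 0 2 0) =
      mk .cup + mk .cup :=
    (LinearMap.map_add₂ (compL (add_zero 0)) (1 : DHom K 0 0 0) 1 (mk .cup)).trans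
      (congrArg₂ (· + ·) (one_comp (K := K) (mk .cup)) (one_comp (K := K) (mk .cup)))
  rw [h', h, h₂]
  exact map_add (compL (add_zero 0) (mk .cap : DHom K 2 0 0)) (mk .cup) (mk .cup)

variable (K) in
lemma zigzag_left : comp (add_zero 0)
    (tensor rfl rfl (add_zero 0) (mk (.id 1)) (mk .cup) : DHom K 1 3 0)
    (tensor rfl rfl (add_zero 0) (mk .cap) (mk (.id 1)) : DHom K 3 1 0) = 1 :=
  Quot.sound .zigzag_left

variable (K) in
lemma zigzag_right : comp (add_zero 0)
    (tensor rfl rfl (add_zero 0) (mk .cup) (mk (.id 1)) : DHom K 1 3 0)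
    (tensor rfl rfl (add_zero 0) (mk (.id 1)) (mk .cap) : DHom K 3 1 0) = 1 :=
  Quot.sound .zigzag_right

variable (K) in
lemma tensorId_cupcap : tensorId (N := 3) 1 rfl (cupcap K) = comp (add_zero 0)
    (tensor rfl rfl (add_zero 0) (mk .cap) (mk (.id 1)) : DHom K 3 1 0)
    (tensor rfl rfl (add_zero 0) (mk .cup) (mk (.id 1)) : DHom K 1 3 0) := by
  rw [← tensor_comp (hm₁ := rfl) (hm₂ := rfl) (hm₃ := rfl)]
  exact congrArg (tensor _ _ _ (cupcap K)) (mul_one (1 : DHom K 1 1 0)).symm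

variable (K) in
lemma idTensor_cupcap : idTensor (N := 3) 1 rfl (cupcap K) = comp (add_zero 0)
    (tensor rfl rfl (add_zero 0) (mk (.id 1)) (mk .cap) : DHom K 3 1 0)
    (tensor rfl rfl (add_zero 0) (mk (.id 1)) (mk .cup) : DHom K 1 3 0) := by
  rw [← tensor_comp (hm₁ := rfl) (hm₂ := rfl) (hm₃ := rfl)]
  exact congrArg (fun x => tensor _ _ _ x (cupcap K)) (mul_one (1 : DHom K 1 1 0)).symm

lemma sandwich {a : ℕ} (x : DHom K a 1 0) (y : DHom K 1 a 0) (x' : DHom K a 1 0) (y' : DHom K 1 a 0)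
    (h : comp (add_zero 0) y x' = 1) (h' : comp (add_zero 0) y' x = 1) :
    comp (add_zero 0) x y * comp (add_zero 0) x' y' * comp (add_zero 0) x y =
      comp (add_zero 0) x y := by
  rw [mul_def, mul_def]
  simp only [comp_assoc]
  rw [← comp_assoc y x', h, one_comp, ← comp_assoc y' x, h', one_comp]

variable (K) in
lemma braid_rel {A : Type u} [Ring A] {x y : A} (hx : x * x = x + x) (hy : y * y = y + y)
    (h : x * y * x = x) (h' : y * x * y = y) :
    (1 - x) * (1 - y) * (1 - x) = (1 - y) * (1 - x) * (1 - y) := by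
  have e : ∀ x y : A, x * x = x + x → x * y * x = x →
      (1 - x) * (1 - y) * (1 - x) = 1 - x - y + x * y + y * x := by
    intro x y hx h
    have : (1 - x) * (1 - y) * (1 - x) = 1 - x - x - y + x * y + y * x + x * x - x * y * x := by
      noncomm_ring
    rw [this, hx, h]
    abel
  rw [e x y hx h, e y x hy h']
  abel

variable (K) in
/-- The crossing `id_i ⊗ crossing ⊗ id` of the strands `i` and `i + 1` (counted from `0`) of `N`
strands. -/
def crossingAt (N i : ℕ) : DHom K N N 0 :=
  if h : i + 2 ≤ N then ctx i (N - (i + 2)) (by omega) (crossing K) else 1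

variable (K) in
lemma crossingAt_eq (N i r : ℕ) (h : i + 2 + r = N) :
    crossingAt K N i = ctx i r h (crossing K) := by
  obtain rfl : r = N - (i + 2) := by omega
  rw [crossingAt, dif_pos (by omega)]

variable (K) in
lemma crossingAt_rel (N : ℕ) : CoxeterRel (crossingAt K N) N where
  sq i h := by
    rw [crossingAt, dif_pos h, ← map_mul]
    refine (congrArg _ ?_).trans (map_one _)
    have : crossing K * crossing K = 1 - cupcap K - cupcap K + cupcap K * cupcap K := by
      rw [crossing]
      noncomm_ring
    rw [this, cupcap_sq]
    abel
  far i j h h' := by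
    rw [crossingAt, crossingAt, dif_pos h', dif_pos (by omega)]
    exact ctx_far _ _ _ _ _ _ h _ _
  braid i h := by
    obtain ⟨r, hr⟩ := Nat.exists_eq_add_of_le h
    have h₁ : crossingAt K N i = ctx (a := 3) i r hr.symm (tensorId 1 rfl (crossing K)) := by
      rw [crossingAt_eq K N i (1 + r) (by omega)]
      rw [ctx_eq i r hr.symm rfl hr.symm, ← tensorId_idTensor i 1 (b := i + 2) rfl rfl rfl rfl,
        tensorId_tensorId r 1 (1 + r) rfl hr.symm rfl (by omega)]
      rfl
    have h₂ : crossingAt K N (i + 1) =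
        ctx (a := 3) i r hr.symm (idTensor 1 rfl (crossing K)) := by
      rw [crossingAt_eq K N (i + 1) r (by omega)]
      rw [ctx_eq i r hr.symm rfl hr.symm]
      exact (ctx_eq (i + 1) r _ (add_assoc i 1 2) hr.symm (crossing K)).trans
        (congrArg (tensorId r hr.symm)
          (idTensor_idTensor i 1 (i + 1) rfl rfl rfl (add_assoc i 1 2) (crossing K)).symm)
    rw [h₁, h₂, ← map_mul, ← map_mul, ← map_mul, ← map_mul]
    congr 1
    simp only [crossing, map_sub, map_one]
    refine braid_rel ?_ ?_ ?_ ?_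
    · rw [← map_mul, cupcap_sq, map_add]
    · rw [← map_mul, cupcap_sq, map_add]
    · rw [tensorId_cupcap, idTensor_cupcap]
      exact sandwich _ _ _ _ (zigzag_right K) (zigzag_left K)
    · rw [tensorId_cupcap, idTensor_cupcap]
      exact sandwich _ _ _ _ (zigzag_left K) (zigzag_right K)

variable (K) in
/-- The sum of all permutations of `n` strands. -/
def permSum (n : ℕ) : DHom K n n 0 := wordSum (crossingAt K n) 0 n

variable (K) in
/-- The symmetrizer `P_n`, the average of all permutations of `n` strands. -/
def symmetrizer (n : ℕ) : DHom K n n 0 := (n.factorial : K)⁻¹ • permSum K n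

variable (K) in
lemma symmetrizer_idem [CharZero K] (n : ℕ) : symmetrizer K n * symmetrizer K n = symmetrizer K n := by
  rw [symmetrizer, smul_mul', mul_smul', permSum, (crossingAt_rel K n).wordSum_mul,
    ← Nat.cast_smul_eq_nsmul K, smul_smul, smul_smul, mul_assoc, inv_mul_cancel₀, mul_one]
  exact_mod_cast n.factorial_ne_zero

end DHom

/-! ### The Kirby color -/

/-- The category of ind-objects in the `ℤ`-additive Karoubi envelope of the dotted Temperley-Lieb
category. -/
abbrev dTLbar (K : Type u) [Field K] : Type (u + 1) := IndObj K (Mat K (Kar K (DTL K)))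

/-- The polynomial representation, extended to images of idempotents, to finite sums of shifts, and
to filtered colimits. -/
def Pol (K : Type u) [Field K] : GFunctor K (dTLbar K) (GVect K) :=
  (polDTL K).extKar.extMat.extInd

lemma Kar.sandwich_mem {K : Type u} [Field K] {C : Type v} [GCat K C] {A B : Kar K C} {d : ℤ}
    (f : GHom K A.X B.X d) :
    GCat.comp (add_zero d) (GCat.comp (zero_add d) A.e f) B.e ∈ Kar.homSub A B d := by
  rw [Kar.mem_homSub,
    ← GCat.assoc (zero_add d) (add_zero d) (add_zero d) (zero_add d) A.e (GCat.comp _ A.e f),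
    ← GCat.assoc (add_zero 0) (zero_add d) (zero_add d) (zero_add d) A.e A.e f, A.idem,
    GCat.assoc (add_zero d) (add_zero d) (add_zero 0) (add_zero d), B.idem]

section Kirby

variable (K : Type u) [Field K] [CharZero K]

/-- The image of the symmetrizer `P_n`, as an object of the Karoubi envelope. -/
def symObj (n : ℕ) : Kar K (DTL K) := ⟨⟨n⟩, DHom.symmetrizer K n, DHom.symmetrizer_idem K n⟩

/-- The dotted cup. -/
def dottedCup : DHom K 0 2 2 :=
  DHom.comp (zero_add 2) (DHom.mk .cup)
    (DHom.tensor rfl rfl (add_zero 2) (DHom.mk .dot) (DHom.mk (.id 1)) : DHom K 2 2 2)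

/-- The morphism `P_{n+2} ∘ (id_n ⊗ dotted cup) ∘ P_n` of degree two. -/
def symMap (n : ℕ) : GHom K (symObj K n) (symObj K (n + 2)) 2 :=
  ⟨GCat.comp (K := K) (X := (⟨n⟩ : DTL K)) (Y := ⟨n + 2⟩) (Z := ⟨n + 2⟩) (add_zero 2)
    (GCat.comp (K := K) (X := (⟨n⟩ : DTL K)) (Y := ⟨n⟩) (Z := ⟨n + 2⟩) (zero_add 2)
      (DHom.symmetrizer K n)
      (DHom.tensor (add_zero n) rfl (zero_add 2) (DHom.mk (.id n)) (dottedCup K)))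
    (DHom.symmetrizer K (n + 2)), Kar.sandwich_mem (A := symObj K n) (B := symObj K (n + 2)) _⟩

/-- The object `q ^ (-2 m) P_{2 m} ⊕ q ^ (-1 - 2 m) P_{1 + 2 m}`. -/
def kirbyStage (m : ℕ) : Mat K (Kar K (DTL K)) :=
  ⟨Fin 2, fun k => -(k : ℕ) - 2 * m, fun k => symObj K (k + 2 * m)⟩

/-- The diagonal matrix whose entries are the degree zero maps
`q ^ (-k - 2 m) P_{k + 2 m} → q ^ (-k - 2 m - 2) P_{k + 2 m + 2}` for `k = 0, 1`. -/
def kirbyMap (m : ℕ) : GHom K (kirbyStage K m) (kirbyStage K (m + 1)) 0 :=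
  fun (k l : Fin 2) =>
  if h : k = l then
    h ▸ degCast (by dsimp only [kirbyStage]; push_cast; ring) (symMap K (k + 2 * m) :
      GHom K (symObj K (k + 2 * m)) (symObj K (k + 2 * (m + 1))) 2)
  else 0

/-- The Kirby color `ω = ω_0 ⊕ ω_1`, where
`ω_k = (q ^ (-k) P_k → q ^ (-k-2) P_{k+2} → q ^ (-k-4) P_{k+4} → ⋯)`; the direct sum of the two
directed systems is formed termwise. -/
def kirby : dTLbar K where
  I := ULift.{u} ℕ
  F := (show Monotone (ULift.down : ULift.{u} ℕ → ℕ) from fun _ _ h => h).functor ⋙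
    Functor.ofSequence (X := fun m => DegZero.mk (K := K) (kirbyStage K m)) (kirbyMap K)

end Kirby

end

end GradedLinear

namespace GradedLinear

noncomputable section

/-! ### Absorption of adjacent transpositions by the sum of all permutations -/

section WordSum

variable {A : Type u} [Ring A] {s : ℕ → A}

/-! Both statements follow from one computation: Hom(A, ω ⊗ c^m) ≅ HOM(Pol A, Pol c^m), naturally in
A and in c^m. A morphism c^a → c^N ⊗ c^m, followed by the inclusion of c^N ⊗ c^m in ω ⊗ c^m, is sent
to the "top rows" of its matrix in the polynomial representation: the rows indexed by the monomials
x_1⋯x_N · u, with u a monomial in the last m variables. Top rows do not see symmetrizers or dotted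
cups. The monomial x_1x_2 does not occur in x_1 + x_2, so crossings fix the top row, and x_1(x_1 +
x_2) = x_1x_2 (`polM_symmetrizer_top`, `polM_dottedCup_top`). Hence the top rows descend to the
colimit that defines ω.

The heart is that the top rows determine the morphism. For m = 0, consider functionals φ_n on
Hom(c^a, c^n) compatible with the symmetrizers and with the dotted cups (`KirbyFamily`).
Symmetrizers kill cups, so φ vanishes on every morphism that ends in a cup. Modulo such morphisms,
neck cutting moves a dotted cup across a strand, so a dotted cup may be inserted between any two
strands without changing φ (`KirbyFamily.wh_dottedCup`). Let dots_s be the endomorphism of c^n with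
a dot on each strand where the monomial s has exponent 0. For x : c^a → c^b one finds φ(x ; dots_s)
= ∑_t Pol(x)_{s,t} φ(dots_t) (`actsPolynomially`). It is checked on generators, where the cap
amounts to neck cutting, the cup to "a dotted cup is invisible and a cup is zero", and the dot to
the vanishing of its square. It is then propagated through composites, tensor products and linear
combinations. For s = x_1⋯x_n there are no dots, and φ(x) is expressed through the top row of x
alone (`KirbyFamily.φ_eq_sum`). Conversely, the top row of dots_t is the unit vector at t
(`polM_dots_top`), so every row is attained. For m > 0 the last strands are bent down; bending
exchanges the exponents 0 and 1 and reduces m to 0.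

The functors being compared turn filtered colimits into limits, and every object of Mat(Kar(dTL)) is
a retract of a finite sum of shifted objects c^a. So it suffices to treat A = c^a
(`GNatTrans.bijectiveAt_of_embed`).

The case m = 0, together with the right unitor and Pol(c^0) ≅ K, is the first statement. For the
second, the isomorphisms above turn composition in the completed category into composition of linear
maps. A vector of Pol(c^m) yields a morphism ω → ω ⊗ c^m and a monomial yields a coefficient
morphism ω ⊗ c^m → ω. The relations between dual bases then exhibit ω ⊗ c^m as the copower Pol(c^m)
⊗ ω (`isCopower_of_basis`). Continuity extends this to all X, and copowers are unique up to natural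
isomorphism. -/

lemma CoxeterRel.op {N : ℕ} (H : CoxeterRel s N) :
    CoxeterRel (fun i => MulOpposite.op (s i)) N where
  sq i h := by rw [← MulOpposite.op_mul, H.sq i h, MulOpposite.op_one]
  far i j h h' := by rw [← MulOpposite.op_mul, ← MulOpposite.op_mul, H.far i j h h']
  braid i h := by
    simp only [← MulOpposite.op_mul, ← mul_assoc]
    rw [H.braid i h]

lemma mul_list_prod_of_absorb {e : A} (l : List ℕ) (h : ∀ i ∈ l, e * s i = e) :
    e * (l.map s).prod = e := by
  induction l with
  | nil => simp
  | cons i l ih =>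
    rw [List.map_cons, List.prod_cons, ← mul_assoc, h i List.mem_cons_self,
      ih fun j hj => h j (List.mem_cons_of_mem _ hj)]

lemma mul_wordSum_of_absorb {e : A} (o n : ℕ) (h : ∀ i, i + 2 ≤ n → e * s (o + i) = e) :
    e * wordSum s o n = n.factorial • e := by
  refine (Finset.mul_sum _ _ _).trans ?_
  rw [Finset.sum_congr rfl fun w _ => mul_list_prod_of_absorb (s := fun i => s (o + i)) _
    fun i hi => h i (permWord_mem n w i hi), Finset.sum_const, Finset.card_univ,
    Fintype.card_perm, Fintype.card_fin]

/-- The opposite relations give a sum `e'` of reversed words that absorbs letters on the right,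
while `e` absorbs them on the left. Evaluating `e' * e` from either side gives both `N! e'` and `N!
e`. The hypothesis `hN` cancels the factorial, so `e = e'` has both properties. -/
lemma CoxeterRel.absorb_right {N : ℕ} (H : CoxeterRel s N)
    (hN : ∀ x y : A, N.factorial • x = N.factorial • y → x = y) (t : ℕ) (ht : t + 2 ≤ N) :
    wordSum s 0 N * s t = wordSum s 0 N := by
  set e := wordSum s 0 N with he
  set e' := (wordSum (fun i => MulOpposite.op (s i)) 0 N).unop with he'
  have h₁ : ∀ i, i + 2 ≤ N → s (0 + i) * e = e := fun i hi =>
    H.absorb N 0 (0 + i) (by omega) (by omega) (by omega)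
  have h₂ : ∀ i, i + 2 ≤ N → e' * s (0 + i) = e' := fun i hi => by
    have := H.op.absorb N 0 (0 + i) (by omega) (by omega) (by omega)
    exact congrArg MulOpposite.unop this
  have h₃ : e' * e = N.factorial • e' := mul_wordSum_of_absorb 0 N h₂
  have h₄ : e' * e = N.factorial • e := by
    have h : ∀ l : List ℕ, (∀ i ∈ l, i + 2 ≤ N) →
        ((l.map fun i => MulOpposite.op (s (0 + i))).prod).unop * e = e := by
      intro l hl
      induction l with
      | nil => simp
      | cons i l ih =>
        rw [List.map_cons, List.prod_cons, MulOpposite.unop_mul, MulOpposite.unop_op, mul_assoc,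
          h₁ i (hl i List.mem_cons_self), ih fun j hj => hl j (List.mem_cons_of_mem _ hj)]
    rw [he', wordSum, Finset.unop_sum, Finset.sum_mul,
      Finset.sum_congr rfl fun w _ => h _ (permWord_mem N w), Finset.sum_const, Finset.card_univ,
      Fintype.card_perm, Fintype.card_fin]
  have h₅ : e = e' := hN _ _ (h₄.symm.trans h₃)
  have := h₂ t ht
  rwa [← h₅, zero_add] at this

lemma map_wordSum {B : Type v} [Ring B] (f : A →+* B) (s : ℕ → A) (o n : ℕ) :
    f (wordSum s o n) = wordSum (fun i => f (s i)) o n := by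
  rw [wordSum, map_sum]
  refine Finset.sum_congr rfl fun w _ => ?_
  rw [map_list_prod, List.map_map]
  rfl

end WordSum

namespace DHom

variable {K : Type u} [Field K]

/-! ### The axioms of a strict monoidal category, in all degrees -/

lemma mk_id (n : ℕ) : (mk (.id n) : DHom K n n 0) = 1 := rfl

lemma gid_comp {a b : ℕ} {d : ℤ} (h : 0 + d = d) (f : DHom K a b d) :
    comp h (1 : DHom K a a 0) f = f := by
  induction f using Quot.ind with | _ f
  exact Quot.sound (.id_comp h f)

lemma gcomp_id {a b : ℕ} {d : ℤ} (h : d + 0 = d) (f : DHom K a b d) :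
    comp h f (1 : DHom K b b 0) = f := by
  induction f using Quot.ind with | _ f
  exact Quot.sound (.comp_id h f)

lemma gcomp_assoc {a b c e : ℕ} {i j k ij jk l : ℤ} (h₁ : i + j = ij) (h₂ : ij + k = l)
    (h₃ : j + k = jk) (h₄ : i + jk = l) (f : DHom K a b i) (g : DHom K b c j) (p : DHom K c e k) :
    comp h₂ (comp h₁ f g) p = comp h₄ f (comp h₃ g p) := by
  induction f using Quot.ind with | _ f
  induction g using Quot.ind with | _ g
  induction p using Quot.ind with | _ p
  exact Quot.sound (.assoc _ _ _ _ f g p)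

lemma interchange {a₁ a₂ a₃ b₁ b₂ b₃ m₁ m₂ m₃ : ℕ} {i i' j j' p q r s k : ℤ}
    (hm₁ : a₁ + b₁ = m₁) (hm₂ : a₂ + b₂ = m₂) (hm₃ : a₃ + b₃ = m₃)
    (h₁ : i + i' = p) (h₂ : j + j' = q) (h₃ : p + q = k)
    (h₄ : i + j = r) (h₅ : i' + j' = s) (h₆ : r + s = k)
    (f : DHom K a₁ a₂ i) (f' : DHom K a₂ a₃ i') (g : DHom K b₁ b₂ j) (g' : DHom K b₂ b₃ j') :
    tensor hm₁ hm₃ h₃ (comp h₁ f f') (comp h₂ g g') =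
      comp h₆ (tensor hm₁ hm₂ h₄ f g) (tensor hm₂ hm₃ h₅ f' g') := by
  induction f using Quot.ind with | _ f
  induction f' using Quot.ind with | _ f'
  induction g using Quot.ind with | _ g
  induction g' using Quot.ind with | _ g'
  exact Quot.sound (.interchange hm₁ hm₂ hm₃ _ _ _ _ _ _ f f' g g')

lemma gtensor_assoc {a b c a' b' c' ab ab' bc bc' m n : ℕ} {i j k ij jk l : ℤ}
    (h₁ : a + b = ab) (h₁' : a' + b' = ab') (h₂ : ab + c = m) (h₂' : ab' + c' = n)
    (h₃ : b + c = bc) (h₃' : b' + c' = bc') (h₄ : a + bc = m) (h₄' : a' + bc' = n)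
    (d₁ : i + j = ij) (d₂ : ij + k = l) (d₃ : j + k = jk) (d₄ : i + jk = l)
    (f : DHom K a a' i) (g : DHom K b b' j) (e : DHom K c c' k) :
    tensor h₂ h₂' d₂ (tensor h₁ h₁' d₁ f g) e = tensor h₄ h₄' d₄ f (tensor h₃ h₃' d₃ g e) := by
  induction f using Quot.ind with | _ f
  induction g using Quot.ind with | _ g
  induction e using Quot.ind with | _ e
  exact Quot.sound (.tensor_assoc h₁ h₁' h₂ h₂' h₃ h₃' h₄ h₄' _ _ _ _ f g e)

lemma gid_tensor {a b : ℕ} {d : ℤ} (ha : 0 + a = a) (hb : 0 + b = b) (h : 0 + d = d)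
    (f : DHom K a b d) : tensor ha hb h (1 : DHom K 0 0 0) f = f := by
  induction f using Quot.ind with | _ f
  exact Quot.sound (.id_tensor ha hb h f)

lemma gtensor_unit {a b : ℕ} {d : ℤ} (ha : a + 0 = a) (hb : b + 0 = b) (h : d + 0 = d)
    (f : DHom K a b d) : tensor ha hb h f (1 : DHom K 0 0 0) = f := by
  induction f using Quot.ind with | _ f
  exact Quot.sound (.tensor_unit ha hb h f)

lemma comp_add' {a b c : ℕ} {i j k : ℤ} (h : i + j = k) (f : DHom K a b i) (g g' : DHom K b c j) :
    comp h f (g + g') = comp h f g + comp h f g' := map_add (compL h f) g g'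

lemma add_comp' {a b c : ℕ} {i j k : ℤ} (h : i + j = k) (f f' : DHom K a b i) (g : DHom K b c j) :
    comp h (f + f') g = comp h f g + comp h f' g := LinearMap.map_add₂ (compL h) f f' g

lemma comp_zero' {a b c : ℕ} {i j k : ℤ} (h : i + j = k) (f : DHom K a b i) :
    comp h f (0 : DHom K b c j) = 0 := map_zero (compL h f)

lemma comp_smul' {a b c : ℕ} {i j k : ℤ} (h : i + j = k) (r : K) (f : DHom K a b i)
    (g : DHom K b c j) : comp h f (r • g) = r • comp h f g := map_smul (compL h f) r g

lemma smul_comp' {a b c : ℕ} {i j k : ℤ} (h : i + j = k) (r : K) (f : DHom K a b i)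
    (g : DHom K b c j) : comp h (r • f) g = r • comp h f g := LinearMap.map_smul₂ (compL h) r f g

lemma tensor_add' {a b a' b' m n : ℕ} {i j k : ℤ} (hm : a + a' = m) (hn : b + b' = n)
    (h : i + j = k) (f : DHom K a b i) (g g' : DHom K a' b' j) :
    tensor hm hn h f (g + g') = tensor hm hn h f g + tensor hm hn h f g' :=
  map_add (tensorL hm hn h f) g g'

lemma add_tensor' {a b a' b' m n : ℕ} {i j k : ℤ} (hm : a + a' = m) (hn : b + b' = n)
    (h : i + j = k) (f f' : DHom K a b i) (g : DHom K a' b' j) :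
    tensor hm hn h (f + f') g = tensor hm hn h f g + tensor hm hn h f' g :=
  LinearMap.map_add₂ (tensorL hm hn h) f f' g

lemma tensor_smul' {a b a' b' m n : ℕ} {i j k : ℤ} (hm : a + a' = m) (hn : b + b' = n)
    (h : i + j = k) (r : K) (f : DHom K a b i) (g : DHom K a' b' j) :
    tensor hm hn h f (r • g) = r • tensor hm hn h f g := map_smul (tensorL hm hn h f) r g

lemma smul_tensor' {a b a' b' m n : ℕ} {i j k : ℤ} (hm : a + a' = m) (hn : b + b' = n)
    (h : i + j = k) (r : K) (f : DHom K a b i) (g : DHom K a' b' j) :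
    tensor hm hn h (r • f) g = r • tensor hm hn h f g :=
  LinearMap.map_smul₂ (tensorL hm hn h) r f g

lemma tensor_zero' {a b a' b' m n : ℕ} {i j k : ℤ} (hm : a + a' = m) (hn : b + b' = n)
    (h : i + j = k) (f : DHom K a b i) : tensor hm hn h f (0 : DHom K a' b' j) = 0 :=
  map_zero (tensorL hm hn h f)

/-! ### Three-fold tensor products -/

/-- The tensor product of three morphisms. -/
def tensor₃ {a b c a' b' c' m n : ℕ} {i j k l : ℤ} (hm : a + b + c = m) (hn : a' + b' + c' = n)
    (h : i + j + k = l) (f : DHom K a a' i) (g : DHom K b b' j) (e : DHom K c c' k) :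
    DHom K m n l :=
  tensor hm hn h (tensor rfl rfl rfl f g) e

lemma tensor₃_comp {a₁ a₂ a₃ b₁ b₂ b₃ c₁ c₂ c₃ m₁ m₂ m₃ : ℕ} {i i' j j' k k' p q r l l' t : ℤ}
    (hm₁ : a₁ + b₁ + c₁ = m₁) (hm₂ : a₂ + b₂ + c₂ = m₂) (hm₃ : a₃ + b₃ + c₃ = m₃)
    (h₁ : i + i' = p) (h₂ : j + j' = q) (h₃ : k + k' = r) (h₄ : p + q + r = t)
    (h₅ : i + j + k = l) (h₆ : i' + j' + k' = l') (h₇ : l + l' = t)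
    (f : DHom K a₁ a₂ i) (f' : DHom K a₂ a₃ i') (g : DHom K b₁ b₂ j) (g' : DHom K b₂ b₃ j')
    (e : DHom K c₁ c₂ k) (e' : DHom K c₂ c₃ k') :
    tensor₃ hm₁ hm₃ h₄ (comp h₁ f f') (comp h₂ g g') (comp h₃ e e') =
      comp h₇ (tensor₃ hm₁ hm₂ h₅ f g e) (tensor₃ hm₂ hm₃ h₆ f' g' e') := by
  rw [tensor₃, tensor₃, tensor₃, ← interchange hm₁ hm₂ hm₃ (by omega) h₃ h₄ h₅ h₆ h₇,
    ← interchange rfl rfl rfl h₁ h₂ rfl rfl rfl (by omega)]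

/-- The morphism `id ⊗ f ⊗ id`. -/
def wh {a b m n : ℕ} {d : ℤ} (l r : ℕ) (hm : l + a + r = m) (hn : l + b + r = n)
    (f : DHom K a b d) : DHom K m n d :=
  tensor hm hn (add_zero d) (tensor rfl rfl (zero_add d) (1 : DHom K l l 0) f) (1 : DHom K r r 0)

lemma tensor₃_eq {a b c a' b' c' m n : ℕ} {i j k l p : ℤ} (hm : a + b + c = m)
    (hn : a' + b' + c' = n) (h : i + j + k = l) (hp : i + j = p) (hp' : p + k = l)
    (f : DHom K a a' i) (g : DHom K b b' j) (e : DHom K c c' k) :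
    tensor₃ hm hn h f g e = tensor hm hn hp' (tensor rfl rfl hp f g) e := by
  subst hp
  rfl

lemma wh_eq_tensor₃ {a b m n : ℕ} {d : ℤ} (l r : ℕ) (hm : l + a + r = m) (hn : l + b + r = n)
    (h : 0 + d + 0 = d) (f : DHom K a b d) :
    wh l r hm hn f = tensor₃ hm hn h (1 : DHom K l l 0) f (1 : DHom K r r 0) :=
  (tensor₃_eq hm hn h (zero_add d) (add_zero d) _ _ _).symm

/-- The map `f ↦ id ⊗ f ⊗ id` as a linear map. -/
def whL {a b m n : ℕ} (d : ℤ) (l r : ℕ) (hm : l + a + r = m) (hn : l + b + r = n) :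
    DHom K a b d →ₗ[K] DHom K m n d where
  toFun := wh l r hm hn
  map_add' f g := by rw [wh, tensor_add', add_tensor']; rfl
  map_smul' c f := by rw [wh, tensor_smul', smul_tensor']; rfl

lemma whL_apply {a b m n : ℕ} (d : ℤ) (l r : ℕ) (hm : l + a + r = m) (hn : l + b + r = n)
    (f : DHom K a b d) : whL d l r hm hn f = wh l r hm hn f := rfl

lemma wh_id {a m : ℕ} (l r : ℕ) (hm : l + a + r = m) : wh l r hm hm (1 : DHom K a a 0) = 1 := by
  rw [wh, tensor_id_id, tensor_id_id]

lemma wh_comp {a b c m n p : ℕ} {i j k : ℤ} (l r : ℕ) (hm : l + a + r = m) (hn : l + b + r = n)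
    (hp : l + c + r = p) (h : i + j = k) (f : DHom K a b i) (g : DHom K b c j) :
    wh l r hm hp (comp h f g) = comp h (wh l r hm hn f) (wh l r hn hp g) := by
  rw [wh_eq_tensor₃ l r hm hn (by omega), wh_eq_tensor₃ l r hn hp (by omega),
    ← tensor₃_comp hm hn hp (add_zero 0) h (add_zero 0) (by omega), gid_comp, gid_comp,
    wh_eq_tensor₃]

/-- `f ⊗ g = (f ⊗ id) ; (id ⊗ g)`. -/
lemma tensor_eq_comp {a b a' b' m n p : ℕ} {i j k : ℤ} (hm : a + a' = m) (hn : b + b' = n)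
    (h : i + j = k) (hp : b + a' = p) (f : DHom K a b i) (g : DHom K a' b' j) :
    tensor hm hn h f g = comp h (tensor hm hp (add_zero i) f (1 : DHom K a' a' 0))
      (tensor hp hn (zero_add j) (1 : DHom K b b 0) g) := by
  rw [← interchange hm hp hn (add_zero i) (zero_add j) h, gcomp_id, gid_comp]

/-- `f ⊗ g = (id ⊗ g) ; (f ⊗ id)`. -/
lemma tensor_eq_comp' {a b a' b' m n p : ℕ} {i j k : ℤ} (hm : a + a' = m) (hn : b + b' = n)
    (h : i + j = k) (h' : j + i = k) (hp : a + b' = p) (f : DHom K a b i) (g : DHom K a' b' j) :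
    tensor hm hn h f g = comp h' (tensor hm hp (zero_add j) (1 : DHom K a a 0) g)
      (tensor hp hn (add_zero i) f (1 : DHom K b' b' 0)) := by
  rw [← interchange hm hp hn (zero_add i) (add_zero j) h, gcomp_id, gid_comp]

lemma wh_eq {a b m n p q : ℕ} {d : ℤ} (l r : ℕ) (hp : l + a = p) (hq : l + b = q)
    (hm : l + a + r = m) (hn : l + b + r = n) (hm' : p + r = m) (hn' : q + r = n)
    (f : DHom K a b d) : wh l r hm hn f = tensor hm' hn' (add_zero d)
      (tensor hp hq (zero_add d) (1 : DHom K l l 0) f) (1 : DHom K r r 0) := by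
  subst hp hq
  rfl

/-- Strictness lets a strand placed beside `f` be counted as part of the margin. Together with
`wh_id_tensor`, this is how a relation on two or three strands is read at an arbitrary position
among many strands. -/
lemma wh_tensor_id {a b c m n ac bc q : ℕ} {d : ℤ} (l r : ℕ) (hac : a + c = ac) (hbc : b + c = bc)
    (hm : l + ac + r = m) (hn : l + bc + r = n) (hq : c + r = q) (hm' : l + a + q = m)
    (hn' : l + b + q = n) (f : DHom K a b d) :
    wh l r hm hn (tensor hac hbc (add_zero d) f (1 : DHom K c c 0)) = wh l q hm' hn' f := by
  subst hac hbc hq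
  rw [wh_eq l r (add_assoc l a c).symm (add_assoc l b c).symm hm hn (by omega) (by omega),
    ← gtensor_assoc (a := l) (a' := l) (b := a) (b' := b) rfl rfl rfl rfl rfl rfl
      (add_assoc l a c).symm (add_assoc l b c).symm (zero_add d) (add_zero d) (add_zero d)
      (zero_add d) (1 : DHom K l l 0) f (1 : DHom K c c 0),
    gtensor_assoc (c := r) (c' := r) rfl rfl (by omega) (by omega) rfl rfl hm' hn' (add_zero d)
      (add_zero d) (add_zero 0) (add_zero d), tensor_id_id]
  rfl

lemma wh_id_tensor {a b c m n ca cb q : ℕ} {d : ℤ} (l r : ℕ) (hca : c + a = ca) (hcb : c + b = cb)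
    (hm : l + ca + r = m) (hn : l + cb + r = n) (hq : l + c = q) (hm' : q + a + r = m)
    (hn' : q + b + r = n) (f : DHom K a b d) :
    wh l r hm hn (tensor hca hcb (zero_add d) (1 : DHom K c c 0) f) = wh q r hm' hn' f := by
  subst hca hcb hq
  rw [wh_eq l r (add_assoc l c a).symm (add_assoc l c b).symm hm hn hm' hn',
    ← gtensor_assoc (a := l) (a' := l) (c := a) (c' := b) rfl rfl rfl rfl rfl rfl
      (add_assoc l c a).symm (add_assoc l c b).symm (add_zero 0) (zero_add d) (zero_add d)
      (zero_add d) (1 : DHom K l l 0) (1 : DHom K c c 0) f, tensor_id_id]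
  rfl

end DHom

end

noncomputable section

namespace DHom

variable {K : Type u} [Field K]

/-! ### Properties of the symmetrizer -/

lemma ctx_eq_wh {a N : ℕ} (i r : ℕ) (h : i + a + r = N) (f : DHom K a a 0) :
    ctx i r h f = wh i r h h f := rfl

section CharZero

variable [CharZero K]

variable (K) in
-- Since `f * g` is `f` after `g`, the crossing here comes first and the symmetrizer second.
-- `CoxeterRel.absorb` only covers the other order, hence the use of `absorb_right`.
lemma symmetrizer_mul_crossingAt (n t : ℕ) (ht : t + 2 ≤ n) :
    symmetrizer K n * crossingAt K n t = symmetrizer K n := by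
  rw [symmetrizer, smul_mul', permSum, (crossingAt_rel K n).absorb_right _ t ht]
  intro x y h
  rw [← Nat.cast_smul_eq_nsmul K, ← Nat.cast_smul_eq_nsmul K] at h
  have h0 : (n.factorial : K) ≠ 0 := by exact_mod_cast n.factorial_ne_zero
  exact smul_right_injective _ h0 h

/-- A symmetrizer that absorbs `id - cup ∘ cap` must kill `cup ∘ cap`. Precomposing with the cup
closes a circle and leaves twice the cup, and 2 is invertible. -/
lemma wh_cup_symmetrizer {m n : ℕ} (l r : ℕ) (hm : l + 0 + r = m) (hn : l + 2 + r = n) :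
    comp (add_zero 0) (wh l r hm hn (mk .cup : DHom K 0 2 0)) (symmetrizer K n) = 0 := by
  have h₁ : symmetrizer K n * wh l r hn hn (cupcap K) = 0 := by
    have h := symmetrizer_mul_crossingAt K n l (by omega)
    rw [crossingAt_eq K n l r hn, crossing, map_sub, map_one, mul_sub, mul_one, ctx_eq_wh] at h
    exact sub_eq_self.1 h
  have h₂ : comp (add_zero 0) (mk .cup : DHom K 0 2 0) (cupcap K) = (2 : K) • mk .cup := by
    rw [cupcap, ← gcomp_assoc (add_zero 0) (add_zero 0) (add_zero 0) (add_zero 0)]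
    have : comp (add_zero 0) (mk .cup) (mk .cap) = (2 : K) • (1 : DHom K 0 0 0) :=
      Quot.sound .circle
    rw [this, smul_comp', gid_comp]
  have h₃ : comp (add_zero 0) (wh l r hm hn (mk .cup : DHom K 0 2 0))
      (comp (add_zero 0) (wh l r hn hn (cupcap K)) (symmetrizer K n)) = 0 := by
    rw [← mul_def, h₁, comp_zero']
  rw [← gcomp_assoc (add_zero 0) (add_zero 0) (add_zero 0) (add_zero 0), ← wh_comp, h₂,
    ← whL_apply 0, map_smul, whL_apply, smul_comp'] at h₃
  exact (smul_eq_zero.1 h₃).resolve_left two_ne_zero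

lemma symmetrizer_mul_of_wordSum {L n : ℕ} (o : ℕ) (h : o + n ≤ L) :
    symmetrizer K L * wordSum (crossingAt K L) o n = n.factorial • symmetrizer K L :=
  mul_wordSum_of_absorb o n fun i hi => symmetrizer_mul_crossingAt K L _ (by omega)

lemma wordSum_congr {A : Type u} [Ring A] {s s' : ℕ → A} {o o' n : ℕ}
    (h : ∀ i, i + 2 ≤ n → s (o + i) = s' (o' + i)) : wordSum s o n = wordSum s' o' n := by
  refine Finset.sum_congr rfl fun w _ => congrArg List.prod (List.map_congr_left fun i hi => ?_)
  exact h i (permWord_mem n w i hi)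

/-- Each of the `n!` words of the smaller symmetrizer becomes a word in crossings of the larger set
of strands and is absorbed. The normalization `1 / n!` then returns the large symmetrizer itself. -/
lemma ringHom_symmetrizer_absorb {L n : ℕ} (o : ℕ) (h : o + n ≤ L)
    (f : DHom K n n 0 →+* DHom K L L 0) (hf' : ∀ (r : K) x, f (r • x) = r • f x)
    (hf : ∀ i, i + 2 ≤ n → f (crossingAt K n i) = crossingAt K L (o + i)) :
    symmetrizer K L * f (symmetrizer K n) = symmetrizer K L := by
  have h₁ : f (permSum K n) = wordSum (crossingAt K L) o n := by
    rw [permSum, map_wordSum]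
    exact wordSum_congr fun i hi => by rw [zero_add, hf i hi]
  rw [show symmetrizer K n = (n.factorial : K)⁻¹ • permSum K n from rfl, hf', h₁, mul_smul',
    symmetrizer_mul_of_wordSum o h, ← Nat.cast_smul_eq_nsmul K, smul_smul, inv_mul_cancel₀, one_smul]
  exact_mod_cast n.factorial_ne_zero

variable (K) in
lemma symmetrizer_tensorId {m n L : ℕ} (h : m + n = L) :
    symmetrizer K L * tensorId n h (symmetrizer K m) = symmetrizer K L := by
  refine ringHom_symmetrizer_absorb 0 (by omega) (tensorId n h) (fun r x => smul_tensor' _ _ _ r x _)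
    fun i hi => ?_
  obtain ⟨r, hr⟩ := Nat.exists_eq_add_of_le hi
  have hL : i + 2 + (r + n) = L := by omega
  rw [zero_add, crossingAt_eq K m i r hr.symm, crossingAt_eq K L i (r + n) hL,
    ctx_eq i r hr.symm rfl hr.symm, tensorId_tensorId n r (r + n) hr.symm h rfl hL]
  exact (ctx_eq i (r + n) hL rfl hL _).symm

end CharZero

/-! ### Sliding a dotted cup -/

variable (K) in
-- This is neck cutting on the last two of three strands, precomposed with a cup on the first two.
-- The two correction terms end in an undotted cup, so they are invisible to any functional that
-- kills cups. What remains says that a dotted cup may pass from the left of a strand to its right.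
lemma dottedCup_slide :
    (tensor rfl rfl (add_zero 2) (dottedCup K) (1 : DHom K 1 1 0) : DHom K 1 3 2) +
      comp (add_zero 2) (mk .dot : DHom K 1 1 2)
        (tensor rfl rfl (add_zero 0) (mk .cup) (1 : DHom K 1 1 0)) =
    tensor rfl rfl (zero_add 2) (1 : DHom K 1 1 0) (dottedCup K) +
      comp (add_zero 2) (comp (zero_add 2)
        (tensor rfl rfl (add_zero 0) (mk .cup) (1 : DHom K 1 1 0) : DHom K 1 3 0)
        (tensor rfl rfl (zero_add 2) (1 : DHom K 1 1 0)
          (comp (add_zero 2) (tensor rfl rfl (add_zero 2) (mk .dot) (1 : DHom K 1 1 0)) (mk .cap)) :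
            DHom K 3 1 2))
        (tensor rfl rfl (add_zero 0) (1 : DHom K 1 1 0) (mk .cup) : DHom K 1 3 0) := by
  have neck : tensor rfl rfl (add_zero 2) (mk .dot) (1 : DHom K 1 1 0) +
      tensor rfl rfl (zero_add 2) (1 : DHom K 1 1 0) (mk .dot) =
      comp (add_zero 2) (comp (add_zero 2)
        (tensor rfl rfl (add_zero 2) (mk .dot) (1 : DHom K 1 1 0) : DHom K 2 2 2) (mk .cap))
        (mk .cup) + comp (zero_add 2) (mk .cap) (dottedCup K) := Quot.sound .neck
  have key := congrArg (fun x : DHom K 2 2 2 => comp (zero_add 2)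
    (tensor rfl rfl (add_zero 0) (mk .cup) (1 : DHom K 1 1 0) : DHom K 1 3 0)
    (tensor rfl rfl (zero_add 2) (1 : DHom K 1 1 0) x : DHom K 3 3 2)) neck
  simp only [tensor_add', comp_add'] at key
  -- The dot sits on the second leg of the cup; sliding it to the first leg gives the dotted cup in
  -- its standard form.
  have e₁ : comp (zero_add 2) (tensor rfl rfl (add_zero 0) (mk .cup) (1 : DHom K 1 1 0) :
      DHom K 1 3 0) (tensor rfl rfl (zero_add 2) (1 : DHom K 1 1 0)
        (tensor rfl rfl (add_zero 2) (mk .dot) (1 : DHom K 1 1 0) : DHom K 2 2 2)) =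
      tensor rfl rfl (add_zero 2) (dottedCup K) (1 : DHom K 1 1 0) := by
    rw [← gtensor_assoc (ab := 2) (ab' := 2) rfl rfl rfl rfl rfl rfl rfl rfl (zero_add 2)
      (add_zero 2), ← interchange rfl rfl rfl (zero_add 2) (add_zero 0) (add_zero 2), gid_comp]
    exact congrArg (fun x => tensor _ _ _ x _) (Quot.sound Rel.dot_cup.symm)
  -- The dot lies on the through strand, disjoint from the cup, so the two can be interchanged and
  -- the morphism ends in the cup.
  have e₂ : comp (zero_add 2) (tensor rfl rfl (add_zero 0) (mk .cup) (1 : DHom K 1 1 0) :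
      DHom K 1 3 0) (tensor rfl rfl (zero_add 2) (1 : DHom K 1 1 0)
        (tensor rfl rfl (zero_add 2) (1 : DHom K 1 1 0) (mk .dot) : DHom K 2 2 2)) =
      comp (add_zero 2) (mk .dot : DHom K 1 1 2)
        (tensor rfl rfl (add_zero 0) (mk .cup) (1 : DHom K 1 1 0)) := by
    rw [← gtensor_assoc (ab := 2) (ab' := 2) rfl rfl rfl rfl rfl rfl rfl rfl (add_zero 0)
      (zero_add 2), tensor_id_id, ← tensor_eq_comp rfl rfl (zero_add 2) rfl,
      tensor_eq_comp' rfl rfl (zero_add 2) (add_zero 2) rfl, gid_tensor]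
  -- The cap of the neck-cutting term meets the cup in front of it, and the zigzag relation
  -- straightens them to a strand.
  have e₃ : comp (zero_add 2) (tensor rfl rfl (add_zero 0) (mk .cup) (1 : DHom K 1 1 0) :
      DHom K 1 3 0) (tensor rfl rfl (zero_add 2) (1 : DHom K 1 1 0)
        (comp (zero_add 2) (mk .cap) (dottedCup K))) =
      tensor rfl rfl (zero_add 2) (1 : DHom K 1 1 0) (dottedCup K) := by
    rw [← gcomp_id (add_zero 0) (1 : DHom K 1 1 0),
      interchange (m₂ := 1) rfl rfl rfl (add_zero 0) (zero_add 2) (zero_add 2) (add_zero 0) (zero_add 2)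
        (zero_add 2), ← gcomp_assoc (add_zero 0) (zero_add 2), gcomp_id]
    exact (congrArg (fun x => comp (zero_add 2) x _) (zigzag_right K)).trans (gid_comp _ _)
  have e₄ : ∀ y : DHom K 2 0 2, comp (zero_add 2)
      (tensor rfl rfl (add_zero 0) (mk .cup) (1 : DHom K 1 1 0) : DHom K 1 3 0)
      (tensor rfl rfl (zero_add 2) (1 : DHom K 1 1 0) (comp (add_zero 2) y (mk .cup))) =
      comp (add_zero 2) (comp (zero_add 2)
        (tensor rfl rfl (add_zero 0) (mk .cup) (1 : DHom K 1 1 0) : DHom K 1 3 0)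
        (tensor rfl rfl (zero_add 2) (1 : DHom K 1 1 0) y : DHom K 3 1 2))
        (tensor rfl rfl (add_zero 0) (1 : DHom K 1 1 0) (mk .cup) : DHom K 1 3 0) := by
    intro y
    rw [gcomp_assoc (zero_add 2) (add_zero 2) (add_zero 2) (zero_add 2),
      ← interchange rfl rfl rfl (add_zero 0) (add_zero 2) (zero_add 2), gcomp_id]
  rw [e₁, e₂, e₃, e₄] at key
  rw [key, add_comm]

end DHom

end

noncomputable section

namespace DHom

variable {K : Type u} [Field K]

/-! ### Dots on the strands where a monomial has exponent zero -/

/-- Identification of morphism spaces in equal degrees. -/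
def dcast {a b : ℕ} {d e : ℤ} (h : d = e) (f : DHom K a b d) : DHom K a b e := h ▸ f

variable (K) in
/-- The identity strand if `b = 1` and the dot if `b = 0`. -/
def strand : ∀ (b : Fin 2) (e : ℤ), e = 2 - 2 * (b : ℕ) → DHom K 1 1 e
  | 0, _, h => dcast (by simpa using h.symm) (mk .dot)
  | 1, _, h => dcast (by simpa using h.symm) (1 : DHom K 1 1 0)

end DHom

lemma Mon.deg_zero (s : Mon 0) : s.deg = 0 := by simp [Mon.deg]

lemma Mon.deg_one (s : Mon 1) : s.deg = 2 * (s 0 : ℕ) - 1 := by simp [Mon.deg]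

lemma Mon.deg_two (s : Mon 2) : s.deg = 2 * (s 0 : ℕ) + 2 * (s 1 : ℕ) - 2 := by
  simp [Mon.deg, Fin.sum_univ_two]; ring

namespace DHom

variable {K : Type u} [Field K]

variable (K) in
/-- The endomorphism of `c ^ n` with a dot on each strand `i` such that `s i = 0`. -/
def dots : ∀ (n : ℕ) (s : Mon n) (e : ℤ), e = n - s.deg → DHom K n n e
  | 0, s, _, h => dcast (by rw [h, s.deg_zero]; simp) (1 : DHom K 0 0 0)
  | n + 1, s, e, h => tensor rfl rfl
      (by rw [h, Mon.deg_split (a := n) (b := 1) rfl s, Mon.deg_one]; push_cast; ring)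
      (dots n (Mon.split (a := n) (b := 1) rfl s).1 _ rfl)
      (strand K ((Mon.split (a := n) (b := 1) rfl s).2 0) _ rfl)

lemma dots_zero (s : Mon 0) (h : (0 : ℤ) = (0 : ℕ) - s.deg) : dots K 0 s 0 h = 1 := rfl

/-- The degrees of the two factors and the last exponent are free variables accompanied by
equations, so that the factorization applies whatever expressions for them occur. -/
lemma dots_succ (n : ℕ) (s : Mon (n + 1)) (e i j : ℤ) (h : e = (n + 1 : ℕ) - s.deg)
    (hi : i = n - (Mon.split (a := n) (b := 1) rfl s).1.deg) (x : Fin 2)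
    (hx : (Mon.split (a := n) (b := 1) rfl s).2 0 = x)
    (hj : j = 2 - 2 * (x : ℕ)) (hij : i + j = e) :
    dots K (n + 1) s e h = tensor rfl rfl hij
      (dots K n (Mon.split (a := n) (b := 1) rfl s).1 i hi) (strand K x j hj) := by
  subst hi hj hx
  rfl

lemma dots_one (s : Mon 1) (e : ℤ) (h : e = (1 : ℕ) - s.deg) (h' : e = 2 - 2 * (s 0 : ℕ)) :
    dots K 1 s e h = strand K (s 0) e h' := by
  rw [dots_succ 0 s e 0 e h (by rw [Mon.deg_zero]; rfl) (s 0) rfl h' (zero_add e), dots_zero, gid_tensor]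

/-- Induction on the right block: the last strand is peeled off on both sides, and strict
associativity regroups the rest. -/
lemma dots_split {a b m : ℕ} (hm : a + b = m) (s : Mon m) (e i j : ℤ) (h : e = m - s.deg)
    (hi : i = a - (Mon.split hm s).1.deg) (hj : j = b - (Mon.split hm s).2.deg) (hij : i + j = e) :
    dots K m s e h = tensor hm hm hij (dots K a (Mon.split hm s).1 i hi)
      (dots K b (Mon.split hm s).2 j hj) := by
  induction b generalizing m e j with
  | zero =>
    subst hm
    obtain rfl : j = 0 := by rw [hj, Mon.deg_zero]; simp
    obtain rfl : i = e := by omega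
    rw [dots_zero, gtensor_unit]
    rfl
  | succ b ih =>
    subst hm
    have hd := Mon.deg_split (a := b) (b := 1) rfl (Mon.split (a := a) (b := b + 1) rfl s).2
    rw [Mon.deg_one] at hd
    have hd' := Mon.deg_split (a := a) (b := b) rfl (Mon.split (a := a + b) (b := 1) rfl s).1
    have hij' : i + (b - (Mon.split (a := b) (b := 1) rfl
        (Mon.split (a := a) (b := b + 1) rfl s).2).1.deg) =
        (a + b : ℕ) - (Mon.split (a := a + b) (b := 1) rfl s).1.deg := by
      rw [hd', hi]; push_cast; exact (add_sub_add_comm _ _ _ _).symm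
    have hx : (Mon.split (a := a + b) (b := 1) rfl s).2 0 = (Mon.split (a := b) (b := 1) rfl
        (Mon.split (a := a) (b := b + 1) rfl s).2).2 0 :=
      congrFun (Mon.split_assoc₃ (a := a) (b := b) (c := 1) rfl rfl rfl rfl s) 0
    rw [dots_succ b (Mon.split (a := a) (b := b + 1) rfl s).2 j
        (b - (Mon.split (a := b) (b := 1) rfl (Mon.split (a := a) (b := b + 1) rfl s).2).1.deg) _
        hj rfl _ rfl rfl (by rw [hj, hd]; push_cast; ring),
      ← gtensor_assoc (ab := a + b) (ab' := a + b) rfl rfl rfl rfl rfl rfl rfl rfl hij' (by omega)]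
    refine (dots_succ (a + b) s e _ _ h rfl _ hx rfl (by
        have := Mon.deg_split (a := a + b) (b := 1) rfl s
        rw [Mon.deg_one, hx] at this
        rw [h, this]; push_cast; ring)).trans ?_
    rw [ih rfl (Mon.split (a := a + b) (b := 1) rfl s).1 _ _ rfl (by exact hi) rfl hij']
    rfl

lemma polM_tensor {a b a' b' m n : ℕ} {i j k : ℤ} (hm : a + a' = m) (hn : b + b' = n)
    (h : i + j = k) (f : DHom K a b i) (g : DHom K a' b' j) :
    polM (tensor hm hn h f g) = tenM hn hm (polM f) (polM g) := by
  induction f using Quot.ind with | _ f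
  induction g using Quot.ind with | _ g
  rfl

lemma polM_comp' {a b c : ℕ} {i j k : ℤ} (h : i + j = k) (f : DHom K a b i) (g : DHom K b c j) :
    polM (comp h f g) = polM g * polM f := polM_comp h f g

lemma polM_one {a : ℕ} : polM (1 : DHom K a a 0) = 1 := rfl

end DHom

/-! ### Families of functionals factoring through the Kirby color -/

/-- Linear maps from the spaces `Hom(c ^ a, c ^ n)`, `n ≥ 0`, to a fixed space `M` that are
compatible with the symmetrizers and with the dotted cups, in a fixed internal degree. -/
structure KirbyFamily (K : Type u) [Field K] (a : ℕ) (c : ℤ) (M : Type u) [AddCommGroup M]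
    [Module K M] where
  -- The inclusion of `c ^ n` in the Kirby color has degree `-n`, so `c` is the degree of the
  -- resulting morphism to the Kirby color.
  φ : ∀ (n : ℕ) (e : ℤ), e = c + n → (DHom K a n e →ₗ[K] M)
  sym : ∀ (n : ℕ) (e : ℤ) (h : e = c + n) (g : DHom K a n e),
    φ n e h (DHom.comp (add_zero e) g (DHom.symmetrizer K n)) = φ n e h g
  cup : ∀ (n : ℕ) (e e' : ℤ) (h : e = c + n) (h' : e' = c + (n + 2 : ℕ)) (hd : e + 2 = e')
    (g : DHom K a n e), φ (n + 2) e' h' (DHom.comp hd g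
      (DHom.tensor (add_zero n) rfl (zero_add 2) (1 : DHom K n n 0) (dottedCup K))) = φ n e h g

/-- Linear maps from the spaces `Hom(c ^ a, c ^ n)` to a fixed space `M` that vanish on cups and are
compatible with dotted cups on two strands. -/
structure StrandFamily (K : Type u) [Field K] (a : ℕ) (c : ℤ) (M : Type u) [AddCommGroup M]
    [Module K M] where
  φ : ∀ (n : ℕ) (e : ℤ), e = c + n → (DHom K a n e →ₗ[K] M)
  cup : ∀ (e : ℤ) (h : e = c + (2 : ℕ)) (g : DHom K a 0 e),
    φ 2 e h (DHom.comp (add_zero e) g (DHom.mk .cup)) = 0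
  dottedCup : ∀ (e e' : ℤ) (h : e = c + (0 : ℕ)) (h' : e' = c + (2 : ℕ)) (hd : e + 2 = e')
    (g : DHom K a 0 e), φ 2 e' h' (DHom.comp hd g (dottedCup K)) = φ 0 e h g

open Classical in
/-- The value on the endomorphism `dots s`, if it has the right degree. -/
def dotsValue {K : Type u} [Field K] {a : ℕ} {c : ℤ} {M : Type u} [AddCommGroup M] [Module K M]
    (φ : ∀ (n : ℕ) (e : ℤ), e = c + n → (DHom K a n e →ₗ[K] M)) (s : Mon a) : M :=
  -- The endomorphism `dots s` has degree `a - s.deg`, and this equals `c + a` exactly when `s.deg =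
  -- -c`. The default value 0 lets sums run over all monomials, without a restriction on the degree.
  if h : s.deg = -c then φ a (a - s.deg) (by omega) (DHom.dots K a s _ rfl) else 0

section

variable {K : Type u} [Field K] {a : ℕ} {c : ℤ} {M : Type u} [AddCommGroup M] [Module K M]

lemma dotsValue_eq (φ : ∀ (n : ℕ) (e : ℤ), e = c + n → (DHom K a n e →ₗ[K] M)) (s : Mon a)
    (e : ℤ) (h : e = a - s.deg) (h' : e = c + a) :
    dotsValue φ s = φ a e h' (DHom.dots K a s e h) := by
  subst h
  rw [dotsValue, dif_pos (by omega)]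

lemma dotsValue_eq_zero (φ : ∀ (n : ℕ) (e : ℤ), e = c + n → (DHom K a n e →ₗ[K] M)) (s : Mon a)
    (h : s.deg ≠ -c) : dotsValue φ s = 0 := by
  rw [dotsValue, dif_neg h]

namespace KirbyFamily

variable (Φ : KirbyFamily K a c M)

/-- A symmetrizer may be inserted under `φ` without changing the value, and it kills the cup. -/
lemma wh_cup [CharZero K] {m n : ℕ} (l r : ℕ) (hm : l + 0 + r = m) (hn : l + 2 + r = n) (e : ℤ)
    (h : e = c + n) (g : DHom K a m e) :
    Φ.φ n e h (DHom.comp (add_zero e) g (DHom.wh l r hm hn (DHom.mk .cup : DHom K 0 2 0))) = 0 := by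
  rw [← Φ.sym, DHom.gcomp_assoc (add_zero e) (add_zero e) (add_zero 0) (add_zero e),
    DHom.wh_cup_symmetrizer, DHom.comp_zero', map_zero]

/-- Induction on the number `r` of strands to the right of the dotted cup. With no such strand this
is the defining property `cup`; otherwise `dottedCup_slide` moves the dotted cup past one strand,
and `φ` kills both correction terms because they end in a cup. -/
lemma wh_dottedCup [CharZero K] {m n : ℕ} (l r : ℕ) (hm : l + 0 + r = m) (hn : l + 2 + r = n)
    (e e' : ℤ) (h : e = c + m) (h' : e' = c + n) (hd : e + 2 = e') (g : DHom K a m e) :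
    Φ.φ n e' h' (DHom.comp hd g (DHom.wh l r hm hn (dottedCup K))) = Φ.φ m e h g := by
  induction r generalizing l m n with
  | zero =>
    subst hm hn
    refine Eq.trans ?_ (Φ.cup l e e' h h' hd g)
    rw [DHom.wh, DHom.gtensor_unit]
  | succ r ih =>
    rw [← ih (l + 1) (by omega) (by omega) h h' g]
    have key := congrArg (fun x => Φ.φ n e' h' (DHom.comp hd g
      (DHom.wh (m := m) (n := n) l r (by omega) (by omega) x))) (DHom.dottedCup_slide K)
    simp only [← DHom.whL_apply 2, map_add] at key
    simp only [DHom.whL_apply, DHom.comp_add', map_add] at key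
    rw [DHom.wh_tensor_id (q := r + 1) l r rfl rfl (by omega) (by omega) (by omega) hm hn,
      DHom.wh_id_tensor (q := l + 1) l r rfl rfl (by omega) (by omega) rfl (by omega) (by omega),
      DHom.wh_comp (n := m) l r (by omega) (by omega) (by omega),
      DHom.wh_comp (n := m) l r (by omega) (by omega) (by omega),
      DHom.wh_tensor_id (q := r + 1) l r rfl rfl (by omega) (by omega) (by omega) hm hn,
      DHom.wh_id_tensor (q := l + 1) l r rfl rfl (by omega) (by omega) rfl (by omega) (by omega),
      ← DHom.gcomp_assoc hd (add_zero e') (add_zero 2) hd, Φ.wh_cup,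
      ← DHom.gcomp_assoc hd (add_zero e') (add_zero 2) hd, Φ.wh_cup, add_zero, add_zero] at key
    exact key

/-- Precomposition with a morphism of the dotted Temperley-Lieb category. -/
def pull {b : ℕ} {d c' : ℤ} (hc : d + c' = c) (x : DHom K a b d) : KirbyFamily K b c' M where
  φ n e h := Φ.φ n (d + e) (by omega) ∘ₗ DHom.compL rfl x
  sym n e h g := by
    refine Eq.trans ?_ (Φ.sym n (d + e) (by omega) (DHom.comp rfl x g))
    rw [DHom.gcomp_assoc rfl (add_zero _) (add_zero e) rfl]
    rfl
  cup n e e' h h' hd g := by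
    refine Eq.trans ?_ (Φ.cup n (d + e) (d + e') (by omega) (by omega) (by omega)
      (DHom.comp rfl x g))
    rw [DHom.gcomp_assoc rfl _ hd rfl]
    rfl

lemma pull_φ {b n : ℕ} {d c' e e' : ℤ} (hc : d + c' = c) (x : DHom K a b d) (h : e = c' + n)
    (h' : d + e = e') (h'' : e' = c + n) (g : DHom K b n e) :
    (Φ.pull hc x).φ n e h g = Φ.φ n e' h'' (DHom.comp h' x g) := by
  subst h'
  rfl

end KirbyFamily

end

end

noncomputable section

/-! ### Functionals on the Kirby color see morphisms through the polynomial representation -/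

section

variable {K : Type u} [Field K]

open DHom

/-- The monomial in `l + a + r` variables with given factors. -/
def Mon.join {l a r m : ℕ} (h : l + a + r = m) (s₁ : Mon l) (s₂ : Mon a) (s₃ : Mon r) : Mon m :=
  (Mon.split h).symm ((Mon.split rfl).symm (s₁, s₂), s₃)

lemma Mon.deg_join {l a r m : ℕ} (h : l + a + r = m) (s₁ : Mon l) (s₂ : Mon a) (s₃ : Mon r) :
    (Mon.join h s₁ s₂ s₃).deg = s₁.deg + s₂.deg + s₃.deg := by
  rw [Mon.deg_split h, Mon.join, Equiv.apply_symm_apply, Mon.deg_split (a := l) (b := a) rfl,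
    Equiv.apply_symm_apply]

lemma Mon.join_surj {l a r m : ℕ} (h : l + a + r = m) (s : Mon m) :
    ∃ s₁ s₂ s₃, Mon.join h s₁ s₂ s₃ = s :=
  ⟨(Mon.split rfl (Mon.split h s).1).1, (Mon.split rfl (Mon.split h s).1).2, (Mon.split h s).2, by
    rw [Mon.join, Prod.mk.eta, Equiv.symm_apply_apply, Prod.mk.eta, Equiv.symm_apply_apply]⟩

lemma DHom.dots_join {l a r m : ℕ} (h : l + a + r = m) (s₁ : Mon l) (s₂ : Mon a) (s₃ : Mon r)
    (e i j k : ℤ) (he : e = m - (Mon.join h s₁ s₂ s₃).deg) (hi : i = l - s₁.deg)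
    (hj : j = a - s₂.deg) (hk : k = r - s₃.deg) (hd : i + j + k = e) :
    dots K m (Mon.join h s₁ s₂ s₃) e he =
      tensor₃ h h hd (dots K l s₁ i hi) (dots K a s₂ j hj) (dots K r s₃ k hk) := by
  have h₁ : Mon.split h (Mon.join h s₁ s₂ s₃) = ((Mon.split rfl).symm (s₁, s₂), s₃) :=
    Equiv.apply_symm_apply _ _
  have h₂ : Mon.split (a := l) (b := a) rfl (Mon.split h (Mon.join h s₁ s₂ s₃)).1 = (s₁, s₂) := by
    rw [h₁, Equiv.apply_symm_apply]
  have e₁ := congrArg Prod.fst h₂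
  have e₂ := congrArg Prod.snd h₂
  have e₃ := congrArg Prod.snd h₁
  dsimp only at e₁ e₂ e₃
  have hd₁ := Mon.deg_split (a := l) (b := a) rfl (Mon.split h (Mon.join h s₁ s₂ s₃)).1
  rw [e₁, e₂] at hd₁
  rw [dots_split h _ e (i + j) k he (by rw [hd₁]; push_cast; omega) (by rw [e₃]; exact hk) hd,
    dots_split rfl _ (i + j) i j _ (by rw [e₁]; exact hi) (by rw [e₂]; exact hj) rfl, tensor₃]
  have c : ∀ {n : ℕ} {s s' : Mon n} (_ : s = s') (e : ℤ) (h : e = n - s.deg) (h' : e = n - s'.deg),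
      dots K n s e h = dots K n s' e h' := by
    intro n s s' hs e h h'
    subst hs
    rfl
  rw [c e₁ i _ hi, c e₂ j _ hj, c e₃ k _ hk]

/-- The matrix identity that expresses that a morphism `x` of the dotted Temperley-Lieb category acts
on the endomorphisms `dots s` in the same way as in the polynomial representation, modulo the
Kirby color. -/
def DHom.ActsPolynomially {a b : ℕ} {d : ℤ} (x : DHom K a b d) : Prop :=
  ∀ (M : Type u) [AddCommGroup M] [Module K M] (c c' : ℤ) (hc : d + c' = c)
    (Φ : KirbyFamily K a c M) (s : Mon b),
    dotsValue (Φ.pull hc x).φ s = ∑ t, polM x s t • dotsValue Φ.φ t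

/-- The analogue of `ActsPolynomially` for strand families. -/
def DHom.ActsOnStrands {a b : ℕ} {d : ℤ} (x : DHom K a b d) : Prop :=
  ∀ (M : Type u) [AddCommGroup M] [Module K M] (c : ℤ)
    (Φ : StrandFamily K a c M) (s : Mon b) (i e : ℤ) (hi : i = b - s.deg) (he : d + i = e)
    (h : e = c + b),
    Φ.φ b e h (DHom.comp he x (dots K b s i hi)) = ∑ t, polM x s t • dotsValue Φ.φ t

/-- The strand family obtained by fixing the morphisms on the strands to the left and to the
right. -/
def KirbyFamily.middle [CharZero K] {l a r m : ℕ} {c c' i k : ℤ} {M : Type u} [AddCommGroup M] [Module K M]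
    (Φ : KirbyFamily K m c M) (h : l + a + r = m) (x : DHom K l l i) (y : DHom K r r k)
    (hc : c' + i + k = c + l + r) : StrandFamily K a c' M where
  φ n e he :=
    { toFun := fun g => Φ.φ (l + n + r) (i + e + k) (by push_cast; omega) (tensor₃ h rfl rfl x g y)
      map_add' := fun g g' => by
        rw [tensor₃, tensor_add', add_tensor', map_add]
        rfl
      map_smul' := fun t g => by
        rw [tensor₃, tensor_smul', smul_tensor', map_smul]
        rfl }
  cup e he g := by
    have h₁ := tensor₃_comp (m₂ := l + 0 + r) h rfl rfl (add_zero i) (add_zero e) (add_zero k)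
      (rfl : _ = i + e + k) rfl (by omega) (add_zero _) x (1 : DHom K l l 0) g
      (DHom.mk .cup : DHom K 0 2 0) y (1 : DHom K r r 0)
    rw [gcomp_id, gcomp_id, ← wh_eq_tensor₃] at h₁
    exact (congrArg (Φ.φ (l + 2 + r) (i + e + k) (by push_cast at *; omega)) h₁).trans
      (Φ.wh_cup l r rfl rfl _ _ _)
  dottedCup e e' he he' hd g := by
    have h₁ := tensor₃_comp (m₂ := l + 0 + r) (r := k) (p := i) (l' := 2) h rfl rfl (add_zero i) hd (add_zero k)
      (rfl : _ = i + e' + k) (rfl : _ = i + e + k) (by omega) (by omega) x (1 : DHom K l l 0) g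
      (GradedLinear.dottedCup K) y (1 : DHom K r r 0)
    rw [gcomp_id, gcomp_id, ← wh_eq_tensor₃] at h₁
    exact (congrArg (Φ.φ (l + 2 + r) (i + e' + k) (by push_cast at *; omega)) h₁).trans
      (Φ.wh_dottedCup l r rfl rfl (i + e + k) (i + e' + k)
        (by push_cast at *; omega) _ (by omega) _)

lemma KirbyFamily.middle_φ [CharZero K] {l a r m n N : ℕ} {c c' i k e E : ℤ} {M : Type u}
    [AddCommGroup M] [Module K M] (Φ : KirbyFamily K m c M) (h : l + a + r = m) (x : DHom K l l i)
    (y : DHom K r r k) (hc : c' + i + k = c + l + r) (he : e = c' + n) (hN : l + n + r = N)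
    (hE : i + e + k = E) (hE' : E = c + N) (g : DHom K a n e) :
    (Φ.middle h x y hc).φ n e he g = Φ.φ N E hE' (tensor₃ h hN hE x g y) := by
  subst hN hE
  rfl

lemma polM_wh {a b l r m n : ℕ} {d : ℤ} (hm : l + a + r = m) (hn : l + b + r = n)
    (x : DHom K a b d) (s₁ t₁ : Mon l) (s₂ : Mon b) (t₂ : Mon a) (s₃ t₃ : Mon r) :
    polM (wh l r hm hn x) (Mon.join hn s₁ s₂ s₃) (Mon.join hm t₁ t₂ t₃) =
      (if s₁ = t₁ then 1 else 0) * polM x s₂ t₂ * (if s₃ = t₃ then 1 else 0) := by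
  rw [wh, polM_tensor, tenM_apply, Mon.join, Mon.join, Equiv.apply_symm_apply,
    Equiv.apply_symm_apply, polM_tensor, tenM_apply, Equiv.apply_symm_apply,
    Equiv.apply_symm_apply, polM_one, polM_one, Matrix.one_apply, Matrix.one_apply]

lemma sum_join {M : Type u} [AddCommGroup M] {l a r m : ℕ} (h : l + a + r = m)
    (f : Mon m → M) : ∑ t, f t = ∑ t₁, ∑ t₂, ∑ t₃, f (Mon.join h t₁ t₂ t₃) := by
  rw [← (Mon.split h).symm.sum_comp, Fintype.sum_prod_type, ← (Mon.split rfl).symm.sum_comp,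
    Fintype.sum_prod_type]
  rfl

/-- Matrices are homogeneous: a nonzero entry in row `s` forces `s.deg = t.deg + d`, so `t` is then
in the wrong degree as well and its value is the default 0. This settles the off-degree rows of
`ActsPolynomially`. -/
lemma sum_polM_eq_zero {a b : ℕ} {d c c' : ℤ} {M : Type u} [AddCommGroup M] [Module K M]
    (hc : d + c' = c) (x : DHom K a b d)
    (φ : ∀ (n : ℕ) (e : ℤ), e = c + n → (DHom K a n e →ₗ[K] M)) (s : Mon b) (hs : s.deg ≠ -c') :
    ∑ t, polM x s t • dotsValue φ t = 0 := by
  refine Finset.sum_eq_zero fun t _ => ?_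
  by_cases hx : polM x s t = 0
  · rw [hx, zero_smul]
  · rw [dotsValue_eq_zero φ t, smul_zero]
    have := polM_deg x hx
    omega

/-- Fixing the dots on the outer strands turns the Kirby family into a strand family for the middle
strands. The matrix of the whiskered morphism is the identity in the outer indices, so the sum over
monomials collapses to the middle factor. -/
lemma DHom.ActsOnStrands.wh [CharZero K] {a b l r m n : ℕ} {d : ℤ} {x : DHom K a b d} (H : ActsOnStrands x)
    (hm : l + a + r = m) (hn : l + b + r = n) : ActsPolynomially (wh l r hm hn x) := by
  intro M _ _ c c' hc Φ s
  by_cases hs : s.deg = -c'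
  swap
  · rw [dotsValue_eq_zero _ _ hs, sum_polM_eq_zero hc _ _ _ hs]
  obtain ⟨s₁, s₂, s₃, rfl⟩ := Mon.join_surj hn s
  have hsd := Mon.deg_join hn s₁ s₂ s₃
  -- The degree `c + s₁.deg + s₃.deg` of the middle family is forced: the outer dots have degrees `l
  -- - s₁.deg` and `r - s₃.deg`, and the outer strands account for `l + r`.
  have hcm : (c + s₁.deg + s₃.deg) + (l - s₁.deg) + (r - s₃.deg) = c + l + r := by omega
  set Ψ := Φ.middle hm (dots K l s₁ _ rfl) (dots K r s₃ _ rfl) hcm with hΨ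
  have hL : dotsValue (Φ.pull hc (DHom.wh l r hm hn x)).φ (Mon.join hn s₁ s₂ s₃) =
      Ψ.φ b (d + (b - s₂.deg)) (by omega) (comp rfl x (dots K b s₂ _ rfl)) := by
    rw [dotsValue_eq _ _ _ rfl (by omega), KirbyFamily.pull_φ _ hc _ _ rfl (by omega),
      dots_join hn s₁ s₂ s₃ _ (l - s₁.deg) (b - s₂.deg) (r - s₃.deg) rfl rfl rfl rfl
        (by push_cast [← hn]; omega),
      wh_eq_tensor₃ l r hm hn (by omega), ← tensor₃_comp (q := d + (b - s₂.deg)) hm hn hn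
        (zero_add _) rfl (zero_add _) (by push_cast [← hn]; omega), gid_comp, gid_comp, hΨ,
        KirbyFamily.middle_φ]
  rw [hL, H M _ Ψ s₂ _ _ rfl rfl (by omega), sum_join hm, Finset.sum_eq_single s₁]
  rotate_left
  · intro t₁ _ ht
    refine Finset.sum_eq_zero fun t₂ _ => Finset.sum_eq_zero fun t₃ _ => ?_
    rw [polM_wh, if_neg (Ne.symm ht), zero_mul, zero_mul, zero_smul]
  · simp
  refine Finset.sum_congr rfl fun t₂ _ => ?_
  rw [Finset.sum_eq_single s₃]
  rotate_left
  · intro t₃ _ ht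
    rw [polM_wh, if_neg (Ne.symm ht), mul_zero, zero_smul]
  · simp
  rw [polM_wh, if_pos rfl, if_pos rfl, one_mul, mul_one]
  congr 1
  have htd := Mon.deg_join hm s₁ t₂ s₃
  by_cases ht : t₂.deg = -(c + s₁.deg + s₃.deg)
  · rw [dotsValue_eq Φ.φ _ _ rfl (by omega), dotsValue_eq Ψ.φ _ (a - t₂.deg) rfl (by omega),
      dots_join hm s₁ t₂ s₃ _ (l - s₁.deg) (a - t₂.deg) (r - s₃.deg) rfl rfl rfl rfl
        (by push_cast [← hm]; omega), hΨ, KirbyFamily.middle_φ]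
  · rw [dotsValue_eq_zero _ _ ht, dotsValue_eq_zero]
    omega

lemma Mon.ext_one {s : Mon 1} {x : Fin 2} (h : s 0 = x) : s = ![x] :=
  funext fun i => by rw [Subsingleton.elim i 0, h]; rfl

lemma Mon.ext_two {s : Mon 2} {x y : Fin 2} (h : s 0 = x) (h' : s 1 = y) : s = ![x, y] :=
  funext fun i => by fin_cases i <;> simp [h, h']

lemma DHom.dots_two (s : Mon 2) (e i j : ℤ) (h : e = (2 : ℕ) - s.deg) (x y : Fin 2) (hx : s 0 = x)
    (hy : s 1 = y) (hi : i = 2 - 2 * (x : ℕ)) (hj : j = 2 - 2 * (y : ℕ)) (hij : i + j = e) :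
    dots K 2 s e h = tensor rfl rfl hij (strand K x i hi) (strand K y j hj) := by
  subst hx hy
  rw [dots_split (a := 1) (b := 1) rfl s e i j h (by rw [Mon.deg_one, hi]; push_cast; ring_nf; rfl)
    (by rw [Mon.deg_one, hj]; push_cast; ring_nf; rfl) hij,
    dots_one _ i _ (by exact hi), dots_one _ j _ (by exact hj)]
  rfl

variable (K) in
-- On a strand that already carries a dot, the square of the dot is zero. On a bare strand, the new
-- dot is the value at the monomial `1`.
lemma dot_actsOnStrands : ActsOnStrands (DHom.mk (.dot) : DHom K 1 1 2) := by
  intro M _ _ c Φ s i e hi he h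
  have hm : ∀ t : Mon 1, polM (DHom.mk (.dot) : DHom K 1 1 2) s t = dotM K s t := fun t => rfl
  obtain ⟨x, rfl⟩ : ∃ x, s = ![x] := ⟨s 0, Mon.ext_one rfl⟩
  have hi' : i = 2 - 2 * (x : ℕ) := by rw [hi, Mon.deg_one, Matrix.cons_val_zero]; push_cast; ring
  rw [dots_one ![x] i hi hi']
  obtain rfl | rfl : x = 0 ∨ x = 1 := by omega
  · obtain rfl : i = 2 := by simpa using hi'
    obtain rfl : e = 4 := by omega
    refine Eq.trans ?_ (Finset.sum_eq_zero fun t _ => ?_).symm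
    · refine (congrArg _ ?_).trans (map_zero _)
      exact Quot.sound .dot_dot
    · rw [hm, dotM, if_neg, zero_smul]
      rintro ⟨_, h⟩
      exact absurd (congrFun h 0) (by simp)
  · obtain rfl : i = 0 := by simpa using hi'
    obtain rfl : e = 2 := by omega
    refine (congrArg (Φ.φ 1 2 h) (gcomp_id he _)).trans ?_
    rw [Finset.sum_eq_single ![0]]
    · rw [hm, dotM, if_pos ⟨rfl, rfl⟩, one_smul, dotsValue_eq _ _ 2 (by simp [Mon.deg_one]) h,
        dots_one ![0] 2 _ rfl]
      rfl
    · intro t _ ht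
      rw [hm, dotM, if_neg (fun h => ht h.1), zero_smul]
    · simp

variable (K) in
-- Four rows, according to the dots on the two legs. Two dots give zero, one dot makes a dotted cup,
-- which does not change the value, and no dot leaves a cup, which is killed. So exactly the rows
-- `x_1` and `x_2` contain a 1.
lemma cup_actsOnStrands : ActsOnStrands (DHom.mk (.cup) : DHom K 0 2 0) := by
  intro M _ _ c Φ s i e hi he h
  obtain rfl : i = e := by omega
  have hm : ∀ t : Mon 0, polM (DHom.mk (.cup) : DHom K 0 2 0) s t = cupM K s t := fun t => rfl
  rw [Fintype.sum_eq_single default (fun t ht => absurd (Subsingleton.elim _ _) ht), hm]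
  obtain ⟨x, y, rfl⟩ : ∃ x y, s = ![x, y] := ⟨s 0, s 1, Mon.ext_two rfl rfl⟩
  have hi' : i = 4 - 2 * (x : ℕ) - 2 * (y : ℕ) := by
    rw [hi, Mon.deg_two, Matrix.cons_val_zero, Matrix.cons_val_one]
    push_cast
    ring
  rw [dots_two ![x, y] i (2 - 2 * (x : ℕ)) (2 - 2 * (y : ℕ)) hi x y rfl rfl rfl rfl
    (by rw [hi']; ring)]
  have e₁ : comp (zero_add 2) (DHom.mk (.cup) : DHom K 0 2 0)
      (tensor rfl rfl (add_zero 2) (DHom.mk .dot) (1 : DHom K 1 1 0) : DHom K 2 2 2) =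
      dottedCup K := rfl
  have e₂ : comp (zero_add 2) (DHom.mk (.cup) : DHom K 0 2 0)
      (tensor rfl rfl (zero_add 2) (1 : DHom K 1 1 0) (DHom.mk .dot) : DHom K 2 2 2) =
      dottedCup K := (Quot.sound Rel.dot_cup).symm
  have hval : ∀ (h' : (0 : ℤ) = c + (0 : ℕ)) (h : (2 : ℤ) = c + (2 : ℕ)),
      Φ.φ 2 2 h (dottedCup K) = dotsValue Φ.φ default := by
    intro h' h
    rw [dotsValue_eq _ _ 0 (by rw [Mon.deg_zero]; simp) h',
      ← Φ.dottedCup 0 2 h' h (zero_add 2), dots_zero, gid_comp]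
  obtain rfl | rfl : x = 0 ∨ x = 1 := by omega
  · obtain rfl | rfl : y = 0 ∨ y = 1 := by omega
    · obtain rfl : i = 4 := by simpa using hi'
      rw [cupM, if_neg (by decide), zero_smul]
      refine (congrArg (Φ.φ 2 4 h) ?_).trans (map_zero _)
      -- The first dot is slid along the cup to the second leg, where it meets the other dot.
      refine (congrArg (fun z : DHom K 2 2 4 => comp (zero_add 4) (DHom.mk .cup : DHom K 0 2 0) z)
        (tensor_eq_comp (b := 1) rfl rfl (two_add_two_eq_four) rfl (DHom.mk .dot)
          (DHom.mk .dot))).trans ?_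
      rw [← gcomp_assoc (zero_add 2) two_add_two_eq_four two_add_two_eq_four (zero_add 4)]
      refine (congrArg (fun z : DHom K 0 2 2 => comp two_add_two_eq_four z _) (e₁.trans e₂.symm)).trans ?_
      rw [gcomp_assoc (zero_add 2) two_add_two_eq_four two_add_two_eq_four (zero_add 4),
        ← interchange rfl rfl rfl (add_zero 0) two_add_two_eq_four (zero_add 4)]
      have : comp two_add_two_eq_four (DHom.mk .dot) (DHom.mk .dot) = (0 : DHom K 1 1 4) :=
        Quot.sound .dot_dot
      refine (congrArg (fun z : DHom K 1 1 4 => comp (zero_add 4) (DHom.mk .cup)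
        (tensor rfl rfl (zero_add 4) (comp (add_zero 0) (1 : DHom K 1 1 0) (1 : DHom K 1 1 0)) z :
          DHom K 2 2 4)) this).trans ?_
      rw [tensor_zero', comp_zero']
    · obtain rfl : i = 2 := by simpa using hi'
      rw [cupM, if_pos (by decide), one_smul]
      exact (congrArg (Φ.φ 2 2 h) e₁).trans (hval (by omega) h)
  · obtain rfl | rfl : y = 0 ∨ y = 1 := by omega
    · obtain rfl : i = 2 := by simpa using hi'
      rw [cupM, if_pos (by decide), one_smul]
      exact (congrArg (Φ.φ 2 2 h) e₂).trans (hval (by omega) h)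
    · obtain rfl : i = 0 := by simpa using hi'
      rw [cupM, if_neg (by decide), zero_smul]
      refine (congrArg (Φ.φ 2 0 h) ?_).trans (Φ.cup 0 h (1 : DHom K 0 0 0))
      rw [gid_comp]
      refine (congrArg (fun z : DHom K 2 2 0 => comp he (DHom.mk .cup) z)
        (tensor_id_id (K := K) (a := 1) (b := 1) rfl)).trans ?_
      exact gcomp_id _ _

variable (K) in
-- Applying the functional to neck cutting, the term ending in a cup dies and the term ending in a
-- dotted cup becomes the value of the cap. The left-hand side is the sum of the two placements of
-- one dot, that is, of the values at `x_2` and `x_1`.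
lemma cap_actsOnStrands : ActsOnStrands (DHom.mk (.cap) : DHom K 2 0 0) := by
  intro M _ _ c Φ s i e hi he h
  obtain rfl : i = 0 := by rw [hi, Mon.deg_zero]; simp
  obtain rfl : e = 0 := by omega
  have hm : ∀ t : Mon 2, polM (DHom.mk (.cap) : DHom K 2 0 0) s t = capM K s t := fun t => rfl
  have neck : tensor rfl rfl (add_zero 2) (mk .dot) (1 : DHom K 1 1 0) +
      tensor rfl rfl (zero_add 2) (1 : DHom K 1 1 0) (mk .dot) =
      comp (add_zero 2) (comp (add_zero 2)
        (tensor rfl rfl (add_zero 2) (mk .dot) (1 : DHom K 1 1 0) : DHom K 2 2 2) (mk .cap))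
        (mk .cup) + comp (zero_add 2) (mk .cap) (dottedCup K) := Quot.sound .neck
  have h₂ : (2 : ℤ) = c + (2 : ℕ) := by push_cast at *; omega
  have key := congrArg (Φ.φ 2 2 h₂) neck
  rw [map_add, map_add, Φ.cup, Φ.dottedCup 0 2 h h₂, zero_add] at key
  rw [Fintype.sum_eq_add ![1, 0] ![0, 1] (by decide), hm, hm,
    show capM K s ![1, 0] = 1 from if_pos (by decide),
    show capM K s ![0, 1] = 1 from if_pos (by decide), one_smul, one_smul,
    dotsValue_eq _ ![1, 0] 2 (by simp [Mon.deg_two]) h₂,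
    dotsValue_eq _ ![0, 1] 2 (by simp [Mon.deg_two]) h₂,
    dots_two ![1, 0] 2 0 2 _ 1 0 rfl rfl rfl rfl rfl,
    dots_two ![0, 1] 2 2 0 _ 0 1 rfl rfl rfl rfl rfl]
  · refine (congrArg (Φ.φ 0 0 h) (gcomp_id he _)).trans (key.symm.trans (add_comm _ _))
  · rintro t ⟨h₁, h₂⟩
    rw [hm, capM, if_neg (by tauto), zero_smul]

/-- Pulling back along a composite is pulling back twice, first along `x` and then along `y`.
Expanding row `s` of `y` and then the rows of `x` produces the matrix product. -/
lemma DHom.ActsPolynomially.comp {a b c : ℕ} {i j k : ℤ} {x : DHom K a b i} {y : DHom K b c j}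
    (hx : ActsPolynomially x) (hy : ActsPolynomially y) (h : i + j = k) :
    ActsPolynomially (DHom.comp h x y) := by
  intro M _ _ d d' hd Φ s
  have h₁ : dotsValue (Φ.pull hd (DHom.comp h x y)).φ s =
      dotsValue ((Φ.pull (c' := j + d') (by omega) x).pull rfl y).φ s := by
    by_cases hs : s.deg = -d'
    · rw [dotsValue_eq _ _ _ rfl (by omega), dotsValue_eq _ _ _ rfl (by omega),
        KirbyFamily.pull_φ _ hd _ _ rfl (by omega), KirbyFamily.pull_φ _ rfl _ _ rfl (by omega),
        Φ.pull_φ _ _ _ (e' := k + (c - s.deg)) (by omega) (by omega),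
        gcomp_assoc h rfl rfl (by omega)]
    · rw [dotsValue_eq_zero _ _ hs, dotsValue_eq_zero _ _ hs]
  rw [h₁, hy M _ _ rfl, Finset.sum_congr rfl fun t _ => by rw [hx M _ _ (by omega) Φ t]]
  simp only [Finset.smul_sum, smul_smul, polM_comp', Matrix.mul_apply, Finset.sum_smul]
  exact Finset.sum_comm

lemma dotsValue_pull_add {a b : ℕ} {d c c' : ℤ} {M : Type u} [AddCommGroup M] [Module K M]
    (hc : d + c' = c) (Φ : KirbyFamily K a c M) (x y : DHom K a b d) (s : Mon b) :
    dotsValue (Φ.pull hc (x + y)).φ s =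
      dotsValue (Φ.pull hc x).φ s + dotsValue (Φ.pull hc y).φ s := by
  by_cases hs : s.deg = -c'
  · rw [dotsValue_eq _ _ _ rfl (by omega), dotsValue_eq _ _ _ rfl (by omega),
      dotsValue_eq _ _ _ rfl (by omega), KirbyFamily.pull_φ _ hc _ _ rfl (by omega),
      KirbyFamily.pull_φ _ hc _ _ rfl (by omega), KirbyFamily.pull_φ _ hc _ _ rfl (by omega),
      add_comp', map_add]
  · rw [dotsValue_eq_zero _ _ hs, dotsValue_eq_zero _ _ hs, dotsValue_eq_zero _ _ hs, add_zero]

lemma dotsValue_pull_smul {a b : ℕ} {d c c' : ℤ} {M : Type u} [AddCommGroup M] [Module K M]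
    (hc : d + c' = c) (Φ : KirbyFamily K a c M) (r : K) (x : DHom K a b d) (s : Mon b) :
    dotsValue (Φ.pull hc (r • x)).φ s = r • dotsValue (Φ.pull hc x).φ s := by
  by_cases hs : s.deg = -c'
  · rw [dotsValue_eq _ _ _ rfl (by omega), dotsValue_eq _ _ _ rfl (by omega),
      KirbyFamily.pull_φ _ hc _ _ rfl (by omega),
      KirbyFamily.pull_φ _ hc _ _ rfl (by omega), smul_comp', map_smul]
  · rw [dotsValue_eq_zero _ _ hs, dotsValue_eq_zero _ _ hs, smul_zero]

lemma DHom.ActsPolynomially.add {a b : ℕ} {d : ℤ} {x y : DHom K a b d}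
    (hx : ActsPolynomially x) (hy : ActsPolynomially y) : ActsPolynomially (x + y) := by
  intro M _ _ c c' hc Φ s
  rw [dotsValue_pull_add, hx M _ _ hc, hy M _ _ hc, ← Finset.sum_add_distrib]
  exact Finset.sum_congr rfl fun t _ => by rw [map_add, Matrix.add_apply, add_smul]

lemma DHom.ActsPolynomially.smul {a b : ℕ} {d : ℤ} {x : DHom K a b d}
    (hx : ActsPolynomially x) (r : K) : ActsPolynomially (r • x) := by
  intro M _ _ c c' hc Φ s
  rw [dotsValue_pull_smul, hx M _ _ hc, Finset.smul_sum]
  exact Finset.sum_congr rfl fun t _ => by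
    rw [map_smul, Matrix.smul_apply, smul_assoc]

lemma actsPolynomially_one {a : ℕ} : ActsPolynomially (1 : DHom K a a 0) := by
  intro M _ _ c c' hc Φ s
  obtain rfl : c' = c := by omega
  have h₁ : dotsValue (Φ.pull hc (1 : DHom K a a 0)).φ s = dotsValue Φ.φ s := by
    by_cases hs : s.deg = -c'
    · rw [dotsValue_eq _ _ _ rfl (by omega), dotsValue_eq _ _ _ rfl (by omega),
        KirbyFamily.pull_φ _ hc _ _ (zero_add _) (by omega), gid_comp]
    · rw [dotsValue_eq_zero _ _ hs, dotsValue_eq_zero _ _ hs]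
  rw [h₁, polM_one, Finset.sum_eq_single s, Matrix.one_apply_eq, one_smul]
  · intro t _ ht
    rw [Matrix.one_apply_ne ht.symm, zero_smul]
  · simp

lemma actsPolynomially_zero {a b : ℕ} {d : ℤ} : ActsPolynomially (0 : DHom K a b d) := by
  intro M _ _ c c' hc Φ s
  have h := dotsValue_pull_smul hc Φ 0 (0 : DHom K a b d) s
  rw [zero_smul, zero_smul] at h
  rw [h]
  exact (Finset.sum_eq_zero fun t _ => by rw [map_zero, Matrix.zero_apply, zero_smul]).symm

/-- The whiskered statement is the one that survives induction over formal morphisms: in `f ⊗ g = (f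
⊗ id) ; (id ⊗ g)` both factors are whiskerings of the smaller morphisms `f` and `g`, so the
inductive hypotheses apply with larger margins. -/
lemma actsPolynomially_wh [CharZero K] {a b l r m n : ℕ} {d : ℤ} (hm : l + a + r = m)
    (hn : l + b + r = n) (x : DHom K a b d) : ActsPolynomially (wh l r hm hn x) := by
  induction x using Quot.ind with | _ f
  change ActsPolynomially (wh l r hm hn (mk f))
  induction f generalizing l r m n with
  | id a =>
    obtain rfl : m = n := by omega
    rw [mk_id, wh_id]
    exact actsPolynomially_one
  | cup => exact (cup_actsOnStrands K).wh hm hn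
  | cap => exact (cap_actsOnStrands K).wh hm hn
  | dot => exact (dot_actsOnStrands K).wh hm hn
  | @comp a b c i j k h f g ihf ihg =>
    have : mk (.comp h f g) = DHom.comp h (mk f) (mk g) := rfl
    rw [this, wh_comp (n := l + b + r) l r hm rfl hn]
    exact (ihf _ _).comp (ihg _ _) h
  | @tensor a b a' b' m' n' i j k hm' hn' h f g ihf ihg =>
    have : mk (.tensor hm' hn' h f g) = DHom.tensor hm' hn' h (mk f) (mk g) := rfl
    rw [this, tensor_eq_comp hm' hn' h rfl, wh_comp (n := l + (b + a') + r) l r hm rfl hn,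
      wh_tensor_id (q := a' + r) l r hm' rfl hm rfl rfl (by omega) (by omega),
      wh_id_tensor (q := l + b) l r rfl hn' rfl hn rfl (by omega) (by omega)]
    exact (ihf _ _).comp (ihg _ _) h
  | zero a b d =>
    have : mk (.zero a b d) = (0 : DHom K a b d) := rfl
    rw [this, ← whL_apply, map_zero]
    exact actsPolynomially_zero
  | add f g ihf ihg =>
    have : mk (.add f g) = mk f + mk g := rfl
    rw [this, ← whL_apply, map_add, whL_apply, whL_apply]
    exact (ihf _ _).add (ihg _ _)
  | smul r' f ih =>
    have : mk (.smul r' f) = r' • mk f := rfl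
    rw [this, ← whL_apply, map_smul, whL_apply]
    exact (ih _ _).smul r'

lemma actsPolynomially [CharZero K] {a b : ℕ} {d : ℤ} (x : DHom K a b d) :
    ActsPolynomially x := by
  have h := actsPolynomially_wh (m := a) (n := b) (l := 0) (r := 0) (by omega) (by omega) x
  rwa [wh_eq 0 0 (zero_add a) (zero_add b) _ _ (add_zero a) (add_zero b), gtensor_unit,
    gid_tensor] at h

/-- The monomial `x_1 ⋯ x_n`. -/
def Mon.top (n : ℕ) : Mon n := fun _ => 1

lemma Mon.deg_top (n : ℕ) : (Mon.top n).deg = n := by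
  simp [Mon.deg, Mon.top]
  ring

lemma dots_top (n : ℕ) (h : (0 : ℤ) = n - (Mon.top n).deg) : dots K n (Mon.top n) 0 h = 1 := by
  induction n with
  | zero => rfl
  | succ n ih =>
    rw [dots_succ n _ 0 0 0 h (by erw [Mon.deg_top]; simp) 1 rfl rfl rfl]
    exact (congrArg (fun x => tensor _ _ _ x _) (ih (by rw [Mon.deg_top]; simp))).trans
      (tensor_id_id rfl)

/-- A morphism to the Kirby color is determined by the top coefficients of its matrix. -/
lemma KirbyFamily.φ_eq_sum [CharZero K] {a n : ℕ} {c e : ℤ} {M : Type u} [AddCommGroup M]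
    [Module K M] (Φ : KirbyFamily K a c M) (h : e = c + n) (x : DHom K a n e) :
    Φ.φ n e h x = ∑ t, polM x (Mon.top n) t • dotsValue Φ.φ t := by
  -- The row `x_1 ⋯ x_n` has degree `n`, which forces `c' = -n`, and its `dots` endomorphism is the
  -- identity, so the pulled back family returns `φ x` itself.
  rw [← actsPolynomially x M c (-n) (by omega) Φ, dotsValue_eq _ _ 0 (by rw [Mon.deg_top]; ring)
    (by omega), dots_top, Φ.pull_φ _ _ _ (add_zero e) h, gcomp_id]

end

end

noncomputable section

section Const

variable {K : Type u} [Field K] {C : Type v} [GCat K C]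

/-! ### Constant ind-objects -/

/-- The constant directed system. -/
@[reducible] def IndObj.const (X : C) : IndObj K C where
  I := PUnit.{u + 1}
  F :=
    { obj := fun _ => ⟨X⟩
      map := fun _ => 𝟙 _
      map_id := fun _ => rfl
      map_comp := fun _ _ => (Category.id_comp _).symm }

/-- Morphisms out of a constant ind-object. -/
def IndObj.ofCHom {X : C} {B : IndObj K C} {d : ℤ} :
    CHom X B d →ₗ[K] GHom K (IndObj.const (K := K) X) B d where
  toFun x := (⟨fun _ => x, fun _ => CHom.pre_id (zero_add d) x⟩ :
    IndObj.homSub (IndObj.const (K := K) X) B d)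
  map_add' _ _ := rfl
  map_smul' _ _ := rfl

/-- The element of the colimit underlying a morphism out of a constant ind-object. -/
def IndObj.toCHom {X : C} {B : IndObj K C} {d : ℤ} :
    GHom K (IndObj.const (K := K) X) B d →ₗ[K] CHom X B d where
  toFun f := f.1 PUnit.unit
  map_add' _ _ := rfl
  map_smul' _ _ := rfl

@[simp] lemma IndObj.toCHom_ofCHom {X : C} {B : IndObj K C} {d : ℤ} (x : CHom X B d) :
    IndObj.toCHom (IndObj.ofCHom x) = x := rfl

@[simp] lemma IndObj.ofCHom_toCHom {X : C} {B : IndObj K C} {d : ℤ}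
    (f : GHom K (IndObj.const (K := K) X) B d) : IndObj.ofCHom (IndObj.toCHom f) = f := rfl

lemma IndObj.toCHom_injective {X : C} {B : IndObj K C} {d : ℤ}
    {f g : GHom K (IndObj.const (K := K) X) B d} (h : IndObj.toCHom f = IndObj.toCHom g) : f = g :=
  congrArg IndObj.ofCHom h

lemma IndObj.toCHom_comp {X : C} {A B : IndObj K C} {i j k : ℤ} (h : i + j = k)
    (f : GHom K (IndObj.const (K := K) X) A i) (g : GHom K A B j) :
    IndObj.toCHom (GCat.comp h f g) = CHom.act h (IndObj.toCHom f) g := rfl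

lemma CHom.exists_rep {X : C} {B : IndObj K C} {d : ℤ} (x : CHom X B d) :
    ∃ j f, CHom.ι X B d j f = x :=
  Concrete.colimit_exists_rep (B.homSys X d) x

variable (K) in
/-- The embedding of a category into its ind-completion. -/
@[reducible] def constFunctor (C : Type v) [GCat K C] : GFunctor K C (IndObj K C) where
  obj X := IndObj.const X
  map {X Y d} := IndObj.ofCHom ∘ₗ CHom.ι X (IndObj.const Y) d PUnit.unit
  map_id X := rfl
  map_comp {X Y Z i j k} h f g := IndObj.toCHom_injective (by
    rw [IndObj.toCHom_comp]
    refine Eq.symm ((CHom.act_ι h (A := IndObj.const Y) PUnit.unit f _).trans ?_)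
    exact CHom.pre_ι (B := IndObj.const Z) h f PUnit.unit g)

lemma constFunctor_map {X Y : C} {d : ℤ} (f : GHom K X Y d) :
    (constFunctor K C).map f = IndObj.ofCHom (CHom.ι X (IndObj.const Y) d PUnit.unit f) := rfl

lemma IndObj.toCHom_const_comp {X Y : C} {B : IndObj K C} {i j k : ℤ} (h : i + j = k)
    (f : GHom K X Y i) (g : GHom K (IndObj.const (K := K) Y) B j) :
    IndObj.toCHom (GCat.comp h ((constFunctor K C).map f) g) = CHom.pre h f (IndObj.toCHom g) := by
  rw [IndObj.toCHom_comp, constFunctor_map, IndObj.toCHom_ofCHom]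
  exact CHom.act_ι h (A := IndObj.const Y) PUnit.unit f g

/-- The inclusion of a term of a directed system. -/
def IndObj.incl (A : IndObj K C) (i : A.I) : GHom K (IndObj.const (K := K) (A.at i)) A 0 :=
  IndObj.ofCHom (CHom.ι _ A 0 i (GCat.id (A.at i)))

lemma IndObj.toCHom_incl_comp (A : IndObj K C) {B : IndObj K C} {d : ℤ} (i : A.I)
    (h : 0 + d = d) (f : GHom K A B d) : IndObj.toCHom (GCat.comp h (A.incl i) f) = f.1 i := by
  rw [IndObj.toCHom_comp, IndObj.incl, IndObj.toCHom_ofCHom]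
  exact (CHom.act_ι h (A := A) i _ f).trans (CHom.pre_id h _)

lemma IndObj.ofCHom_ι {X : C} {B : IndObj K C} {d : ℤ} (j : B.I) (f : GHom K X (B.at j) d)
    (h : d + 0 = d) :
    IndObj.ofCHom (CHom.ι X B d j f) = GCat.comp h ((constFunctor K C).map f) (B.incl j) :=
  IndObj.toCHom_injective (by
    rw [IndObj.toCHom_const_comp, IndObj.incl, IndObj.toCHom_ofCHom, IndObj.toCHom_ofCHom,
      CHom.pre_ι, GCat.comp_id])

lemma IndObj.tr_comp_incl (A : IndObj K C) {i j : A.I} (u : i ⟶ j) :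
    GCat.comp (add_zero 0) ((constFunctor K C).map (A.tr u)) (A.incl j) = A.incl i := by
  rw [← IndObj.ofCHom_ι, IndObj.incl]
  refine congrArg _ ((congrArg _ (GCat.id_comp (add_zero 0) _).symm).trans (CHom.w u _))

/-- Every morphism from a constant ind-object factors through a term of the directed system. -/
lemma IndObj.exists_factor {X : C} {B : IndObj K C} {d : ℤ}
    (f : GHom K (IndObj.const (K := K) X) B d) (h : d + 0 = d) :
    ∃ j g, f = GCat.comp h ((constFunctor K C).map g) (B.incl j) := by
  obtain ⟨j, g, hg⟩ := CHom.exists_rep (IndObj.toCHom f)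
  exact ⟨j, g, by rw [← IndObj.ofCHom_ι, hg, IndObj.ofCHom_toCHom]⟩

lemma IndObj.hom_ext {A B : IndObj K C} {d : ℤ} {f g : GHom K A B d} (h : 0 + d = d)
    (H : ∀ i, GCat.comp h (A.incl i) f = GCat.comp h (A.incl i) g) : f = g :=
  Subtype.ext (funext fun i => by
    rw [← A.toCHom_incl_comp i h, ← A.toCHom_incl_comp i h, H])

/-! ### Natural transformations of functors to graded vector spaces -/

/-- The components of a natural transformation at `X` are isomorphisms. -/
def GNatTrans.BijectiveAt {D : Type w} [GCat K D] {F G : GFunctor K D (GVect K)}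
    (θ : GNatTrans F G) (X : D) : Prop :=
  ∀ p, Function.Bijective (HOM.at (θ.app X) p p (add_zero p))

lemma GNatTrans.naturality_at {D : Type w} [GCat K D] {F G : GFunctor K D (GVect K)}
    (θ : GNatTrans F G) {X Y : D} {d p q : ℤ} (h : p + d = q) (f : GHom K X Y d)
    (x : (F.obj X).V p) : HOM.at (θ.app Y) q q (add_zero q) (HOM.at (F.map f) p q h x) =
      HOM.at (G.map f) p q h (HOM.at (θ.app X) p p (add_zero p) x) := by
  rw [← HOM.comp_at (add_zero d) _ _ p q q h _ h, θ.naturality,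
    HOM.comp_at (zero_add d) _ _ p p q (add_zero p) h]

/-- For every functor, the equation `∑ r_k s_k = id` recovers an element of its value at `X` from
components at the `Y k`; no orthogonality is needed. Injectivity follows because the components are
determined, and surjectivity by lifting each component and recombining. -/
lemma GNatTrans.bijectiveAt_of_retract {D : Type w} [GCat K D] {F G : GFunctor K D (GVect K)}
    (θ : GNatTrans F G) {X : D} {ι : Type} [Fintype ι] (Y : ι → D) (δ ε : ι → ℤ)
    (hδ : ∀ k, δ k + ε k = 0) (r : ∀ k, GHom K X (Y k) (δ k)) (s : ∀ k, GHom K (Y k) X (ε k))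
    (h : ∑ k, GCat.comp (hδ k) (r k) (s k) = GCat.id X) (hY : ∀ k, θ.BijectiveAt (Y k)) :
    θ.BijectiveAt X := by
  have key : ∀ (H : GFunctor K D (GVect K)) (p : ℤ) (x : (H.obj X).V p),
      x = ∑ k, HOM.at (H.map (s k)) (p + δ k) p (by have := hδ k; omega)
        (HOM.at (H.map (r k)) p (p + δ k) rfl x) := by
    intro H p x
    have h₁ : HOM.at (H.map (GCat.id X)) p p (add_zero p) x = x := by
      rw [H.map_id, HOM.id_at, GVect.tr_self]
    conv_lhs => rw [← h₁, ← h, map_sum]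
    refine (HOM.sum_at _ _ _ _ _ _).trans (Finset.sum_congr rfl fun k _ => ?_)
    rw [H.map_comp, HOM.comp_at (hδ k) _ _ p (p + δ k) p rfl]
  intro p
  constructor
  · intro x y hxy
    rw [key F p x, key F p y]
    refine Finset.sum_congr rfl fun k _ => congrArg _ ((hY k _).1 ?_)
    rw [θ.naturality_at, θ.naturality_at, hxy]
  · intro y
    choose x hx using fun k => (hY k (p + δ k)).2 (HOM.at (G.map (r k)) p (p + δ k) rfl y)
    refine ⟨∑ k, HOM.at (F.map (s k)) (p + δ k) p (by have := hδ k; omega) (x k), ?_⟩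
    rw [map_sum, key G p y]
    exact Finset.sum_congr rfl fun k _ => by rw [θ.naturality_at, hx]

/-- A natural transformation whose components are bijective has an inverse. -/
lemma GNatTrans.nonempty_iso {D : Type w} [GCat K D] {F G : GFunctor K D (GVect K)}
    (θ : GNatTrans F G) (h : ∀ X, θ.BijectiveAt X) : Nonempty (GNatIso F G) := by
  let e : ∀ X p, (F.obj X).V p ≃ₗ[K] (G.obj X).V p := fun X p =>
    LinearEquiv.ofBijective (HOM.at (θ.app X) p p (add_zero p)) (h X p)
  let inv : ∀ X, GHom K (G.obj X) (F.obj X) 0 := fun X p =>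
    (F.obj X).tr (by have := p.2; omega) ∘ₗ (e X p.1.1).symm.toLinearMap
  have inv_at : ∀ X p x, HOM.at (inv X) p p (add_zero p) x = (e X p).symm x := fun X p x => rfl
  have e_apply : ∀ X p x, e X p x = HOM.at (θ.app X) p p (add_zero p) x := fun X p x => rfl
  refine ⟨⟨θ, ⟨inv, ?_⟩, ?_, ?_⟩⟩
  · intro X Y d f
    refine HOM.ext fun p q hq x => ?_
    rw [HOM.comp_at (add_zero d) _ _ p q q hq (add_zero q), HOM.comp_at (zero_add d) _ _ p p q
      (add_zero p) hq, inv_at, inv_at, LinearEquiv.symm_apply_eq, e_apply, θ.naturality_at,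
      ← e_apply, LinearEquiv.apply_symm_apply]
  · intro X
    refine HOM.ext fun p q hq x => ?_
    obtain rfl : p = q := by omega
    rw [HOM.comp_at (add_zero 0) _ _ p p p (add_zero p) (add_zero p), inv_at, HOM.id_at,
      GVect.tr_self, LinearEquiv.symm_apply_eq, e_apply]
  · intro X
    refine HOM.ext fun p q hq x => ?_
    obtain rfl : p = q := by omega
    rw [HOM.comp_at (add_zero 0) _ _ p p p (add_zero p) (add_zero p), inv_at, HOM.id_at,
      GVect.tr_self, ← e_apply, LinearEquiv.apply_symm_apply]

/-- The action of a contravariant functor on morphisms. -/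
def GFunctor.mapOp {D : Type w} [GCat K D] (G : GFunctor K (GOp D) (GVect K)) {X Y : D} {d : ℤ} :
    GHom K X Y d →ₗ[K] HOM (G.obj ⟨Y⟩) (G.obj ⟨X⟩) d :=
  G.map (X := ⟨Y⟩) (Y := ⟨X⟩)

lemma GFunctor.mapOp_comp_at {D : Type w} [GCat K D] (G : GFunctor K (GOp D) (GVect K)) {X Y Z : D}
    {i j k p q r : ℤ} (h : i + j = k) (f : GHom K X Y i) (g : GHom K Y Z j) (hq : p + j = q)
    (hr : q + i = r) (hpr : p + k = r) (x : (G.obj ⟨Z⟩).V p) :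
    HOM.at (G.mapOp (GCat.comp h f g)) p r hpr x =
      HOM.at (G.mapOp f) q r hr (HOM.at (G.mapOp g) p q hq x) :=
  (congrArg (fun z : HOM (G.obj ⟨Z⟩) (G.obj ⟨X⟩) k => HOM.at z p r hpr x)
    (G.map_comp (X := ⟨Z⟩) (Y := ⟨Y⟩) (Z := ⟨X⟩) ((add_comm j i).trans h) g f)).trans
      (HOM.comp_at _ _ _ p q r hq hr hpr x)

lemma GNatTrans.naturality_mapOp {D : Type w} [GCat K D] {F G : GFunctor K (GOp D) (GVect K)}
    (θ : GNatTrans F G) {X Y : D} {d p q : ℤ} (h : p + d = q) (f : GHom K X Y d)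
    (x : (F.obj ⟨Y⟩).V p) :
    HOM.at (θ.app ⟨X⟩) q q (add_zero q) (HOM.at (F.mapOp f) p q h x) =
      HOM.at (G.mapOp f) p q h (HOM.at (θ.app ⟨Y⟩) p p (add_zero p) x) :=
  θ.naturality_at (X := ⟨Y⟩) (Y := ⟨X⟩) h f x

/-! ### Contravariant functors compatible with filtered colimits -/

/-- A contravariant functor on ind-objects takes the presentation of an ind-object as a filtered
colimit of constant ones to a limit. -/
structure GFunctor.IsContinuous (G : GFunctor K (GOp (IndObj K C)) (GVect K)) : Prop where
  ext : ∀ (A : IndObj K C) (p : ℤ) (x y : (G.obj ⟨A⟩).V p),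
    (∀ i, HOM.at (G.mapOp (A.incl i)) p p (add_zero p) x =
      HOM.at (G.mapOp (A.incl i)) p p (add_zero p) y) → x = y
  glue : ∀ (A : IndObj K C) (p : ℤ) (x : ∀ i, (G.obj ⟨IndObj.const (A.at i)⟩).V p),
    (∀ (i j : A.I) (u : i ⟶ j), HOM.at (G.mapOp ((constFunctor K C).map (A.tr u))) p p (add_zero p) (x j) =
        x i) →
    ∃ y, ∀ i, HOM.at (G.mapOp (A.incl i)) p p
      (add_zero p) y = x i

/-- Preimages are chosen termwise on the directed system. They are compatible because compatibility
may be tested after applying `θ`, which is injective on each term, and so they glue. -/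
lemma GNatTrans.bijectiveAt_of_isContinuous {F G : GFunctor K (GOp (IndObj K C)) (GVect K)}
    (θ : GNatTrans F G) (hF : F.IsContinuous) (hG : G.IsContinuous)
    (h : ∀ X : C, θ.BijectiveAt ⟨IndObj.const X⟩) (A : IndObj K C) : θ.BijectiveAt ⟨A⟩ := by
  intro p
  constructor
  · intro x y hxy
    refine hF.ext A p x y fun i => (h _ p).1 ?_
    rw [θ.naturality_mapOp, θ.naturality_mapOp, hxy]
  · intro y
    choose x hx using fun i : A.I => (h (A.at i) p).2
      (HOM.at (G.mapOp (A.incl i)) p p (add_zero p) y)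
    obtain ⟨z, hz⟩ := hF.glue A p x (by
      intro i j u
      refine (h (A.at i) p).1 ?_
      rw [θ.naturality_mapOp, hx, hx, ← G.mapOp_comp_at (add_zero 0) _ _ (add_zero p) (add_zero p)
        (add_zero p), A.tr_comp_incl])
    refine ⟨z, hG.ext A p _ _ fun i => ?_⟩
    rw [← θ.naturality_mapOp, hz, hx]

lemma homInto_isContinuous (Y : IndObj K C) : (homInto K Y).IsContinuous where
  ext A p x y h := IndObj.hom_ext (zero_add p) h
  glue A p x h := by
    have h' : ∀ (i j : A.I) (u : i ⟶ j), GCat.comp (zero_add p)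
        ((constFunctor K C).map (A.tr u)) (x j : GHom K (IndObj.const (A.at j)) Y p) =
        (x i : GHom K (IndObj.const (A.at i)) Y p) := h
    refine ⟨(⟨fun i => IndObj.toCHom (x i : GHom K (IndObj.const (A.at i)) Y p),
      fun {i j} v => ?_⟩ : IndObj.homSub A Y p), fun i => ?_⟩
    · exact (IndObj.toCHom_const_comp (zero_add p) (A.tr v) (x j)).symm.trans
        (congrArg IndObj.toCHom (h' i j v))
    · exact IndObj.toCHom_injective (A.toCHom_incl_comp i (zero_add p) _)

end Const

end

noncomputable section

attribute [reducible] GFunctor.comp GFunctor.op homInto homFrom GFunctor.extInd GFunctor.extMat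
  GFunctor.extKar GFunctor.matObj GFunctor.indObj tensorLeft

/-! ### Continuity of the functors to be compared -/

section Continuity

variable {K : Type u} [Field K] {C : Type v} [GCat K C]

lemma GFunctor.extInd_incl (F : GFunctor K C (GVect K)) (A : IndObj K C) (i : A.I) (p : ℤ)
    (x : (F.obj (A.at i)).V p) :
    HOM.at (F.extInd.map (A.incl i)) p p (add_zero p)
      (F.indι (IndObj.const (A.at i)) p PUnit.unit x) = F.indι A p i x := by
  refine (F.indMap_ι (A := IndObj.const (A.at i)) (add_zero p) _ PUnit.unit x).trans ?_
  refine (F.evalC_ι (add_zero p) i _ x).trans ?_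
  rw [F.map_id]
  rfl

lemma GFunctor.extInd_const_map (F : GFunctor K C (GVect K)) {X Y : C} {d p q : ℤ} (h : p + d = q)
    (f : GHom K X Y d) (x : (F.obj X).V p) :
    HOM.at (F.extInd.map ((constFunctor K C).map f)) p q h
      (F.indι (IndObj.const X) p PUnit.unit x) =
      F.indι (IndObj.const Y) q PUnit.unit (HOM.at (F.map f) p q h x) :=
  (F.indMap_ι (A := IndObj.const X) h _ PUnit.unit x).trans (F.evalC_ι h _ _ x)

lemma GFunctor.indι_const_surjective (F : GFunctor K C (GVect K)) (X : C) (p : ℤ) :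
    Function.Surjective (F.indι (IndObj.const X) p PUnit.unit) := fun y => by
  obtain ⟨_, x, hx⟩ := Concrete.colimit_exists_rep (F.indSys (IndObj.const X) p) y
  exact ⟨x, hx⟩

/-- The extension is a colimit by construction, degree by degree, and maps out of a colimit into `V`
are compatible families of maps. -/
lemma extInd_isContinuous (F : GFunctor K C (GVect K)) (V : GVect K) :
    (F.extInd.op.comp (homInto K V)).IsContinuous where
  ext A p x y h := by
    change HOM (F.indObj A) V p at x y
    refine HOM.ext fun j k hk z => ?_
    refine LinearMap.congr_fun (F.ind_ext (φ := HOM.at x j k hk) (ψ := HOM.at y j k hk)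
      fun i z => ?_) z
    have := congrArg (fun w : HOM (F.indObj (IndObj.const (A.at i))) V p =>
      HOM.at w j k hk (F.indι (IndObj.const (A.at i)) j PUnit.unit z)) (h i)
    have e : ∀ x : GHom K (F.extInd.obj A) V p,
        HOM.at (GCat.comp (zero_add p) (F.extInd.map (A.incl i)) x : HOM _ V p) j k hk
          (F.indι (IndObj.const (A.at i)) j PUnit.unit z) = HOM.at x j k hk (F.indι A j i z) := by
      intro x
      rw [HOM.comp_at (zero_add p) _ _ j j k (add_zero j) hk, F.extInd_incl]
    exact (e x).symm.trans (this.trans (e y))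
  glue A p x h := by
    have hx : ∀ (i i' : A.I) (u : i ⟶ i'), (GCat.comp (zero_add p)
        (F.extInd.map ((constFunctor K C).map (A.tr u)))
        (x i' : GHom K (F.extInd.obj (IndObj.const (A.at i'))) V p) : GHom K _ V p) = x i := h
    have w : ∀ (j k : ℤ) (hk : j + p = k) (i i' : A.I) (u : i ⟶ i') (z : (F.obj (A.at i)).V j),
        (HOM.at (V := F.indObj (IndObj.const (A.at i'))) (x i') j k hk ∘ₗ
          F.indι (IndObj.const (A.at i')) j PUnit.unit) (HOM.at (F.map (A.tr u)) j j (add_zero j) z) =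
        (HOM.at (V := F.indObj (IndObj.const (A.at i))) (x i) j k hk ∘ₗ
          F.indι (IndObj.const (A.at i)) j PUnit.unit) z := by
      intro j k hk i i' u z
      rw [LinearMap.comp_apply, LinearMap.comp_apply, ← F.extInd_const_map, ← hx i i' u]
      exact (HOM.comp_at (zero_add p) _ _ _ _ _ (add_zero _) hk _ _).symm
    refine ⟨(fun q => F.indDesc (fun i => HOM.at (V := F.indObj (IndObj.const (A.at i))) (x i)
      q.1.1 q.1.2 q.2 ∘ₗ F.indι (IndObj.const (A.at i)) q.1.1 PUnit.unit) (w _ _ q.2) :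
      HOM (F.indObj A) V p), fun i => HOM.ext fun j k hk z => ?_⟩
    refine (HOM.comp_at (zero_add p) (F.extInd.map (A.incl i)) _ j j k (add_zero j) hk hk z).trans ?_
    obtain ⟨z, rfl⟩ := F.indι_const_surjective _ j z
    rw [F.extInd_incl]
    exact F.indDesc_ι _ (w j k hk) i z

lemma tensorLeft_incl_comp_val [GTensor K C] (W A : IndObj K C) {Y : IndObj K C} {d : ℤ} (i : A.I)
    (n : W.I) (f : GHom K (W.tensorObj A) Y d) :
    (GCat.comp (zero_add d) ((tensorLeft W).map (A.incl i)) f :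
      IndObj.homSub (W.tensorObj (IndObj.const (A.at i))) Y d).1 (n, PUnit.unit) = f.1 (n, i) := by
  refine (congrArg (fun z => CHom.act (zero_add d) z f) (CHom.whisker_ι W n i (GCat.id (A.at i)))).trans ?_
  refine (CHom.act_ι (A := W.tensorObj A) (zero_add d) (n, i) _ f).trans ?_
  rw [GTensor.id_hom_id]
  exact CHom.pre_id (zero_add d) _

lemma tensorLeft_const_comp_val [GTensor K C] (W : IndObj K C) {X X' : C} {Y : IndObj K C}
    {i d e : ℤ} (h : i + d = e) (n : W.I) (g : GHom K X X' i)
    (f : GHom K (W.tensorObj (IndObj.const X')) Y d) :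
    (GCat.comp h ((tensorLeft W).map ((constFunctor K C).map g)) f :
      IndObj.homSub (W.tensorObj (IndObj.const X)) Y e).1 (n, PUnit.unit) =
      CHom.pre h (GTensor.hom (zero_add i) (GCat.id (W.at n)) g) (f.1 (n, PUnit.unit)) := by
  refine (congrArg (fun z => CHom.act h z f)
    (CHom.whisker_ι W n (B := IndObj.const X') PUnit.unit g)).trans ?_
  exact CHom.act_ι (A := W.tensorObj (IndObj.const X')) h (n, PUnit.unit) _ f

/-- The system `W ⊗ A` is indexed by pairs, so a family of morphisms out of the `W ⊗ A i` is already
a family over its indices. Compatibility along an arrow of pairs splits in two: the `W`-component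
holds inside each given morphism, and the `A`-component is the gluing condition. -/
lemma tensorLeft_isContinuous [GTensor K C] (W Y : IndObj K C) :
    ((tensorLeft W).op.comp (homInto K Y)).IsContinuous where
  ext A p x y h := Subtype.ext (funext fun q => by
    have := congrArg (fun z : IndObj.homSub (W.tensorObj (IndObj.const (A.at q.2))) Y p =>
      z.1 (q.1, PUnit.unit)) (h q.2)
    exact (tensorLeft_incl_comp_val W A q.2 q.1 x).symm.trans
      (this.trans (tensorLeft_incl_comp_val W A q.2 q.1 y)))
  glue A p x h := by
    let x' : ∀ i : A.I, IndObj.homSub (W.tensorObj (IndObj.const (A.at i))) Y p := x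
    have hx : ∀ (i i' : A.I) (u : i ⟶ i') (n : W.I), CHom.pre (zero_add p)
        (GTensor.hom (zero_add 0) (GCat.id (W.at n)) (A.tr u)) ((x' i').1 (n, PUnit.unit)) =
        (x' i).1 (n, PUnit.unit) := fun i i' u n =>
      (tensorLeft_const_comp_val W (zero_add p) n (A.tr u) (x' i')).symm.trans
        (congrArg (fun z : IndObj.homSub (W.tensorObj (IndObj.const (A.at i))) Y p =>
          z.1 (n, PUnit.unit)) (h i i' u))
    refine ⟨(⟨fun q => (x' q.2).1 (q.1, PUnit.unit), fun {q q'} v => ?_⟩ :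
      IndObj.homSub (W.tensorObj A) Y p), fun i => ?_⟩
    · have h₁ : CHom.pre (zero_add p) (GTensor.hom (zero_add 0) (W.tr v.1)
          (GCat.id (A.at q'.2))) ((x' q'.2).1 (q'.1, PUnit.unit)) =
          (x' q'.2).1 (q.1, PUnit.unit) :=
        (x' q'.2).2 (i := (q.1, PUnit.unit)) (i' := (q'.1, PUnit.unit)) (v.1, 𝟙 PUnit.unit)
      change CHom.pre (zero_add p) (GTensor.hom (zero_add 0) (W.tr v.1) (A.tr v.2))
        ((x' q'.2).1 (q'.1, PUnit.unit)) = (x' q.2).1 (q.1, PUnit.unit)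
      rw [← hx q.2 q'.2 v.2 q.1, ← h₁, ← CHom.pre_pre (zero_add 0) (zero_add p),
        ← GTensor.interchange (zero_add 0) (zero_add 0) (zero_add 0), GCat.id_comp, GCat.comp_id]
    · refine Subtype.ext (funext fun q => ?_)
      exact tensorLeft_incl_comp_val W A i q.1 _

end Continuity

/-! ### Extension of natural transformations along completions -/

section Extend

variable {K : Type u} [Field K] {C : Type v} [GCat K C]

variable (K C) in
/-- The embedding of a category into its Karoubi envelope. -/
@[reducible] def toKar : GFunctor K C (Kar K C) where
  obj X := ⟨X, GCat.id X, GCat.id_comp _ _⟩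
  map :=
    { toFun := fun f => ⟨f, Kar.mem_of (GCat.id_comp _ f) (GCat.comp_id _ f)⟩
      map_add' := fun _ _ => rfl
      map_smul' := fun _ _ => rfl }
  map_id _ := rfl
  map_comp _ _ _ := rfl

/-- The projection onto the image of an idempotent. -/
def Kar.proj (A : Kar K C) : GHom K ((toKar K C).obj A.X) A 0 :=
  (⟨A.e, Kar.mem_of (GCat.id_comp _ A.e) A.idem⟩ : Kar.homSub ((toKar K C).obj A.X) A 0)

/-- The inclusion of the image of an idempotent. -/
def Kar.inclusion (A : Kar K C) : GHom K A ((toKar K C).obj A.X) 0 :=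
  (⟨A.e, Kar.mem_of A.idem (GCat.comp_id _ A.e)⟩ : Kar.homSub A ((toKar K C).obj A.X) 0)

lemma Kar.inclusion_proj (A : Kar K C) :
    GCat.comp (add_zero 0) A.inclusion A.proj = GCat.id A := Subtype.ext A.idem

lemma Kar.map_comp_proj {A B : Kar K C} {d : ℤ} (f : GHom K A B d) (h : d + 0 = d)
    (h' : 0 + d = d) :
    GCat.comp h ((toKar K C).map f.1) B.proj = GCat.comp h' A.proj f :=
  Subtype.ext ((Kar.comp_id' _ f.2).trans (Kar.id_comp' _ f.2).symm)

/-- Extension of a natural transformation to the Karoubi envelope. -/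
def GNatTrans.extKar {F : GFunctor K C (GVect K)} {G : GFunctor K (Kar K C) (GVect K)}
    (τ : GNatTrans F ((toKar K C).comp G)) : GNatTrans F.extKar G where
  -- The value at `(X, e)` is a subspace of `F X`, so `τ` is restricted to it and the result is
  -- brought back to `(X, e)` by the projection.
  app A p := HOM.at (GCat.comp (add_zero 0) (τ.app A.X) (G.map A.proj) :
    HOM (F.obj A.X) (G.obj A) 0) p.1.1 p.1.2 p.2 ∘ₗ Submodule.subtype _
  naturality {A B d} f := HOM.ext fun j k h x => by
    rw [HOM.comp_at (add_zero d) _ _ j k k h (add_zero k), HOM.comp_at (zero_add d) _ _ j j k (add_zero j) h]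
    have e : HOM.at (GCat.comp (add_zero 0) (τ.app B.X) (G.map B.proj) :
        HOM (F.obj B.X) (G.obj B) 0) k k (add_zero k) (HOM.at (F.map f.1) j k h x.1) =
        HOM.at (G.map f) j k h (HOM.at (GCat.comp (add_zero 0) (τ.app A.X) (G.map A.proj) :
        HOM (F.obj A.X) (G.obj A) 0) j j (add_zero j) x.1) := by
      have e : HOM.at (G.map B.proj) k k (add_zero k) (HOM.at (G.map ((toKar K C).map f.1)) j k h
          (HOM.at (τ.app A.X) j j (add_zero j) x.1)) = HOM.at (G.map f) j k h
          (HOM.at (G.map A.proj) j j (add_zero j) (HOM.at (τ.app A.X) j j (add_zero j) x.1)) := by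
        rw [← HOM.comp_at (zero_add d) (G.map A.proj) (G.map f) j j k (add_zero j) h h, ← G.map_comp,
          ← Kar.map_comp_proj f (add_zero d), G.map_comp,
          HOM.comp_at (add_zero d) _ _ j k k h (add_zero k) h]
      rw [HOM.comp_at (add_zero 0) _ _ k k k (add_zero k) (add_zero k),
        HOM.comp_at (add_zero 0) _ _ j j j (add_zero j) (add_zero j), τ.naturality_at]
      exact e
    exact e

lemma GNatTrans.extKar_at {F : GFunctor K C (GVect K)} {G : GFunctor K (Kar K C) (GVect K)}
    (τ : GNatTrans F ((toKar K C).comp G)) (A : Kar K C) (p : ℤ) (x : (F.extKar.obj A).V p) :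
    HOM.at (τ.extKar.app A) p p (add_zero p) x =
      HOM.at (G.map A.proj) p p (add_zero p) (HOM.at (τ.app A.X) p p (add_zero p) x.1) :=
  HOM.comp_at (add_zero 0) (τ.app A.X) (G.map A.proj) p p p (add_zero p) (add_zero p) (add_zero p)
    x.1

variable (K C) in
/-- The embedding of a category into its additive completion. -/
@[reducible] def toMat : GFunctor K C (Mat K C) where
  obj X := ⟨Unit, fun _ => 0, fun _ => X⟩
  map :=
    { toFun := fun f => fun _ _ => degCast (by simp) f
      map_add' := fun f g => funext fun _ => funext fun _ => map_add _ f g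
      map_smul' := fun c f => funext fun _ => funext fun _ => map_smul _ c f }
  map_id X := funext fun (_ : Unit) => funext fun (_ : Unit) =>
    (Mat.idM_self (⟨Unit, fun _ => 0, fun _ => X⟩ : Mat K C) ()).symm
  map_comp {X Y Z i j k} h f g := funext fun (_ : Unit) => funext fun (_ : Unit) => by
    change degCast _ (GCat.comp h f g) = ∑ u : Unit, GCat.comp (i := i + 0 - 0) (j := j + 0 - 0)
      (k := k + 0 - 0) _ (degCast _ f) (degCast _ g)
    rw [Fintype.sum_unique]
    have key : ∀ (i' j' k' : ℤ) (hi : i = i') (hj : j = j') (hk : k = k') (h' : i' + j' = k'),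
        degCast hk (GCat.comp h f g) = GCat.comp h' (degCast hi f) (degCast hj g) := by
      intro i' j' k' hi hj hk h'
      subst hi hj hk
      rfl
    exact key _ _ _ _ _ _ _

open Classical in
/-- The inclusion of a summand. -/
def Mat.inM (A : Mat K C) (i : A.ι) : GHom K ((toMat K C).obj (A.X i)) A (A.s i) := fun _ j =>
  if h : i = j then h ▸ degCast (by simp) (GCat.id (K := K) (A.X i)) else 0

open Classical in
/-- The projection onto a summand. -/
def Mat.outM (A : Mat K C) (i : A.ι) : GHom K A ((toMat K C).obj (A.X i)) (-A.s i) := fun j _ =>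
  if h : i = j then h ▸ degCast (by simp) (GCat.id (K := K) (A.X i)) else 0

lemma degCast_degCast {X Y : C} {a b c : ℤ} (h : a = b) (h' : b = c) (f : GHom K X Y a) :
    degCast h' (degCast h f) = degCast (h.trans h') f := by
  subst h h'; rfl

lemma comp_degCast_left {X Y Z : C} {i i' j k : ℤ} (h : i = i') (h' : i' + j = k)
    (f : GHom K X Y i) (g : GHom K Y Z j) :
    GCat.comp h' (degCast h f) g = GCat.comp (by omega) f g := by
  subst h; rfl

lemma Mat.comp_inM (A : Mat K C) {X : C} {i d : ℤ} (a : A.ι) (h : i + A.s a = d)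
    (f : GHom K X (A.X a) i) (u : Unit) : (GCat.comp h ((toMat K C).map f) (A.inM a) :
      Mat.HomM _ A d) u a = degCast (by simp; omega) f := by
  refine (Mat.compM_apply (A := (toMat K C).obj X) (B := (toMat K C).obj (A.X a)) (D := A) h _ _ u a).trans ?_
  refine (Fintype.sum_unique (ι := Unit) _).trans ?_
  simp only [Mat.inM, dite_true]
  refine (comp_degCast_left _ _ f _).trans ?_
  exact comp_degCast_id _ _ f

lemma Mat.comp_inM_ne (A : Mat K C) {X : C} {i d : ℤ} {a b : A.ι} (h : i + A.s a = d)
    (f : GHom K X (A.X a) i) (u : Unit) (hab : a ≠ b) : (GCat.comp h ((toMat K C).map f) (A.inM a) :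
      Mat.HomM _ A d) u b = 0 := by
  refine (Mat.compM_apply (A := (toMat K C).obj X) (B := (toMat K C).obj (A.X a)) (D := A) h _ _ u b).trans ?_
  refine (Fintype.sum_unique (ι := Unit) _).trans ?_
  simp only [Mat.inM, dif_neg hab, map_zero]

/-- A morphism into a formal sum is the sum of its components. -/
lemma Mat.eq_sum_inM (A : Mat K C) {X : C} {d : ℤ} (f : GHom K ((toMat K C).obj X) A d) :
    f = ∑ a, GCat.comp (by simp) ((toMat K C).map (f () a)) (A.inM a) := by
  funext u b
  have hs : (∑ a, GCat.comp (by simp) ((toMat K C).map (f () a)) (A.inM a) : Mat.HomM _ A d) u b =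
      ∑ a, (GCat.comp (by simp) ((toMat K C).map (f () a)) (A.inM a) : Mat.HomM _ A d) u b := by
    rw [Finset.sum_apply, Finset.sum_apply]
  refine Eq.trans ?_ hs.symm
  rw [Finset.sum_eq_single b (fun a _ hab => A.comp_inM_ne _ _ u hab) (by simp), Mat.comp_inM]
  rfl

lemma Mat.inM_comp (A : Mat K C) {B : Mat K C} {d e : ℤ} (a : A.ι) (h : A.s a + d = e)
    (f : GHom K A B d) : GCat.comp h (A.inM a) f =
      ∑ b, GCat.comp (by omega) ((toMat K C).map (f a b)) (B.inM b) := by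
  rw [Mat.eq_sum_inM B (GCat.comp h (A.inM a) f)]
  refine Finset.sum_congr rfl fun b _ => ?_
  have hb : (GCat.comp h (A.inM a) f : Mat.HomM _ B e) () b = degCast (by simp; omega) (f a b) := by
    refine (Mat.compM_apply (D := B) h (A.inM a) f () b).trans ?_
    rw [Finset.sum_eq_single a]
    · simp only [Mat.inM, dite_true]
      exact degCast_id_comp _ _ _
    · intro c _ hc
      simp only [Mat.inM, dif_neg hc.symm, map_zero, LinearMap.zero_apply]
    · simp
  rw [hb]
  have key : ∀ (i i' : ℤ) (hi : i = i') (h : i + B.s b = e) (h' : i' + B.s b = e)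
      (g : GHom K (A.X a) (B.X b) i),
      GCat.comp h' ((toMat K C).map (degCast hi g)) (B.inM b) =
        GCat.comp h ((toMat K C).map g) (B.inM b) := by
    intro i i' hi h h' g
    subst hi
    rfl
  exact key _ _ _ _ _ _

lemma Mat.sum_outM_inM (A : Mat K C) :
    ∑ a, GCat.comp (neg_add_cancel (A.s a)) (A.outM a) (A.inM a) = GCat.id A := by
  funext b c
  have hs : (∑ a, GCat.comp (neg_add_cancel (A.s a)) (A.outM a) (A.inM a) : Mat.HomM A A 0) b c =
      ∑ a, (GCat.comp (neg_add_cancel (A.s a)) (A.outM a) (A.inM a) : Mat.HomM A A 0) b c := by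
    rw [Finset.sum_apply, Finset.sum_apply]
  refine hs.trans ?_
  change _ = A.idM b c
  rw [Finset.sum_eq_single b]
  · refine (Mat.compM_apply (D := A) _ (A.outM b) (A.inM b) b c).trans ?_
    refine (Fintype.sum_unique (ι := Unit) _).trans ?_
    simp only [Mat.outM, dite_true]
    refine (degCast_id_comp _ _ _).trans ?_
    by_cases hbc : b = c
    · subst hbc
      rw [Mat.idM_self]
      simp only [Mat.inM, dite_true]
      exact degCast_degCast _ _ _
    · rw [Mat.idM_ne _ hbc]
      simp only [Mat.inM, dif_neg hbc, map_zero]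
  · intro a _ ha
    refine (Mat.compM_apply (D := A) _ (A.outM a) (A.inM a) b c).trans ?_
    refine (Fintype.sum_unique (ι := Unit) _).trans ?_
    simp only [Mat.outM, dif_neg ha, map_zero, LinearMap.zero_apply]
  · simp

/-- Extension of a natural transformation to the additive completion. -/
def GNatTrans.extMat {F : GFunctor K C (GVect K)} {G : GFunctor K (Mat K C) (GVect K)}
    (τ : GNatTrans F ((toMat K C).comp G)) : GNatTrans F.extMat G where
  app A p := ∑ i, HOM.at (G.map (A.inM i)) (p.1.1 - A.s i) p.1.2 (by have := p.2; omega) ∘ₗ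
    HOM.at (τ.app (A.X i)) (p.1.1 - A.s i) (p.1.1 - A.s i) (add_zero _) ∘ₗ
      LinearMap.proj (φ := fun i => (F.obj (A.X i)).V (p.1.1 - A.s i)) i
  naturality {A B d} f := HOM.ext fun j k h x => by
    rw [HOM.comp_at (add_zero d) _ _ j k k h (add_zero k), HOM.comp_at (zero_add d) _ _ j j k (add_zero j) h]
    have e₁ : ∀ (A : Mat K C) (p : ℤ) (x : (F.matObj A).V p), (∑ i,
        HOM.at (G.map (A.inM i)) (p - A.s i) p (by omega) ∘ₗ
        HOM.at (τ.app (A.X i)) (p - A.s i) (p - A.s i) (add_zero _) ∘ₗ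
        LinearMap.proj (φ := fun i => (F.obj (A.X i)).V (p - A.s i)) i) x = ∑ i,
        HOM.at (G.map (A.inM i)) (p - A.s i) p (by omega)
        (HOM.at (τ.app (A.X i)) (p - A.s i) (p - A.s i) (add_zero _) (x i)) := by
      intro A p x
      rw [LinearMap.sum_apply]
      rfl
    refine (e₁ B k _).trans (Eq.trans ?_ (congrArg _ (e₁ A j x).symm))
    rw [map_sum]
    have e₂ : ∀ b, (HOM.at (F.matMap f) j k h x) b = ∑ a,
        HOM.at (F.map (f a b)) (j - A.s a) (k - B.s b) (by omega) (x a) := fun b =>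
      F.matMap_at f j k h x b
    have e₃ : ∀ a, HOM.at (G.map f) j k h (HOM.at (G.map (A.inM a)) (j - A.s a) j (by omega)
        (HOM.at (τ.app (A.X a)) (j - A.s a) (j - A.s a) (add_zero _) (x a))) = ∑ b,
        HOM.at (G.map (B.inM b)) (k - B.s b) k (by omega)
        (HOM.at (τ.app (B.X b)) (k - B.s b) (k - B.s b) (add_zero _)
          (HOM.at (F.map (f a b)) (j - A.s a) (k - B.s b) (by omega) (x a))) := by
      intro a
      rw [← HOM.comp_at (i := A.s a) (j := d) rfl _ _ (j - A.s a) j k _ h (by omega), ← G.map_comp, Mat.inM_comp,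
        map_sum]
      refine (HOM.sum_at _ _ _ _ _ _).trans (Finset.sum_congr rfl fun b _ => ?_)
      rw [G.map_comp, HOM.comp_at _ _ _ (j - A.s a) (k - B.s b) k (by omega) (by omega),
        τ.naturality_at]
      rfl
    rw [Finset.sum_congr rfl fun a _ => e₃ a, Finset.sum_comm]
    refine Finset.sum_congr rfl fun b _ => ?_
    refine (congrArg (fun z => HOM.at (G.map (B.inM b)) (k - B.s b) k (by omega)
      (HOM.at (τ.app (B.X b)) (k - B.s b) (k - B.s b) (add_zero _) z)) (e₂ b)).trans ?_
    rw [map_sum, map_sum]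

lemma GNatTrans.extInd_w {F : GFunctor K C (GVect K)} {G : GFunctor K (IndObj K C) (GVect K)}
    (τ : GNatTrans F ((constFunctor K C).comp G)) (A : IndObj K C) (p q : ℤ) (h : p + 0 = q)
    (i j : A.I) (v : i ⟶ j) (x : (F.obj (A.at i)).V p) :
    (HOM.at (G.map (A.incl j)) p q h ∘ₗ HOM.at (τ.app (A.at j)) p p (add_zero _))
      (HOM.at (F.map (A.tr v)) p p (add_zero p) x) =
    (HOM.at (G.map (A.incl i)) p q h ∘ₗ HOM.at (τ.app (A.at i)) p p (add_zero _)) x := by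
  rw [LinearMap.comp_apply, LinearMap.comp_apply, τ.naturality_at, ← A.tr_comp_incl v, G.map_comp,
    HOM.comp_at (add_zero 0) _ _ _ _ _ (add_zero _) h]
  rfl

/-- Extension of a natural transformation to the ind-completion. -/
def GNatTrans.extInd {F : GFunctor K C (GVect K)} {G : GFunctor K (IndObj K C) (GVect K)}
    (τ : GNatTrans F ((constFunctor K C).comp G)) : GNatTrans F.extInd G where
  app A p := F.indDesc _ (τ.extInd_w A p.1.1 p.1.2 p.2)
  naturality {A B d} f := HOM.ext fun p q h x => by
    rw [HOM.comp_at (add_zero d) _ _ p q q h (add_zero q),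
      HOM.comp_at (zero_add d) _ _ p p q (add_zero p) h]
    refine LinearMap.congr_fun (F.ind_ext (φ := _ ∘ₗ _) (ψ := _ ∘ₗ _) fun i x => ?_) x
    rw [LinearMap.comp_apply, LinearMap.comp_apply]
    -- Naturality is tested on elements coming from a term `i` of `A`. There `f` factors through a
    -- term `j` of `B`, and only the naturality of `τ` for the morphism `g` of terms is needed.
    obtain ⟨j, g, hg⟩ := IndObj.exists_factor
      (GCat.comp (zero_add d) (A.incl i) f) (add_zero d)
    have e₁ : HOM.at (F.extInd.map f) p q h (F.indι A p i x) =
        F.indι B q j (HOM.at (F.map g) p q h x) := by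
      rw [← F.extInd_incl, ← HOM.comp_at (zero_add d) _ _ p p q (add_zero p) h h, ← F.extInd.map_comp,
        hg, F.extInd.map_comp, HOM.comp_at (add_zero d) _ _ p q q h (add_zero q) h, F.extInd_const_map,
        F.extInd_incl]
    rw [e₁]
    refine (F.indDesc_ι _ (τ.extInd_w B q q (add_zero q)) j _).trans (Eq.trans ?_
      (congrArg _ (F.indDesc_ι _ (τ.extInd_w A p p (add_zero p)) i x).symm))
    rw [LinearMap.comp_apply, LinearMap.comp_apply, τ.naturality_at]
    refine (HOM.comp_at (add_zero d) (G.map ((constFunctor K C).map g)) (G.map (B.incl j)) p q q h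
      (add_zero q) h _).symm.trans ?_
    rw [← G.map_comp, ← hg, G.map_comp, HOM.comp_at (zero_add d) _ _ p p q (add_zero p) h]

lemma GNatTrans.extInd_ι {F : GFunctor K C (GVect K)} {G : GFunctor K (IndObj K C) (GVect K)}
    (τ : GNatTrans F ((constFunctor K C).comp G)) (A : IndObj K C) (p : ℤ) (i : A.I)
    (x : (F.obj (A.at i)).V p) : HOM.at (τ.extInd.app A) p p (add_zero p) (F.indι A p i x) =
      HOM.at (G.map (A.incl i)) p p (add_zero p) (HOM.at (τ.app (A.at i)) p p (add_zero p) x) :=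
  F.indDesc_ι _ (τ.extInd_w A p p (add_zero p)) i x

end Extend

end

noncomputable section

/-! ### Reduction from the completions to the original objects -/

section Generators

variable {K : Type u} [Field K] {C : Type v} [GCat K C]

variable (K C) in
/-- The embedding of a category into the additive completion of its Karoubi envelope. -/
abbrev embedMat : GFunctor K C (Mat K (Kar K C)) := (toKar K C).comp (toMat K (Kar K C))

variable (K C) in
/-- The embedding of a category into the ind-completion of the additive completion of its Karoubi
envelope. -/
abbrev embed : GFunctor K C (IndObj K (Mat K (Kar K C))) :=
  (embedMat K C).comp (constFunctor K (Mat K (Kar K C)))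

/-- The inclusion of the image of an idempotent as a summand. -/
def Mat.fromEmbed (B : Mat K (Kar K C)) (b : B.ι) :
    GHom K ((embedMat K C).obj (B.X b).X) B (B.s b) :=
  GCat.comp (zero_add _) ((toMat K (Kar K C)).map (B.X b).proj) (B.inM b)

/-- The projection onto a summand, which is the image of an idempotent. -/
def Mat.toEmbed (B : Mat K (Kar K C)) (b : B.ι) :
    GHom K B ((embedMat K C).obj (B.X b).X) (-B.s b) :=
  GCat.comp (add_zero _) (B.outM b) ((toMat K (Kar K C)).map (B.X b).inclusion)

/-- Inclusion followed by projection is the identity of the image of an idempotent. So a formal sum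
of images is a retract of a sum of shifts of original objects, which is the input of
`GNatTrans.bijectiveAt_of_retract`. -/
lemma Mat.sum_toEmbed_fromEmbed (B : Mat K (Kar K C)) :
    ∑ b, GCat.comp (neg_add_cancel (B.s b)) (B.toEmbed b) (B.fromEmbed b) = GCat.id B := by
  rw [← B.sum_outM_inM]
  refine Finset.sum_congr rfl fun b _ => ?_
  rw [Mat.toEmbed, Mat.fromEmbed, GCat.assoc (add_zero _) (neg_add_cancel _) (zero_add _)
    (neg_add_cancel _), ← GCat.assoc (add_zero 0) (zero_add _) (zero_add _) (zero_add _),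
    ← GFunctor.map_comp, Kar.inclusion_proj, GFunctor.map_id, GCat.id_comp]

/-- A natural transformation of contravariant functors is an isomorphism if it is one on the
objects of the original category. -/
lemma GNatTrans.bijectiveAt_of_embed {F G : GFunctor K (GOp (IndObj K (Mat K (Kar K C)))) (GVect K)}
    (θ : GNatTrans F G) (hF : F.IsContinuous) (hG : G.IsContinuous)
    (h : ∀ X : C, θ.BijectiveAt ⟨(embed K C).obj X⟩) (A : IndObj K (Mat K (Kar K C))) :
    θ.BijectiveAt ⟨A⟩ := by
  refine θ.bijectiveAt_of_isContinuous hF hG (fun B => ?_) A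
  have e : ∑ b, GCat.comp (neg_add_cancel (B.s b)) ((constFunctor K _).map (B.toEmbed b))
      ((constFunctor K _).map (B.fromEmbed b)) = GCat.id (IndObj.const B) := by
    rw [← GFunctor.map_id (constFunctor K _) B, ← B.sum_toEmbed_fromEmbed, map_sum]
    exact Finset.sum_congr rfl fun b _ => ((constFunctor K _).map_comp _ _ _).symm
  -- The functors are contravariant, so in the opposite category `fromEmbed` leads out of `B` and
  -- `toEmbed` leads back into it. This is why the degrees are `s b` first and `-s b` second.
  exact θ.bijectiveAt_of_retract (X := ⟨IndObj.const B⟩)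
    (fun b : B.ι => ⟨(embed K C).obj (B.X b).X⟩) (fun b => B.s b) (fun b => -B.s b)
    (fun b => add_neg_cancel _) (fun b => (constFunctor K _).map (B.fromEmbed b))
    (fun b => (constFunctor K _).map (B.toEmbed b)) e (fun b => h _)

end Generators

/-! ### Copowers: a test by natural transformations, and uniqueness -/

section Copower

variable {K : Type u} [Field K] {D : Type v} [GCat K D]

/-- The natural maps `Hom(T(X), Y) → HOM(P(X), Hom(W, Y))`. -/
def copowerTrans {P : GFunctor K D (GVect K)} {W : D} {T : GFunctor K D D}
    (η : GNatTrans P (T.comp (homFrom K W))) (Y : D) :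
    GNatTrans (T.op.comp (homInto K Y)) (P.op.comp (homInto K ((homFrom K W).obj Y))) where
  app X p := GCat.comp (K := K) (X := P.obj X.unop) (Y := (homFrom K W).obj (T.obj X.unop))
      (Z := (homFrom K W).obj Y) ((add_comm _ _).trans p.2) (η.app X.unop) ∘ₗ
    (homFrom K W).map (X := T.obj X.unop) (Y := Y) (d := p.1.1)
  naturality {X X' d} f := HOM.ext fun p q h g => by
    rw [HOM.comp_at (add_zero d) _ _ p q q h (add_zero q),
      HOM.comp_at (zero_add d) _ _ p p q (add_zero p) h]
    let f' : GHom K X'.unop X.unop d := f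
    let g' : GHom K (T.obj X.unop) Y p := g
    have e : GCat.comp (zero_add q) (η.app X'.unop)
        ((homFrom K W).map (GCat.comp ((add_comm d p).trans h) (T.map f') g')) =
        GCat.comp ((add_comm d p).trans h) (P.map f')
          (GCat.comp (zero_add p) (η.app X.unop) ((homFrom K W).map g')) := by
      rw [GFunctor.map_comp]
      refine (GCat.assoc (zero_add d) ((add_comm d p).trans h) _ _ (η.app X'.unop)
        ((homFrom K W).map (T.map f')) ((homFrom K W).map g')).symm.trans ?_
      refine Eq.trans ?_ (GCat.assoc (add_zero d) ((add_comm d p).trans h) _ _ (P.map f')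
        (η.app X.unop) ((homFrom K W).map g'))
      exact congrArg (fun z => GCat.comp _ z ((homFrom K W).map g')) (η.naturality f').symm
    exact e

/-- The copower property, read as bijectivity of a natural transformation of contravariant functors
in `X`, can be propagated along the completions by `GNatTrans.bijectiveAt_of_embed`. -/
lemma isCopower_of_bijectiveAt {P : GFunctor K D (GVect K)} {W : D} {T : GFunctor K D D}
    (η : GNatTrans P (T.comp (homFrom K W))) (X : D) (h : ∀ Y, (copowerTrans η Y).BijectiveAt ⟨X⟩) :
    IsCopower (P.obj X) W (T.obj X) (η.app X) := fun Y d => h Y d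

lemma bijectiveAt_of_isCopower {P : GFunctor K D (GVect K)} {W : D} {T : GFunctor K D D}
    (η : GNatTrans P (T.comp (homFrom K W))) (X : D)
    (h : IsCopower (P.obj X) W (T.obj X) (η.app X)) (Y : D) :
    (copowerTrans η Y).BijectiveAt ⟨X⟩ := fun d => h Y d

/-- Copowers are unique up to natural isomorphism. -/
lemma CopowerFunctor.nonempty_iso {P : GFunctor K D (GVect K)} {W : D} (T T' : CopowerFunctor P W) :
    Nonempty (GNatIso T.functor T'.functor) := by
  have ex : ∀ T T' : CopowerFunctor P W, ∃ g : ∀ X, GHom K (T.functor.obj X) (T'.functor.obj X) 0,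
      ∀ X, GCat.comp (zero_add 0) (T.unit.app X) ((homFrom K W).map (g X)) = T'.unit.app X := by
    intro T T'
    choose g hg using fun X => (T.isCopower X (T'.functor.obj X) 0).2 (T'.unit.app X)
    exact ⟨g, hg⟩
  have inj : ∀ (T : CopowerFunctor P W) {X Y : D} {d : ℤ} {f g : GHom K (T.functor.obj X) Y d},
      GCat.comp (zero_add d) (T.unit.app X) ((homFrom K W).map f) =
      GCat.comp (zero_add d) (T.unit.app X) ((homFrom K W).map g) → f = g :=
    fun T X Y d f g h => (T.isCopower X Y d).1 h
  have comp : ∀ (T : CopowerFunctor P W) {X Y Z : D} {i j k : ℤ} (h : i + j = k)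
      (f : GHom K (T.functor.obj X) Y i) (g : GHom K Y Z j),
      GCat.comp (zero_add k) (T.unit.app X) ((homFrom K W).map (GCat.comp h f g)) =
      GCat.comp h (GCat.comp (zero_add i) (T.unit.app X) ((homFrom K W).map f))
        ((homFrom K W).map g) := by
    intro T X Y Z i j k h f g
    rw [GFunctor.map_comp]
    exact (GCat.assoc (zero_add i) h h (zero_add k) (T.unit.app X) _ _).symm
  have nat : ∀ (T : CopowerFunctor P W) {X Y : D} {d : ℤ} (f : GHom K X Y d),
      GCat.comp (zero_add d) (T.unit.app X) ((homFrom K W).map (T.functor.map f)) =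
        GCat.comp (add_zero d) (P.map f) (T.unit.app Y) := fun T X Y d f =>
    (T.unit.naturality f).symm
  -- By the copower property, morphisms out of `T X` may be compared after composition with the
  -- unit. There the square reduces to naturality of the two units.
  have tr : ∀ (T T' : CopowerFunctor P W) (g : ∀ X, GHom K (T.functor.obj X) (T'.functor.obj X) 0),
      (∀ X, GCat.comp (zero_add 0) (T.unit.app X) ((homFrom K W).map (g X)) = T'.unit.app X) →
      ∀ {X Y : D} {d : ℤ} (f : GHom K X Y d), GCat.comp (add_zero d) (T.functor.map f) (g Y) =
        GCat.comp (zero_add d) (g X) (T'.functor.map f) := by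
    intro T T' g hg X Y d f
    refine inj T ?_
    rw [comp, comp, nat, hg, nat]
    refine (GCat.assoc (add_zero d) (add_zero d) (add_zero 0) (add_zero d) (P.map f)
      (T.unit.app Y) ((homFrom K W).map (g Y))).trans ?_
    rw [hg]
  have one : ∀ (T T' : CopowerFunctor P W)
      (g : ∀ X, GHom K (T.functor.obj X) (T'.functor.obj X) 0)
      (g' : ∀ X, GHom K (T'.functor.obj X) (T.functor.obj X) 0),
      (∀ X, GCat.comp (zero_add 0) (T.unit.app X) ((homFrom K W).map (g X)) = T'.unit.app X) →
      (∀ X, GCat.comp (zero_add 0) (T'.unit.app X) ((homFrom K W).map (g' X)) = T.unit.app X) →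
      ∀ X, GCat.comp (add_zero 0) (g X) (g' X) = GCat.id (T.functor.obj X) := by
    intro T T' g g' hg hg' X
    refine inj T ?_
    rw [comp, hg, hg', GFunctor.map_id]
    exact (GCat.comp_id _ (T.unit.app X)).symm
  obtain ⟨g, hg⟩ := ex T T'
  obtain ⟨g', hg'⟩ := ex T' T
  exact ⟨⟨⟨g, tr T T' g hg⟩, ⟨g', tr T' T g' hg'⟩, one T T' g g' hg hg', one T' T g' g hg' hg⟩⟩

end Copower

end

noncomputable section

open DHom

/-! ### Families of functionals factoring through the Kirby color tensored with strands -/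

/-- The juxtaposition of two monomials. -/
abbrev Mon.join₂ {a b m : ℕ} (h : a + b = m) (s : Mon a) (t : Mon b) : Mon m :=
  (Mon.split h).symm (s, t)

/-- Exchange of `1` and `x` in each variable. -/
def Mon.flip {n : ℕ} (s : Mon n) : Mon n := fun i => Fin.rev (s i)

@[simp] lemma Mon.flip_flip {n : ℕ} (s : Mon n) : s.flip.flip = s :=
  funext fun i => Fin.rev_rev (s i)

lemma Mon.deg_flip_one (s : Mon 1) : s.flip.deg = -s.deg := by
  obtain ⟨x, rfl⟩ : ∃ x, s = ![x] := ⟨s 0, Mon.ext_one rfl⟩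
  rw [Mon.deg_one, Mon.deg_one]
  fin_cases x <;> simp [Mon.flip]

lemma Mon.deg_join₂ {a b m : ℕ} (h : a + b = m) (s : Mon a) (t : Mon b) :
    (Mon.join₂ h s t).deg = s.deg + t.deg := by
  rw [Mon.deg_split h, Equiv.apply_symm_apply]

lemma Mon.join₂_surj {a b m : ℕ} (h : a + b = m) (s : Mon m) : ∃ t u, Mon.join₂ h t u = s :=
  ⟨(Mon.split h s).1, (Mon.split h s).2, Equiv.symm_apply_apply _ _⟩

lemma Mon.join₂_inj {a b m : ℕ} (h : a + b = m) {s s' : Mon a} {t t' : Mon b} :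
    Mon.join₂ h s t = Mon.join₂ h s' t' ↔ s = s' ∧ t = t' := by
  rw [Mon.join₂, Equiv.apply_eq_iff_eq, Prod.mk.injEq]

lemma Mon.join₂_zero {a : ℕ} (s : Mon a) (t : Mon 0) :
    Mon.join₂ (add_zero a) s t = s := by
  have h := congrArg Prod.fst (Equiv.apply_symm_apply (Mon.split (add_zero a)) (s, t))
  rwa [Mon.split_zero_right] at h

lemma Mon.join₂_assoc {a b c ab bc m : ℕ} (h₁ : a + b = ab) (h₂ : ab + c = m) (h₃ : b + c = bc)
    (h₄ : a + bc = m) (s : Mon a) (t : Mon b) (r : Mon c) :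
    Mon.join₂ h₂ (Mon.join₂ h₁ s t) r = Mon.join₂ h₄ s (Mon.join₂ h₃ t r) := by
  have e : Mon.split h₂ (Mon.join₂ h₄ s (Mon.join₂ h₃ t r)) = (Mon.join₂ h₁ s t, r) := by
    refine Prod.ext ?_ ?_
    · refine (Equiv.eq_symm_apply _).2 (Prod.ext ?_ ?_)
      · rw [Mon.split_assoc₁ h₁ h₂ h₃ h₄, Equiv.apply_symm_apply]
      · rw [Mon.split_assoc₂ h₁ h₂ h₃ h₄, Equiv.apply_symm_apply, Equiv.apply_symm_apply]
    · rw [Mon.split_assoc₃ h₁ h₂ h₃ h₄, Equiv.apply_symm_apply, Equiv.apply_symm_apply]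
  rw [Mon.join₂, ← e, Equiv.symm_apply_apply]

lemma Mon.sum_join₂ {M : Type u} [AddCommGroup M] {a b m : ℕ} (h : a + b = m) (f : Mon m → M) :
    ∑ t, f t = ∑ s, ∑ u, f (Mon.join₂ h s u) := by
  rw [← (Mon.split h).symm.sum_comp, Fintype.sum_prod_type]

variable {K : Type u} [Field K]

lemma tenM_join₂ {a b m a' b' m' : ℕ} (h : a + b = m) (h' : a' + b' = m')
    (A : Matrix (Mon a) (Mon a') K) (B : Matrix (Mon b) (Mon b') K) (s : Mon a) (t : Mon b)
    (s' : Mon a') (t' : Mon b') :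
    tenM h h' A B (Mon.join₂ h s t) (Mon.join₂ h' s' t') = A s s' * B t t' := by
  rw [tenM_apply, Equiv.apply_symm_apply, Equiv.apply_symm_apply]

/-- The morphism obtained by bending the last input strand upwards. -/
def unbend {a p : ℕ} {e : ℤ} (g : DHom K (a + 1) p e) : DHom K a (p + 1) e :=
  comp (zero_add e) (tensor (add_zero a) (rfl : a + 2 = a + 1 + 1) (zero_add 0) (1 : DHom K a a 0) (mk .cup) :
    DHom K a (a + 1 + 1) 0) (tensor rfl rfl (add_zero e) g (1 : DHom K 1 1 0))

/-- The morphism obtained by bending the last output strand downwards. -/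
def bend {a p : ℕ} {e : ℤ} (g : DHom K a (p + 1) e) : DHom K (a + 1) p e :=
  comp (add_zero e) (tensor rfl rfl (add_zero e) g (1 : DHom K 1 1 0) : DHom K (a + 1) (p + 1 + 1) e)
    (tensor (rfl : p + 2 = p + 1 + 1) (add_zero p) (zero_add 0) (1 : DHom K p p 0) (mk .cap))

/-- The strand that was bent down is bent up again. Once the new cup has been moved past `g`, it
meets the cap, and the zigzag relation removes both. -/
lemma unbend_bend {a p : ℕ} {e : ℤ} (g : DHom K a (p + 1) e) : unbend (bend g) = g := by
  have h₁ : tensor rfl rfl (add_zero e) (bend g) (1 : DHom K 1 1 0) = comp (add_zero e)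
      (tensor rfl rfl (add_zero e) (tensor rfl rfl (add_zero e) g (1 : DHom K 1 1 0))
        (1 : DHom K 1 1 0) : DHom K (a + 1 + 1) (p + 1 + 1 + 1) e)
      (tensor rfl rfl (zero_add 0) (tensor (rfl : p + 2 = p + 1 + 1) (add_zero p) (zero_add 0) (1 : DHom K p p 0)
        (mk .cap)) (1 : DHom K 1 1 0) : DHom K (p + 1 + 1 + 1) (p + 1) 0) := by
    rw [← interchange rfl rfl rfl (add_zero e) (add_zero 0) (add_zero e), gid_comp]
    rfl
  have h₂ : (tensor rfl rfl (add_zero e) (tensor rfl rfl (add_zero e) g (1 : DHom K 1 1 0))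
        (1 : DHom K 1 1 0) : DHom K (a + 1 + 1) (p + 1 + 1 + 1) e) =
      tensor (rfl : a + 2 = a + 1 + 1) (rfl : p + 1 + 2 = p + 1 + 1 + 1) (add_zero e) g
        (1 : DHom K 2 2 0) := by
    rw [gtensor_assoc rfl rfl rfl rfl rfl rfl rfl rfl (add_zero e) (add_zero e) (add_zero 0)
      (add_zero e), tensor_id_id]
  -- The new cup is disjoint from `g`, so it can be created after `g` instead of before it.
  have h₃ : comp (zero_add e) (tensor (add_zero a) (rfl : a + 2 = a + 1 + 1) (zero_add 0) (1 : DHom K a a 0) (mk .cup) :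
      DHom K a (a + 1 + 1) 0) (tensor (rfl : a + 2 = a + 1 + 1)
        (rfl : p + 1 + 2 = p + 1 + 1 + 1) (add_zero e) g (1 : DHom K 2 2 0)) =
      comp (add_zero e) g (tensor (add_zero (p + 1)) (rfl : p + 1 + 2 = p + 1 + 1 + 1) (zero_add 0)
        (1 : DHom K (p + 1) (p + 1) 0) (mk .cup)) := by
    rw [← tensor_eq_comp' (add_zero a) rfl (add_zero e) (zero_add e) rfl,
      tensor_eq_comp (add_zero a) rfl (add_zero e) (add_zero (p + 1)), gtensor_unit]
  -- With `p` strands split off on the left, what remains is exactly the left zigzag.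
  have h₄ : comp (add_zero 0) (tensor (add_zero (p + 1)) (rfl : p + 1 + 2 = p + 1 + 1 + 1) (zero_add 0)
        (1 : DHom K (p + 1) (p + 1) 0) (mk .cup) : DHom K (p + 1) (p + 1 + 1 + 1) 0)
      (tensor rfl rfl (zero_add 0) (tensor (rfl : p + 2 = p + 1 + 1) (add_zero p) (zero_add 0) (1 : DHom K p p 0)
        (mk .cap)) (1 : DHom K 1 1 0) : DHom K (p + 1 + 1 + 1) (p + 1) 0) = 1 := by
    rw [← tensor_id_id (a := p) (b := 1) rfl, gtensor_assoc (a := p) (b := 1) (c := 0) (a' := p)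
      (b' := 1) (c' := 2) rfl rfl (add_zero (p + 1)) rfl rfl rfl rfl rfl (zero_add 0) (zero_add 0)
      (zero_add 0) (zero_add 0), gtensor_assoc (a := p) (b := 2) (c := 1) (a' := p)
      (b' := 0) (c' := 1) rfl (add_zero p) rfl rfl rfl rfl rfl rfl (zero_add 0) (zero_add 0)
      (zero_add 0) (zero_add 0), ← interchange rfl rfl rfl (add_zero 0) (add_zero 0) (add_zero 0),
      gid_comp]
    refine congrArg (tensor rfl rfl (add_zero 0) (1 : DHom K p p 0)) ?_
    exact zigzag_left K
  rw [unbend, h₁, h₂, ← gcomp_assoc (zero_add e) (add_zero e) (add_zero e) (zero_add e), h₃,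
    gcomp_assoc (add_zero e) (add_zero e) (add_zero 0) (add_zero e), h₄, gcomp_id]

/-- The cup `x_1 + x_2` has entry 1 exactly when one leg carries exponent 1 and the other exponent
0. Bending therefore moves an index from input to output and exchanges its exponent. -/
lemma polM_unbend {a p : ℕ} {e : ℤ} (g : DHom K (a + 1) p e) (x : Mon p) (i : Mon 1) (t : Mon a) :
    polM (unbend g) (Mon.join₂ rfl x i) t = polM g x (Mon.join₂ rfl t i.flip) := by
  rw [unbend, polM_comp', polM_tensor, polM_tensor, Matrix.mul_apply, polM_one, polM_one,
    Mon.sum_join₂ (a := a + 1) (b := 1) rfl]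
  have hcup : ∀ (t' : Mon a) (k l : Mon 1), tenM (a := a) (b := 2) rfl (add_zero a)
      (1 : Matrix (Mon a) (Mon a) K) (polM (mk .cup : DHom K 0 2 0))
      (Mon.join₂ (a := a + 1) (b := 1) rfl (Mon.join₂ rfl t' k) l) t =
      if t' = t ∧ k = l.flip then 1 else 0 := by
    intro t' k l
    rw [Mon.join₂_assoc (bc := 2) rfl rfl rfl rfl,
      ← Mon.join₂_zero t (default : Mon 0), tenM_join₂, Matrix.one_apply, Mon.join₂_zero]
    change _ * cupM K _ (default : Mon 0) = _
    have h2 : cupM K (Mon.join₂ (a := 1) (b := 1) (m := 2) rfl k l) default =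
        if k = l.flip then 1 else 0 := by
      rw [cupM]
      revert k l
      have : ∀ k l : Mon 1, (Mon.join₂ (a := 1) (b := 1) (m := 2) rfl k l = ![1, 0] ∨
        Mon.join₂ (a := 1) (b := 1) (m := 2) rfl k l = ![0, 1]) ↔ k = l.flip := by decide +kernel
      intro k l
      exact if_congr (this k l) rfl rfl
    rw [h2, ite_and, ite_mul, one_mul, zero_mul]
  rw [Finset.sum_eq_single (Mon.join₂ rfl t i.flip), Fintype.sum_eq_single i]
  · rw [tenM_join₂, hcup, if_pos ⟨rfl, rfl⟩, Matrix.one_apply_eq, mul_one, mul_one]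
  · intro l hl
    rw [tenM_join₂, Matrix.one_apply_ne hl.symm, mul_zero, zero_mul]
  · intro y _ hy
    refine Finset.sum_eq_zero fun l _ => ?_
    obtain ⟨t', k, rfl⟩ := Mon.join₂_surj (a := a) (b := 1) rfl y
    by_cases hl : l = i
    · subst hl
      rw [hcup, if_neg, mul_zero]
      rintro ⟨rfl, rfl⟩
      exact hy rfl
    · rw [tenM_join₂, Matrix.one_apply_ne (Ne.symm hl), mul_zero, zero_mul]
  · intro h
    exact absurd (Finset.mem_univ _) h

lemma polM_bend {a p : ℕ} {e : ℤ} (g : DHom K a (p + 1) e) (x : Mon p) (i : Mon 1) (t : Mon a) :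
    polM (bend g) x (Mon.join₂ rfl t i) = polM g (Mon.join₂ rfl x i.flip) t := by
  conv_rhs => rw [← unbend_bend g, polM_unbend, Mon.flip_flip]

/-- Linear maps from the spaces `Hom(c ^ a, c ^ n ⊗ c ^ m)`, `n ≥ 0`, to a fixed space `M` that are
compatible with the symmetrizers and with the dotted cups on the first factor. -/
structure ColorFamily (K : Type u) [Field K] (a m : ℕ) (c : ℤ) (M : Type u) [AddCommGroup M]
    [Module K M] where
  φ : ∀ (n : ℕ) (e : ℤ), e = c + n → (DHom K a (n + m) e →ₗ[K] M)
  sym : ∀ (n : ℕ) (e : ℤ) (h : e = c + n) (g : DHom K a (n + m) e),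
    φ n e h (DHom.comp (add_zero e) g (DHom.tensor rfl rfl (add_zero 0) (DHom.symmetrizer K n)
      (1 : DHom K m m 0))) = φ n e h g
  cup : ∀ (n : ℕ) (e e' : ℤ) (h : e = c + n) (h' : e' = c + (n + 2 : ℕ)) (hd : e + 2 = e')
    (g : DHom K a (n + m) e), φ (n + 2) e' h' (DHom.comp hd g
      (DHom.tensor rfl rfl (add_zero 2) (DHom.tensor (add_zero n) rfl (zero_add 2) (1 : DHom K n n 0)
        (dottedCup K)) (1 : DHom K m m 0))) = φ n e h g

variable {M : Type u} [AddCommGroup M] [Module K M]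

/-- The family obtained by bending a strand. -/
def ColorFamily.bend {a m : ℕ} {c : ℤ} (Φ : ColorFamily K a (m + 1) c M) :
    ColorFamily K (a + 1) m c M where
  φ n e h :=
    { toFun := fun g => Φ.φ n e h (unbend g)
      map_add' := fun g g' => by rw [unbend, add_tensor', comp_add', map_add]; rfl
      map_smul' := fun r g => by rw [unbend, smul_tensor', comp_smul', map_smul]; rfl }
  sym n e h g := by
    refine Eq.trans ?_ (Φ.sym n e h (unbend g))
    refine congrArg (Φ.φ n e h) ?_
    rw [unbend, unbend, gcomp_assoc (zero_add e) (add_zero e) (add_zero e) (zero_add e),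
      ← tensor_id_id (a := m) (b := 1) rfl,
      ← gtensor_assoc (a := n) (b := m) (c := 1) (a' := n) (b' := m) (c' := 1) rfl rfl rfl rfl rfl
        rfl rfl rfl (add_zero 0) (add_zero 0) (add_zero 0) (add_zero 0)]
    congr 1
    rw [← interchange rfl rfl rfl (add_zero e) (add_zero 0) (add_zero e), gcomp_id]
  cup n e e' h h' hd g := by
    refine Eq.trans ?_ (Φ.cup n e e' h h' hd (unbend g))
    refine congrArg (Φ.φ (n + 2) e' h') ?_
    rw [unbend, unbend, gcomp_assoc (zero_add e) hd hd (zero_add e'),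
      ← tensor_id_id (a := m) (b := 1) rfl,
      ← gtensor_assoc (a := n) (b := m) (c := 1) (a' := n + 2) (b' := m) (c' := 1) (m := n + (m + 1))
        (n := n + 2 + (m + 1)) rfl rfl rfl rfl rfl
        rfl rfl rfl (add_zero 2) (add_zero 2) (add_zero 0) (add_zero 2)]
    congr 1
    rw [← interchange rfl rfl rfl hd (add_zero 0) (add_zero e'), gcomp_id]

/-- The values of a color family depend only on the top coefficients of the associated matrix. -/
lemma ColorFamily.exists_eq_sum [CharZero K] {a m : ℕ} {c : ℤ} (Φ : ColorFamily K a m c M) :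
    ∃ γ : Mon m → Mon a → M, ∀ (n : ℕ) (e : ℤ) (h : e = c + n) (g : DHom K a (n + m) e),
      Φ.φ n e h g = ∑ u, ∑ t, polM g (Mon.join₂ rfl (Mon.top n) u) t • γ u t := by
  induction m generalizing a with
  | zero =>
    let Ψ : KirbyFamily K a c M := ⟨Φ.φ, fun n e h g => by
      refine Eq.trans ?_ (Φ.sym n e h g)
      rw [gtensor_unit], fun n e e' h h' hd g => by
      refine Eq.trans ?_ (Φ.cup n e e' h h' hd g)
      rw [gtensor_unit]⟩
    refine ⟨fun _ t => dotsValue Ψ.φ t, fun n e h g => ?_⟩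
    rw [Fintype.sum_unique, Mon.join₂_zero]
    exact Ψ.φ_eq_sum h g
  | succ m ih =>
    -- The bent family has one output strand fewer and one input strand more. The last input index
    -- of its coefficients is read back as the last output index, with the exponent exchanged.
    obtain ⟨γ, hγ⟩ := ih Φ.bend
    refine ⟨fun u t => γ (Mon.split rfl u).1 (Mon.join₂ rfl t (Mon.split rfl u).2.flip),
      fun n e h g => ?_⟩
    have h₁ : Φ.φ n e h g = Φ.bend.φ n e h (GradedLinear.bend g) := by
      conv_lhs => rw [← unbend_bend (p := n + m) g]
      rfl
    rw [h₁, hγ, Mon.sum_join₂ (a := m) (b := 1) rfl]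
    refine Finset.sum_congr rfl fun u _ => ?_
    rw [Mon.sum_join₂ (a := a) (b := 1) rfl, Finset.sum_comm]
    -- The sum over the bent index is reindexed by the exchange of exponents, which is an
    -- involution.
    refine Fintype.sum_equiv ⟨Mon.flip, Mon.flip, Mon.flip_flip, Mon.flip_flip⟩ _ _ fun i => ?_
    refine Finset.sum_congr rfl fun t _ => ?_
    have h₂ : Mon.split (a := m) (b := 1) rfl (Mon.join₂ rfl u i.flip) = (u, i.flip) :=
      Equiv.apply_symm_apply _ _
    rw [polM_bend, Mon.join₂_assoc (bc := m + 1) rfl rfl rfl rfl]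
    change _ = _ • γ (Mon.split (a := m) (b := 1) rfl (Mon.join₂ rfl u i.flip)).1
      (Mon.join₂ rfl t (Mon.split (a := m) (b := 1) rfl (Mon.join₂ rfl u i.flip)).2.flip)
    rw [h₂, Mon.flip_flip]
    rfl

lemma polM_strand_top (b : Fin 2) (e : ℤ) (h : e = 2 - 2 * (b : ℕ)) (t : Mon 1) :
    polM (strand K b e h) (Mon.top 1) t = if b = t 0 then 1 else 0 := by
  obtain ⟨x, rfl⟩ : ∃ x, t = ![x] := ⟨t 0, Mon.ext_one rfl⟩
  fin_cases b
  · obtain rfl : e = 2 := by simpa using h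
    change dotM K (Mon.top 1) ![x] = _
    rw [dotM]
    refine if_congr ?_ rfl rfl
    revert x
    decide +kernel
  · obtain rfl : e = 0 := by simpa using h
    change (1 : Matrix (Mon 1) (Mon 1) K) (Mon.top 1) ![x] = _
    rw [Matrix.one_apply]
    refine if_congr ?_ rfl rfl
    revert x
    decide +kernel

lemma Mon.top_add {a b m : ℕ} (h : a + b = m) :
    Mon.top m = Mon.join₂ h (Mon.top a) (Mon.top b) := by
  rw [Mon.join₂, Equiv.eq_symm_apply]
  rfl

/-- The endomorphism `dots s` is multiplication by the product of the `x_i` with `s i = 0`. Since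
squares vanish, it takes a monomial `t` to `x_1 ⋯ x_n` only when `t` is complementary to that
product, that is, when `t = s`. -/
lemma polM_dots_top (n : ℕ) (s t : Mon n) (e : ℤ) (h : e = n - s.deg) :
    polM (dots K n s e h) (Mon.top n) t = if s = t then 1 else 0 := by
  induction n generalizing e with
  | zero =>
    obtain rfl : e = 0 := by rw [h, s.deg_zero]; simp
    rw [if_pos (Subsingleton.elim s t), Subsingleton.elim (Mon.top 0) t]
    exact Matrix.one_apply_eq _
  | succ n ih =>
    obtain ⟨s, i, rfl⟩ := Mon.join₂_surj (a := n) (b := 1) rfl s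
    obtain ⟨t, j, rfl⟩ := Mon.join₂_surj (a := n) (b := 1) rfl t
    rw [dots, polM_tensor, Mon.top_add (a := n) (b := 1) rfl, tenM_join₂, ih, polM_strand_top]
    simp only [Equiv.apply_symm_apply, Mon.join₂_inj]
    have hi : i = j ↔ i 0 = j 0 := ⟨fun h => by rw [h], fun h => (Mon.ext_one h).trans (Mon.ext_one rfl).symm⟩
    rw [if_congr (and_congr_right fun _ => hi) rfl rfl, ite_and, ite_mul, one_mul, zero_mul]

/-- Morphisms whose top coefficients form a matrix unit. -/
lemma exists_polM_top_eq (a m : ℕ) (t : Mon a) (u : Mon m) :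
    ∃ (n : ℕ) (g : DHom K a (n + m) (n + u.deg - t.deg)), ∀ u' t',
      polM g (Mon.join₂ rfl (Mon.top n) u') t' = if u = u' ∧ t = t' then 1 else 0 := by
  induction m generalizing a with
  | zero =>
    -- With no extra strands, the top row of `dots t` is the unit vector at `t`, so `n = a`
    -- suffices.
    refine ⟨a, dots K a t _ (by rw [Mon.deg_zero]; ring), fun u' t' => ?_⟩
    rw [Mon.join₂_zero]
    refine (polM_dots_top a t t' _ _).trans (if_congr ?_ rfl rfl)
    simp [Subsingleton.elim u u']
  | succ m ih =>
    obtain ⟨u, i, rfl⟩ := Mon.join₂_surj (a := m) (b := 1) rfl u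
    -- The last output exponent `i` is moved to the input side, where it appears exchanged, and the
    -- resulting morphism is bent back.
    obtain ⟨n, g, hg⟩ := ih (a + 1) (Mon.join₂ rfl t i.flip) u
    have hd : (n : ℤ) + u.deg - (Mon.join₂ rfl t i.flip).deg =
        n + (Mon.join₂ (m := m + 1) rfl u i).deg - t.deg := by
      rw [Mon.deg_join₂, Mon.deg_join₂, Mon.deg_flip_one]
      ring
    -- The degree of the inductive morphism agrees with the required one only after computing
    -- degrees of monomials, so it is replaced by a variable before substituting.
    generalize (n : ℤ) + u.deg - (Mon.join₂ rfl t i.flip).deg = e at hd g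
    subst hd
    refine ⟨n, unbend g, fun u' t' => ?_⟩
    obtain ⟨u', i', rfl⟩ := Mon.join₂_surj (a := m) (b := 1) rfl u'
    refine (congrArg (fun z => polM (unbend g) z t')
      (Mon.join₂_assoc (bc := m + 1) rfl rfl rfl rfl (Mon.top n) u' i').symm).trans ?_
    rw [polM_unbend, hg]
    refine if_congr ?_ rfl rfl
    have hi : i.flip = i'.flip ↔ i = i' :=
      ⟨fun h => by rw [← i.flip_flip, h, Mon.flip_flip], fun h => by rw [h]⟩
    rw [Mon.join₂_inj, Mon.join₂_inj, hi]
    tauto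

/-! ### Top coefficients of the symmetrizers and the dotted cups -/

lemma polM_mul {n : ℕ} (f g : DHom K n n 0) : polM (f * g) = polM f * polM g :=
  polM_comp' _ _ _

/-- The image of the cup does not involve `x_1 x_2`, so `cup ∘ cap` contributes nothing to the top
row and only the identity remains. -/
lemma polM_crossing_top (t : Mon 2) :
    polM (crossing K) (Mon.top 2) t = if t = Mon.top 2 then 1 else 0 := by
  have h : polM (cupcap K) (Mon.top 2) t = 0 := by
    rw [cupcap, polM_comp', Matrix.mul_apply, Fintype.sum_unique]
    have : cupM K (Mon.top 2) default = 0 := by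
      rw [cupM, if_neg]
      decide +kernel
    exact (congrArg (· * _) this).trans (zero_mul _)
  rw [crossing, map_sub, Matrix.sub_apply, h, sub_zero, polM_one, Matrix.one_apply]
  exact if_congr eq_comm rfl rfl

lemma Mon.top_join {l a r m : ℕ} (h : l + a + r = m) :
    Mon.top m = Mon.join h (Mon.top l) (Mon.top a) (Mon.top r) :=
  (Mon.top_add h).trans (congrArg (fun z => Mon.join₂ h z (Mon.top r)) (Mon.top_add rfl))

lemma polM_crossingAt_top (n i : ℕ) (t : Mon n) :
    polM (crossingAt K n i) (Mon.top n) t = if t = Mon.top n then 1 else 0 := by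
  by_cases h : i + 2 ≤ n
  · rw [crossingAt, dif_pos h, ctx_eq_wh]
    have hn : i + 2 + (n - (i + 2)) = n := by omega
    obtain ⟨t₁, t₂, t₃, rfl⟩ := Mon.join_surj hn t
    rw [Mon.top_join hn, polM_wh, polM_crossing_top]
    have e : Mon.join hn t₁ t₂ t₃ = Mon.join hn (Mon.top i) (Mon.top 2) (Mon.top (n - (i + 2))) ↔
        (Mon.top i = t₁ ∧ t₂ = Mon.top 2) ∧ Mon.top (n - (i + 2)) = t₃ := by
      change Mon.join₂ hn (Mon.join₂ rfl t₁ t₂) t₃ = Mon.join₂ hn (Mon.join₂ rfl _ _) _ ↔ _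
      rw [Mon.join₂_inj, Mon.join₂_inj]
      exact and_congr (and_congr eq_comm Iff.rfl) eq_comm
    rw [if_congr e rfl rfl]
    simp only [ite_and]
    split_ifs <;> simp
  · rw [crossingAt, dif_neg h, polM_one, Matrix.one_apply]
    exact if_congr eq_comm rfl rfl

lemma polM_prod_top {n : ℕ} (l : List (DHom K n n 0))
    (h : ∀ f ∈ l, ∀ t, polM f (Mon.top n) t = if t = Mon.top n then 1 else 0) (t : Mon n) :
    polM l.prod (Mon.top n) t = if t = Mon.top n then 1 else 0 := by
  induction l with
  | nil =>
    rw [List.prod_nil, polM_one, Matrix.one_apply]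
    exact if_congr eq_comm rfl rfl
  | cons f l ih =>
    rw [List.prod_cons, polM_mul, Matrix.mul_apply, Fintype.sum_eq_single (Mon.top n),
      h f List.mem_cons_self, if_pos rfl, one_mul, ih fun g hg => h g (List.mem_cons_of_mem _ hg)]
    intro s hs
    rw [h f List.mem_cons_self, if_neg hs, zero_mul]

/-- Every product of crossings has the same top row as the identity, and the symmetrizer is the
average of `n!` such products. -/
lemma polM_symmetrizer_top [CharZero K] (n : ℕ) (t : Mon n) :
    polM (symmetrizer K n) (Mon.top n) t = if t = Mon.top n then 1 else 0 := by
  rw [symmetrizer, map_smul, Matrix.smul_apply, permSum, wordSum, map_sum, Matrix.sum_apply,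
    Finset.sum_congr rfl fun w _ => polM_prod_top _ (fun f hf s => by
      obtain ⟨i, _, rfl⟩ := List.mem_map.1 hf
      exact polM_crossingAt_top n _ s) t, Finset.sum_const, Finset.card_univ,
    Fintype.card_perm, Fintype.card_fin, ← Nat.cast_smul_eq_nsmul K, smul_smul, inv_mul_cancel₀,
    one_smul]
  exact_mod_cast n.factorial_ne_zero

lemma polM_dottedCup_top (t : Mon 0) : polM (dottedCup K) (Mon.top 2) t = 1 := by
  -- This is the coefficient of `x_1 x_2` in `x_1 (x_1 + x_2)`. It is evaluated over the integers,
  -- where it is decidable, and then mapped to `K`.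
  have h : (tenM (a := 1) (b := 1) (m := 2) (a' := 1) (b' := 1) (m' := 2) rfl rfl (dotM ℤ) 1 *
      cupM ℤ) (Mon.top 2) default = 1 := by decide +kernel
  have h' := congrArg (Int.castRingHom K) h
  rw [map_one] at h'
  rw [← h', Subsingleton.elim t default, dottedCup, polM_comp', polM_tensor]
  change (tenM (a := 1) (b := 1) (m := 2) (a' := 1) (b' := 1) (m' := 2) rfl rfl (dotM K)
    (1 : Matrix (Mon 1) (Mon 1) K) * cupM K : Matrix (Mon 2) (Mon 0) K) (Mon.top 2) default = _
  rw [← map_cupM, ← map_dotM, ← map_oneM, ← map_tenM, ← Matrix.map_mul]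
  rfl

end

noncomputable section

/-! ### Morphisms between original objects and the summands of a directed system -/

section Summands

variable {K : Type u} [Field K] {C : Type v} [GCat K C]

variable (K) in
/-- An object, as an object of the additive completion of the Karoubi envelope. -/
def matBase (X : C) : Mat K (Kar K C) := (embedMat K C).obj X

/-- The action of `matBase` on morphisms. -/
def matBaseMap {X Y : C} {d : ℤ} : GHom K X Y d →ₗ[K] GHom K (matBase K X) (matBase K Y) d :=
  (embedMat K C).map

variable (K) in
/-- An object, as an object of the ind-completion of the additive completion of the Karoubi
envelope. -/
def base (X : C) : IndObj K (Mat K (Kar K C)) := (embed K C).obj X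

/-- The action of `base` on morphisms. -/
def baseMap {X Y : C} {d : ℤ} : GHom K X Y d →ₗ[K] GHom K (base K X) (base K Y) d :=
  (embed K C).map

lemma baseMap_comp {X Y Z : C} {i j k : ℤ} (h : i + j = k) (f : GHom K X Y i)
    (g : GHom K Y Z j) : baseMap (GCat.comp h f g) = GCat.comp h (baseMap f) (baseMap g) :=
  (embed K C).map_comp h f g

/-- The projection from the object underlying the image of an idempotent. -/
def Kar.embedProj (A : Kar K C) : GHom K (matBase K A.X) ((toMat K (Kar K C)).obj A) 0 :=
  (toMat K (Kar K C)).map A.proj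

lemma Kar.embedProj_toKar (X : C) :
    ((toKar K C).obj X).embedProj = GCat.id (matBase K X) :=
  (toMat K (Kar K C)).map_id _

lemma Kar.map_comp_embedProj {A B : Kar K C} {d : ℤ} (f : GHom K A B d) :
    GCat.comp (add_zero d) (matBaseMap f.1) B.embedProj =
      GCat.comp (zero_add d) A.embedProj ((toMat K (Kar K C)).map f) :=
  ((toMat K (Kar K C)).map_comp (add_zero d) _ _).symm.trans
    ((congrArg _ (Kar.map_comp_proj f (add_zero d) (zero_add d))).trans
      ((toMat K (Kar K C)).map_comp (zero_add d) _ _))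

/-- The projection onto the image of an idempotent, followed by the inclusion as a summand. -/
def Mat.fromBase (B : Mat K (Kar K C)) (b : B.ι) : GHom K (matBase K (B.X b).X) B (B.s b) :=
  B.fromEmbed b

lemma Mat.fromBase_eq (B : Mat K (Kar K C)) (b : B.ι) :
    B.fromBase b = GCat.comp (zero_add _) (B.X b).embedProj (B.inM b) := rfl

lemma Mat.map_comp_fromBase (B : Mat K (Kar K C)) {A : Kar K C} (b : B.ι) {d e : ℤ}
    (h : d + B.s b = e) (f : GHom K A (B.X b) d) :
    GCat.comp h (matBaseMap f.1) (B.fromBase b) = GCat.comp (zero_add e) A.embedProj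
      (GCat.comp h ((toMat K (Kar K C)).map f) (B.inM b)) := by
  rw [Mat.fromBase_eq, ← GCat.assoc (add_zero d) h (zero_add _) h, Kar.map_comp_embedProj,
    GCat.assoc (zero_add d) h h (zero_add e)]

lemma Mat.idem_comp_fromBase (B : Mat K (Kar K C)) (b : B.ι) :
    GCat.comp (zero_add _) (matBaseMap (B.X b).e) (B.fromBase b) = B.fromBase b := by
  refine (B.map_comp_fromBase b (zero_add _) (GCat.id (B.X b))).trans ?_
  rw [GFunctor.map_id, GCat.id_comp, Mat.fromBase_eq]

/-- A matrix acts on the inclusions of summands through the morphisms underlying its entries,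
because the idempotents are absorbed on either side. This replaces computations with images of
idempotents by computations in the original category. -/
lemma Mat.fromBase_comp {A B : Mat K (Kar K C)} (f : Mat.HomM A B 0) (a : A.ι) :
    GCat.comp (add_zero _) (A.fromBase a) (f : GHom K A B 0) =
      ∑ b, GCat.comp (show 0 + A.s a - B.s b + B.s b = A.s a by omega)
        (matBaseMap (f a b).1) (B.fromBase b) := by
  rw [Finset.sum_congr rfl fun b _ => B.map_comp_fromBase b
    (show 0 + A.s a - B.s b + B.s b = A.s a by omega) (f a b), Mat.fromBase_eq,
    GCat.assoc (zero_add _) (add_zero _) (add_zero _) (zero_add _), Mat.inM_comp _ _ (add_zero _),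
    map_sum]

lemma Mat.exists_eq_sum_fromBase (B : Mat K (Kar K C)) {X : C} {d : ℤ}
    (f : GHom K (matBase K X) B d) : ∃ g : ∀ b : B.ι, GHom K X (B.X b).X (d - B.s b),
      f = ∑ b, GCat.comp (sub_add_cancel d _) (matBaseMap (g b)) (B.fromBase b) := by
  let f' : Mat.HomM (matBase K X) B d := f
  have hd : ∀ b, d + 0 - B.s b = d - B.s b := fun b => by omega
  refine ⟨fun b => degCast (hd b) (f' () b).1, ?_⟩
  refine (Mat.eq_sum_inM B f).trans (Finset.sum_congr rfl fun b _ => ?_)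
  have e : ∀ (e' : ℤ) (he : d + 0 - B.s b = e'), GCat.comp (show e' + B.s b = d by omega)
      (matBaseMap (degCast he (f' () b).1)) (B.fromBase b) =
      GCat.comp (show d + 0 - B.s b + B.s b = d by omega) (matBaseMap (f' () b).1)
        (B.fromBase b) := by
    intro e' he
    subst he
    rfl
  refine Eq.trans ?_ (e _ (hd b)).symm
  refine Eq.trans ?_ (B.map_comp_fromBase (A := (toKar K C).obj X) b
    (show d + 0 - B.s b + B.s b = d by omega) (f' () b)).symm
  have key : ∀ z : GHom K (matBase K X) B d,
      z = GCat.comp (zero_add d) ((toKar K C).obj X).embedProj z := fun z =>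
    ((congrArg (fun w : GHom K (matBase K X) (matBase K X) 0 => GCat.comp (zero_add d) w z)
      (Kar.embedProj_toKar X)).trans (GCat.id_comp (zero_add d) z)).symm
  exact key _

/-- Morphisms out of the image of an object, regarded as morphisms of ind-objects. -/
def constMap (X : C) (B : Mat K (Kar K C)) (d : ℤ) :
    GHom K (matBase K X) B d →ₗ[K] GHom K (base K X) (IndObj.const B) d :=
  (constFunctor K (Mat K (Kar K C))).map (X := matBase K X) (Y := B) (d := d)

lemma map_comp_constMap {X Y : C} {B : Mat K (Kar K C)} {i j k : ℤ} (h : i + j = k)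
    (f : GHom K X Y i) (g : GHom K (matBase K Y) B j) :
    GCat.comp h (baseMap f) (constMap Y B j g) =
      constMap X B k (GCat.comp h (matBaseMap f) g) :=
  ((constFunctor K (Mat K (Kar K C))).map_comp h (matBaseMap f) g).symm

lemma constMap_comp {X : C} {A B : Mat K (Kar K C)} {i j k : ℤ} (h : i + j = k)
    (f : GHom K (matBase K X) A i) (g : GHom K A B j) :
    GCat.comp h (constMap X A i f) ((constFunctor K (Mat K (Kar K C))).map g) =
      constMap X B k (GCat.comp h f g) :=
  ((constFunctor K (Mat K (Kar K C))).map_comp h f g).symm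

/-- The morphism to an ind-object from the object underlying a summand of one of its terms. -/
def IndObj.summandIncl (B : IndObj K (Mat K (Kar K C))) (i : B.I) (b : (B.at i).ι) :
    GHom K (base K ((B.at i).X b).X) B ((B.at i).s b) :=
  GCat.comp (add_zero _) (constMap _ _ _ ((B.at i).fromBase b)) (B.incl i)

/-- The entries of a transition morphism. -/
abbrev IndObj.trEntry (B : IndObj K (Mat K (Kar K C))) {i j : B.I} (v : i ⟶ j)
    (b : (B.at i).ι) (b' : (B.at j).ι) :
    GHom K ((B.at i).X b) ((B.at j).X b') (0 + (B.at i).s b - (B.at j).s b') :=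
  (B.tr v : Mat.HomM (B.at i) (B.at j) 0) b b'

lemma IndObj.map_comp_summandIncl (B : IndObj K (Mat K (Kar K C))) {X : C} (i : B.I)
    (b : (B.at i).ι) {d e : ℤ} (h : d + (B.at i).s b = e) (f : GHom K X ((B.at i).X b).X d) :
    GCat.comp h (baseMap f) (B.summandIncl i b) = GCat.comp (add_zero e)
      (constMap X (B.at i) e (GCat.comp h (matBaseMap f) ((B.at i).fromBase b)))
      (B.incl i) := by
  rw [IndObj.summandIncl, ← GCat.assoc h (add_zero e) (add_zero _) h, map_comp_constMap]

/-- The inclusion passes through the image of the idempotent and so absorbs it. For the Kirby color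
the idempotent is the symmetrizer. -/
lemma IndObj.idem_comp_summandIncl (B : IndObj K (Mat K (Kar K C))) (i : B.I) (b : (B.at i).ι) :
    GCat.comp (zero_add _) (baseMap ((B.at i).X b).e) (B.summandIncl i b) =
      B.summandIncl i b := by
  rw [B.map_comp_summandIncl i b (zero_add _), Mat.idem_comp_fromBase, IndObj.summandIncl]

/-- Pushing a summand to a later term of the system expresses its inclusion by a row of the
transition matrix. For the Kirby color this is the source of the compatibility with dotted cups. -/
lemma IndObj.summandIncl_eq_sum (B : IndObj K (Mat K (Kar K C))) {i j : B.I} (v : i ⟶ j)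
    (b : (B.at i).ι) : B.summandIncl i b =
      ∑ b', GCat.comp (show 0 + (B.at i).s b - (B.at j).s b' + (B.at j).s b' = (B.at i).s b by omega)
        (baseMap (B.trEntry v b b').1) (B.summandIncl j b') := by
  have h₁ : B.summandIncl i b = GCat.comp (add_zero _) (constMap _ _ _
      (GCat.comp (add_zero _) ((B.at i).fromBase b) (B.tr v))) (B.incl j) := by
    rw [IndObj.summandIncl, ← B.tr_comp_incl v,
      ← GCat.assoc (add_zero _) (add_zero _) (add_zero 0) (add_zero _), constMap_comp]
  rw [h₁, Mat.fromBase_comp (B.tr v) b, map_sum, map_sum, LinearMap.sum_apply]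
  exact Finset.sum_congr rfl fun b' _ =>
    (B.map_comp_summandIncl j b' _ (B.trEntry v b b').1).symm

/-- A morphism from an original object to a filtered colimit factors through some term, and a
morphism to a formal sum is the sum of its components. -/
lemma IndObj.exists_eq_sum_summandIncl (B : IndObj K (Mat K (Kar K C))) {X : C} {d : ℤ}
    (f : GHom K (base K X) B d) : ∃ (i : B.I)
      (g : ∀ b : (B.at i).ι, GHom K X ((B.at i).X b).X (d - (B.at i).s b)),
      f = ∑ b, GCat.comp (sub_add_cancel d _) (baseMap (g b)) (B.summandIncl i b) := by
  obtain ⟨i, f, rfl⟩ := IndObj.exists_factor f (add_zero d)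
  obtain ⟨g, rfl⟩ := (B.at i).exists_eq_sum_fromBase f
  refine ⟨i, g, ?_⟩
  rw [Finset.sum_congr rfl fun b _ => B.map_comp_summandIncl i b (sub_add_cancel d _) (g b)]
  refine Eq.trans ?_ (LinearMap.sum_apply _ _ _)
  rw [← map_sum, ← map_sum]
  rfl

/-! ### Restriction of extended functors to the original category -/

lemma GVect.tr_tr (V : GVect K) {i j k : ℤ} (h : i = j) (h' : j = k) (x : V.V i) :
    V.tr h' (V.tr h x) = V.tr (h.trans h') x := by
  subst h h'; rfl

lemma GFunctor.at_degCast {D : Type w} [GCat K D] (F : GFunctor K D (GVect K)) {X Y : D}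
    {d d' p p' q q' : ℤ} (hd : d = d') (hp : p = p') (hq : q = q') (h : p + d = q) (h' : p' + d' = q')
    (f : GHom K X Y d) (x : (F.obj X).V p) :
    HOM.at (F.map (degCast hd f)) p' q' h' ((F.obj X).tr hp x) =
      (F.obj Y).tr hq (HOM.at (F.map f) p q h x) := by
  subst hd hp hq; rfl

/-- The canonical map from the values of a functor to the values of its extension. -/
def GFunctor.embedι (F : GFunctor K C (GVect K)) (X : C) (p : ℤ) :
    (F.obj X).V p →ₗ[K] (F.extKar.extMat.extInd.obj (base K X)).V p :=
  F.extKar.extMat.indι (IndObj.const ((embedMat K C).obj X)) p PUnit.unit ∘ₗ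
    LinearMap.pi fun _ => LinearMap.codRestrict
      (LinearMap.range (HOM.at (F.map (GCat.id (K := K) X)) (p - 0) (p - 0) (add_zero _)))
      ((F.obj X).tr (sub_zero p).symm) fun x => ⟨(F.obj X).tr (sub_zero p).symm x, by
        rw [F.map_id]; rfl⟩

lemma GFunctor.embedι_map (F : GFunctor K C (GVect K)) {X Y : C} {d p q : ℤ} (h : p + d = q)
    (f : GHom K X Y d) (x : (F.obj X).V p) :
    HOM.at (F.extKar.extMat.extInd.map (baseMap f)) p q h (F.embedι X p x) =
      F.embedι Y q (HOM.at (F.map f) p q h x) := by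
  refine (F.extKar.extMat.extInd_const_map h ((embedMat K C).map f) _).trans ?_
  refine congrArg (F.extKar.extMat.indι (IndObj.const ((embedMat K C).obj Y)) q PUnit.unit) ?_
  funext b
  refine (F.extKar.matMap_at ((embedMat K C).map f : Mat.HomM ((embedMat K C).obj X)
    ((embedMat K C).obj Y) d) p q h _ b).trans ((Fintype.sum_unique (ι := Unit) _).trans ?_)
  refine Subtype.ext ?_
  have e : ∀ (d' : ℤ) (hd : d = d'), (degCast hd ((toKar K C).map f)).1 = degCast hd f := by
    intro d' hd
    subst hd
    rfl
  refine Eq.trans ?_ (F.at_degCast (by simp : d = d + 0 - 0) (sub_zero p).symm (sub_zero q).symm h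
    (by omega) f x)
  exact congrArg (fun z => HOM.at (F.map z) (p - 0) (q - 0)
    (show p - 0 + (d + 0 - 0) = q - 0 by omega) ((F.obj X).tr (sub_zero p).symm x)) (e _ _)

lemma GFunctor.embedι_surjective (F : GFunctor K C (GVect K)) (X : C) (p : ℤ) :
    Function.Surjective (F.embedι X p) := fun y => by
  obtain ⟨x, rfl⟩ := F.extKar.extMat.indι_const_surjective ((embedMat K C).obj X) p y
  refine ⟨(F.obj X).tr (sub_zero p) (x ()).1, congrArg _ (funext fun b => Subtype.ext ?_)⟩
  exact GVect.tr_tr _ _ _ _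

end Summands

end

noncomputable section

/-! ### Extended natural transformations on the original objects -/

section ExtEmbed

variable {K : Type u} [Field K] {C : Type v} [GCat K C]

lemma GNatTrans.at_tr {D : Type w} [GCat K D] {F G : GFunctor K D (GVect K)} (θ : GNatTrans F G)
    (X : D) {p p' : ℤ} (h : p = p') (x : (F.obj X).V p) :
    HOM.at (θ.app X) p' p' (add_zero p') ((F.obj X).tr h x) =
      (G.obj X).tr h (HOM.at (θ.app X) p p (add_zero p) x) := by
  subst h; rfl

lemma GFunctor.map_degCast_id_at {D : Type w} [GCat K D] (F : GFunctor K D (GVect K)) (X : D)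
    {d p q : ℤ} (h₀ : 0 = d) (h : p + d = q) (x : (F.obj X).V p) :
    HOM.at (F.map (degCast h₀ (GCat.id (K := K) X))) p q h x = (F.obj X).tr (by omega) x := by
  subst h₀
  obtain rfl : p = q := by omega
  exact F.map_degCast_id X rfl p h x

lemma GNatTrans.extMat_at {F : GFunctor K C (GVect K)} {G : GFunctor K (Mat K C) (GVect K)}
    (τ : GNatTrans F ((toMat K C).comp G)) (A : Mat K C) (p : ℤ) (x : (F.matObj A).V p) :
    HOM.at (τ.extMat.app A) p p (add_zero p) x = ∑ i, HOM.at (G.map (A.inM i)) (p - A.s i) p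
      (by omega) (HOM.at (τ.app (A.X i)) (p - A.s i) (p - A.s i) (add_zero _) (x i)) :=
  LinearMap.sum_apply _ _ _

lemma GNatTrans.extMat_toMat {F : GFunctor K C (GVect K)} {G : GFunctor K (Mat K C) (GVect K)}
    (τ : GNatTrans F ((toMat K C).comp G)) (X : C) (p : ℤ)
    (x : (F.matObj ((toMat K C).obj X)).V p) :
    HOM.at (τ.extMat.app ((toMat K C).obj X)) p p (add_zero p) x =
      HOM.at (τ.app X) p p (add_zero p) ((F.obj X).tr (sub_zero p) (x ())) := by
  refine (τ.extMat_at _ p x).trans ((Fintype.sum_unique (ι := Unit) _).trans ?_)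
  rw [τ.at_tr X (sub_zero p) (x ())]
  have hp : p - 0 + 0 = p := by omega
  have h : ((toMat K C).obj X).inM () = GCat.id ((toMat K C).obj X) := by
    funext a b
    have e : (((toMat K C).obj X).inM () : Mat.HomM _ _ 0) a b = degCast (by simp) (GCat.id X) := by
      simp only [Mat.inM]
      rfl
    exact e.trans (((toMat K C).obj X).idM_self ()).symm
  refine Eq.trans ?_ (G.map_degCast_id_at ((toMat K C).obj X) rfl hp _)
  exact congrArg (fun z => HOM.at (G.map z) (p - 0) p hp
    (HOM.at (τ.app X) (p - 0) (p - 0) (add_zero _) (x ()))) h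

lemma GNatTrans.extKar_toKar {F : GFunctor K C (GVect K)} {G : GFunctor K (Kar K C) (GVect K)}
    (τ : GNatTrans F ((toKar K C).comp G)) (X : C) (p : ℤ)
    (x : (F.extKar.obj ((toKar K C).obj X)).V p) :
    HOM.at (τ.extKar.app ((toKar K C).obj X)) p p (add_zero p) x =
      HOM.at (τ.app X) p p (add_zero p) x.1 := by
  refine (τ.extKar_at _ p x).trans ?_
  refine (congrArg (fun z => HOM.at z p p (add_zero p) _) (G.map_id ((toKar K C).obj X))).trans ?_
  exact HOM.id_at p p _ _

lemma GNatTrans.extInd_const {F : GFunctor K C (GVect K)} {G : GFunctor K (IndObj K C) (GVect K)}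
    (τ : GNatTrans F ((constFunctor K C).comp G)) (X : C) (p : ℤ) (x : (F.obj X).V p) :
    HOM.at (τ.extInd.app (IndObj.const X)) p p (add_zero p)
      (F.indι (IndObj.const X) p PUnit.unit x) = HOM.at (τ.app X) p p (add_zero p) x := by
  refine (τ.extInd_ι (IndObj.const X) p PUnit.unit x).trans ?_
  refine (congrArg (fun z => HOM.at z p p (add_zero p) _) (G.map_id (IndObj.const X))).trans ?_
  exact HOM.id_at p p _ _

/-- Extension of a natural transformation along the three completions. -/
def GNatTrans.extEmbed {F : GFunctor K C (GVect K)}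
    {G : GFunctor K (IndObj K (Mat K (Kar K C))) (GVect K)} (τ : GNatTrans F ((embed K C).comp G)) :
    GNatTrans F.extKar.extMat.extInd G :=
  GNatTrans.extInd (F := F.extKar.extMat) (G := G)
    (GNatTrans.extMat (F := F.extKar) (G := (constFunctor K (Mat K (Kar K C))).comp G)
      (GNatTrans.extKar (F := F)
        (G := (toMat K (Kar K C)).comp ((constFunctor K (Mat K (Kar K C))).comp G))
        ⟨τ.app, τ.naturality⟩))

lemma GNatTrans.extEmbed_embedι {F : GFunctor K C (GVect K)}
    {G : GFunctor K (IndObj K (Mat K (Kar K C))) (GVect K)} (τ : GNatTrans F ((embed K C).comp G))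
    (X : C) (p : ℤ) (x : (F.obj X).V p) :
    HOM.at (τ.extEmbed.app (base K X)) p p (add_zero p) (F.embedι X p x) =
      HOM.at (τ.app X) p p (add_zero p) x := by
  refine (GNatTrans.extInd_const (F := F.extKar.extMat) (G := G) _
    ((embedMat K C).obj X) p _).trans ?_
  refine (GNatTrans.extMat_toMat (F := F.extKar)
    (G := (constFunctor K (Mat K (Kar K C))).comp G) _ ((toKar K C).obj X) p _).trans ?_
  refine (GNatTrans.extKar_toKar (F := F)
    (G := (toMat K (Kar K C)).comp ((constFunctor K (Mat K (Kar K C))).comp G)) _ X p _).trans ?_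
  refine congrArg (HOM.at (τ.app X) p p (add_zero p)) ?_
  have e : ∀ (p' : ℤ) (h : p' = p) (y : (F.extKar.obj ((toKar K C).obj X)).V p'),
      ((F.extKar.obj ((toKar K C).obj X)).tr h y).1 = (F.obj X).tr h y.1 := by
    intro p' h y
    subst h
    rfl
  exact (e _ _ _).trans (GVect.tr_tr _ _ _ _)

end ExtEmbed

end

noncomputable section

/-! ### Inclusions of summands, with source and degree given up to equality -/

section InclAs

variable {K : Type u} [Field K] {C : Type v} [GCat K C] (B : IndObj K (Mat K (Kar K C)))

/-- The inclusion `IndObj.summandIncl`, with its source and its degree replaced by equal ones. -/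
def IndObj.inclAs {i : B.I} {b : (B.at i).ι} {X : C} {s : ℤ} (hX : ((B.at i).X b).X = X)
    (hs : (B.at i).s b = s) : GHom K (base K X) B s :=
  hX ▸ degCast hs (B.summandIncl i b)

variable {B}

lemma IndObj.idem_comp_inclAs {i : B.I} {b : (B.at i).ι} {X : C} {s : ℤ}
    (hX : ((B.at i).X b).X = X) (hs : (B.at i).s b = s) (e : GHom K X X 0)
    (he : HEq ((B.at i).X b).e e) :
    GCat.comp (zero_add s) (baseMap e) (B.inclAs hX hs) = B.inclAs hX hs := by
  subst hX hs
  obtain rfl := eq_of_heq he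
  exact B.idem_comp_summandIncl i b

/-- If the row of `b` in the transition matrix has `b'` as its only nonzero entry, then the sum in
`summandIncl_eq_sum` has one term. Heterogeneous equality compares that entry with a morphism
between objects that are equal only propositionally. -/
lemma IndObj.comp_inclAs {i j : B.I} (v : i ⟶ j) {b : (B.at i).ι} {b' : (B.at j).ι} {X X' : C}
    {s s' d : ℤ} (hX : ((B.at i).X b).X = X) (hs : (B.at i).s b = s)
    (hX' : ((B.at j).X b').X = X') (hs' : (B.at j).s b' = s') (f : GHom K X X' d)
    (h : d + s' = s) (hv : ∀ l, l ≠ b' → B.trEntry v b l = 0)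
    (f₀ : GHom K ((B.at i).X b).X ((B.at j).X b').X d) (hf : HEq f₀ f)
    (hd : d = 0 + (B.at i).s b - (B.at j).s b') (hv' : (B.trEntry v b b').1 = degCast hd f₀) :
    GCat.comp h (baseMap f) (B.inclAs hX' hs') = B.inclAs hX hs := by
  subst hX hs hX' hs' hd
  obtain rfl := eq_of_heq hf
  obtain rfl : (B.trEntry v b b').1 = f₀ := hv'
  refine ((B.summandIncl_eq_sum v b).trans (Fintype.sum_eq_single b' fun l hl => ?_)).symm
  rw [hv l hl]
  have e : baseMap (0 : GHom K ((B.at i).X b).X ((B.at j).X l).X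
      (0 + (B.at i).s b - (B.at j).s l)) = 0 := map_zero _
  exact (congrArg (fun z => GCat.comp (show 0 + (B.at i).s b - (B.at j).s l + (B.at j).s l =
    (B.at i).s b by omega) z (B.summandIncl j l)) e).trans (LinearMap.map_zero₂ _ _)

lemma IndObj.exists_eq_sum_inclAs {J : Type} [Fintype J] (r : ∀ i : B.I, J ≃ (B.at i).ι)
    {X : B.I → J → C} {s : B.I → J → ℤ} (hX : ∀ i b, ((B.at i).X (r i b)).X = X i b)
    (hs : ∀ i b, (B.at i).s (r i b) = s i b) {Y : C} {d : ℤ} (f : GHom K (base K Y) B d) :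
    ∃ (i : B.I) (g : ∀ b, GHom K Y (X i b) (d - s i b)),
      f = ∑ b, GCat.comp (sub_add_cancel d _) (baseMap (g b)) (B.inclAs (hX i b) (hs i b)) := by
  obtain rfl : (fun i b => ((B.at i).X (r i b)).X) = X := funext fun i => funext (hX i)
  obtain rfl : (fun i b => (B.at i).s (r i b)) = s := funext fun i => funext (hs i)
  obtain ⟨i, g, h⟩ := B.exists_eq_sum_summandIncl f
  exact ⟨i, fun b => g (r i b), h.trans (Equiv.sum_comp (r i) _).symm⟩

end InclAs

/-! ### Transition morphisms of the Kirby color tensored with strands -/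

section KirbyTensor

variable {K : Type u} [Field K] [CharZero K]

open DHom

/-- The Kirby color tensored with `m` strands. -/
def kirbyStrands (K : Type u) [Field K] [CharZero K] (m : ℕ) : dTLbar K :=
  (kirby K).tensorObj ((embed K (DTL K)).obj ⟨m⟩)

/-- The symmetrizer on the first `n` strands and the dotted cup occupy disjoint strands and can be
interchanged. The symmetrizer then sits in front of the larger one, which absorbs it. -/
lemma symMap_val (n : ℕ) : (symMap K n).1 = comp (add_zero 2)
    (tensor (add_zero n) rfl (zero_add 2) (1 : DHom K n n 0) (dottedCup K)) (symmetrizer K (n + 2)) := by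
  have h₁ : (symMap K n).1 = comp (add_zero 2) (comp (zero_add 2) (symmetrizer K n)
      (tensor (add_zero n) rfl (zero_add 2) (1 : DHom K n n 0) (dottedCup K)))
      (symmetrizer K (n + 2)) := rfl
  have h₂ : comp (zero_add 2) (symmetrizer K n)
      (tensor (add_zero n) rfl (zero_add 2) (1 : DHom K n n 0) (dottedCup K)) =
      comp (add_zero 2) (tensor (add_zero n) rfl (zero_add 2) (1 : DHom K n n 0) (dottedCup K))
        (tensorId 2 rfl (symmetrizer K n)) := by
    refine Eq.trans ?_ (tensor_eq_comp' (add_zero n) rfl (zero_add 2) (add_zero 2) rfl _ _)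
    refine Eq.trans ?_ (tensor_eq_comp (add_zero n) rfl (zero_add 2) (add_zero n) _ _).symm
    rw [gtensor_unit]
  rw [h₁, h₂, gcomp_assoc (add_zero 2) (add_zero 2) (add_zero 0) (add_zero 2)]
  exact congrArg _ (symmetrizer_tensorId K rfl)

/-- The entries of the transition morphisms of the Kirby color, as morphisms of strands. -/
lemma kirbyMap_self (n : ℕ) (k : Fin 2) (e : ℤ) (he : (2 : ℤ) = e)
    (h : 0 + (kirbyStage K n).s k - (kirbyStage K (n + 1)).s k = e) :
    degCast h (kirbyMap K n k k) = degCast he (symMap K (k + 2 * n) :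
      GHom K (symObj K (k + 2 * n)) (symObj K (k + 2 * (n + 1))) 2) := by
  simp only [kirbyMap, dif_pos]
  exact degCast_degCast _ _ _

lemma kirbyMap_ne (n : ℕ) {k l : Fin 2} (h : k ≠ l) : kirbyMap K n k l = 0 := dif_neg h

/-- The arrows in the index category of the Kirby color. -/
def kirbyArrow {n n' : ℕ} (h : n ≤ n') : (⟨n⟩ : (kirby K).I) ⟶ ⟨n'⟩ :=
  homOfLE (X := ULift.{u} ℕ) (x := ⟨n⟩) (y := ⟨n'⟩) (ULift.up_le.2 h)

lemma kirby_tr_succ (n : ℕ) : (kirby K).tr (kirbyArrow n.le_succ) = kirbyMap K n :=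
  Functor.ofSequence_map_homOfLE_succ (X := fun m => DegZero.mk (K := K) (kirbyStage K m))
    (kirbyMap K) n

/-- Properties of the transition morphisms of the Kirby color that are stable under composition. -/
lemma kirby_tr_induction {P : ∀ n n' : ℕ, GHom K (kirbyStage K n) (kirbyStage K n') 0 → Prop}
    (id : ∀ n, P n n (GCat.id _))
    (step : ∀ n n' f, P n n' f → P n (n' + 1) (GCat.comp (add_zero 0) f (kirbyMap K n')))
    {i j : (kirby K).I} (v : i ⟶ j) : P i.down j.down ((kirby K).tr v) := by
  obtain ⟨n⟩ := i
  obtain ⟨n'⟩ := j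
  have hle : n ≤ n' := leOfHom (X := ULift.{u} ℕ) (x := ⟨n⟩) (y := ⟨n'⟩) v
  induction n', hle using Nat.le_induction with
  | base =>
    have : (kirby K).tr v = GCat.id (kirbyStage K n) := (kirby K).tr_id ⟨n⟩
    rw [this]
    exact id n
  | succ n' hle ih =>
    have : (kirby K).tr v = GCat.comp (add_zero 0) ((kirby K).tr (kirbyArrow hle))
        (kirbyMap K n') := by
      refine ((kirby K).tr_comp (kirbyArrow hle) (kirbyArrow n'.le_succ)).trans ?_
      exact congrArg (GCat.comp (add_zero 0) ((kirby K).tr (kirbyArrow hle))) (kirby_tr_succ n')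
    rw [this]
    exact step n n' _ (ih _)

/-- The summand `0` is the shift of the one-term formal sum that represents `c ^ m`; it is added to
the shift of the stage by the tensor product. -/
lemma kirbyStage_s (n : ℕ) (k : Fin 2) {N : ℕ} (h : k + 2 * n = N) :
    (kirbyStage K n).s k + 0 = -(N : ℤ) := by
  subst h
  dsimp only [kirbyStage]
  push_cast
  ring

/-- The inclusion of `c ^ N ⊗ c ^ m`, `N = k + 2 n`, into the Kirby color tensored with `m`
strands. -/
def stageIncl (m n : ℕ) (k : Fin 2) (N : ℕ) (h : k + 2 * n = N) :
    GHom K (base K (⟨N + m⟩ : DTL K)) (kirbyStrands K m) (-N) :=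
  (kirbyStrands K m).inclAs (i := (⟨n⟩, PUnit.unit)) (b := (k, ())) (X := ⟨N + m⟩)
    (congrArg (fun a => (⟨a + m⟩ : DTL K)) h) (kirbyStage_s n k h)

/-- The idempotent of the summand is the symmetrizer tensored with the identity of the `m` strands.
This becomes the first axiom of a `ColorFamily`. -/
lemma symmetrizer_comp_stageIncl (m n : ℕ) (k : Fin 2) (N : ℕ) (h : k + 2 * n = N) :
    GCat.comp (zero_add _) (baseMap (X := (⟨N + m⟩ : DTL K)) (Y := ⟨N + m⟩)
      (tensor rfl rfl (add_zero 0) (symmetrizer K N) (1 : DHom K m m 0)))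
      (stageIncl m n k N h) = stageIncl (K := K) m n k N h := by
  subst h
  exact IndObj.idem_comp_inclAs (B := kirbyStrands K m) (i := (⟨n⟩, PUnit.unit)) (b := (k, ()))
    (X := ⟨k + 2 * n + m⟩) (s := -(k + 2 * n : ℕ)) rfl (kirbyStage_s n k rfl)
    (tensor (rfl : k + 2 * n + m = k + 2 * n + m) rfl (add_zero 0) (symmetrizer K (k + 2 * n))
      (1 : DHom K m m 0)) HEq.rfl

/-- The entries of the transition morphisms of the Kirby color tensored with strands. -/
lemma kirbyStrands_trEntry (m : ℕ) {i j : (kirby K).I} (v : i ⟶ j) (k l : Fin 2) :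
    ((kirbyStrands K m).trEntry (i := (i, PUnit.unit)) (j := (j, PUnit.unit)) (v, 𝟙 _)
      (k, ()) (l, ())) =
    GTensor.hom (show 0 + (kirbyStage K i.down).s k - (kirbyStage K j.down).s l + (0 + 0 - 0) =
        0 + ((kirbyStage K i.down).s k + 0) - ((kirbyStage K j.down).s l + 0) by omega)
      ((show Mat.HomM (kirbyStage K i.down) (kirbyStage K j.down) 0 from (kirby K).tr v) k l)
      (degCast (show (0 : ℤ) = 0 + 0 - 0 by omega) (GCat.id ((toKar K (DTL K)).obj ⟨m⟩))) :=
  congrArg (GTensor.hom (show 0 + (kirbyStage K i.down).s k - (kirbyStage K j.down).s l +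
      (0 + 0 - 0) = 0 + ((kirbyStage K i.down).s k + 0) - ((kirbyStage K j.down).s l + 0) by omega)
      ((show Mat.HomM (kirbyStage K i.down) (kirbyStage K j.down) 0 from (kirby K).tr v) k l))
    (Mat.idM_self (matBase K (⟨m⟩ : DTL K)) ())

end KirbyTensor

end

noncomputable section

/-! ### Compatibility of the operations with identifications of degrees -/

section DegreeCasts

variable {K : Type u} [Field K] {C : Type v} [GCat K C]

lemma GTensor.hom_degCast [GTensor K C] {X X' Y Y' : C} {i i' j j' k k' : ℤ} (hi : i = i') (hj : j = j')
    (hk : k = k') (h : i + j = k) (h' : i' + j' = k') (f : GHom K X X' i) (g : GHom K Y Y' j) :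
    GTensor.hom h' (degCast hi f) (degCast hj g) = degCast hk (GTensor.hom h f g) := by
  subst hi hj hk; rfl

lemma Kar.degCast_val {A B : Kar K C} {d e : ℤ} (h : d = e) (f : GHom K A B d) :
    (degCast h f).1 = degCast h f.1 := by
  subst h; rfl

lemma comp_baseMap_degCast {X Y : C} {B : IndObj K (Mat K (Kar K C))} {d e s t : ℤ} (he : d = e)
    (h : d + s = t) (h' : e + s = t) (f : GHom K X Y d) (g : GHom K (base K Y) B s) :
    GCat.comp h' (baseMap (degCast he f)) g = GCat.comp h (baseMap f) g := by
  subst he; rfl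

lemma comp_baseMap_comp {X Y Z : C} {B : IndObj K (Mat K (Kar K C))} {i j s t ij js : ℤ}
    (h₁ : i + j = ij) (h₂ : ij + s = t) (h₃ : j + s = js) (h₄ : i + js = t) (f : GHom K X Y i)
    (g : GHom K Y Z j) (x : GHom K (base K Z) B s) :
    GCat.comp h₂ (baseMap (GCat.comp h₁ f g)) x =
      GCat.comp h₄ (baseMap f) (GCat.comp h₃ (baseMap g) x) := by
  rw [baseMap_comp, GCat.assoc h₁ h₂ h₃ h₄]

end DegreeCasts

/-! ### The inclusions into the Kirby color tensored with strands -/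

section KirbyTensor

variable {K : Type u} [Field K] [CharZero K]

open DHom

lemma kirbyStrands_trEntry_ne (m n : ℕ) {k l : Fin 2} (hkl : k ≠ l) :
    (kirbyStrands K m).trEntry (i := (⟨n⟩, PUnit.unit)) (j := (⟨n + 1⟩, PUnit.unit))
      (kirbyArrow n.le_succ, 𝟙 _) (k, ()) (l, ()) = 0 := by
  refine (kirbyStrands_trEntry m (kirbyArrow n.le_succ) k l).trans ?_
  have h := congrFun (congrFun (kirby_tr_succ (K := K) n) k) l
  refine (congrArg (fun z => GTensor.hom _ z _) (h.trans (kirbyMap_ne n hkl))).trans ?_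
  exact LinearMap.map_zero₂ _ _

lemma kirbyStrands_trEntry_self (m n : ℕ) (k : Fin 2)
    (he : (2 : ℤ) = 0 + ((kirbyStage K n).s k + 0) - ((kirbyStage K (n + 1)).s k + 0)) :
    ((kirbyStrands K m).trEntry (i := (⟨n⟩, PUnit.unit)) (j := (⟨n + 1⟩, PUnit.unit))
      (kirbyArrow n.le_succ, 𝟙 _) (k, ()) (k, ())).1 = degCast he
      (tensor rfl rfl (add_zero 2) (symMap K (k + 2 * n)).1 (1 : DHom K m m 0) :
        GHom K (⟨k + 2 * n + m⟩ : DTL K) ⟨k + 2 * (n + 1) + m⟩ 2) := by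
  have h := congrFun (congrFun (kirby_tr_succ (K := K) n) k) k
  have he' : (2 : ℤ) = 0 + (kirbyStage K n).s k - (kirbyStage K (n + 1)).s k := by omega
  refine (congrArg Subtype.val ((kirbyStrands_trEntry m (kirbyArrow n.le_succ) k k).trans
    ((congrArg (fun z => GTensor.hom _ z _)
      (h.trans (kirbyMap_self n k _ he' rfl))).trans
    (GTensor.hom_degCast he' (by omega) he (add_zero 2) _ (symMap K (k + 2 * n) :
      GHom K (symObj K (k + 2 * n)) (symObj K (k + 2 * (n + 1))) 2)
      (GCat.id ((toKar K (DTL K)).obj ⟨m⟩)))))).trans ?_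
  exact Kar.degCast_val _ _

lemma symMap_comp_stageIncl (m n : ℕ) (k : Fin 2) (N : ℕ) (hN : k + 2 * n = N)
    (h : 2 + -((N + 2 : ℕ) : ℤ) = -N) :
    GCat.comp h (baseMap (X := (⟨N + m⟩ : DTL K)) (Y := ⟨N + 2 + m⟩)
      (tensor rfl rfl (add_zero 2) (symMap K N).1 (1 : DHom K m m 0)))
      (stageIncl m (n + 1) k (N + 2) (by omega)) = stageIncl (K := K) m n k N hN := by
  subst hN
  have he : (2 : ℤ) = 0 + ((kirbyStage K n).s k + 0) - ((kirbyStage K (n + 1)).s k + 0) := by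
    have h₁ := kirbyStage_s (K := K) n k rfl
    have h₂ := kirbyStage_s (K := K) (n + 1) k (N := k + 2 * n + 2) rfl
    omega
  exact IndObj.comp_inclAs (B := kirbyStrands K m) (i := (⟨n⟩, PUnit.unit)) (j := (⟨n + 1⟩, PUnit.unit))
    (kirbyArrow n.le_succ, 𝟙 _) (b := (k, ())) (b' := (k, ())) (X := ⟨k + 2 * n + m⟩)
    (X' := ⟨k + 2 * (n + 1) + m⟩) rfl (kirbyStage_s n k rfl) rfl
    (kirbyStage_s (n + 1) k (N := k + 2 * n + 2) rfl)
    (tensor (rfl : k + 2 * n + m = k + 2 * n + m) (rfl : k + 2 * (n + 1) + m = k + 2 * (n + 1) + m)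
      (add_zero 2) (symMap K (k + 2 * n)).1 (1 : DHom K m m 0)) h
    (fun l hl => kirbyStrands_trEntry_ne m n (k := k) (l := l.1) fun h => hl (Prod.ext h.symm rfl))
    (tensor (rfl : k + 2 * n + m = k + 2 * n + m) (rfl : k + 2 * (n + 1) + m = k + 2 * (n + 1) + m)
      (add_zero 2) (symMap K (k + 2 * n)).1 (1 : DHom K m m 0)) HEq.rfl he
    (kirbyStrands_trEntry_self m n k he)

/-- The transition morphism is the dotted cup followed by a symmetrizer, and the next inclusion
already absorbs that symmetrizer. So the bare dotted cup has the same effect, which becomes the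
second axiom of a `ColorFamily`. -/
lemma dottedCup_comp_stageIncl (m n : ℕ) (k : Fin 2) (N : ℕ) (hN : k + 2 * n = N)
    (h : 2 + -((N + 2 : ℕ) : ℤ) = -N) :
    GCat.comp h (baseMap (X := (⟨N + m⟩ : DTL K)) (Y := ⟨N + 2 + m⟩)
      (tensor rfl rfl (add_zero 2) (tensor (add_zero N) rfl (zero_add 2) (1 : DHom K N N 0)
        (dottedCup K)) (1 : DHom K m m 0)))
      (stageIncl m (n + 1) k (N + 2) (by omega)) = stageIncl (K := K) m n k N hN := by
  have e : (tensor rfl rfl (add_zero 2) (comp (add_zero 2) (tensor (add_zero N) rfl (zero_add 2)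
      (1 : DHom K N N 0) (dottedCup K)) (symmetrizer K (N + 2))) (1 : DHom K m m 0) :
        DHom K (N + m) (N + 2 + m) 2) = comp (add_zero 2)
      (tensor rfl rfl (add_zero 2) (tensor (add_zero N) rfl (zero_add 2) (1 : DHom K N N 0)
        (dottedCup K)) (1 : DHom K m m 0))
      (tensor rfl rfl (add_zero 0) (symmetrizer K (N + 2)) (1 : DHom K m m 0)) := by
    rw [← interchange rfl rfl rfl (add_zero 2) (add_zero 0) (add_zero 2), gcomp_id]
  have e' : (tensor rfl rfl (add_zero 2) (symMap K N).1 (1 : DHom K m m 0) :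
      DHom K (N + m) (N + 2 + m) 2) = comp (add_zero 2)
      (tensor rfl rfl (add_zero 2) (tensor (add_zero N) rfl (zero_add 2) (1 : DHom K N N 0)
        (dottedCup K)) (1 : DHom K m m 0))
      (tensor rfl rfl (add_zero 0) (symmetrizer K (N + 2)) (1 : DHom K m m 0)) :=
    (congrArg (fun z : DHom K N (N + 2) 2 => (tensor rfl rfl (add_zero 2) z (1 : DHom K m m 0) :
      DHom K (N + m) (N + 2 + m) 2)) (symMap_val N)).trans e
  have e'' := comp_baseMap_comp (C := DTL K) (X := ⟨N + m⟩) (Y := ⟨N + 2 + m⟩) (Z := ⟨N + 2 + m⟩)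
    (add_zero 2) h (zero_add _) h (tensor rfl rfl (add_zero 2) (tensor (add_zero N) rfl (zero_add 2)
      (1 : DHom K N N 0) (dottedCup K)) (1 : DHom K m m 0))
      (tensor rfl rfl (add_zero 0) (symmetrizer K (N + 2)) (1 : DHom K m m 0))
      (stageIncl m (n + 1) k (N + 2) (by omega))
  rw [symmetrizer_comp_stageIncl] at e''
  refine e''.symm.trans ((congrArg (fun z : DHom K (N + m) (N + 2 + m) 2 => GCat.comp h
    (baseMap (X := (⟨N + m⟩ : DTL K)) (Y := ⟨N + 2 + m⟩) z)
    (stageIncl m (n + 1) k (N + 2) (by omega))) e'.symm).trans ?_)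
  exact symMap_comp_stageIncl m n k N hN h

variable (K) in
/-- The inclusion of `c ^ N ⊗ c ^ m` into the Kirby color tensored with `m` strands. -/
def colorIncl (m N : ℕ) : GHom K (base K (⟨N + m⟩ : DTL K)) (kirbyStrands K m) (-N) :=
  -- Here `N = k + 2 n`: the remainder `k` selects the component of the Kirby color of the right
  -- parity, and `n` is the stage at which `c ^ N` occurs.
  stageIncl m (N / 2) ⟨N % 2, N.mod_lt two_pos⟩ N (N.mod_add_div 2)

lemma stageIncl_eq (m n : ℕ) (k : Fin 2) (N : ℕ) (h : k + 2 * n = N) :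
    stageIncl m n k N h = colorIncl K m N := by
  obtain rfl : n = N / 2 := by omega
  obtain rfl : k = ⟨N % 2, N.mod_lt two_pos⟩ := Fin.ext (by simp only; omega)
  rfl

lemma symmetrizer_comp_colorIncl (m N : ℕ) :
    GCat.comp (zero_add _) (baseMap (X := (⟨N + m⟩ : DTL K)) (Y := ⟨N + m⟩)
      (tensor rfl rfl (add_zero 0) (symmetrizer K N) (1 : DHom K m m 0)))
      (colorIncl K m N) = colorIncl K m N :=
  symmetrizer_comp_stageIncl _ _ _ _ _

lemma dottedCup_comp_colorIncl (m N : ℕ) (h : 2 + -((N + 2 : ℕ) : ℤ) = -N) :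
    GCat.comp h (baseMap (X := (⟨N + m⟩ : DTL K)) (Y := ⟨N + 2 + m⟩)
      (tensor rfl rfl (add_zero 2) (tensor (add_zero N) rfl (zero_add 2) (1 : DHom K N N 0)
        (dottedCup K)) (1 : DHom K m m 0)))
      (colorIncl K m (N + 2)) = colorIncl K m N := by
  rw [← stageIncl_eq m (N / 2 + 1) ⟨N % 2, N.mod_lt two_pos⟩ (N + 2) (by simp only; omega)]
  exact dottedCup_comp_stageIncl m (N / 2) _ N _ h

/-- Every morphism to the Kirby color tensored with strands is a sum of composites with the
canonical inclusions. -/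
lemma exists_eq_sum_colorIncl (m : ℕ) {a : ℕ} {d : ℤ}
    (f : GHom K (base K (⟨a⟩ : DTL K)) (kirbyStrands K m) d) :
    ∃ (N : Fin 2 → ℕ) (g : ∀ k, DHom K a (N k + m) (d + N k)), f = ∑ k,
      GCat.comp (show d + N k + -(N k : ℤ) = d by omega)
        (baseMap (X := (⟨a⟩ : DTL K)) (Y := ⟨N k + m⟩) (g k)) (colorIncl K m (N k)) := by
  obtain ⟨i, g, h⟩ := IndObj.exists_eq_sum_inclAs (B := kirbyStrands K m)
    (J := Fin 2) (fun i => (Equiv.prodPUnit (Fin 2)).symm)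
    (X := fun i k => (⟨k + 2 * i.1.down + m⟩ : DTL K))
    (s := fun i k => -((k + 2 * i.1.down : ℕ) : ℤ)) (fun i k => rfl)
    (fun i k => kirbyStage_s i.1.down k rfl) f
  refine ⟨fun k => k + 2 * i.1.down, fun k => degCast (X := (⟨a⟩ : DTL K))
    (Y := ⟨k + 2 * i.1.down + m⟩) (sub_neg_eq_add d _) (g k),
    h.trans (Finset.sum_congr rfl fun k _ => ?_)⟩
  rw [comp_baseMap_degCast (C := DTL K) (sub_neg_eq_add d _) (sub_add_cancel d _)]
  exact congrArg _ (stageIncl_eq m i.1.down k (k + 2 * i.1.down) rfl)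

end KirbyTensor

end

noncomputable section

/-! ### Generators of the values of an extended functor, and maps out of them -/

section ExtDesc

variable {K : Type u} [Field K] {C : Type v} [GCat K C] (F : GFunctor K C (GVect K))
  (B : IndObj K (Mat K (Kar K C)))

/-- The projection onto the image of an idempotent. -/
def GFunctor.karProj (A : Kar K C) (p : ℤ) : (F.obj A.X).V p →ₗ[K] (F.extKar.obj A).V p :=
  LinearMap.rangeRestrict (HOM.at (F.map A.e) p p (add_zero p))

open Classical in
lemma GFunctor.matMap_fromBase (A : Mat K (Kar K C)) (b : A.ι) (p : ℤ) (h : p - A.s b + A.s b = p)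
    (x : (F.obj (A.X b).X).V (p - A.s b))
    (x' : (F.extKar.matObj (matBase K (A.X b).X)).V (p - A.s b))
    (hx : (x' ()).1 = (F.obj (A.X b).X).tr (sub_zero _).symm x) :
    HOM.at (F.extKar.matMap (A.fromBase b)) (p - A.s b) p h x' =
      Pi.single b (F.karProj (A.X b) (p - A.s b) x) := by
  funext b'
  refine (F.extKar.matMap_at (A.fromBase b : Mat.HomM (matBase K (A.X b).X) A _) _ p h x' b').trans
    ((Fintype.sum_unique (ι := Unit) _).trans ?_)
  by_cases hb : b = b'
  · subst hb
    rw [Pi.single_eq_same]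
    refine Subtype.ext ?_
    have hd : 0 = A.s b + 0 - A.s b := by omega
    have e : (A.fromBase b : Mat.HomM (matBase K (A.X b).X) A _) () b = degCast hd (A.X b).proj :=
      A.comp_inM b (zero_add _) (A.X b).proj ()
    have hp : p - A.s b - 0 + (A.s b + 0 - A.s b) = p - A.s b := by omega
    refine (congrArg (fun z => (HOM.at (F.extKar.map z) (p - A.s b - 0) (p - A.s b)
      hp (x' ())).1) e).trans ?_
    have e' : (degCast hd (A.X b).proj).1 = degCast hd (A.X b).e := Kar.degCast_val hd (A.X b).proj
    refine (congrArg (fun z => HOM.at (F.map z) (p - A.s b - 0) (p - A.s b)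
      hp (x' ()).1) e').trans ?_
    rw [hx]
    exact F.at_degCast hd (sub_zero _).symm rfl (add_zero _) _ _ x
  · rw [Pi.single_eq_of_ne (Ne.symm hb)]
    have e : (A.fromBase b : Mat.HomM (matBase K (A.X b).X) A _) () b' = 0 :=
      A.comp_inM_ne (zero_add _) (A.X b).proj () hb
    have hp : p - A.s b - 0 + (A.s b + 0 - A.s b') = p - A.s b' := by omega
    refine (congrArg (fun z => HOM.at (F.extKar.map z) (p - A.s b - 0) (p - A.s b')
      hp (x' ())) e).trans ?_
    exact (congrArg (fun z : HOM _ _ _ => HOM.at z (p - A.s b - 0) (p - A.s b') _ (x' ()))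
      (map_zero F.extKar.map)).trans rfl

open Classical in
lemma GFunctor.map_summandIncl_embedι (i : B.I) (b : (B.at i).ι) (p : ℤ)
    (h : p - (B.at i).s b + (B.at i).s b = p)
    (x : (F.obj ((B.at i).X b).X).V (p - (B.at i).s b)) :
    HOM.at (F.extKar.extMat.extInd.map (B.summandIncl i b)) (p - (B.at i).s b) p h
      (F.embedι _ _ x) = F.extKar.extMat.indι B p i
        (Pi.single b (F.karProj ((B.at i).X b) (p - (B.at i).s b) x)) := by
  have e : F.extKar.extMat.extInd.map (B.summandIncl i b) = GCat.comp (add_zero _)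
      (F.extKar.extMat.extInd.map (constMap _ _ _ ((B.at i).fromBase b)))
      (F.extKar.extMat.extInd.map (B.incl i)) := F.extKar.extMat.extInd.map_comp (add_zero _)
      (constMap _ _ _ ((B.at i).fromBase b)) (B.incl i)
  rw [e, HOM.comp_at (add_zero _) _ _ (p - (B.at i).s b) p p h (add_zero p)]
  refine (congrArg (HOM.at (F.extKar.extMat.extInd.map (B.incl i)) p p (add_zero p))
    (F.extKar.extMat.extInd_const_map h ((B.at i).fromBase b) _)).trans ?_
  refine (F.extKar.extMat.extInd_incl B i p _).trans ?_
  exact congrArg (F.extKar.extMat.indι B p i) (F.matMap_fromBase (B.at i) b p h x _ rfl)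

/-- The values of an extended functor are generated by the values on the original category. -/
lemma GFunctor.exists_eq_sum_embedι (p : ℤ) (y : (F.extKar.extMat.extInd.obj B).V p) :
    ∃ (i : B.I) (x : ∀ b, (F.obj ((B.at i).X b).X).V (p - (B.at i).s b)),
      y = ∑ b, HOM.at (F.extKar.extMat.extInd.map (B.summandIncl i b)) (p - (B.at i).s b) p
        (sub_add_cancel _ _) (F.embedι _ _ (x b)) := by
  classical
  obtain ⟨i, y, hy⟩ := Concrete.colimit_exists_rep (F.extKar.extMat.indSys B p) y
  have hx : ∀ b, ∃ x, F.karProj ((B.at i).X b) (p - (B.at i).s b) x =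
      (show F.extKar.extMat.obj (B.at i) |>.V p from y) b := fun b =>
    LinearMap.surjective_rangeRestrict _ _
  choose x hx using hx
  refine ⟨i, x, hy.symm.trans ?_⟩
  rw [Finset.sum_congr rfl fun b _ => F.map_summandIncl_embedι B i b p _ (x b), ← map_sum]
  refine congrArg (F.extKar.extMat.indι B p i) ?_
  rw [Finset.sum_congr rfl fun b _ => by rw [hx b]]
  exact (Finset.univ_sum_single _).symm

lemma GFunctor.exists_eq_sum_inclAs_embedι {J : Type} [Fintype J]
    (r : ∀ i : B.I, J ≃ (B.at i).ι) {X : B.I → J → C} {s : B.I → J → ℤ}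
    (hX : ∀ i b, ((B.at i).X (r i b)).X = X i b) (hs : ∀ i b, (B.at i).s (r i b) = s i b) (p : ℤ)
    (y : (F.extKar.extMat.extInd.obj B).V p) :
    ∃ (i : B.I) (x : ∀ b, (F.obj (X i b)).V (p - s i b)),
      y = ∑ b, HOM.at (F.extKar.extMat.extInd.map (B.inclAs (hX i b) (hs i b))) (p - s i b) p
        (sub_add_cancel _ _) (F.embedι _ _ (x b)) := by
  obtain rfl : (fun i b => ((B.at i).X (r i b)).X) = X := funext fun i => funext (hX i)
  obtain rfl : (fun i b => (B.at i).s (r i b)) = s := funext fun i => funext (hs i)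
  obtain ⟨i, x, h⟩ := F.exists_eq_sum_embedι B p y
  exact ⟨i, fun b => x (r i b), h.trans (Equiv.sum_comp (r i) _).symm⟩

variable {M : Type u} [AddCommGroup M] [Module K M] {p : ℤ}

/-- Maps out of a value of an extended functor, given on the objects underlying the summands. -/
def GFunctor.extDesc (φ : ∀ i (b : (B.at i).ι), (F.obj ((B.at i).X b).X).V (p - (B.at i).s b) →ₗ[K] M)
    (w : ∀ {i j : B.I} (v : i ⟶ j) (b : (B.at i).ι) x, ∑ b', φ j b' (HOM.at
      (F.map (B.trEntry v b b').1) (p - (B.at i).s b) (p - (B.at j).s b') (by omega) x) = φ i b x) :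
    (F.extKar.extMat.extInd.obj B).V p →ₗ[K] M :=
  F.extKar.extMat.indDesc (fun i => ∑ b, φ i b ∘ₗ Submodule.subtype _ ∘ₗ
      (LinearMap.proj b : (F.extKar.extMat.obj (B.at i)).V p →ₗ[K]
        (F.extKar.obj ((B.at i).X b)).V (p - (B.at i).s b))) fun i j v x => by
    rw [LinearMap.sum_apply, LinearMap.sum_apply]
    refine Eq.trans ?_ (Finset.sum_congr rfl fun b _ => w v b (x b).1)
    rw [Finset.sum_comm]
    refine Finset.sum_congr rfl fun b' _ => ?_
    refine Eq.trans (congrArg (φ j b') (congrArg Subtype.val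
      (F.extKar.matMap_at (B.tr v) p p (add_zero p) x b'))) ?_
    rw [AddSubmonoidClass.coe_finsetSum, map_sum]
    rfl

/-- A vector of `F` at the underlying object enters the value at the summand through the projection
onto the image of the idempotent. This is why the idempotent appears on the right. -/
lemma GFunctor.extDesc_summandIncl (φ : ∀ i (b : (B.at i).ι),
      (F.obj ((B.at i).X b).X).V (p - (B.at i).s b) →ₗ[K] M)
    (w : ∀ {i j : B.I} (v : i ⟶ j) (b : (B.at i).ι) x, ∑ b', φ j b' (HOM.at
      (F.map (B.trEntry v b b').1) (p - (B.at i).s b) (p - (B.at j).s b') (by omega) x) = φ i b x)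
    (i : B.I) (b : (B.at i).ι) (x : (F.obj ((B.at i).X b).X).V (p - (B.at i).s b)) :
    F.extDesc B φ w (HOM.at (F.extKar.extMat.extInd.map (B.summandIncl i b)) (p - (B.at i).s b) p
        (sub_add_cancel _ _) (F.embedι _ _ x)) =
      φ i b (HOM.at (F.map ((B.at i).X b).e) _ _ (add_zero _) x) := by
  classical
  rw [F.map_summandIncl_embedι, GFunctor.extDesc, GFunctor.indDesc_ι, LinearMap.sum_apply,
    Fintype.sum_eq_single b]
  · refine Eq.trans (b := φ i b (F.karProj ((B.at i).X b) _ x).1) ?_ rfl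
    refine congrArg (fun z : (F.extKar.obj ((B.at i).X b)).V (p - (B.at i).s b) => φ i b z.1) ?_
    exact Pi.single_eq_same (M := fun b => (F.extKar.obj ((B.at i).X b)).V (p - (B.at i).s b)) b _
  · intro b' hb
    refine (congrArg (fun z : (F.extKar.obj ((B.at i).X b')).V (p - (B.at i).s b') => φ i b' z.1)
      (Pi.single_eq_of_ne (M := fun b => (F.extKar.obj ((B.at i).X b)).V (p - (B.at i).s b)) hb _)).trans ?_
    exact map_zero _

lemma GFunctor.extDesc_inclAs (φ : ∀ i (b : (B.at i).ι),
      (F.obj ((B.at i).X b).X).V (p - (B.at i).s b) →ₗ[K] M)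
    (w : ∀ {i j : B.I} (v : i ⟶ j) (b : (B.at i).ι) x, ∑ b', φ j b' (HOM.at
      (F.map (B.trEntry v b b').1) (p - (B.at i).s b) (p - (B.at j).s b') (by omega) x) = φ i b x)
    {i : B.I} {b : (B.at i).ι} {X : C} {s p' : ℤ} (hX : ((B.at i).X b).X = X)
    (hs : (B.at i).s b = s) (h : p' + s = p) (x : (F.obj X).V p') (ψ : (F.obj X).V p' →ₗ[K] M)
    (hψ : ∀ x₀ : (F.obj ((B.at i).X b).X).V (p - (B.at i).s b), HEq x₀ x →
      φ i b (HOM.at (F.map ((B.at i).X b).e) _ _ (add_zero _) x₀) = ψ x) :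
    F.extDesc B φ w (HOM.at (F.extKar.extMat.extInd.map (B.inclAs hX hs)) p' p h
      (F.embedι X p' x)) = ψ x := by
  subst hX hs
  obtain rfl : p' = p - (B.at i).s b := by omega
  exact (F.extDesc_summandIncl B φ w i b x).trans (hψ x HEq.rfl)

end ExtDesc

end

noncomputable section

open DHom

/-! ### Top coefficients -/

section TopRows

variable {K : Type u} [Field K]

lemma polM_degCast {X Y : DTL K} {d e : ℤ} (h : d = e) (f : GHom K X Y d) :
    polM (degCast h f : DHom K X.n Y.n e) = polM (f : DHom K X.n Y.n d) := by
  subst h; rfl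

/-- The coefficients of the monomials divisible by `x_1 ⋯ x_N`. -/
def topRow (N m : ℕ) {p q : ℤ} (h : q + N = p) :
    (polObj K (N + m)).V p →ₗ[K] (polObj K m).V q where
  toFun x u := x ⟨Mon.join₂ rfl (Mon.top N) u.1, by
    rw [Mon.deg_join₂, Mon.deg_top, u.2, ← h, add_comm]⟩
  map_add' _ _ := rfl
  map_smul' _ _ := rfl

lemma topRow_apply (N m : ℕ) {p q : ℤ} (h : q + N = p) (x : (polObj K (N + m)).V p)
    (u : {u : Mon m // u.deg = q}) (hu : (Mon.join₂ rfl (Mon.top N) u.1).deg = p) :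
    topRow N m h x u = x ⟨Mon.join₂ rfl (Mon.top N) u.1, hu⟩ := rfl

/-- A sum over the monomials of a given degree may be replaced by a sum over all monomials. -/
lemma polAct_at_eq_sum {a b : ℕ} {d p q : ℤ} (h : p + d = q) (f : DHom K a b d)
    (x : (polObj K a).V p) (t : {t : Mon b // t.deg = q}) :
    HOM.at (polAct f) p q h x t =
      ∑ s : Mon a, polM f t.1 s * if hs : s.deg = p then x ⟨s, hs⟩ else 0 := by
  rw [polAct_at]
  have e : ∀ s : {s : Mon a // s.deg = p}, polM f t.1 s.1 * x s =
      (fun s : Mon a => polM f t.1 s * if hs : s.deg = p then x ⟨s, hs⟩ else 0) s.1 := fun s => by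
    simp only [dif_pos s.2]
  rw [Finset.sum_congr rfl fun s _ => e s,
    ← Finset.sum_subtype (Finset.univ.filter fun u : Mon a => u.deg = p) (by simp)
      (fun s : Mon a => polM f t.1 s * if hs : s.deg = p then x ⟨s, hs⟩ else 0)]
  refine Finset.sum_subset (Finset.filter_subset _ _) fun s _ hs => ?_
  rw [dif_neg fun h => hs (Finset.mem_filter.2 ⟨Finset.mem_univ _, h⟩), mul_zero]

/-- A morphism whose top row is that of `id ⊗ g` acts on top coefficients as `g`. -/
lemma topRow_polAct {N N' m m' : ℕ} {d e p q p' q' : ℤ} (f : DHom K (N + m) (N' + m') d)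
    (g : DHom K m m' e) (r : K) (h : p + d = p') (h' : q + e = q') (hp : q + N = p)
    (hp' : q' + N' = p')
    (hf : ∀ u t v, polM f (Mon.join₂ rfl (Mon.top N') u) (Mon.join₂ rfl t v) =
      if t = Mon.top N then r * polM g u v else 0) (x : (polObj K (N + m)).V p) :
    topRow N' m' hp' (HOM.at (polAct f) p p' h x) =
      r • HOM.at (polAct g) q q' h' (topRow N m hp x) := by
  funext u
  have hu : (Mon.join₂ rfl (Mon.top N') u.1).deg = p' := by
    rw [Mon.deg_join₂, Mon.deg_top, u.2, ← hp', add_comm]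
  rw [topRow_apply _ _ _ _ _ hu, polAct_at_eq_sum]
  refine Eq.trans ?_ (congrArg (r * ·) (polAct_at_eq_sum h' g (topRow N m hp x) u).symm)
  rw [Mon.sum_join₂ (a := N) (b := m) rfl, Fintype.sum_eq_single (Mon.top N), Finset.mul_sum]
  · refine Finset.sum_congr rfl fun v _ => ?_
    rw [hf, if_pos rfl, mul_assoc]
    refine congrArg (fun z => r * (polM g u.1 v * z)) ?_
    have hd : (Mon.join₂ (rfl : N + m = N + m) (Mon.top N) v).deg = p ↔ v.deg = q := by
      rw [Mon.deg_join₂, Mon.deg_top]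
      omega
    by_cases hv : v.deg = q
    · rw [dif_pos hv, dif_pos (hd.2 hv)]
      rfl
    · rw [dif_neg hv, dif_neg fun h => hv (hd.1 h)]
  · intro t ht
    refine Finset.sum_eq_zero fun v _ => ?_
    rw [hf, if_neg ht, zero_mul]

/-- Row `s` of the sum involves only the rows `s` of the last factors. If these are a unit vector
for `l` and zero for the other indices, a single row of a single first factor survives. This is the
inductive step for products of transition matrices. -/
lemma polM_sum_comp {ι : Type} [Fintype ι] {a c : ℕ} {b : ι → ℕ} {d e : ι → ℤ} {d' : ℤ}
    (h : ∀ j, d j + e j = d') (f : ∀ j, DHom K a (b j) (d j)) (g : ∀ j, DHom K (b j) c (e j))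
    {s : Mon c} (l : ι) (r : Mon (b l)) (hl : ∀ t, polM (g l) s t = if t = r then 1 else 0)
    (hne : ∀ j, j ≠ l → ∀ t, polM (g j) s t = 0) (t : Mon a) :
    polM (∑ j, comp (h j) (f j) (g j)) s t = polM (f l) r t := by
  rw [map_sum, Matrix.sum_apply, Fintype.sum_eq_single l, polM_comp', Matrix.mul_apply,
    Fintype.sum_eq_single r, hl, if_pos rfl, one_mul]
  · intro t ht
    rw [hl, if_neg ht, zero_mul]
  · intro j hj
    rw [polM_comp', Matrix.mul_apply]
    exact Finset.sum_eq_zero fun t _ => by rw [hne j hj, zero_mul]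

end TopRows

/-! ### Evaluation of the polynomial representation on the Kirby color tensored with strands -/

section KirbyEval

/-- The canonical map from the polynomial representation to its extension. -/
def polι {K : Type u} [Field K] (a : ℕ) (p : ℤ) :
    (polObj K a).V p →ₗ[K] ((Pol K).obj (base K (⟨a⟩ : DTL K))).V p :=
  (polDTL K).embedι ⟨a⟩ p

lemma polι_map {K : Type u} [Field K] {a b : ℕ} {d p q : ℤ} (h : p + d = q) (f : DHom K a b d)
    (x : (polObj K a).V p) :
    HOM.at ((Pol K).map (baseMap (X := (⟨a⟩ : DTL K)) (Y := ⟨b⟩) f)) p q h (polι a p x) =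
      polι b q (HOM.at (polAct f) p q h x) :=
  (polDTL K).embedι_map (X := ⟨a⟩) (Y := ⟨b⟩) h f x

lemma polι_surjective {K : Type u} [Field K] (a : ℕ) (p : ℤ) :
    Function.Surjective (polι (K := K) a p) :=
  (polDTL K).embedι_surjective ⟨a⟩ p

variable {K : Type u} [Field K] [CharZero K]

lemma polM_symMap_top (n : ℕ) (t : Mon n) :
    polM (symMap K n).1 (Mon.top (n + 2)) t = if t = Mon.top n then 1 else 0 := by
  have e := congrArg (fun z : DHom K n (n + 2) 2 => polM z (Mon.top (n + 2)) t) (symMap_val (K := K) n)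
  refine e.trans ?_
  rw [polM_comp', Matrix.mul_apply, Fintype.sum_eq_single (Mon.top (n + 2)),
    polM_symmetrizer_top, if_pos rfl, one_mul, polM_tensor, Mon.top_add (a := n) (b := 2) rfl,
    ← Mon.join₂_zero t (default : Mon 0), tenM_join₂, polM_one, polM_dottedCup_top, mul_one,
    Matrix.one_apply, Mon.join₂_zero]
  · exact if_congr eq_comm rfl rfl
  · intro s hs
    rw [polM_symmetrizer_top, if_neg hs, zero_mul]

/-- The transition morphisms of the Kirby color preserve top coefficients. -/
lemma polM_kirbyMap_top (n : ℕ) (k l : Fin 2) (t : Mon (k + 2 * n)) :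
    polM ((kirbyMap K n k l).1 : DHom K (k + 2 * n) (l + 2 * (n + 1)) _) (Mon.top _) t =
      if k = l ∧ t = Mon.top _ then 1 else 0 := by
  by_cases hkl : k = l
  · subst hkl
    have h : 2 = 0 + (kirbyStage K n).s k - (kirbyStage K (n + 1)).s k := by
      have h₁ := kirbyStage_s (K := K) n k rfl
      have h₂ := kirbyStage_s (K := K) (n + 1) k (N := k + 2 * n + 2) rfl
      omega
    refine (congrArg (fun z : Kar.homSub _ _ _ =>
      polM (z.1 : DHom K (k + 2 * n) (k + 2 * (n + 1)) _) (Mon.top _) t)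
      (kirbyMap_self n k _ h rfl)).trans ?_
    refine (congrArg (fun z : DHom K (k + 2 * n) (k + 2 * (n + 1)) _ =>
      polM z (Mon.top _) t) (Kar.degCast_val h (symMap K (k + 2 * n)))).trans ?_
    refine (congrFun (congrFun (polM_degCast (X := ⟨k + 2 * n⟩) (Y := ⟨k + 2 * (n + 1)⟩) h
      (symMap K (k + 2 * n)).1) _) _).trans ?_
    refine (polM_symMap_top _ t).trans (if_congr ?_ rfl rfl)
    simp
  · rw [if_neg fun h => hkl h.1, kirbyMap_ne n hkl]
    exact congrFun (congrFun (map_zero polM) _) _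

/-- Induction on the number of steps: symmetrizers and single transition morphisms have the unit
vector as top row within one parity, and entries between different parities have zero top row. -/
lemma polM_kirby_tr_top {i j : (kirby K).I} (v : i ⟶ j) (k l : Fin 2) (t : Mon (k + 2 * i.down)) :
    polM (((show Mat.HomM (kirbyStage K i.down) (kirbyStage K j.down) 0 from
      (kirby K).tr v) k l).1 : DHom K (k + 2 * i.down) (l + 2 * j.down) _) (Mon.top _) t =
      if k = l ∧ t = Mon.top _ then 1 else 0 := by
  refine kirby_tr_induction (P := fun n n' f => ∀ (k l : Fin 2) (t : Mon (k + 2 * n)),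
    polM (((show Mat.HomM (kirbyStage K n) (kirbyStage K n') 0 from f) k l).1 :
      DHom K (k + 2 * n) (l + 2 * n') _) (Mon.top _) t = if k = l ∧ t = Mon.top _ then 1 else 0)
    (fun n k l t => ?_) (fun n n' f hf k l t => ?_) v k l t
  · by_cases hkl : k = l
    · subst hkl
      have h : 0 = 0 + (kirbyStage K n).s k - (kirbyStage K n).s k := by omega
      refine (congrArg (fun z : Kar.homSub _ _ _ =>
        polM (z.1 : DHom K (k + 2 * n) (k + 2 * n) _) (Mon.top _) t)
        (Mat.idM_self (kirbyStage K n) k)).trans ?_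
      refine (congrArg (fun z : DHom K (k + 2 * n) (k + 2 * n) _ =>
        polM z (Mon.top _) t) (Kar.degCast_val h (GCat.id (symObj K (k + 2 * n))))).trans ?_
      refine (congrFun (congrFun (polM_degCast (X := ⟨k + 2 * n⟩) (Y := ⟨k + 2 * n⟩) h
        (symmetrizer K (k + 2 * n))) _) _).trans ?_
      refine (polM_symmetrizer_top _ t).trans (if_congr ?_ rfl rfl)
      simp
    · rw [if_neg fun h => hkl h.1]
      refine (congrArg (fun z : Kar.homSub _ _ _ =>
        polM (z.1 : DHom K (k + 2 * n) (l + 2 * n) _) (Mon.top _) t)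
        (Mat.idM_ne (kirbyStage K n) hkl)).trans ?_
      exact congrFun (congrFun (map_zero polM) _) _
  · have e : (GCat.comp (add_zero 0) f (kirbyMap K n') : Mat.HomM (kirbyStage K n)
        (kirbyStage K (n' + 1)) 0) k l = ∑ j, GCat.comp (by omega)
        ((show Mat.HomM (kirbyStage K n) (kirbyStage K n') 0 from f) k j)
        (kirbyMap K n' j l) := rfl
    refine (congrArg (fun z : Kar.homSub _ _ _ =>
        polM (z.1 : DHom K (k + 2 * n) (l + 2 * (n' + 1)) _) (Mon.top _) t) e).trans ?_
    rw [AddSubmonoidClass.coe_finsetSum]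
    refine (polM_sum_comp (a := k + 2 * n) (c := l + 2 * (n' + 1)) (b := fun j : Fin 2 => j + 2 * n')
      (fun j : Fin 2 => show 0 + (kirbyStage K n).s k - (kirbyStage K n').s j +
        (0 + (kirbyStage K n').s j - (kirbyStage K (n' + 1)).s l) =
        0 + (kirbyStage K n).s k - (kirbyStage K (n' + 1)).s l by omega)
      (fun j => ((show Mat.HomM (kirbyStage K n) (kirbyStage K n') 0 from f) k j).1)
      (fun j => (kirbyMap K n' j l).1) l (Mon.top _)
      (fun t => (polM_kirbyMap_top n' l l t).trans (if_congr (by simp) rfl rfl))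
      (fun j hj t => (polM_kirbyMap_top n' j l t).trans (if_neg fun h => hj h.1)) t).trans ?_
    exact hf k l t

/-- Entries of transition morphisms of the Kirby color tensored with strands, on top
coefficients. -/
lemma topRow_trEntry (m : ℕ) {i j : (kirby K).I} (v : i ⟶ j) (k l : Fin 2) {p q p' : ℤ}
    (h : p + (0 + ((kirbyStage K i.down).s k + 0) - ((kirbyStage K j.down).s l + 0)) = p')
    (hp : q + (k + 2 * i.down : ℕ) = p) (hp' : q + (l + 2 * j.down : ℕ) = p')
    (x : (polObj K (k + 2 * i.down + m)).V p) :
    topRow (l + 2 * j.down) m hp' (HOM.at (polAct ((kirbyStrands K m).trEntry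
      (i := (i, PUnit.unit)) (j := (j, PUnit.unit)) (v, 𝟙 _) (k, ()) (l, ())).1) p p' h x) =
      (if k = l then (1 : K) else 0) • topRow (k + 2 * i.down) m hp x := by
  refine (topRow_polAct (N := k + 2 * i.down) (N' := l + 2 * j.down) (m := m) (m' := m) _
    (1 : DHom K m m 0) (if k = l then (1 : K) else 0) h (add_zero q) hp hp'
    (fun u t v' => ?_) x).trans ?_
  · have e := congrArg (fun z : Kar.homSub _ _ _ => (z.1 :
      DHom K (k + 2 * i.down + m) (l + 2 * j.down + m) _)) (kirbyStrands_trEntry m v k l)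
    refine (congrArg (fun z => polM z (Mon.join₂ rfl (Mon.top (l + 2 * j.down)) u)
      (Mon.join₂ rfl t v')) e).trans ?_
    refine (congrFun (congrFun (polM_tensor rfl rfl _ _ _) _) _).trans ?_
    refine (tenM_join₂ rfl rfl _ _ _ _ _ _).trans ?_
    have h₀ : (0 : ℤ) = 0 + 0 - 0 := by omega
    have e' := (congrArg polM (Kar.degCast_val h₀ (GCat.id ((toKar K (DTL K)).obj ⟨m⟩)))).trans
      (polM_degCast (X := ⟨m⟩) (Y := ⟨m⟩) h₀ (1 : DHom K m m 0))
    refine (congrArg₂ (· * ·) (polM_kirby_tr_top v k l t)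
      (congrFun (congrFun e' u) v')).trans ?_
    by_cases ht : t = Mon.top (k + 2 * i.down)
    · simp [ht]
    · simp [ht]
  · exact congrArg ((if k = l then (1 : K) else 0) • ·)
      ((congrArg (fun z : HOM _ _ _ => HOM.at z q q (add_zero q) (topRow _ m hp x))
        ((polDTL K).map_id ⟨m⟩)).trans rfl)

lemma kirbyStrands_degree (m : ℕ) (q : ℤ) (i : (kirbyStrands K m).I)
    (b : ((kirbyStrands K m).at i).ι) :
    q + ((show Fin 2 from b.1).val + 2 * i.1.down : ℕ) = q - ((kirbyStrands K m).at i).s b := by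
  have h : ((kirbyStrands K m).at i).s b = _ := kirbyStage_s i.1.down (show Fin 2 from b.1) rfl
  rw [h, sub_neg_eq_add]

/-- Top coefficients do not change along the directed system. This is the compatibility that
`GFunctor.extDesc` requires, so they descend to the colimit. -/
lemma sum_topRow_trEntry (m : ℕ) (q : ℤ) {i j : (kirbyStrands K m).I} (v : i ⟶ j)
    (b : ((kirbyStrands K m).at i).ι)
    (x : ((polDTL K).obj (((kirbyStrands K m).at i).X b).X).V (q - ((kirbyStrands K m).at i).s b)) :
    ∑ b', topRow ((show Fin 2 from b'.1).val + 2 * j.1.down) m (kirbyStrands_degree m q j b')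
      (HOM.at ((polDTL K).map ((kirbyStrands K m).trEntry v b b').1)
        (q - ((kirbyStrands K m).at i).s b) (q - ((kirbyStrands K m).at j).s b') (by omega) x) =
      topRow ((show Fin 2 from b.1).val + 2 * i.1.down) m (kirbyStrands_degree m q i b) x := by
  refine (Fintype.sum_eq_single (b.1, ()) ?_).trans ?_
  · rintro ⟨l, ⟨⟩⟩ hl
    have hne : (show Fin 2 from b.1) ≠ l := fun h => hl (Prod.ext h.symm rfl)
    refine (topRow_trEntry m v.1 b.1 l _ (kirbyStrands_degree m q i b)
      (kirbyStrands_degree m q j (l, ())) x).trans ?_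
    rw [if_neg hne, zero_smul]
  · refine (topRow_trEntry m v.1 b.1 b.1 _ (kirbyStrands_degree m q i b)
      (kirbyStrands_degree m q j (b.1, ())) x).trans ?_
    exact (congrArg (· • _) (if_pos rfl)).trans (one_smul K _)

/-- The linear map given by the coefficients of the monomials divisible by all variables of the
Kirby color. -/
def kirbyEvalAt (m : ℕ) (q : ℤ) : ((Pol K).obj (kirbyStrands K m)).V q →ₗ[K] (polObj K m).V q :=
  (polDTL K).extDesc (kirbyStrands K m)
    (fun i b => topRow ((show Fin 2 from b.1).val + 2 * i.1.down) m (kirbyStrands_degree m q i b))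
    (sum_topRow_trEntry m q)

/-- Vectors of an image of an idempotent are represented by vectors of the underlying object. Top
coefficients do not depend on whether the symmetrizer has been applied to the representative. -/
lemma topRow_symmetrizer (N m : ℕ) {p q : ℤ} (h : q + N = p) (x : (polObj K (N + m)).V p) :
    topRow N m h (HOM.at (polAct (tensor rfl rfl (add_zero 0) (symmetrizer K N)
      (1 : DHom K m m 0))) p p (add_zero p) x) = topRow N m h x := by
  refine (topRow_polAct _ (1 : DHom K m m 0) 1 (add_zero p) (add_zero q) h h
    (fun u t v => ?_) x).trans ?_
  · rw [polM_tensor, tenM_join₂, polM_symmetrizer_top, polM_one]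
    split_ifs <;> simp
  · exact (one_smul K _).trans
      ((congrArg (fun z : HOM _ _ _ => HOM.at z q q (add_zero q) (topRow _ m h x))
        ((polDTL K).map_id ⟨m⟩)).trans rfl)

lemma kirbyEvalAt_stageIncl (m n : ℕ) (k : Fin 2) (N : ℕ) (hN : k + 2 * n = N) {p q : ℤ}
    (h : p + -(N : ℤ) = q) (h' : q + N = p) (x : (polObj K (N + m)).V p) :
    kirbyEvalAt m q (HOM.at ((Pol K).map (stageIncl m n k N hN)) p q h
      (polι (N + m) p x)) = topRow N m h' x := by
  subst hN
  refine (polDTL K).extDesc_inclAs (kirbyStrands K m) _ (sum_topRow_trEntry m q) (i := (⟨n⟩, PUnit.unit)) (b := (k, ()))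
    (X := ⟨k + 2 * n + m⟩) rfl (kirbyStage_s n k rfl) h x (topRow (k + 2 * n) m h')
    (fun x₀ hx => ?_)
  have hp := kirbyStrands_degree (K := K) m q (⟨n⟩, PUnit.unit) (k, ())
  obtain rfl : p = q - ((kirbyStrands K m).at (⟨n⟩, PUnit.unit)).s (k, ()) := h'.symm.trans hp
  obtain rfl := eq_of_heq hx
  exact topRow_symmetrizer (k + 2 * n) m h' x₀

lemma kirbyEvalAt_colorIncl (m N : ℕ) {p q : ℤ} (h : p + -(N : ℤ) = q) (h' : q + N = p)
    (x : (polObj K (N + m)).V p) :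
    kirbyEvalAt m q (HOM.at ((Pol K).map (colorIncl K m N)) p q h
      (polι (N + m) p x)) = topRow N m h' x :=
  kirbyEvalAt_stageIncl m _ _ N _ h h' x

end KirbyEval

end

noncomputable section

open DHom

/-! ### Natural transformations out of representable functors -/

section YonedaTrans

variable {K : Type u} [Field K] {D : Type v} [GCat K D]

/-- The natural transformation `Hom(-, W) → HOM(P(-), V)` given by a degree zero map `P(W) → V`. -/
def yonedaTrans (P : GFunctor K D (GVect K)) (W : D) {V : GVect K} (ε : GHom K (P.obj W) V 0) :
    GNatTrans (homInto K W) (P.op.comp (homInto K V)) where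
  app X p := (GCat.comp (K := K) (X := P.obj X.unop) (Y := P.obj W) (Z := V) p.2).flip ε ∘ₗ P.map
  naturality {X Y d} f := HOM.ext fun j k h x => by
    rw [HOM.comp_at (add_zero d) _ _ j k k h (add_zero k),
      HOM.comp_at (zero_add d) _ _ j j k (add_zero j) h]
    have e : ∀ (h₁ : d + j = k), GCat.comp (add_zero k) (P.map (GCat.comp h₁
        (show GHom K Y.unop X.unop d from f) (show GHom K X.unop W j from x))) ε =
        GCat.comp h₁ (P.map (show GHom K Y.unop X.unop d from f))
          (GCat.comp (add_zero j) (P.map (show GHom K X.unop W j from x)) ε) := fun h₁ => by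
      rw [P.map_comp, GCat.assoc h₁ (add_zero k) (add_zero j) h₁]
    exact e _

end YonedaTrans

/-! ### The pairing given by top coefficients -/

section KirbyPairing

variable {K : Type u} [Field K] [CharZero K]

variable (K) in
/-- The map from the value of the polynomial representation on the Kirby color tensored with
strands to the value on the strands. -/
def kirbyEval (m : ℕ) : GHom K ((Pol K).obj (kirbyStrands K m)) (polObj K m) 0 :=
  fun p => (polObj K m).tr (by have := p.2; omega) ∘ₗ kirbyEvalAt m p.1.1

lemma kirbyEval_at (m : ℕ) (p : ℤ) (x : ((Pol K).obj (kirbyStrands K m)).V p) :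
    HOM.at (kirbyEval K m) p p (add_zero p) x = kirbyEvalAt m p x := rfl

/-- Linear maps out of the value of the polynomial representation on the Kirby color tensored with
strands. -/
lemma Pol_kirbyStrands_ext {m : ℕ} {q : ℤ} {M : Type u} [AddCommGroup M] [Module K M]
    {φ ψ : ((Pol K).obj (kirbyStrands K m)).V q →ₗ[K] M}
    (H : ∀ (N : ℕ) (p : ℤ) (h : p + -(N : ℤ) = q) (x : (polObj K (N + m)).V p),
      φ (HOM.at ((Pol K).map (colorIncl K m N)) p q h (polι _ p x)) =
      ψ (HOM.at ((Pol K).map (colorIncl K m N)) p q h (polι _ p x))) : φ = ψ := by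
  refine LinearMap.ext fun y => ?_
  obtain ⟨i, x, rfl⟩ := (polDTL K).exists_eq_sum_inclAs_embedι (kirbyStrands K m)
    (J := Fin 2) (fun i => (Equiv.prodPUnit (Fin 2)).symm)
    (X := fun i k => (⟨k + 2 * i.1.down + m⟩ : DTL K))
    (s := fun i k => -((k + 2 * i.1.down : ℕ) : ℤ)) (fun i k => rfl)
    (fun i k => kirbyStage_s i.1.down k rfl) q y
  refine (map_sum φ _ _).trans (Eq.trans (Finset.sum_congr rfl fun k _ => ?_) (map_sum ψ _ _).symm)
  have h := H (k + 2 * i.1.down) _ (sub_add_cancel q _) (x k)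
  rw [← stageIncl_eq m i.1.down k (k + 2 * i.1.down) rfl] at h
  exact h

/-- The matrix of a morphism to the Kirby color tensored with strands. -/
lemma kirbyEvalAt_comp_colorIncl {a m N : ℕ} {d e p q : ℤ} (g : DHom K a (N + m) e)
    (hd : e + -(N : ℤ) = d) (h : p + d = q) (x : (polObj K a).V p) (u : {u : Mon m // u.deg = q}) :
    kirbyEvalAt m q (HOM.at ((Pol K).map (GCat.comp hd
      (baseMap (X := (⟨a⟩ : DTL K)) (Y := ⟨N + m⟩) g) (colorIncl K m N))) p q h (polι a p x)) u =
      ∑ t : {t : Mon a // t.deg = p}, polM g (Mon.join₂ rfl (Mon.top N) u.1) t.1 * x t := by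
  rw [GFunctor.map_comp, HOM.comp_at hd _ _ p (p + e) q rfl (by omega), polι_map,
    kirbyEvalAt_colorIncl m N (by omega) (by omega)]
  rfl

variable (K) in
/-- The pairing `Hom(-, ω ⊗ c ^ m) → HOM(Pol(-), Pol(c ^ m))`. -/
def kirbyPairing (m : ℕ) : GNatTrans (homInto K (kirbyStrands K m))
    ((Pol K).op.comp (homInto K (polObj K m))) :=
  yonedaTrans (Pol K) (kirbyStrands K m) (kirbyEval K m)

/-- The color family of composites with the inclusions into the Kirby color tensored with
strands. -/
def colorFamily (a m : ℕ) (d : ℤ) : ColorFamily K a m d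
    (GHom K (base K (⟨a⟩ : DTL K)) (kirbyStrands K m) d) where
  φ n e h := (GCat.comp (show e + -(n : ℤ) = d by omega)).flip (colorIncl K m n) ∘ₗ
    baseMap (X := (⟨a⟩ : DTL K)) (Y := ⟨n + m⟩)
  sym n e h g := by
    refine (comp_baseMap_comp (X := (⟨a⟩ : DTL K)) (Y := ⟨n + m⟩) (Z := ⟨n + m⟩) (add_zero e) _
      (zero_add _) (show e + -(n : ℤ) = d by omega) g (tensor rfl rfl (add_zero 0)
        (symmetrizer K n) (1 : DHom K m m 0)) (colorIncl K m n)).trans ?_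
    rw [symmetrizer_comp_colorIncl]
    rfl
  cup n e e' h h' hd g := by
    refine (comp_baseMap_comp (X := (⟨a⟩ : DTL K)) (Y := ⟨n + m⟩) (Z := ⟨n + 2 + m⟩) hd _
      (show 2 + -((n + 2 : ℕ) : ℤ) = -n by push_cast; ring) (show e + -(n : ℤ) = d by omega) g
      (tensor rfl rfl (add_zero 2) (tensor (add_zero n) rfl (zero_add 2) (1 : DHom K n n 0)
        (dottedCup K)) (1 : DHom K m m 0)) (colorIncl K m (n + 2))).trans ?_
    rw [dottedCup_comp_colorIncl]
    rfl

end KirbyPairing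

end

noncomputable section

open DHom

/-! ### The basis of monomials -/

section PolBasis

variable {K : Type u} [Field K]

/-- The basis vectors of the polynomial representation. -/
def polBasis {a : ℕ} (t : Mon a) {p : ℤ} (h : t.deg = p) : (polObj K a).V p :=
  Pi.single ⟨t, h⟩ 1

lemma sum_mul_polBasis {a : ℕ} (t : Mon a) {p : ℤ} (h : t.deg = p) (c : Mon a → K) :
    ∑ s : {s : Mon a // s.deg = p}, c s.1 * polBasis t h s = c t := by
  rw [Fintype.sum_eq_single ⟨t, h⟩]
  · rw [polBasis, Pi.single_eq_same, mul_one]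
  · intro s hs
    rw [polBasis, Pi.single_eq_of_ne hs, mul_zero]

lemma pol_base_ext {a : ℕ} {p : ℤ} {M : Type u} [AddCommGroup M] [Module K M]
    {φ ψ : ((Pol K).obj (base K (⟨a⟩ : DTL K))).V p →ₗ[K] M}
    (H : ∀ (t : Mon a) (h : t.deg = p), φ (polι a p (polBasis t h)) = ψ (polι a p (polBasis t h))) :
    φ = ψ := by
  refine LinearMap.ext fun y => ?_
  obtain ⟨x, rfl⟩ := polι_surjective a p y
  have e : φ ∘ₗ polι a p = ψ ∘ₗ polι a p := LinearMap.pi_ext' fun t => LinearMap.ext_ring (H t.1 t.2)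
  exact LinearMap.congr_fun e x

end PolBasis

/-! ### Bijectivity of the pairing -/

section KirbyPairing

variable {K : Type u} [Field K] [CharZero K]

lemma kirbyPairing_at {m : ℕ} {A : dTLbar K} {d p q : ℤ} (f : GHom K A (kirbyStrands K m) d)
    (h : p + d = q) (x : ((Pol K).obj A).V p) :
    HOM.at (HOM.at ((kirbyPairing K m).app ⟨A⟩) d d (add_zero d) f : HOM _ _ d) p q h x =
      kirbyEvalAt m q (HOM.at ((Pol K).map f) p q h x) :=
  (HOM.comp_at (add_zero d) ((Pol K).map f) (kirbyEval K m) p q q h (add_zero q) h x).trans rfl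

/-- The matrix coefficients of the maps paired with morphisms to the Kirby color tensored with
strands. -/
def kirbyCoeff {a m : ℕ} {d : ℤ} (t : Mon a) (u : Mon m) (h : t.deg + d = u.deg) :
    GHom K (base K (⟨a⟩ : DTL K)) (kirbyStrands K m) d →ₗ[K] K where
  toFun f := kirbyEvalAt m u.deg (HOM.at ((Pol K).map f) t.deg u.deg h
    (polι a _ (polBasis t rfl))) ⟨u, rfl⟩
  map_add' f g := by
    refine (congrArg (fun z : HOM _ _ d => kirbyEvalAt m u.deg (HOM.at z t.deg u.deg h
      (polι a _ (polBasis t rfl))) ⟨u, rfl⟩) (map_add (Pol K).map f g)).trans ?_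
    rw [HOM.add_at, LinearMap.add_apply, map_add]
    rfl
  map_smul' c f := by
    refine (congrArg (fun z : HOM _ _ d => kirbyEvalAt m u.deg (HOM.at z t.deg u.deg h
      (polι a _ (polBasis t rfl))) ⟨u, rfl⟩) (map_smul (Pol K).map c f)).trans ?_
    rw [HOM.smul_at, LinearMap.smul_apply, map_smul]
    rfl

lemma kirbyCoeff_comp {a m N : ℕ} {d e : ℤ} (t : Mon a) (u : Mon m) (h : t.deg + d = u.deg)
    (g : DHom K a (N + m) e) (hd : e + -(N : ℤ) = d) :
    kirbyCoeff t u h (GCat.comp hd (baseMap (X := (⟨a⟩ : DTL K)) (Y := ⟨N + m⟩) g)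
      (colorIncl K m N)) = polM g (Mon.join₂ rfl (Mon.top N) u) t :=
  (kirbyEvalAt_comp_colorIncl g hd h _ ⟨u, rfl⟩).trans
    (sum_mul_polBasis t rfl (polM g (Mon.join₂ rfl (Mon.top N) u)))

/-- Morphisms into the Kirby color tensored with strands form a color family, so each composite of
`g k` with an inclusion is a combination of fixed morphisms `γ u t` whose coefficients are the top
coefficients of `g k`. Summed over the two parities, these coefficients are the matrix of the paired
map, hence zero. -/
lemma kirbyPairing_injective (a m : ℕ) (d : ℤ)
    (f : GHom K (base K (⟨a⟩ : DTL K)) (kirbyStrands K m) d)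
    (hf : HOM.at ((kirbyPairing K m).app ⟨base K (⟨a⟩ : DTL K)⟩) d d (add_zero d) f = 0) : f = 0 := by
  obtain ⟨γ, hγ⟩ := (colorFamily (K := K) a m d).exists_eq_sum
  obtain ⟨N, g, rfl⟩ := exists_eq_sum_colorIncl m f
  have e : ∀ k, GCat.comp (show d + N k + -(N k : ℤ) = d by omega)
      (baseMap (X := (⟨a⟩ : DTL K)) (Y := ⟨N k + m⟩) (g k)) (colorIncl K m (N k)) =
      ∑ u, ∑ t, polM (g k) (Mon.join₂ rfl (Mon.top (N k)) u) t • γ u t := fun k =>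
    hγ (N k) (d + N k) rfl (g k)
  have key : ∀ (u : Mon m) (t : Mon a),
      ∑ k, polM (g k) (Mon.join₂ rfl (Mon.top (N k)) u) t = 0 := by
    intro u t
    by_cases h : t.deg + d = u.deg
    · refine Eq.trans (Finset.sum_congr rfl fun k _ => (kirbyCoeff_comp t u h (g k)
        (show d + N k + -(N k : ℤ) = d by omega)).symm) ?_
      rw [← map_sum]
      exact congrFun ((kirbyPairing_at _ h (polι a _ (polBasis t rfl))).symm.trans
        (congrArg (fun z : HOM _ (polObj K m) d => HOM.at z t.deg u.deg h
          (polι a _ (polBasis t rfl))) hf)) ⟨u, rfl⟩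
    -- Outside the matching degrees `kirbyCoeff` is not available, but there every top coefficient
    -- vanishes by homogeneity.
    · refine Finset.sum_eq_zero fun k _ => ?_
      by_contra hne
      have := polM_deg _ hne
      rw [Mon.deg_join₂, Mon.deg_top] at this
      exact h (by omega)
  rw [Finset.sum_congr rfl fun k _ => e k, Finset.sum_comm]
  refine Finset.sum_eq_zero fun u _ => ?_
  rw [Finset.sum_comm]
  refine Finset.sum_eq_zero fun t _ => ?_
  rw [← Finset.sum_smul, key, zero_smul]

/-- Each matrix unit is realized as the block of top coefficients of some morphism by
`exists_polM_top_eq`, and a homogeneous map is a combination of the matrix units of its degree. -/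
lemma kirbyPairing_surjective (a m : ℕ) (d : ℤ)
    (φ : GHom K ((Pol K).obj (base K (⟨a⟩ : DTL K))) (polObj K m) d) :
    ∃ f : GHom K (base K (⟨a⟩ : DTL K)) (kirbyStrands K m) d,
      HOM.at ((kirbyPairing K m).app ⟨base K (⟨a⟩ : DTL K)⟩) d d (add_zero d) f = φ := by
  choose n g hg using exists_polM_top_eq (K := K) a m
  let f : ∀ t u, GHom K (base K (⟨a⟩ : DTL K)) (kirbyStrands K m) d := fun t u =>
    if h : t.deg + d = u.deg then HOM.at φ t.deg u.deg h (polι a _ (polBasis t rfl)) ⟨u, rfl⟩ •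
      GCat.comp (show (n t u : ℤ) + u.deg - t.deg + -(n t u : ℤ) = d by omega)
      (baseMap (X := (⟨a⟩ : DTL K)) (Y := ⟨n t u + m⟩) (g t u)) (colorIncl K m (n t u)) else 0
  refine ⟨∑ t, ∑ u, f t u, HOM.ext fun p q h y => ?_⟩
  revert y
  refine LinearMap.congr_fun (pol_base_ext fun t ht => ?_)
  subst ht
  refine (kirbyPairing_at _ h _).trans (funext fun v => ?_)
  obtain ⟨v, rfl⟩ := v
  refine Eq.trans (b := kirbyCoeff t v h (∑ t, ∑ u, f t u)) rfl ?_
  have hf : ∀ t' u, kirbyCoeff t v h (f t' u) = if u = v ∧ t' = t then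
      HOM.at φ t.deg v.deg h (polι a _ (polBasis t rfl)) ⟨v, rfl⟩ else 0 := by
    intro t' u
    by_cases h' : t'.deg + d = u.deg
    · simp only [f, dif_pos h', map_smul]
      rw [kirbyCoeff_comp, hg]
      by_cases huv : u = v ∧ t' = t
      · obtain ⟨rfl, rfl⟩ := huv
        simp
      · rw [if_neg huv, if_neg huv, smul_zero]
    · simp only [f, dif_neg h', map_zero]
      rw [if_neg]
      rintro ⟨rfl, rfl⟩
      exact h' h
  rw [map_sum, Fintype.sum_eq_single t, map_sum, Fintype.sum_eq_single v, hf, if_pos ⟨rfl, rfl⟩]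
  · intro u hu
    rw [hf, if_neg fun h => hu h.1]
  · intro t' ht
    rw [map_sum]
    exact Finset.sum_eq_zero fun u _ => by rw [hf, if_neg fun h => ht h.2]

lemma kirbyPairing_bijectiveAt_base (a m : ℕ) :
    (kirbyPairing K m).BijectiveAt ⟨base K (⟨a⟩ : DTL K)⟩ := by
  refine fun d => ⟨fun f g h => sub_eq_zero.1 (kirbyPairing_injective a m d (f - g) ?_),
    kirbyPairing_surjective a m d⟩
  refine (map_sub (HOM.at ((kirbyPairing K m).app ⟨base K (⟨a⟩ : DTL K)⟩) d d (add_zero d))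
    f g).trans (sub_eq_zero.2 h)

lemma kirbyPairing_bijectiveAt (m : ℕ) (A : dTLbar K) : (kirbyPairing K m).BijectiveAt ⟨A⟩ :=
  (kirbyPairing K m).bijectiveAt_of_embed (homInto_isContinuous _)
    (extInd_isContinuous _ _) (fun X => kirbyPairing_bijectiveAt_base X.n m) A

end KirbyPairing

end

noncomputable section

open DHom

/-! ### The right unitor -/

section RightUnitor

variable {K : Type u} [Field K]

variable (K) in
/-- The tensor unit, as an object of the Karoubi envelope. -/
abbrev karUnit : Kar K (DTL K) := (toKar K (DTL K)).obj ⟨0⟩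

/-- The objects `c ^ n ⊗ c ^ 0` and `c ^ n` coincide by definition, but `f ⊗ id` equals `f` only
through a relation. So the idempotents of `X` and `X ⊗ 1` are equal without being identical, and the
unitor is a morphism with underlying `X.e` rather than an identity. -/
lemma tensor_karUnit_val {X Y : Kar K (DTL K)} {d : ℤ} (h : d + 0 = d) (f : GHom K X Y d) :
    (GTensor.hom h f (GCat.id (karUnit K))).1 = f.1 :=
  gtensor_unit (K := K) (a := X.X.n) (b := Y.X.n) rfl rfl h f.1

lemma tensor_karUnit_e (X : Kar K (DTL K)) : (GTensor.obj K X (karUnit K)).e = X.e :=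
  gtensor_unit (K := K) (a := X.X.n) (b := X.X.n) rfl rfl (add_zero 0) X.e

/-- The right unitor of the Karoubi envelope. -/
def Kar.unitor (X : Kar K (DTL K)) : GHom K X (GTensor.obj K X (karUnit K)) 0 :=
  ⟨X.e, Kar.mem_of (A := X) (B := GTensor.obj K X (karUnit K)) X.idem
    ((congrArg (GCat.comp (add_zero 0) X.e) (tensor_karUnit_e X)).trans X.idem)⟩

/-- The inverse of the right unitor of the Karoubi envelope. -/
def Kar.unitorInv (X : Kar K (DTL K)) : GHom K (GTensor.obj K X (karUnit K)) X 0 :=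
  ⟨X.e, Kar.mem_of (A := GTensor.obj K X (karUnit K)) (B := X)
    ((congrArg (fun z => GCat.comp (add_zero 0) z X.e) (tensor_karUnit_e X)).trans X.idem) X.idem⟩

lemma Kar.unitor_comp_unitorInv (X : Kar K (DTL K)) {i j k : ℤ} (hi : 0 = i) (hj : 0 = j)
    (h : i + j = k) : GCat.comp h (degCast hi X.unitor) (degCast hj X.unitorInv) =
      degCast (by omega) (GCat.id X) := by
  subst hi hj
  obtain rfl : 0 = k := by omega
  exact Subtype.ext X.idem

lemma Kar.unitorInv_comp_unitor (X : Kar K (DTL K)) {i j k : ℤ} (hi : 0 = i) (hj : 0 = j)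
    (h : i + j = k) : GCat.comp h (degCast hi X.unitorInv) (degCast hj X.unitor) =
      degCast (by omega) (GCat.id (GTensor.obj K X (karUnit K))) := by
  subst hi hj
  obtain rfl : 0 = k := by omega
  exact Subtype.ext (X.idem.trans (tensor_karUnit_e X).symm)

lemma Kar.unitor_naturality {X Y : Kar K (DTL K)} {d i j k l z : ℤ} (hi : 0 = i) (hz : 0 = z)
    (hj : 0 = j) (h₁ : d + z = k) (h₂ : i + k = l) (h₃ : d + j = l) (f : GHom K X Y d) :
    GCat.comp h₂ (degCast hi X.unitor) (GTensor.hom h₁ f (degCast hz (GCat.id (karUnit K)))) =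
      GCat.comp h₃ f (degCast hj Y.unitor) := by
  subst hi hj hz
  obtain rfl : d = k := by omega
  obtain rfl : d = l := by omega
  refine Subtype.ext ?_
  refine (congrArg (GCat.comp h₂ X.e) (tensor_karUnit_val h₁ f)).trans ?_
  exact (Kar.id_comp' _ f.2).trans (Kar.comp_id' h₃ f.2).symm

open Classical in
/-- The right unitor of the additive completion. -/
def Mat.unitor (A : Mat K (Kar K (DTL K))) :
    Mat.HomM A (Mat.tensorObj A (matBase K (⟨0⟩ : DTL K))) 0 := fun a p =>
  if h : a = p.1 then h ▸ degCast (show 0 = 0 + A.s a - (A.s a + 0) by omega) (A.X a).unitor else 0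

open Classical in
/-- The inverse of the right unitor of the additive completion. -/
def Mat.unitorInv (A : Mat K (Kar K (DTL K))) :
    Mat.HomM (Mat.tensorObj A (matBase K (⟨0⟩ : DTL K))) A 0 := fun p a =>
  if h : a = p.1 then h ▸ degCast (show 0 = 0 + (A.s a + 0) - A.s a by omega) (A.X a).unitorInv
  else 0

lemma Mat.unitor_self (A : Mat K (Kar K (DTL K))) (a : A.ι) :
    A.unitor a (a, ()) = degCast (show 0 = 0 + A.s a - (A.s a + 0) by omega) (A.X a).unitor :=
  dif_pos rfl

lemma Mat.unitor_ne (A : Mat K (Kar K (DTL K))) {a b : A.ι} (h : a ≠ b) : A.unitor a (b, ()) = 0 :=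
  dif_neg h

lemma Mat.unitorInv_self (A : Mat K (Kar K (DTL K))) (a : A.ι) :
    A.unitorInv (a, ()) a = degCast (show 0 = 0 + (A.s a + 0) - A.s a by omega) (A.X a).unitorInv :=
  dif_pos rfl

lemma Mat.unitorInv_ne (A : Mat K (Kar K (DTL K))) {a b : A.ι} (h : b ≠ a) :
    A.unitorInv (a, ()) b = 0 :=
  dif_neg h

lemma Mat.unitor_comp_unitorInv (A : Mat K (Kar K (DTL K))) :
    Mat.compM (add_zero 0) A.unitor A.unitorInv = A.idM := by
  funext a b
  rw [Mat.compM_apply]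
  refine (Fintype.sum_eq_single (a, ()) fun p hp => ?_).trans ?_
  · have h : a ≠ p.1 := fun h => hp (Prod.ext h.symm rfl)
    exact (congrArg (fun z => GCat.comp _ z _) (A.unitor_ne h)).trans (LinearMap.map_zero₂ _ _)
  · by_cases hab : a = b
    · subst hab
      refine (congrArg₂ (fun y z => GCat.comp _ y z) (A.unitor_self a) (A.unitorInv_self a)).trans ?_
      exact (Kar.unitor_comp_unitorInv _ _ _ _).trans (A.idM_self a).symm
    · refine (congrArg (GCat.comp _ _) (A.unitorInv_ne (Ne.symm hab))).trans ((map_zero _).trans ?_)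
      exact (A.idM_ne hab).symm

lemma Mat.unitorInv_comp_unitor (A : Mat K (Kar K (DTL K))) :
    Mat.compM (add_zero 0) A.unitorInv A.unitor =
      (Mat.tensorObj A (matBase K (⟨0⟩ : DTL K))).idM := by
  funext ⟨a, _⟩ ⟨b, _⟩
  rw [Mat.compM_apply]
  refine (Fintype.sum_eq_single a fun c hc => ?_).trans ?_
  · exact (congrArg (fun z => GCat.comp _ z _) (A.unitorInv_ne hc)).trans (LinearMap.map_zero₂ _ _)
  · by_cases hab : a = b
    · subst hab
      refine (congrArg₂ (fun y z => GCat.comp _ y z) (A.unitorInv_self a) (A.unitor_self a)).trans ?_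
      exact (Kar.unitorInv_comp_unitor _ _ _ _).trans
        ((Mat.tensorObj A (matBase K (⟨0⟩ : DTL K))).idM_self (a, ())).symm
    · refine (congrArg (GCat.comp _ _) (A.unitor_ne hab)).trans ((map_zero _).trans ?_)
      exact ((Mat.tensorObj A (matBase K (⟨0⟩ : DTL K))).idM_ne fun h => hab (congrArg Prod.fst h)).symm

lemma Mat.unitor_naturality {A B : Mat K (Kar K (DTL K))} (f : Mat.HomM A B 0) :
    Mat.compM (add_zero 0) A.unitor
      (Mat.tensorM (add_zero 0) f (matBase K (⟨0⟩ : DTL K)).idM) =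
      Mat.compM (add_zero 0) f B.unitor := by
  funext a ⟨b, _⟩
  rw [Mat.compM_apply, Mat.compM_apply]
  refine (Fintype.sum_eq_single (a, ()) fun p hp => ?_).trans
    (Eq.trans ?_ (Fintype.sum_eq_single b fun c hc => ?_).symm)
  · have h : a ≠ p.1 := fun h => hp (Prod.ext h.symm rfl)
    exact (congrArg (fun z => GCat.comp _ z _) (A.unitor_ne h)).trans (LinearMap.map_zero₂ _ _)
  · refine (congrArg₂ (fun y z => GCat.comp _ y (GTensor.hom _ (f a b) z)) (A.unitor_self a)
      ((matBase K (⟨0⟩ : DTL K)).idM_self ())).trans (Eq.trans ?_ (congrArg (GCat.comp _ (f a b))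
        (B.unitor_self b)).symm)
    exact Kar.unitor_naturality _ _ _ _ _ _ _
  · exact (congrArg (GCat.comp _ (f a c)) (B.unitor_ne hc)).trans (map_zero _)

/-- Formal from naturality of the unitor, by composing with the inverses on both sides. -/
lemma Mat.unitorInv_naturality {A B : Mat K (Kar K (DTL K))} (f : Mat.HomM A B 0) :
    Mat.compM (add_zero 0) (Mat.tensorM (add_zero 0) f (matBase K (⟨0⟩ : DTL K)).idM) B.unitorInv =
      Mat.compM (add_zero 0) A.unitorInv f := by
  let U := matBase K (⟨0⟩ : DTL K)
  let f' : GHom K A B 0 := f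
  let F : GHom K (Mat.tensorObj A U) (Mat.tensorObj B U) 0 := Mat.tensorM (add_zero 0) f U.idM
  let r : ∀ A : Mat K (Kar K (DTL K)), GHom K A (Mat.tensorObj A U) 0 := Mat.unitor
  let r' : ∀ A : Mat K (Kar K (DTL K)), GHom K (Mat.tensorObj A U) A 0 := Mat.unitorInv
  have h₁ : GCat.comp (add_zero 0) (r' A) (r A) = GCat.id _ := Mat.unitorInv_comp_unitor A
  have h₂ : GCat.comp (add_zero 0) (r B) (r' B) = GCat.id _ := Mat.unitor_comp_unitorInv B
  have h₃ : GCat.comp (add_zero 0) (r A) F = GCat.comp (add_zero 0) f' (r B) :=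
    Mat.unitor_naturality f
  change GCat.comp (add_zero 0) F (r' B) = GCat.comp (add_zero 0) (r' A) f'
  rw [← GCat.comp_id (add_zero 0) f', ← h₂,
    ← GCat.assoc (add_zero 0) (add_zero 0) (add_zero 0) (add_zero 0) f', ← h₃,
    ← GCat.assoc (add_zero 0) (add_zero 0) (add_zero 0) (add_zero 0) (r' A),
    ← GCat.assoc (add_zero 0) (add_zero 0) (add_zero 0) (add_zero 0) (r' A), h₁, GCat.id_comp]

/-- The right unitor of the ind-completion. -/
def IndObj.unitor (A : dTLbar K) : GHom K A (A.tensorObj (base K (⟨0⟩ : DTL K))) 0 :=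
  (⟨fun i => CHom.ι (A.at i) (A.tensorObj (base K (⟨0⟩ : DTL K))) 0 (i, PUnit.unit)
    (Mat.unitor (A.at i)), fun {i j} v => by
    refine (CHom.pre_ι (B := A.tensorObj (base K (⟨0⟩ : DTL K))) (zero_add 0) (A.tr v)
      (j, PUnit.unit) (Mat.unitor (A.at j))).trans ?_
    refine Eq.trans (congrArg _ (Mat.unitor_naturality (A.tr v)).symm) ?_
    exact CHom.w (B := A.tensorObj (base K (⟨0⟩ : DTL K))) (j := (i, PUnit.unit))
      (j' := (j, PUnit.unit)) (v, 𝟙 _) (Mat.unitor (A.at i))⟩ : IndObj.homSub A _ 0)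

/-- The inverse of the right unitor of the ind-completion. -/
def IndObj.unitorInv (A : dTLbar K) : GHom K (A.tensorObj (base K (⟨0⟩ : DTL K))) A 0 :=
  (⟨fun p => CHom.ι ((A.tensorObj (base K (⟨0⟩ : DTL K))).at p) A 0 p.1
    (Mat.unitorInv (A.at p.1)), fun {p q} v => by
    refine (CHom.pre_ι (B := A) (zero_add 0) ((A.tensorObj (base K (⟨0⟩ : DTL K))).tr v)
      q.1 (Mat.unitorInv (A.at q.1))).trans ?_
    refine Eq.trans (congrArg _ (Mat.unitorInv_naturality (A.tr v.1))) ?_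
    exact CHom.w (B := A) (j := p.1) (j' := q.1) v.1 (Mat.unitorInv (A.at p.1))⟩ :
      IndObj.homSub _ A 0)

lemma IndObj.unitor_comp_unitorInv (A : dTLbar K) :
    GCat.comp (add_zero 0) A.unitor A.unitorInv = GCat.id A := by
  refine Subtype.ext (funext fun i => ?_)
  refine (CHom.act_ι (A := A.tensorObj (base K (⟨0⟩ : DTL K))) (add_zero 0) (i, PUnit.unit)
    (Mat.unitor (A.at i)) _).trans ?_
  refine (CHom.pre_ι (add_zero 0) _ i _).trans ?_
  exact congrArg _ (Mat.unitor_comp_unitorInv (A.at i))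

lemma IndObj.unitorInv_comp_unitor (A : dTLbar K) :
    GCat.comp (add_zero 0) A.unitorInv A.unitor =
      GCat.id (A.tensorObj (base K (⟨0⟩ : DTL K))) := by
  refine Subtype.ext (funext fun p => ?_)
  refine (CHom.act_ι (add_zero 0) p.1 (Mat.unitorInv (A.at p.1)) _).trans ?_
  refine (CHom.pre_ι (B := A.tensorObj (base K (⟨0⟩ : DTL K))) (add_zero 0) _ (p.1, PUnit.unit)
    _).trans ?_
  exact congrArg _ (Mat.unitorInv_comp_unitor (A.at p.1))

end RightUnitor

end

noncomputable section

/-! ### The Kirby color represents the dual of the polynomial representation -/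

section KirbyDual

variable {K : Type u} [Field K]

variable (K) in
/-- The value of the polynomial representation on the tensor unit is the ground field. -/
def polUnit : GHom K (polObj K 0) (GVect.unit K) 0 := fun p =>
  -- There is one monomial in no variables, so the sum is its coefficient. In nonzero degrees the
  -- index set is empty, and the sum lands in the zero space as it must.
  { toFun := fun x => ⟨∑ t, x t, by
      by_cases h : p.1.2 = 0
      · rw [if_pos h]
        trivial
      · rw [if_neg h, Submodule.mem_bot]
        refine Finset.sum_eq_zero fun t _ => (h ?_).elim
        rw [← p.2, ← t.2, Mon.deg_zero, add_zero]⟩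
    map_add' := fun x y => Subtype.ext Finset.sum_add_distrib
    map_smul' := fun c x => Subtype.ext (Finset.mul_sum (Finset.univ : Finset {t : Mon 0 // t.deg = p.1.1}) x c).symm }

variable (K) in
/-- The inverse of `polUnit`. -/
def polUnitInv : GHom K (GVect.unit K) (polObj K 0) 0 := fun _ =>
  { toFun := fun y _ => y.1
    map_add' := fun _ _ => rfl
    map_smul' := fun _ _ => rfl }

lemma polUnit_at {p : ℤ} (x : (polObj K 0).V p) :
    (HOM.at (polUnit K) p p (add_zero p) x).1 = ∑ t : {t : Mon 0 // t.deg = p}, x t := rfl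

lemma polUnit_comp_polUnitInv : GCat.comp (add_zero 0) (polUnit K) (polUnitInv K) = GCat.id _ := by
  refine HOM.ext fun p q h x => ?_
  obtain rfl : p = q := by omega
  rw [HOM.comp_at (add_zero 0) _ _ p p p (add_zero p) (add_zero p), HOM.id_at, GVect.tr_self]
  funext t
  refine (polUnit_at x).trans ?_
  exact Fintype.sum_eq_single (M := K) t fun s hs => (hs (Subtype.ext (Subsingleton.elim _ _))).elim

lemma polUnitInv_comp_polUnit : GCat.comp (add_zero 0) (polUnitInv K) (polUnit K) = GCat.id _ := by
  refine HOM.ext fun p q h y => ?_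
  obtain rfl : p = q := by omega
  rw [HOM.comp_at (add_zero 0) _ _ p p p (add_zero p) (add_zero p), HOM.id_at, GVect.tr_self]
  refine Subtype.ext ((polUnit_at _).trans ?_)
  by_cases hp : p = 0
  · exact Fintype.sum_eq_single (M := K)
      (⟨default, (Mon.deg_zero _).trans hp.symm⟩ : {s : Mon 0 // s.deg = p})
      fun s hs => (hs (Subtype.ext (Subsingleton.elim _ _))).elim
  · have e : ∀ S : Submodule K K, S = ⊥ → ∀ y : S, (y : K) = 0 := by
      rintro _ rfl y
      exact (Submodule.mem_bot K).1 y.2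
    exact (Finset.sum_eq_zero (M := K) fun s _ => e _ (if_neg hp) y).trans (e _ (if_neg hp) y).symm

lemma comp_bijective {D : Type w} [GCat K D] {X Y Z : D} {d : ℤ} (f : GHom K Y Z 0) (g : GHom K Z Y 0)
    (h : GCat.comp (add_zero 0) f g = GCat.id Y) (h' : GCat.comp (add_zero 0) g f = GCat.id Z) :
    Function.Bijective fun x : GHom K X Y d => GCat.comp (add_zero d) x f := by
  refine Function.bijective_iff_has_inverse.2 ⟨fun y => GCat.comp (add_zero d) y g, fun x => ?_,
    fun y => ?_⟩
  · change GCat.comp (add_zero d) (GCat.comp (add_zero d) x f) g = x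
    rw [GCat.assoc (add_zero d) (add_zero d) (add_zero 0) (add_zero d), h, GCat.comp_id]
  · change GCat.comp (add_zero d) (GCat.comp (add_zero d) y g) f = y
    rw [GCat.assoc (add_zero d) (add_zero d) (add_zero 0) (add_zero d), h', GCat.comp_id]

variable [CharZero K]

variable (K) in
/-- The functional on the value of the polynomial representation on the Kirby color. -/
def kirbyFunctional : GHom K ((Pol K).obj (kirby K)) (GVect.unit K) 0 :=
  GCat.comp (add_zero 0) (GCat.comp (add_zero 0) ((Pol K).map (kirby K).unitor) (kirbyEval K 0))
    (polUnit K)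

lemma comp_kirbyEval_bijective (m : ℕ) (A : dTLbar K) (d : ℤ) :
    Function.Bijective fun f : GHom K A (kirbyStrands K m) d =>
      (GCat.comp (add_zero d) ((Pol K).map f) (kirbyEval K m) :
        GHom K ((Pol K).obj A) (polObj K m) d) :=
  kirbyPairing_bijectiveAt m A d

/-- A composite of three bijections: the right unitor `ω ≅ ω ⊗ c^0`, the pairing for `m = 0`, and
the identification of `Pol(c^0)` with the ground field. -/
lemma comp_kirbyFunctional_bijective (A : dTLbar K) (d : ℤ) :
    Function.Bijective fun f : GHom K A (kirby K) d =>
      (GCat.comp (add_zero d) ((Pol K).map f) (kirbyFunctional K) :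
        GHom K ((Pol K).obj A) (GVect.unit K) d) := by
  have h₁ := comp_bijective (X := A) (d := d) (kirby K).unitor (kirby K).unitorInv
    (kirby K).unitor_comp_unitorInv (kirby K).unitorInv_comp_unitor
  have h₃ := comp_bijective (X := (Pol K).obj A) (d := d) (polUnit K) (polUnitInv K)
    polUnit_comp_polUnitInv polUnitInv_comp_polUnit
  refine (congrArg Function.Bijective (funext fun f => ?_)).mpr
    (h₃.comp ((comp_kirbyEval_bijective 0 A d).comp h₁))
  have h : ∀ (u : GHom K (kirby K) (kirbyStrands K 0) 0) (ε : GHom K _ (polObj K 0) 0),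
      GCat.comp (add_zero d) ((Pol K).map f)
        (GCat.comp (add_zero 0) (GCat.comp (add_zero 0) ((Pol K).map u) ε) (polUnit K)) =
      GCat.comp (add_zero d) (GCat.comp (add_zero d)
        ((Pol K).map (GCat.comp (add_zero d) f u)) ε) (polUnit K) := by
    intro u ε
    rw [GFunctor.map_comp, GCat.assoc (add_zero d) (add_zero d) (add_zero 0) (add_zero d),
      GCat.assoc (add_zero d) (add_zero d) (add_zero 0) (add_zero d),
      GCat.assoc (add_zero 0) (add_zero 0) (add_zero 0) (add_zero 0)]
  exact h _ _

lemma kirbyFunctional_bijectiveAt (A : dTLbar K) :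
    (yonedaTrans (Pol K) (kirby K) (kirbyFunctional K)).BijectiveAt ⟨A⟩ :=
  fun d => comp_kirbyFunctional_bijective A d

variable (K) in
/-- The Kirby color represents the graded dual of the polynomial representation. -/
theorem kirby_represents : Nonempty (GNatIso (homInto K (kirby K))
    ((Pol K).op.comp (gradedDual K))) :=
  (yonedaTrans (Pol K) (kirby K) (kirbyFunctional K)).nonempty_iso
    fun A => kirbyFunctional_bijectiveAt A.unop

end KirbyDual

end

noncomputable section

open DHom

/-! ### Morphisms of ind-objects on summands -/

section TensorSummands

variable {K : Type u} [Field K] {C : Type v} [GCat K C]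

lemma Mat.fromBase_comp_apply {A B : Mat K (Kar K C)} {d e : ℤ} (f : GHom K A B d) (a : A.ι)
    (h : A.s a + d = e) :
    GCat.comp h (A.fromBase a) f =
      ∑ b, GCat.comp (show d + A.s a - B.s b + B.s b = e by omega)
        (matBaseMap ((f : Mat.HomM A B d) a b).1) (B.fromBase b) := by
  rw [Finset.sum_congr rfl fun b _ => B.map_comp_fromBase b
    (show d + A.s a - B.s b + B.s b = e by omega) ((f : Mat.HomM A B d) a b), Mat.fromBase_eq,
    GCat.assoc (zero_add _) h h (zero_add _), Mat.inM_comp _ _ h,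
    map_sum]

lemma IndObj.summandIncl_comp {B B' : IndObj K (Mat K (Kar K C))} {i : B.I} {i' : B'.I}
    {d t : ℤ} (F : GHom K B B' d) (f : GHom K (B.at i) (B'.at i') d)
    (hF : GCat.comp (zero_add d) (B.incl i) F =
      GCat.comp (add_zero d) ((constFunctor K (Mat K (Kar K C))).map f) (B'.incl i'))
    (b : (B.at i).ι) (h : (B.at i).s b + d = t) :
    GCat.comp h (B.summandIncl i b) F = ∑ b', GCat.comp (show d + (B.at i).s b - (B'.at i').s b' +
      (B'.at i').s b' = t by omega) (baseMap ((f : Mat.HomM (B.at i) (B'.at i') d) b b').1)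
      (B'.summandIncl i' b') := by
  have h₁ : GCat.comp h (B.summandIncl i b) F = GCat.comp (add_zero t) (constMap _ _ _
      (GCat.comp h ((B.at i).fromBase b) f)) (B'.incl i') := by
    rw [IndObj.summandIncl, GCat.assoc (add_zero _) h (zero_add d) h, hF,
      ← GCat.assoc h (add_zero t) (add_zero d) h, constMap_comp]
  rw [h₁, Mat.fromBase_comp_apply f b h, map_sum, map_sum, LinearMap.sum_apply]
  exact Finset.sum_congr rfl fun b' _ => (B'.map_comp_summandIncl i' b' _ _).symm

/-- The counterpart of `comp_inclAs` for a morphism `F` that is represented on one term by a matrix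
`f`: a row with a single nonzero entry leaves a single summand. -/
lemma IndObj.inclAs_comp {B B' : IndObj K (Mat K (Kar K C))} {i : B.I} {i' : B'.I}
    {b : (B.at i).ι} {b' : (B'.at i').ι} {X X' : C} {s s' d t : ℤ}
    (hX : ((B.at i).X b).X = X) (hs : (B.at i).s b = s) (hX' : ((B'.at i').X b').X = X')
    (hs' : (B'.at i').s b' = s') (F : GHom K B B' d) (f : GHom K (B.at i) (B'.at i') d)
    (hF : GCat.comp (zero_add d) (B.incl i) F =
      GCat.comp (add_zero d) ((constFunctor K (Mat K (Kar K C))).map f) (B'.incl i'))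
    (hne : ∀ l, l ≠ b' → (f : Mat.HomM (B.at i) (B'.at i') d) b l = 0) (g : GHom K X X' d)
    (g₀ : GHom K ((B.at i).X b).X ((B'.at i').X b').X d) (hg : HEq g₀ g)
    (hd : d = d + (B.at i).s b - (B'.at i').s b')
    (hv : ((f : Mat.HomM (B.at i) (B'.at i') d) b b').1 = degCast hd g₀)
    (h : s + d = t) (h' : d + s' = t) :
    GCat.comp h (B.inclAs hX hs) F = GCat.comp h' (baseMap g) (B'.inclAs hX' hs') := by
  subst hX hs hX' hs'
  obtain rfl := eq_of_heq hg
  refine (IndObj.summandIncl_comp F f hF b h).trans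
    ((Fintype.sum_eq_single b' fun l hl => ?_).trans ?_)
  · rw [hne l hl]
    have e : baseMap (0 : GHom K ((B.at i).X b).X ((B'.at i').X l).X
        (d + (B.at i).s b - (B'.at i').s l)) = 0 := map_zero _
    exact (congrArg (fun z => GCat.comp (show d + (B.at i).s b - (B'.at i').s l +
      (B'.at i').s l = t by omega) z (B'.summandIncl i' l)) e).trans (LinearMap.map_zero₂ _ _)
  · rw [hv]
    exact comp_baseMap_degCast hd h' _ _ _

variable [GTensor K C]

lemma Mat.tensor_matBaseMap_ne (A : Mat K (Kar K C)) {X Y : C} {d : ℤ} (g : GHom K X Y d)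
    {b b' : A.ι} (h : b ≠ b') :
    (GTensor.hom (zero_add d) (GCat.id A) (matBaseMap g) : Mat.HomM (Mat.tensorObj A (matBase K X))
      (Mat.tensorObj A (matBase K Y)) d) (b, ()) (b', ()) = 0 :=
  (congrArg (fun z => GTensor.hom _ z _) (A.idM_ne h)).trans (LinearMap.map_zero₂ _ _)

lemma Mat.tensor_matBaseMap_self (A : Mat K (Kar K C)) {X Y : C} {d : ℤ} (g : GHom K X Y d)
    (b : A.ι) (h : d = d + (A.s b + 0) - (A.s b + 0)) :
    ((GTensor.hom (zero_add d) (GCat.id A) (matBaseMap g) : Mat.HomM (Mat.tensorObj A (matBase K X))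
      (Mat.tensorObj A (matBase K Y)) d) (b, ()) (b, ())).1 =
      degCast h (GTensor.hom (zero_add d) (A.X b).e g) := by
  have h₁ : (0 : ℤ) = 0 + A.s b - A.s b := by omega
  have h₂ : d = d + 0 - 0 := by omega
  have e : (GTensor.hom (zero_add d) (GCat.id A) (matBaseMap g) : Mat.HomM
      (Mat.tensorObj A (matBase K X)) (Mat.tensorObj A (matBase K Y)) d) (b, ()) (b, ()) =
      GTensor.hom (show 0 + A.s b - A.s b + (d + 0 - 0) = d + (A.s b + 0) - (A.s b + 0) by omega)
        (degCast h₁ (GCat.id (A.X b))) (degCast h₂ ((toKar K C).map g)) :=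
    congrArg (fun z => GTensor.hom (show 0 + A.s b - A.s b + (d + 0 - 0) =
      d + (A.s b + 0) - (A.s b + 0) by omega) z _) (A.idM_self b)
  rw [e, GTensor.hom_degCast h₁ h₂ h (zero_add d), Kar.degCast_val]
  rfl

end TensorSummands

end

noncomputable section

open DHom

/-! ### Naturality of the evaluation in the strands -/

section KirbyNaturality

variable {K : Type u} [Field K] [CharZero K]

/-- The action of morphisms of strands on the Kirby color tensored with strands. -/
def strandsMap {m m' : ℕ} {d : ℤ} (g : DHom K m m' d) :
    GHom K (kirbyStrands K m) (kirbyStrands K m') d :=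
  (tensorLeft (kirby K)).map (baseMap (X := (⟨m⟩ : DTL K)) (Y := ⟨m'⟩) g)

/-- The action of morphisms of strands on a stage of the Kirby color tensored with strands. -/
def stageMap {m m' : ℕ} {d : ℤ} (g : DHom K m m' d) (n : ℕ) :
    GHom K ((kirbyStrands K m).at (⟨n⟩, PUnit.unit)) ((kirbyStrands K m').at (⟨n⟩, PUnit.unit)) d :=
  GTensor.hom (zero_add d) (GCat.id ((kirby K).at ⟨n⟩)) (matBaseMap (X := (⟨m⟩ : DTL K))
    (Y := ⟨m'⟩) g)

lemma strandsMap_val {m m' : ℕ} {d : ℤ} (g : DHom K m m' d) (n : ℕ) :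
    (strandsMap g : IndObj.homSub _ _ _).1 (⟨n⟩, PUnit.unit) =
      CHom.ι _ (kirbyStrands K m') d (⟨n⟩, PUnit.unit) (stageMap g n) :=
  CHom.whisker_ι (kirby K) ⟨n⟩ (B := base K (⟨m'⟩ : DTL K)) PUnit.unit
    (matBaseMap (X := (⟨m⟩ : DTL K)) (Y := ⟨m'⟩) g)

lemma incl_comp_strandsMap {m m' : ℕ} {d : ℤ} (g : DHom K m m' d) (n : ℕ) :
    GCat.comp (zero_add d) ((kirbyStrands K m).incl (⟨n⟩, PUnit.unit)) (strandsMap g) =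
    GCat.comp (add_zero d) ((constFunctor K (Mat K (Kar K (DTL K)))).map (stageMap g n))
      ((kirbyStrands K m').incl (⟨n⟩, PUnit.unit)) := by
  refine IndObj.toCHom_injective (((kirbyStrands K m).toCHom_incl_comp (⟨n⟩, PUnit.unit)
    (zero_add d) _).trans ((strandsMap_val g n).trans ?_))
  exact congrArg IndObj.toCHom (IndObj.ofCHom_ι (B := kirbyStrands K m') (⟨n⟩, PUnit.unit)
    (stageMap g n) (add_zero d))

/-- The identity of the image of an idempotent is the idempotent itself, so on a summand `id ⊗ g`
appears with the symmetrizer in place of the identity. -/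
lemma stageIncl_comp_strandsMap_symmetrizer {m m' : ℕ} {d t : ℤ} (g : DHom K m m' d) (n : ℕ)
    (k : Fin 2) (N : ℕ) (hN : k + 2 * n = N) (h : -(N : ℤ) + d = t) (h' : d + -(N : ℤ) = t) :
    GCat.comp h (stageIncl m n k N hN) (strandsMap g) =
      GCat.comp h' (baseMap (X := (⟨N + m⟩ : DTL K)) (Y := ⟨N + m'⟩)
        (tensor rfl rfl (zero_add d) (symmetrizer K N) g)) (stageIncl m' n k N hN) := by
  subst hN
  have hd : d = d + ((kirbyStage K n).s k + 0) - ((kirbyStage K n).s k + 0) := by omega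
  exact IndObj.inclAs_comp (B := kirbyStrands K m) (B' := kirbyStrands K m') (i := (⟨n⟩, PUnit.unit))
    (i' := (⟨n⟩, PUnit.unit)) (b := (k, ())) (b' := (k, ())) (X := ⟨k + 2 * n + m⟩)
    (X' := ⟨k + 2 * n + m'⟩) (s := -(k + 2 * n : ℕ)) (s' := -(k + 2 * n : ℕ)) (d := d) (t := t)
    rfl (kirbyStage_s n k rfl) rfl (kirbyStage_s n k rfl) (strandsMap g)
    (stageMap g n) (incl_comp_strandsMap g n)
    (fun l hl => ((kirby K).at ⟨n⟩).tensor_matBaseMap_ne (X := (⟨m⟩ : DTL K)) (Y := ⟨m'⟩) g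
      (b := k) (b' := l.1) fun h => hl (Prod.ext h.symm rfl))
    (tensor (rfl : k + 2 * n + m = k + 2 * n + m) (rfl : k + 2 * n + m' = k + 2 * n + m')
      (zero_add d) (symmetrizer K (k + 2 * n)) g)
    (tensor (rfl : k + 2 * n + m = k + 2 * n + m) (rfl : k + 2 * n + m' = k + 2 * n + m')
      (zero_add d) (symmetrizer K (k + 2 * n)) g) HEq.rfl hd
    (((kirby K).at ⟨n⟩).tensor_matBaseMap_self (X := (⟨m⟩ : DTL K)) (Y := ⟨m'⟩) g k hd) h h'

/-- The symmetrizer can be split off after `id ⊗ g`, where the inclusion absorbs it. -/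
lemma stageIncl_comp_strandsMap {m m' : ℕ} {d t : ℤ} (g : DHom K m m' d) (n : ℕ) (k : Fin 2)
    (N : ℕ) (hN : k + 2 * n = N) (h : -(N : ℤ) + d = t) (h' : d + -(N : ℤ) = t) :
    GCat.comp h (stageIncl m n k N hN) (strandsMap g) =
      GCat.comp h' (baseMap (X := (⟨N + m⟩ : DTL K)) (Y := ⟨N + m'⟩)
        (tensor rfl rfl (zero_add d) (1 : DHom K N N 0) g)) (stageIncl m' n k N hN) := by
  have e : (tensor rfl rfl (zero_add d) (symmetrizer K N) g : DHom K (N + m) (N + m') d) =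
      comp (add_zero d) (tensor rfl rfl (zero_add d) (1 : DHom K N N 0) g)
        (tensor rfl rfl (add_zero 0) (symmetrizer K N) (1 : DHom K m' m' 0)) := by
    rw [← interchange rfl rfl rfl (zero_add 0) (add_zero d) (zero_add d), gid_comp, gcomp_id]
  have e' := comp_baseMap_comp (C := DTL K) (X := ⟨N + m⟩) (Y := ⟨N + m'⟩) (Z := ⟨N + m'⟩)
    (add_zero d) h' (zero_add _) h' (tensor rfl rfl (zero_add d) (1 : DHom K N N 0) g)
    (tensor rfl rfl (add_zero 0) (symmetrizer K N) (1 : DHom K m' m' 0))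
    (stageIncl m' n k N hN)
  rw [symmetrizer_comp_stageIncl] at e'
  refine (stageIncl_comp_strandsMap_symmetrizer g n k N hN h h').trans (Eq.trans ?_ e')
  exact congrArg (fun z : DHom K (N + m) (N + m') d => GCat.comp h'
    (baseMap (X := (⟨N + m⟩ : DTL K)) (Y := ⟨N + m'⟩) z) (stageIncl m' n k N hN)) e

lemma colorIncl_comp_strandsMap {m m' : ℕ} {d t : ℤ} (g : DHom K m m' d) (N : ℕ)
    (h : -(N : ℤ) + d = t) (h' : d + -(N : ℤ) = t) :
    GCat.comp h (colorIncl K m N) (strandsMap g) =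
      GCat.comp h' (baseMap (X := (⟨N + m⟩ : DTL K)) (Y := ⟨N + m'⟩)
        (tensor rfl rfl (zero_add d) (1 : DHom K N N 0) g)) (colorIncl K m' N) :=
  stageIncl_comp_strandsMap g _ _ N _ h h'

/-- By `Pol_kirbyStrands_ext` it is enough to test on the inclusions of `c^N ⊗ c^m`. There `g` acts
as `id ⊗ g`, whose rows at `x_1 ⋯ x_N u` are those of `g` at `u`. -/
lemma kirbyEvalAt_strandsMap {m m' : ℕ} {d q q' : ℤ} (g : DHom K m m' d) (h : q + d = q')
    (y : ((Pol K).obj (kirbyStrands K m)).V q) :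
    kirbyEvalAt m' q' (HOM.at ((Pol K).map (strandsMap g)) q q' h y) =
      HOM.at (polAct g) q q' h (kirbyEvalAt m q y) := by
  refine LinearMap.congr_fun (Pol_kirbyStrands_ext
    (φ := kirbyEvalAt m' q' ∘ₗ HOM.at ((Pol K).map (strandsMap g)) q q' h)
    (ψ := HOM.at (polAct g) q q' h ∘ₗ kirbyEvalAt m q) fun N p hp x => ?_) y
  rw [LinearMap.comp_apply, LinearMap.comp_apply, kirbyEvalAt_colorIncl m N hp (by omega),
    ← HOM.comp_at (show -(N : ℤ) + d = d - N by omega) _ _ p q q' hp h (by omega),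
    ← GFunctor.map_comp, colorIncl_comp_strandsMap g N _ (show d + -(N : ℤ) = d - N by omega),
    GFunctor.map_comp, HOM.comp_at (show d + -(N : ℤ) = d - N by omega) _ _ p (p + d) q' rfl (by omega),
    polι_map, kirbyEvalAt_colorIncl m' N (by omega) (by omega)]
  refine (topRow_polAct _ g 1 rfl h (by omega) (by omega) (fun u t v => ?_) x).trans (one_smul K _)
  rw [polM_tensor, tenM_join₂, polM_one, Matrix.one_apply]
  refine Eq.trans ?_ (if_congr (eq_comm (a := Mon.top N)) rfl rfl)
  split_ifs <;> simp

end KirbyNaturality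

end

noncomputable section

open DHom

/-! ### Vectors and coefficients as morphisms, and their duality -/

section Points

variable {K : Type u} [Field K]

/-- A homogeneous vector of degree `p`, as a morphism of degree `p` from the ground field. -/
def GVect.point (V : GVect K) (p : ℤ) : V.V p →ₗ[K] GHom K (GVect.unit K) V p :=
  -- The component ends in degree `p` exactly when it starts in degree 0, the only degree where the
  -- ground field is nonzero.
  LinearMap.pi fun i => if h : p = i.1.2 then
    LinearMap.lcomp K (V.V i.1.2) (Submodule.subtype _) ∘ₗ (LinearMap.lsmul K (V.V i.1.2)).flip ∘ₗ
      V.tr h else 0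

lemma GVect.point_at (V : GVect K) {p : ℤ} (v : V.V p) (h : 0 + p = p) (y : (GVect.unit K).V 0) :
    HOM.at (V.point p v) 0 p h y = y.1 • v :=
  (congrArg (fun z : V.V p →ₗ[K] (GVect.unit K).V 0 →ₗ[K] V.V p => z v y) (dif_pos rfl)).trans rfl

lemma GVect.unit_eq_zero {j : ℤ} (hj : j ≠ 0) (y : (GVect.unit K).V j) : y = 0 := by
  have e : ∀ S : Submodule K K, S = ⊥ → ∀ y : S, y = 0 := by
    rintro _ rfl y
    exact Subsingleton.elim _ _
  exact e _ (if_neg hj) y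

lemma GVect.hom_unit_ext {V : GVect K} {p : ℤ} {f g : GHom K (GVect.unit K) V p}
    (H : ∀ y, HOM.at f 0 p (zero_add p) y = HOM.at g 0 p (zero_add p) y) : f = g := by
  refine HOM.ext fun j k h y => ?_
  by_cases hj : j = 0
  · subst hj
    obtain rfl : p = k := by omega
    exact H y
  · rw [GVect.unit_eq_zero hj y, map_zero, map_zero]

lemma GVect.point_comp {V W : GVect K} {p q d : ℤ} (h : p + d = q) (v : V.V p) (f : GHom K V W d) :
    GCat.comp h (V.point p v) f = W.point q (HOM.at f p q h v) := by
  refine GVect.hom_unit_ext fun y => ?_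
  rw [HOM.comp_at h _ _ 0 p q (zero_add p) h, GVect.point_at, GVect.point_at, map_smul]

variable (K) in
/-- The coefficient of a monomial, as a morphism to the ground field. -/
def polCoeff {m : ℕ} (t : Mon m) : GHom K (polObj K m) (GVect.unit K) (-t.deg) := fun p =>
  { toFun := fun x => ⟨∑ s : {s : Mon m // s.deg = p.1.1}, if s.1 = t then x s else 0, by
      by_cases h : p.1.2 = 0
      · rw [if_pos h]
        trivial
      · rw [if_neg h, Submodule.mem_bot]
        refine Finset.sum_eq_zero fun s _ => if_neg fun hs => h ?_
        rw [← p.2, ← s.2, hs, add_neg_cancel]⟩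
    map_add' := fun x y => Subtype.ext (by
      refine Eq.trans ?_ (Finset.sum_add_distrib (M := K))
      refine Finset.sum_congr rfl fun s _ => ?_
      by_cases h : s.1 = t
      · simp only [if_pos h]
        rfl
      · simp only [if_neg h, add_zero])
    map_smul' := fun c x => Subtype.ext (by
      refine Eq.trans ?_ (Finset.mul_sum (R := K) _ _ _).symm
      refine Finset.sum_congr rfl fun s _ => ?_
      by_cases h : s.1 = t
      · simp only [if_pos h]
        rfl
      · simp only [if_neg h, mul_zero]) }

lemma polCoeff_at {m : ℕ} (t : Mon m) {p q : ℤ} (h : p + -t.deg = q) (x : (polObj K m).V p) :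
    (HOM.at (polCoeff K t) p q h x).1 =
      ∑ s : {s : Mon m // s.deg = p}, if s.1 = t then x s else 0 := rfl

lemma sum_polCoeff_comp_point (m : ℕ) :
    ∑ t : Mon m, GCat.comp (neg_add_cancel t.deg) (polCoeff K t)
      ((polObj K m).point t.deg (polBasis t rfl)) = GCat.id (polObj K m) := by
  refine HOM.ext fun p q h x => ?_
  obtain rfl : p = q := by omega
  rw [HOM.id_at, GVect.tr_self]
  refine (HOM.sum_at _ _ _ _ _ _).trans (funext fun s => ?_)
  obtain ⟨s, rfl⟩ := s
  refine (Finset.sum_apply _ _ _).trans ?_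
  have e : ∀ t : Mon m, HOM.at (GCat.comp (neg_add_cancel t.deg) (polCoeff K t)
      ((polObj K m).point t.deg (polBasis t rfl)) : HOM (polObj K m) (polObj K m) 0) s.deg s.deg h x
        ⟨s, rfl⟩ = if t = s then x ⟨s, rfl⟩ else 0 := by
    intro t
    -- If the degrees differ, the composite passes through a nonzero degree of the ground field and
    -- vanishes.
    by_cases hd : t.deg = s.deg
    · have h0 : s.deg + -t.deg = 0 := by omega
      have h1 : 0 + t.deg = s.deg := by omega
      rw [HOM.comp_at (neg_add_cancel t.deg) _ _ s.deg 0 s.deg h0 h1]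
      have key : ∀ (q : ℤ) (hq : t.deg = q) (h1 : 0 + t.deg = q) (y : (GVect.unit K).V 0) (s : {s : Mon m // s.deg = q}),
          HOM.at ((polObj K m).point t.deg (polBasis t rfl)) 0 q h1 y s =
            y.1 * if t = s.1 then 1 else 0 := by
        rintro _ rfl h1 y s
        refine (congrFun ((polObj K m).point_at _ h1 y) s).trans (congrArg (y.1 * ·) ?_)
        by_cases hs : t = s.1
        · rw [if_pos hs]
          obtain rfl : s = ⟨t, rfl⟩ := Subtype.ext hs.symm
          exact Pi.single_eq_same _ _
        · rw [if_neg hs]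
          exact Pi.single_eq_of_ne (fun h => hs (congrArg Subtype.val h).symm) _
      rw [key _ hd, polCoeff_at]
      by_cases hts : t = s
      · subst hts
        rw [if_pos rfl, if_pos rfl, mul_one, Fintype.sum_eq_single ⟨t, rfl⟩, if_pos rfl]
        exact fun s hs => if_neg fun h => hs (Subtype.ext h)
      · rw [if_neg hts, if_neg hts, mul_zero]
    · rw [if_neg fun h => hd (congrArg Mon.deg h), HOM.comp_at (neg_add_cancel t.deg) _ _ s.deg
        (s.deg + -t.deg) s.deg rfl (by omega),
        GVect.unit_eq_zero (by omega) (HOM.at (polCoeff K t) s.deg (s.deg + -t.deg) rfl x), map_zero]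
      rfl
  exact (Finset.sum_congr rfl fun t _ => e t).trans (by simp)

lemma point_comp_polCoeff_self {m : ℕ} (t : Mon m) :
    GCat.comp (add_neg_cancel t.deg) ((polObj K m).point t.deg (polBasis t rfl)) (polCoeff K t) =
      GCat.id (GVect.unit K) := by
  refine GVect.hom_unit_ext fun y => ?_
  rw [HOM.comp_at (add_neg_cancel t.deg) _ _ 0 t.deg 0 (zero_add _) (add_neg_cancel _),
    GVect.point_at, HOM.id_at, GVect.tr_self]
  refine Subtype.ext ((polCoeff_at t _ _).trans ?_)
  rw [Fintype.sum_eq_single ⟨t, rfl⟩, if_pos rfl]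
  · refine (congrArg (y.1 * ·) (Pi.single_eq_same _ _)).trans (mul_one _)
  · exact fun s hs => if_neg fun h => hs (Subtype.ext h)

lemma point_comp_polCoeff_ne {m : ℕ} {s t : Mon m} (hst : s ≠ t) {d : ℤ} (h : s.deg + -t.deg = d) :
    GCat.comp h ((polObj K m).point s.deg (polBasis s rfl)) (polCoeff K t) = 0 := by
  refine GVect.hom_unit_ext fun y => ?_
  rw [HOM.comp_at h _ _ 0 s.deg d (zero_add _) h, GVect.point_at]
  refine Subtype.ext ((polCoeff_at t _ _).trans ?_)
  refine (Finset.sum_eq_zero fun r _ => ?_).trans rfl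
  by_cases hr : r.1 = t
  · rw [if_pos hr]
    refine (congrArg (y.1 * ·) (Pi.single_eq_of_ne ?_ _)).trans (mul_zero _)
    rintro rfl
    exact hst hr
  · exact if_neg hr

end Points

end

noncomputable section

open DHom

/-! ### Tensoring with the Kirby color is a copower -/

/-- A natural transformation to a functor of the form `Hom(W, T(E(-)))`. -/
def GNatTrans.toHomFrom {K : Type u} [Field K] {A : Type*} {B : Type*} {C : Type v} [GCat K A]
    [GCat K B] [GCat K C] (P : GFunctor K A (GVect K)) (E : GFunctor K A B) (T : GFunctor K B C)
    (W : C) (app : ∀ X, GHom K (P.obj X) ((homFrom K W).obj (T.obj (E.obj X))) 0)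
    (naturality : ∀ {X Y : A} {d : ℤ} (f : GHom K X Y d),
      GCat.comp (add_zero d) (P.map f) (app Y) =
        GCat.comp (zero_add d) (app X) ((homFrom K W).map (T.map (E.map f)))) :
    GNatTrans P (E.comp (T.comp (homFrom K W))) :=
  ⟨app, naturality⟩

section CopowerBasis

/-- A criterion for copowers by a graded vector space with a finite homogeneous basis. -/
lemma isCopower_of_basis {K : Type u} [Field K] {D : Type (u + 1)} [GCat K D] {V : GVect K} {W T : D}
    (unit : GHom K V ((homFrom K W).obj T) 0) {ι : Type} [Fintype ι] (δ : ι → ℤ)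
    (b : ∀ t, V.V (δ t))
    (ext : ∀ {p : ℤ} {M : Type u} [AddCommGroup M] [Module K M] {φ ψ : V.V p →ₗ[K] M},
      (∀ t (h : δ t = p), φ (V.tr h (b t)) = ψ (V.tr h (b t))) → φ = ψ)
    (π : ∀ t, GHom K T W (-δ t))
    (sum_eq : ∑ t, GCat.comp (neg_add_cancel (δ t)) (π t)
      (show GHom K W T (δ t) from HOM.at unit (δ t) (δ t) (add_zero _) (b t)) = GCat.id T)
    (self : ∀ t, GCat.comp (add_neg_cancel (δ t))
      (show GHom K W T (δ t) from HOM.at unit (δ t) (δ t) (add_zero _) (b t)) (π t) = GCat.id W)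
    (ne : ∀ s t, s ≠ t → ∀ (d : ℤ) (h : δ s + -δ t = d), GCat.comp h
      (show GHom K W T (δ s) from HOM.at unit (δ s) (δ s) (add_zero _) (b s)) (π t) = 0) :
    IsCopower V W T unit := by
  intro Y d
  let η : ∀ t, GHom K W T (δ t) := fun t => HOM.at unit (δ t) (δ t) (add_zero _) (b t)
  have at_eq : ∀ (g : GHom K T Y d) t, HOM.at (GCat.comp (zero_add d) unit ((homFrom K W).map g) :
      HOM _ _ d) (δ t) (δ t + d) rfl (b t) = GCat.comp rfl (η t) g := fun g t =>
    HOM.comp_at (zero_add d) _ _ (δ t) (δ t) (δ t + d) (add_zero _) rfl rfl _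
  -- A morphism out of `T` is recovered from its composites with the `η t` by inserting the
  -- decomposition of the identity of `T`.
  have expand : ∀ g : GHom K T Y d, g = ∑ t, GCat.comp (show -δ t + (δ t + d) = d by omega) (π t)
      (GCat.comp rfl (η t) g) := by
    intro g
    conv_lhs => rw [← GCat.id_comp (zero_add d) g, ← sum_eq, map_sum, LinearMap.sum_apply]
    exact Finset.sum_congr rfl fun t _ => GCat.assoc _ _ _ _ _ _ _
  constructor
  · intro g g' hg
    have e : ∀ t, GCat.comp (rfl : δ t + d = δ t + d) (η t) g = GCat.comp rfl (η t) g' := fun t =>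
      (at_eq g t).symm.trans ((congrArg (fun z : HOM _ _ d => HOM.at z (δ t) (δ t + d) rfl (b t))
        hg).trans (at_eq g' t))
    rw [expand g, expand g', Finset.sum_congr rfl fun t _ => by rw [e t]]
  · intro φ
    let y : ∀ t, GHom K W Y (δ t + d) := fun t => HOM.at φ (δ t) (δ t + d) rfl (b t)
    -- The preimage is prescribed on each basis vector; `self` and `ne` say that composing with `η
    -- s` picks out the value at `s`.
    refine ⟨∑ t, GCat.comp (show -δ t + (δ t + d) = d by omega) (π t) (y t),
      HOM.ext fun p q h x => ?_⟩
    revert x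
    refine LinearMap.congr_fun (ext fun s hs => ?_)
    subst hs h
    refine (at_eq _ s).trans ?_
    rw [map_sum, Fintype.sum_eq_single s]
    · rw [← GCat.assoc (add_neg_cancel (δ s)) (zero_add _) (show -δ s + (δ s + d) = d by omega) rfl,
        self, GCat.id_comp]
      rfl
    · intro t ht
      rw [← GCat.assoc (rfl : δ s + -δ t = δ s + -δ t)
        (show δ s + -δ t + (δ t + d) = δ s + d by omega)
        (show -δ t + (δ t + d) = d by omega) rfl, ne s t (Ne.symm ht),
        map_zero, LinearMap.zero_apply]

end CopowerBasis

section KirbyCopower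

variable {K : Type u} [Field K] [CharZero K]

/-- The isomorphism `Hom(A, ω ⊗ c ^ m) ≅ HOM(Pol(A), Pol(c ^ m))`. -/
def kirbyEquiv (m : ℕ) (A : dTLbar K) (d : ℤ) :
    GHom K A (kirbyStrands K m) d ≃ₗ[K] GHom K ((Pol K).obj A) (polObj K m) d :=
  LinearEquiv.ofBijective ((GCat.comp (add_zero d)).flip (kirbyEval K m) ∘ₗ (Pol K).map)
    (comp_kirbyEval_bijective m A d)

lemma kirbyEquiv_apply {m : ℕ} {A : dTLbar K} {d : ℤ} (f : GHom K A (kirbyStrands K m) d) :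
    kirbyEquiv m A d f = GCat.comp (add_zero d) ((Pol K).map f) (kirbyEval K m) := rfl

/-- Composition on the left becomes composition with `Pol f`. Identities between morphisms into `ω ⊗
c^m` can therefore be verified on graded vector spaces. -/
lemma kirbyEquiv_comp {m : ℕ} {A B : dTLbar K} {i j k : ℤ} (h : i + j = k) (f : GHom K A B i)
    (g : GHom K B (kirbyStrands K m) j) : kirbyEquiv m A k (GCat.comp h f g) =
      GCat.comp h ((Pol K).map f) (kirbyEquiv m B j g) := by
  rw [kirbyEquiv_apply, kirbyEquiv_apply, GFunctor.map_comp,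
    GCat.assoc h (add_zero k) (add_zero j) h]

/-- The isomorphism `Hom(A, ω) ≅ HOM(Pol(A), K)`. -/
def kirbyDualEquiv (A : dTLbar K) (d : ℤ) :
    GHom K A (kirby K) d ≃ₗ[K] GHom K ((Pol K).obj A) (GVect.unit K) d :=
  LinearEquiv.ofBijective ((GCat.comp (add_zero d)).flip (kirbyFunctional K) ∘ₗ (Pol K).map)
    (comp_kirbyFunctional_bijective A d)

lemma kirbyDualEquiv_apply {A : dTLbar K} {d : ℤ} (f : GHom K A (kirby K) d) :
    kirbyDualEquiv A d f = GCat.comp (add_zero d) ((Pol K).map f) (kirbyFunctional K) := rfl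

lemma kirbyDualEquiv_comp {A B : dTLbar K} {i j k : ℤ} (h : i + j = k) (f : GHom K A B i)
    (g : GHom K B (kirby K) j) : kirbyDualEquiv A k (GCat.comp h f g) =
      GCat.comp h ((Pol K).map f) (kirbyDualEquiv B j g) := by
  rw [kirbyDualEquiv_apply, kirbyDualEquiv_apply, GFunctor.map_comp,
    GCat.assoc h (add_zero k) (add_zero j) h]

lemma map_strandsMap_comp_kirbyEval {m m' : ℕ} {d : ℤ} (g : DHom K m m' d) :
    GCat.comp (add_zero d) ((Pol K).map (strandsMap g)) (kirbyEval K m') =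
      GCat.comp (zero_add d) (kirbyEval K m) (polAct g : GHom K (polObj K m) (polObj K m') d) := by
  refine HOM.ext fun p q h y => ?_
  rw [HOM.comp_at (add_zero d) _ _ p q q h (add_zero q), HOM.comp_at (zero_add d) _ _ p p q
    (add_zero p) h, kirbyEval_at, kirbyEval_at]
  exact kirbyEvalAt_strandsMap g h y

lemma kirbyEquiv_comp_strandsMap {m m' : ℕ} {A : dTLbar K} {i d k : ℤ} (h : i + d = k)
    (f : GHom K A (kirbyStrands K m) i) (g : DHom K m m' d) :
    kirbyEquiv m' A k (GCat.comp h f (strandsMap g)) =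
      GCat.comp h (kirbyEquiv m A i f) (polAct g : GHom K (polObj K m) (polObj K m') d) := by
  rw [kirbyEquiv_apply, kirbyEquiv_apply, GFunctor.map_comp,
    GCat.assoc h (add_zero k) (add_zero d) h, map_strandsMap_comp_kirbyEval,
    GCat.assoc (add_zero i) h (zero_add d) h]

/-- The morphism `ω → ω ⊗ c ^ m` given by a vector of `Pol(c ^ m)`. -/
def kirbyInsert (m : ℕ) (p : ℤ) :
    (polObj K m).V p →ₗ[K] GHom K (kirby K) (kirbyStrands K m) p :=
  (kirbyEquiv m (kirby K) p).symm.toLinearMap ∘ₗ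
    GCat.comp (zero_add p) (kirbyFunctional K) ∘ₗ (polObj K m).point p

lemma kirbyEquiv_kirbyInsert {m : ℕ} {p : ℤ} (v : (polObj K m).V p) :
    kirbyEquiv m (kirby K) p (kirbyInsert m p v) =
      GCat.comp (zero_add p) (kirbyFunctional K) ((polObj K m).point p v) :=
  LinearEquiv.apply_symm_apply _ _

/-- Both sides correspond to the functional on `Pol(ω)` followed by the vector `g v`. This is what
makes the maps `Pol(c^m) → Hom(ω, ω ⊗ c^m)` natural in `c^m`. -/
lemma kirbyInsert_comp_strandsMap {m m' : ℕ} {d p q : ℤ} (h : p + d = q) (g : DHom K m m' d)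
    (v : (polObj K m).V p) : GCat.comp h (kirbyInsert m p v) (strandsMap g) =
      kirbyInsert m' q (HOM.at (polAct g) p q h v) := by
  refine (kirbyEquiv m' (kirby K) q).injective ?_
  rw [kirbyEquiv_comp_strandsMap, kirbyEquiv_kirbyInsert, kirbyEquiv_kirbyInsert,
    GCat.assoc (zero_add p) h h (zero_add q)]
  exact congrArg (GCat.comp (zero_add q) (kirbyFunctional K)) (GVect.point_comp h v _)

/-- The morphism `ω ⊗ c ^ m → ω` given by a monomial. -/
def kirbyExtract {m : ℕ} (t : Mon m) : GHom K (kirbyStrands K m) (kirby K) (-t.deg) :=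
  (kirbyDualEquiv (kirbyStrands K m) (-t.deg)).symm
    (GCat.comp (zero_add _) (kirbyEval K m) (polCoeff K t))

lemma kirbyDualEquiv_kirbyExtract {m : ℕ} (t : Mon m) :
    kirbyDualEquiv (kirbyStrands K m) (-t.deg) (kirbyExtract t) =
      GCat.comp (zero_add _) (kirbyEval K m) (polCoeff K t) :=
  LinearEquiv.apply_symm_apply _ _

/-- Under `kirbyEquiv` the sum becomes `kirbyEval` followed by the sum of all "coefficient, then
basis vector", which is the identity of `Pol(c^m)`. The identity of `ω ⊗ c^m` also corresponds to
`kirbyEval`. -/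
lemma sum_kirbyExtract_comp_kirbyInsert (m : ℕ) :
    ∑ t : Mon m, GCat.comp (neg_add_cancel t.deg) (kirbyExtract t)
      (kirbyInsert m t.deg (polBasis t rfl)) = GCat.id (kirbyStrands K m) := by
  refine (kirbyEquiv m (kirbyStrands K m) 0).injective ?_
  rw [map_sum]
  have e : ∀ t : Mon m, kirbyEquiv m (kirbyStrands K m) 0 (GCat.comp (neg_add_cancel t.deg)
      (kirbyExtract t) (kirbyInsert m t.deg (polBasis t rfl))) =
      GCat.comp (zero_add 0) (kirbyEval K m) (GCat.comp (neg_add_cancel t.deg) (polCoeff K t)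
        ((polObj K m).point t.deg (polBasis t rfl))) := by
    intro t
    rw [kirbyEquiv_comp, kirbyEquiv_kirbyInsert,
      ← GCat.assoc (add_zero _) (neg_add_cancel _) (zero_add _) (neg_add_cancel _),
      ← kirbyDualEquiv_apply, kirbyDualEquiv_kirbyExtract,
      GCat.assoc (zero_add _) (neg_add_cancel _) (neg_add_cancel _) (zero_add 0)]
  rw [Finset.sum_congr rfl fun t _ => e t, ← map_sum, sum_polCoeff_comp_point, kirbyEquiv_apply,
    GFunctor.map_id, GCat.comp_id, GCat.id_comp]

lemma kirbyDualEquiv_kirbyInsert_comp {m : ℕ} {p d : ℤ} (v : (polObj K m).V p) (t : Mon m)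
    (h : p + -t.deg = d) : kirbyDualEquiv (kirby K) d (GCat.comp h (kirbyInsert m p v)
      (kirbyExtract t)) = GCat.comp (zero_add d) (kirbyFunctional K)
        (GCat.comp h ((polObj K m).point p v) (polCoeff K t)) := by
  rw [kirbyDualEquiv_comp, kirbyDualEquiv_kirbyExtract,
    ← GCat.assoc (add_zero _) h (zero_add _) h, ← kirbyEquiv_apply, kirbyEquiv_kirbyInsert,
    GCat.assoc (zero_add _) h h (zero_add d)]

/-- Under `kirbyDualEquiv` this is the functional followed by the coefficient of a basis vector at
itself, which is 1. The functional alone corresponds to the identity of `ω`. -/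
lemma kirbyInsert_comp_kirbyExtract_self {m : ℕ} (t : Mon m) :
    GCat.comp (add_neg_cancel t.deg) (kirbyInsert m t.deg (polBasis t rfl)) (kirbyExtract t) =
      GCat.id (kirby K) := by
  refine (kirbyDualEquiv (kirby K) 0).injective ?_
  rw [kirbyDualEquiv_kirbyInsert_comp, point_comp_polCoeff_self, kirbyDualEquiv_apply,
    GFunctor.map_id, GCat.id_comp, GCat.comp_id]

lemma kirbyInsert_comp_kirbyExtract_ne {m : ℕ} {s t : Mon m} (hst : s ≠ t) {d : ℤ}
    (h : s.deg + -t.deg = d) :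
    GCat.comp h (kirbyInsert m s.deg (polBasis s rfl)) (kirbyExtract (K := K) t) = 0 := by
  refine (kirbyDualEquiv (kirby K) d).injective ?_
  rw [kirbyDualEquiv_kirbyInsert_comp, point_comp_polCoeff_ne hst, map_zero, map_zero]

variable (K) in
/-- The maps `Pol(c ^ m) → Hom(ω, ω ⊗ c ^ m)`, as a homogeneous map. -/
def kirbyInsertMap (m : ℕ) :
    GHom K (polObj K m) ((homFrom K (kirby K)).obj (kirbyStrands K m)) 0 :=
  fun p => kirbyInsert m p.1.2 ∘ₗ (polObj K m).tr (by have := p.2; omega)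

lemma kirbyInsertMap_at (m : ℕ) (p : ℤ) (v : (polObj K m).V p) :
    HOM.at (kirbyInsertMap K m) p p (add_zero p) v = kirbyInsert m p v := rfl

lemma kirbyInsertMap_naturality {m m' : ℕ} {d : ℤ} (g : DHom K m m' d) :
    GCat.comp (add_zero d) (polAct g : GHom K (polObj K m) (polObj K m') d) (kirbyInsertMap K m') =
      GCat.comp (zero_add d) (kirbyInsertMap K m) ((homFrom K (kirby K)).map (strandsMap g)) := by
  refine HOM.ext fun p q h v => ?_
  rw [HOM.comp_at (add_zero d) _ _ p q q h (add_zero q), HOM.comp_at (zero_add d) _ _ p p q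
    (add_zero p) h, kirbyInsertMap_at, kirbyInsertMap_at]
  exact (kirbyInsert_comp_strandsMap h g v).symm

variable (K) in
/-- The natural maps `Pol(c ^ m) → Hom(ω, ω ⊗ c ^ m)`. -/
def kirbyInsertTrans : GNatTrans (polDTL K)
    ((embed K (DTL K)).comp ((tensorLeft (kirby K)).comp (homFrom K (kirby K)))) :=
  GNatTrans.toHomFrom (polDTL K) (embed K (DTL K)) (tensorLeft (kirby K)) (kirby K)
    (fun | ⟨m⟩ => kirbyInsertMap K m)
    (by
      rintro ⟨m⟩ ⟨m'⟩ d g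
      exact kirbyInsertMap_naturality (m := m) (m' := m') g)

variable (K) in
/-- The natural maps `Pol(X) → Hom(ω, ω ⊗ X)`. -/
def kirbyUnit : GNatTrans (Pol K) ((tensorLeft (kirby K)).comp (homFrom K (kirby K))) :=
  (kirbyInsertTrans K).extEmbed

variable (K) in
/-- The map `Pol(c ^ m) → Hom(ω, ω ⊗ c ^ m)`, for the extension of the polynomial representation. -/
def kirbyUnitAt (m : ℕ) : GHom K ((Pol K).obj (base K (⟨m⟩ : DTL K)))
    ((homFrom K (kirby K)).obj (kirbyStrands K m)) 0 := (kirbyUnit K).app (base K ⟨m⟩)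

lemma kirbyUnitAt_at (m : ℕ) (p : ℤ) (x : (polObj K m).V p) :
    HOM.at (kirbyUnitAt K m) p p (add_zero p) (polι m p x) = kirbyInsert m p x :=
  (kirbyInsertTrans K).extEmbed_embedι ⟨m⟩ p x

/-- The inserted monomials and the extracted coefficients are dual bases over `ω`, as
`isCopower_of_basis` demands: `ω ⊗ c^m` is a direct sum of shifts of `ω` indexed by the monomials.
-/
lemma kirbyUnitAt_isCopower (m : ℕ) :
    IsCopower ((Pol K).obj (base K (⟨m⟩ : DTL K))) (kirby K) (kirbyStrands K m) (kirbyUnitAt K m) := by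
  refine isCopower_of_basis (kirbyUnitAt K m) (fun t : Mon m => t.deg)
    (fun t => polι m _ (polBasis t rfl)) (fun {p M _ _ φ ψ} H => pol_base_ext fun t h => ?_)
    (fun t => kirbyExtract t) ?_ (fun t => ?_) (fun s t hst d h => ?_)
  · subst h
    exact H t rfl
  · refine Eq.trans (Finset.sum_congr rfl fun t _ => ?_) (sum_kirbyExtract_comp_kirbyInsert m)
    rw [kirbyUnitAt_at]
  · rw [kirbyUnitAt_at, kirbyInsert_comp_kirbyExtract_self]
  · rw [kirbyUnitAt_at, kirbyInsert_comp_kirbyExtract_ne hst]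

/-- Both sides of the comparison are continuous in `X`, so it is enough to know the copower property
at the objects `c^m`. -/
lemma kirbyUnit_isCopower (X : dTLbar K) :
    IsCopower ((Pol K).obj X) (kirby K) ((tensorLeft (kirby K)).obj X) ((kirbyUnit K).app X) :=
  isCopower_of_bijectiveAt (kirbyUnit K) X fun Y =>
    (copowerTrans (kirbyUnit K) Y).bijectiveAt_of_embed (tensorLeft_isContinuous _ _)
      (extInd_isContinuous _ _)
      (fun | ⟨m⟩ => bijectiveAt_of_isCopower (kirbyUnit K) (base K ⟨m⟩) (kirbyUnitAt_isCopower m) Y)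
      X

variable (K) in
/-- Tensoring with the Kirby color, as a functor given by copowers. -/
def kirbyCopower : CopowerFunctor (Pol K) (kirby K) :=
  ⟨tensorLeft (kirby K), kirbyUnit K, kirbyUnit_isCopower⟩

end KirbyCopower

end

end GradedLinear

/-- Since `ω ⊗ -` with its unit is itself a functor of copowers, copowers exist for all objects, and
uniqueness identifies it with any other choice. -/
theorem theoremD (K : Type*) [Field K] [CharZero K] :
    Nonempty (GradedLinear.GNatIso (GradedLinear.homInto K (GradedLinear.kirby K))
      ((GradedLinear.Pol K).op.comp (GradedLinear.gradedDual K))) ∧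
    Nonempty (GradedLinear.CopowerFunctor (GradedLinear.Pol K) (GradedLinear.kirby K)) ∧
    ∀ T : GradedLinear.CopowerFunctor (GradedLinear.Pol K) (GradedLinear.kirby K),
      Nonempty (GradedLinear.GNatIso (GradedLinear.tensorLeft (GradedLinear.kirby K))
        T.functor) :=
  ⟨GradedLinear.kirby_represents K, ⟨GradedLinear.kirbyCopower K⟩,
    fun T => (GradedLinear.kirbyCopower K).nonempty_iso T⟩
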